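/- Let $(M,\omega)$ be a symplectic manifold (smooth, Hausdorff) with a smooth torsion-free connection $\nabla$ preserving $\omega$. Write $\omega_{kl}=\omega(\partial_k,\partial_l)$, let $(\omega^{kl})$ be the inverse matrix, and $\{a,b\}=\omega^{kl}\partial_k a\,\partial_l b$. **Notation.** Let $\mathcal W\to M$ be the formal Weyl algebra bundle: its fibre at $x$ consists of the formal power series in $t$ and in the generators $e^1,\dots,e^m$ of $T_x^*M$ (corresponding to $dx^1,\dots,dx^m$) with complex coefficients, with the Moyal–Vey product $$a\circ b=\exp\Bigl(-\tfrac{it}{2}\,\omega^{kl}\frac{\partial}{\partial x^k}\frac{\partial}{\partial z^l}\Bigr)a(x,t)\,b(z,t)\Big|_{x=z=e}.$$ Give $e^k$ degree $1$ and $t$ degree $2$, and let $\mathcal W^i$ be the part of degree $i$. On $\mathcal W$-valued forms put $\delta a=dx^k\wedge\partial a/\partial e^k$ and $\delta^*a=e^k\,\iota_{\partial/\partial x^k}a$, and let $\delta^{-1}=\frac1{p+q}\delta^*$ on $q$-forms, $q\ge1$, homogeneous of degree $p$ in the $e^k$. The connection lifts to $\mathcal W$ by the Leibniz rule, and $\nabla^2=\frac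 it[R,\cdot\,]$ with $R(X,Y)=\frac12\,\omega(e,R(X,Y)e)$, where on the right $R(X,Y)$ is the curvature endomorphism of $TM$ and $e=e^k\partial_k$. Consider sequences of operators $r_k=\frac it[\rho_k,\cdot\,]_\circ$, $k\ge1$, where $\rho_k$ is a smooth $1$-form with values in $\mathcal W^{k+2}$. Thus $r_k$ maps $\Gamma(M,\mathcal W^i)$ to $\Gamma(M,T^*M\otimes\mathcal W^{i+k})$ for every $i$. The condition $\delta^*r_k=0$ means $\delta^*\rho_k=0$. The square of $D=-\delta+\nabla+r_1+r_2+\dots$ is $\frac it[\Omega,\cdot\,]_\circ$ with $$\Omega=R-\delta\rho+\nabla\rho+\tfrac it\,\rho\circ\rho,\qquad \rho=\sum_{k\ge1}\rho_k,\qquad (\rho\circ\rho)(X,Y)=[\rho(X),\rho(Y)]_\circ ;$$ call $D$ *normalized* if the part of $\Omega$ that is free of the generators $e^k$ is zero. **Theorem (Fedosov).** 1. There is a unique sequence of operators $r_k$ ($k\ge 1$) of this kind such that $\delta^*r_k=0$ for all $k$, $D^2=0$ and $D$ is normalized. 2. For these operators the forms $\rho_k$ satisfy, for $k\ge1$, $$\delta\rho_1=R,\qquad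 \delta\rho_{k+1}=\nabla\rho_k+\tfrac it\sum_{i+j=k}\rho_i\circ\rho_j,$$ where the last sum evaluated on $(X,Y)$ is $\sum_{i+j=k}[\rho_i(X),\rho_j(Y)]_\circ$, and they are given recursively by $\rho_1=\delta^{-1}R$ and $\rho_{k+1}=\delta^{-1}\bigl(\nabla\rho_k+\frac it\sum_{i+j=k}\rho_i\circ\rho_j\bigr)$. 3. There is a bijection $Q$ from $C^\infty(M)[[t]]$ (complex valued functions) onto the set of smooth sections $A$ of $\mathcal W$ with $DA=0$, such that $Q(a)|_{e=0}=a$, and $A=Q(a)$ satisfies $A=a+\delta^{-1}(\nabla A+r_1A+r_2A+\dots)$. 4. The product of two flat sections is flat, and $a*b=Q^{-1}(Q(a)\circ Q(b))$ is a star-product on $C^\infty(M)[[t]]$: it is associative, $\mathbb C[[t]]$-bilinear and unital with unit $1$; the $k$-th coefficient of $a*b$ is $\sum_{i+j+l=k}B_l(a_i,b_j)$, where $B_l$ is biadditive and $B_l(f,g)(x)$ depends only on the derivatives of $f$ and $g$ at $x$ of order at most $l$; the coefficient of $t^0$ is $a_0b_0$; and $\frac it(a*b-b*a)=\{a_0,b_0\}+t\,r(a,b)$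 with $r(a,b)\in C^\infty(M)[[t]]$. -/

import Mathlib

open scoped Manifold ContDiff

noncomputable section

namespace Fedosov

/-! ### The formal Weyl algebra -/

/-- The formal Weyl algebra on the generators `e 0, …, e (m-1)` and the formal parameter `t`:
power series in `t` whose coefficients are complex formal power series in the `e i`. -/
abbrev Weyl (m : ℕ) : Type := PowerSeries (MvPowerSeries (Fin m) ℂ)

namespace Weyl

variable {m : ℕ}

/-- The coefficient of `t ^ j * e ^ α`. -/
def coef (j : ℕ) (α : Fin m →₀ ℕ) (a : Weyl m) : ℂ :=
  MvPowerSeries.coeff α (PowerSeries.coeff j a)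

/-- The element with prescribed coefficients. -/
def ofCoef (c : ℕ → (Fin m →₀ ℕ) → ℂ) : Weyl m :=
  PowerSeries.mk fun j => (fun α => c j α : MvPowerSeries (Fin m) ℂ)

/-- The generator `e k`. -/
def gen (k : Fin m) : Weyl m := PowerSeries.C (MvPowerSeries.X k)

/-- The partial derivative `∂ / ∂ e k`. -/
def partialE (k : Fin m) (a : Weyl m) : Weyl m :=
  PowerSeries.mk fun j => MvPowerSeries.pderiv ℂ k (PowerSeries.coeff j a)

/-- Homogeneity for the grading in which each `e k` has degree `1` and `t` has degree `2`. -/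
def IsHomogeneous (n : ℕ) (a : Weyl m) : Prop :=
  ∀ j α, coef j α a ≠ 0 → α.degree + 2 * j = n

/-- The sum `∑ k, c k` of a sequence such that `c k` only has terms of degree `≥ k`
(`e k` of degree `1`, `t` of degree `2`): the terms with `k > n` do not contribute in degree `n`. -/
def formalSum (c : ℕ → Weyl m) : Weyl m :=
  ofCoef fun j α => ∑ k ∈ Finset.range (α.degree + 2 * j + 1), coef j α (c k)

/-- The value at `x = z = e` of
`(∑ k l, P k l ∂/∂x k ∂/∂z l) ^ p` applied to `f x * g z`. -/
def bidiff (P : Matrix (Fin m) (Fin m) ℝ) :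
    ℕ → MvPowerSeries (Fin m) ℂ → MvPowerSeries (Fin m) ℂ → MvPowerSeries (Fin m) ℂ
  | 0, f, g => f * g
  | p + 1, f, g => ∑ k, ∑ l, (P k l : ℂ) •
      bidiff P p (MvPowerSeries.pderiv ℂ k f) (MvPowerSeries.pderiv ℂ l g)

/-- The Moyal–Vey product
`a ∘ b = exp (- (i t / 2) P k l ∂/∂x k ∂/∂z l) a(x, t) b(z, t)` at `x = z = e`. -/
def moyal (P : Matrix (Fin m) (Fin m) ℝ) (a b : Weyl m) : Weyl m :=
  PowerSeries.mk fun n =>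
    ∑ s ∈ Finset.HasAntidiagonal.antidiagonal n, ∑ q ∈ Finset.HasAntidiagonal.antidiagonal s.2,
      ((-Complex.I / 2) ^ s.1 / (s.1.factorial : ℂ)) •
        bidiff P s.1 (PowerSeries.coeff q.1 a) (PowerSeries.coeff q.2 b)

/-- `(i / t) [a, b]` for the Moyal–Vey product; the commutator `a ∘ b - b ∘ a` has no term of
order `0` in `t`, so that division by `t` is a shift of coefficients. -/
def bracket (P : Matrix (Fin m) (Fin m) ℝ) (a b : Weyl m) : Weyl m :=
  PowerSeries.mk fun n =>
    Complex.I • PowerSeries.coeff (n + 1) (moyal P a b - moyal P b a)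

/-- The linear change of variables `e i ↦ ∑ k, (L k) i * e k`, that is, the pullback of a formal
function on the span of the vectors `L k` to the coordinates with respect to these vectors. -/
def pull (L : Fin m → EuclideanSpace ℝ (Fin m)) (a : Weyl m) : Weyl m :=
  PowerSeries.mk fun j =>
    MvPowerSeries.subst
      (fun i => ∑ k, (L k i : ℂ) • (MvPowerSeries.X k : MvPowerSeries (Fin m) ℂ))
      (PowerSeries.coeff j a)

/-- Divide the part of degree `d` in the `e k` by `d + c`. -/
def divDegree (c : ℕ) (a : Weyl m) : Weyl m :=
  ofCoef fun j α => coef j α a / ((α.degree + c : ℕ) : ℂ)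

end Weyl

/-! ### Smooth functions, symplectic forms, connections -/

variable {m : ℕ} {M : Type*} [TopologicalSpace M] [ChartedSpace (EuclideanSpace ℝ (Fin m)) M]

instance : ContMDiffRing 𝓘(ℝ, ℂ) ∞ ℂ where
  contMDiff_mul := by
    rw [← modelWithCornersSelf_prod, chartedSpaceSelf_prod]
    exact contDiff_mul.contMDiff

variable (m M) in
/-- The ring of smooth complex valued functions on `M`. -/
abbrev SmoothFun : Type _ := C^∞⟮𝓡 m, M; 𝓘(ℝ, ℂ), ℂ⟯

/-- The `k`-th coordinate vector of the tangent space at `x`, for the preferred chart at `x`. -/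
def coordVec (x : M) (k : Fin m) : TangentSpace (𝓡 m) x :=
  (EuclideanSpace.single k 1 : EuclideanSpace ℝ (Fin m))

/-- The coordinates of a tangent vector at `x` in the basis `coordVec x`. -/
def tangentCoords {x : M} (v : TangentSpace (𝓡 m) x) : EuclideanSpace ℝ (Fin m) := v

variable [IsManifold (𝓡 m) ∞ M]

/-- The extension of a tangent vector at `x` to a vector field which near `x` has constant
coefficients in the preferred chart at `x`. -/
def extendVec {x : M} (v : TangentSpace (𝓡 m) x) : ∀ y : M, TangentSpace (𝓡 m) y :=
  FiberBundle.extend (EuclideanSpace ℝ (Fin m)) v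

variable (m) in
/-- The vector field `X` is smooth. -/
def IsSmoothVF (X : ∀ x : M, TangentSpace (𝓡 m) x) : Prop :=
  ContMDiff (𝓡 m) ((𝓡 m).prod 𝓘(ℝ, EuclideanSpace ℝ (Fin m))) ∞
    (fun x => Bundle.TotalSpace.mk' (EuclideanSpace ℝ (Fin m)) x (X x))

/-- The derivative of a complex valued function along a tangent vector. -/
def dirDeriv (f : M → ℂ) (x : M) (v : TangentSpace (𝓡 m) x) : ℂ :=
  mfderiv (𝓡 m) 𝓘(ℝ, ℂ) f x v

/-- The derivative of a real function along a vector field. -/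
def lieD (X : ∀ x : M, TangentSpace (𝓡 m) x) (f : M → ℝ) (x : M) : ℝ :=
  mfderiv (𝓡 m) 𝓘(ℝ, ℝ) f x (X x)

variable (m M) in
/-- A symplectic form: a smooth, alternating, nondegenerate and closed `2`-form. -/
structure SymplecticForm where
  form : ∀ x : M, TangentSpace (𝓡 m) x →L[ℝ] TangentSpace (𝓡 m) x →L[ℝ] ℝ
  smooth : ContMDiff (𝓡 m)
    ((𝓡 m).prod 𝓘(ℝ, EuclideanSpace ℝ (Fin m) →L[ℝ] EuclideanSpace ℝ (Fin m) →L[ℝ] ℝ)) ∞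
    (fun x => Bundle.TotalSpace.mk'
      (EuclideanSpace ℝ (Fin m) →L[ℝ] EuclideanSpace ℝ (Fin m) →L[ℝ] ℝ) x (form x))
  alternating : ∀ x v, form x v v = 0
  nondegenerate : ∀ x v, (∀ w, form x v w = 0) → v = 0
  closed : ∀ X Y Z : ∀ x : M, TangentSpace (𝓡 m) x,
    IsSmoothVF m X → IsSmoothVF m Y → IsSmoothVF m Z → ∀ x,
      lieD X (fun y => form y (Y y) (Z y)) x + lieD Y (fun y => form y (Z y) (X y)) x
        + lieD Z (fun y => form y (X y) (Y y)) x
        - form x (VectorField.mlieBracket (𝓡 m) X Y x) (Z x)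
        - form x (VectorField.mlieBracket (𝓡 m) Y Z x) (X x)
        - form x (VectorField.mlieBracket (𝓡 m) Z X x) (Y x) = 0

/-- The matrix of the Poisson bivector at `x`: the inverse of the matrix of the symplectic form,
in the basis `coordVec x`. -/
def SymplecticForm.poissonMatrix (Ω : SymplecticForm m M) (x : M) : Matrix (Fin m) (Fin m) ℝ :=
  (Matrix.of fun k l => Ω.form x (coordVec x k) (coordVec x l))⁻¹

/-- The Poisson bracket of two functions. -/
def SymplecticForm.poisson (Ω : SymplecticForm m M) (f g : M → ℂ) (x : M) : ℂ :=
  ∑ k, ∑ l, (Ω.poissonMatrix x k l : ℂ) *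
    dirDeriv f x (coordVec x k) * dirDeriv g x (coordVec x l)

variable (m M) in
/-- Affine connections (covariant derivatives of vector fields); `conn Y x v` is `∇_v Y`. -/
abbrev Connection : Type _ :=
  CovariantDerivative (𝓡 m) (EuclideanSpace ℝ (Fin m)) (TangentSpace (𝓡 m) : M → Type _)

/-- The connection preserves the symplectic form. -/
def IsSymplecticConnection (Ω : SymplecticForm m M) (conn : Connection m M) : Prop :=
  ∀ X Y Z : ∀ x : M, TangentSpace (𝓡 m) x,
    IsSmoothVF m X → IsSmoothVF m Y → IsSmoothVF m Z → ∀ x,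
      lieD X (fun y => Ω.form y (Y y) (Z y)) x =
        Ω.form x (conn Y x (X x)) (Z x) + Ω.form x (Y x) (conn Z x (X x))

/-- The curvature `R(u, v) w = ∇_u ∇_v w - ∇_v ∇_u w - ∇_[u, v] w` of the connection. -/
def riemann (conn : Connection m M) (x : M) (u v w : TangentSpace (𝓡 m) x) :
    TangentSpace (𝓡 m) x :=
  conn (fun y => conn (extendVec w) y (extendVec v y)) x u - conn (fun y => conn (extendVec w) y (extendVec u y)) x v
    - conn (extendVec w) x (VectorField.mlieBracket (𝓡 m) (extendVec u) (extendVec v) x)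

/-! ### The Weyl algebra bundle

The fibre at `x` is the formal Weyl algebra whose generators `e k` are the linear coordinates on
the tangent space at `x` in the basis `coordVec x`. Sections are functions `M → Weyl m`, and
smoothness is tested in local frames. -/

/-- The element `a y` of the fibre at `y`, written in the frame of vector fields
`extendVec (coordVec x k)`, which is a smooth frame near `x`. -/
def inFrame (x : M) (a : M → Weyl m) (y : M) : Weyl m :=
  Weyl.pull (fun k => tangentCoords (extendVec (coordVec x k) y)) (a y)

/-- Smoothness at `x` of a section of the Weyl bundle. -/
def IsSmoothAt (a : M → Weyl m) (x : M) : Prop :=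
  ∀ j α, ContMDiffAt (𝓡 m) 𝓘(ℝ, ℂ) ∞ (fun y => Weyl.coef j α (inFrame x a y)) x

/-- Smooth sections of the Weyl bundle. -/
def IsSmoothSection (a : M → Weyl m) : Prop := ∀ x, IsSmoothAt a x

variable (m M) in
/-- The type underlying the `1`-forms with values in the Weyl bundle. -/
abbrev OneForm : Type _ := ∀ x : M, TangentSpace (𝓡 m) x → Weyl m

variable (m M) in
/-- The type underlying the `2`-forms with values in the Weyl bundle. -/
abbrev TwoForm : Type _ := ∀ x : M, TangentSpace (𝓡 m) x → TangentSpace (𝓡 m) x → Weyl m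

/-- Smooth `1`-forms with values in the Weyl bundle. -/
def IsSmoothOneForm (σ : OneForm m M) : Prop :=
  (∀ x, IsLinearMap ℝ (σ x)) ∧
    ∀ (x : M) (v : TangentSpace (𝓡 m) x), IsSmoothAt (fun y => σ y (extendVec v y)) x

/-- The derivative of a fibre element along a tangent vector, `∑ k, v k ∂a/∂e k`. -/
def fiberDeriv {x : M} (v : TangentSpace (𝓡 m) x) (a : Weyl m) : Weyl m :=
  ∑ k, (tangentCoords v k : ℂ) • Weyl.partialE k a

/-- `δ a = dx k ∂a/∂e k` on sections. -/
def delta₀ (a : M → Weyl m) : OneForm m M := fun x v => fiberDeriv v (a x)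

/-- `δ σ = dx k ∧ ∂σ/∂e k` on `1`-forms. -/
def delta₁ (σ : OneForm m M) : TwoForm m M :=
  fun x u v => fiberDeriv u (σ x v) - fiberDeriv v (σ x u)

/-- `δ* σ = e k ι(∂/∂x k) σ` on `1`-forms. -/
def deltaStar₁ (σ : OneForm m M) : M → Weyl m :=
  fun x => ∑ k, Weyl.gen k * σ x (coordVec x k)

/-- `δ* τ = e k ι(∂/∂x k) τ` on `2`-forms. -/
def deltaStar₂ (τ : TwoForm m M) : OneForm m M :=
  fun x v => ∑ k, Weyl.gen k * τ x (coordVec x k) v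

/-- `δ⁻¹ = δ* / (p + q)` on the `1`-forms (`q = 1`) of degree `p` in the `e k`. As `δ*` raises
this degree by one, the divisor is the degree of the result. -/
def deltaInv₁ (σ : OneForm m M) : M → Weyl m := fun x => Weyl.divDegree 0 (deltaStar₁ σ x)

/-- `δ⁻¹ = δ* / (p + q)` on the `2`-forms (`q = 2`) of degree `p` in the `e k`. -/
def deltaInv₂ (τ : TwoForm m M) : OneForm m M := fun x v => Weyl.divDegree 1 (deltaStar₂ τ x v)

/-- The lift of the connection to sections of the Weyl bundle. In the frame of the vector fields
`s k = extendVec (coordVec x k)` it is the derivative of the coefficients minus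
`∑ k, e k * ∂_{∇ s k}`. -/
def nabla (conn : Connection m M) (a : M → Weyl m) : OneForm m M := fun x v =>
  Weyl.ofCoef (fun j α =>
      dirDeriv (fun y => Weyl.coef j α (inFrame x a y)) x v)
    - ∑ k, Weyl.gen k * fiberDeriv (conn (extendVec (coordVec x k)) x v) (a x)

/-- The extension of a connection `D` on the Weyl bundle to `1`-forms:
`(D σ)(X, Y) = D_X (σ Y) - D_Y (σ X) - σ [X, Y]`. -/
def extendToOneForms (D : (M → Weyl m) → OneForm m M) (σ : OneForm m M) : TwoForm m M :=
  fun x u v => D (fun y => σ y (extendVec v y)) x u - D (fun y => σ y (extendVec u y)) x v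
    - σ x (VectorField.mlieBracket (𝓡 m) (extendVec u) (extendVec v) x)

/-- The connection `D` on the Weyl bundle is flat, `D ^ 2 = 0`. -/
def IsFlat (D : (M → Weyl m) → OneForm m M) : Prop :=
  ∀ a, IsSmoothSection a → extendToOneForms D (D a) = 0

/-- The curvature of the connection as a `2`-form whose values are homogeneous quadratic in the
generators, `R(u, v) = (1/2) Ω(e, R(u, v) e)`, so that `∇ ^ 2 = (i / t) [R, ·]`. -/
def curvatureForm (Ω : SymplecticForm m M) (conn : Connection m M) : TwoForm m M := fun x u v =>
  ∑ k, ∑ l, ((Ω.form x (coordVec x k) (riemann conn x u v (coordVec x l)) / 2 : ℝ) : ℂ) •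
    (Weyl.gen k * Weyl.gen l)

/-! ### Fedosov connections -/

/-- The operator `(i / t) [σ, ·]` from sections to `1`-forms, for a `1`-form `σ`. -/
def adOp (Ω : SymplecticForm m M) (σ : OneForm m M) (a : M → Weyl m) : OneForm m M :=
  fun x v => Weyl.bracket (Ω.poissonMatrix x) (σ x v) (a x)

/-- `∇ + r 1 + r 2 + …`. -/
def higherPart (conn : Connection m M) (r : ℕ → (M → Weyl m) → OneForm m M) (a : M → Weyl m) :
    OneForm m M :=
  fun x v => nabla conn a x v + Weyl.formalSum fun k => r k a x v

/-- `D = - δ + ∇ + r 1 + r 2 + …`. -/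
def fedosovD (conn : Connection m M) (r : ℕ → (M → Weyl m) → OneForm m M) (a : M → Weyl m) :
    OneForm m M :=
  - delta₀ a + higherPart conn r a

/-- The component of degree `k + 2` of `R + ∇ ρ + (i / t) ρ ∘ ρ`, where `ρ = ∑ k, ρ k`. -/
def fedosovSource (Ω : SymplecticForm m M) (conn : Connection m M) (ρ : ℕ → OneForm m M) (k : ℕ) :
    TwoForm m M :=
  (if k = 0 then curvatureForm Ω conn else 0) + extendToOneForms (nabla conn) (ρ k)
    + fun x u v => ∑ p ∈ Finset.HasAntidiagonal.antidiagonal k,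
        Weyl.bracket (Ω.poissonMatrix x) (ρ p.1 x u) (ρ p.2 x v)

/-- The component of degree `k + 2` of the `2`-form `R - δ ρ + ∇ ρ + (i / t) ρ ∘ ρ`. The square
of `- δ + ∇ + (i / t) [ρ, ·]` is `(i / t)` times the commutator with this form. -/
def curvatureLift (Ω : SymplecticForm m M) (conn : Connection m M) (ρ : ℕ → OneForm m M) (k : ℕ) :
    TwoForm m M :=
  fedosovSource Ω conn ρ k - delta₁ (ρ (k + 1))

/-- The operators `r k = (i / t) [ρ k, ·]`, `k ≥ 1`, given by `1`-forms `ρ k` of degree `k + 2`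
with `δ* ρ k = 0`, are such that `D ^ 2 = 0` and the curvature of `D`, lifted to the Weyl algebra,
has no central part (no part of degree `0` in the generators). The index `0` is not used:
`ρ 0 = 0`. -/
structure IsFedosovPotential (Ω : SymplecticForm m M) (conn : Connection m M)
    (ρ : ℕ → OneForm m M) : Prop where
  zero : ρ 0 = 0
  smooth : ∀ k, IsSmoothOneForm (ρ k)
  homogeneous : ∀ k x v, Weyl.IsHomogeneous (k + 2) (ρ k x v)
  deltaStar : ∀ k, deltaStar₁ (ρ k) = 0
  flat : IsFlat (fedosovD conn fun k => adOp Ω (ρ k))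
  normalized : ∀ k x u v j, Weyl.coef j 0 (curvatureLift Ω conn ρ k x u v) = 0

/-- The sequence `r 1, r 2, …` of operators (with `r 0 = 0`) defines a Fedosov connection. -/
def IsFedosovSequence (Ω : SymplecticForm m M) (conn : Connection m M)
    (r : ℕ → (M → Weyl m) → OneForm m M) : Prop :=
  ∃ ρ, IsFedosovPotential Ω conn ρ ∧ ∀ k, r k = adOp Ω (ρ k)

/-- The smooth flat sections of `D`. -/
def FlatSection (D : (M → Weyl m) → OneForm m M) : Type _ :=
  {a : M → Weyl m // IsSmoothSection a ∧ D a = 0}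

/-- A formal series of smooth functions as a section of the Weyl bundle free of the generators. -/
def ofSeries (a : PowerSeries (SmoothFun m M)) : M → Weyl m := fun x =>
  Weyl.ofCoef fun j α => if α = 0 then (PowerSeries.coeff j a : SmoothFun m M) x else 0

/-! ### Star-products -/

/-- The functions `f` and `g` have the same partial derivatives of order `≤ n` at `x`. -/
def SameJet (n : ℕ) (f g : SmoothFun m M) (x : M) : Prop :=
  ∀ i ≤ n, iteratedFDeriv ℝ i (f ∘ (extChartAt (𝓡 m) x).symm) (extChartAt (𝓡 m) x x) =
    iteratedFDeriv ℝ i (g ∘ (extChartAt (𝓡 m) x).symm) (extChartAt (𝓡 m) x x)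

/-- A formal power series in `t` with constant coefficients. -/
def IsScalar (c : PowerSeries (SmoothFun m M)) : Prop :=
  ∃ z : ℕ → ℂ, ∀ n x, PowerSeries.coeff n c x = z n

/-- Deformation quantizations of `(M, Ω)`: associative unital `ℂ⟦t⟧`-bilinear products on
`C^∞(M)⟦t⟧` which are local, deform the pointwise product and satisfy the correspondence
principle. -/
structure IsStarProduct (Ω : SymplecticForm m M)
    (star : PowerSeries (SmoothFun m M) → PowerSeries (SmoothFun m M) →
      PowerSeries (SmoothFun m M)) : Prop where
  add_left : ∀ a b c, star (a + b) c = star a c + star b c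
  add_right : ∀ a b c, star a (b + c) = star a b + star a c
  scalar_left : ∀ c a b, IsScalar c → star (c * a) b = c * star a b
  scalar_right : ∀ c a b, IsScalar c → star a (c * b) = c * star a b
  assoc : ∀ a b c, star (star a b) c = star a (star b c)
  one_left : ∀ a, star 1 a = a
  one_right : ∀ a, star a 1 = a
  /-- The `k`-th coefficient of `a * b` is the sum over `i + j + l = k` of terms which depend only
  on the derivatives of order `≤ l` of the coefficients `a i` and `b j`. -/
  isLocal : ∃ B : ℕ → (SmoothFun m M →+ SmoothFun m M →+ SmoothFun m M),
    (∀ k a b, PowerSeries.coeff k (star a b) =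
      ∑ s ∈ Finset.HasAntidiagonal.antidiagonal k, ∑ q ∈ Finset.HasAntidiagonal.antidiagonal s.2,
        B s.1 (PowerSeries.coeff q.1 a) (PowerSeries.coeff q.2 b)) ∧
    ∀ l f f' g g' x, SameJet l f f' x → SameJet l g g' x → B l f g x = B l f' g' x
  coeff_zero : ∀ a b, PowerSeries.coeff 0 (star a b) =
    PowerSeries.coeff 0 a * PowerSeries.coeff 0 b
  /-- `(i / t) (a * b - b * a) = {a 0, b 0} + O(t)`; the commutator vanishes for `t = 0`. -/
  correspondence : ∀ a b x, Complex.I * PowerSeries.coeff 1 (star a b - star b a) x =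
    Ω.poisson (⇑(PowerSeries.coeff 0 a : SmoothFun m M)) (⇑(PowerSeries.coeff 0 b : SmoothFun m M)) x

end Fedosov

end

open Fedosov

/-! The argument rests on one quantity, the total curvature `Ω = R - δρ + ∇ρ + (i/t) ρ∘ρ`, for which
`D² = (i/t)[Ω, ·]`. Since the Poisson matrix is invertible, an element of the fibre that commutes
with every generator contains none of them. Hence `D² = 0` forces `Ω` to be central, the
normalization kills the central part, and being a Fedosov potential becomes `Ω = 0`
(`isFedosovPotential_iff`). Sorted by degree, `Ω = 0` reads `δρ_{k+1} = source_k`, where the source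
depends only on `ρ_0, …, ρ_k`.

Uniqueness: Euler's identity gives the homotopy formula `δδ⁻¹ + δ⁻¹δ = 1` on forms
(`homotopy_oneForm`, `homotopy_twoForm`). As `δ*ρ = 0`, applying `δ⁻¹` to the graded equations
yields `ρ_{k+1} = δ⁻¹(source_k)`, which determines everything recursively.

Existence: the forms produced by the recursion satisfy `δ*ρ = 0` because `δ*δ* = 0`, and then `δ⁻¹Ω
= 0` by construction. The Bianchi identity `DΩ = 0` (`bianchi_locOmega`) turns `δΩ` into `(D + δ)Ω`,
so that `Ω = δ⁻¹δΩ = δ⁻¹(D + δ)Ω`. The operator `D + δ = ∇ + (i/t)[ρ, ·]` does not lower the degree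
and `δ⁻¹` raises it by one. So `Ω` lies in every step of the degree filtration and is zero
(`inFil_totalCurvature_fedosovForm`).

Flat sections obey the same mechanism. On functions `δ⁻¹δA = A - A|_{e=0}`, so a flat section with
symbol `a` solves `A = a + δ⁻¹(D + δ)A`. The right side is a contraction for the degree filtration,
hence has exactly one fixed point, the limit of its iterates. Conversely, for a fixed point the form
`B = DA` satisfies `δ⁻¹B = 0` and `DB = 0`, hence `B = δ⁻¹(D + δ)B`, and again `B = 0`
(`fedosovD_eq_zero`).

The Moyal product is associative because the three constant coefficient operators `P₁₂`, `P₁₃`,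
`P₂₃` on a triple tensor product commute, so that both bracketings are multiplication after `exp` of
their sum (`sum_moyalTerm_assoc`). Each part of `D` is a derivation of it (for `∇` this is `∇P =
0`), so flat sections form an algebra. Locality follows by running the iteration inside a filtration
of functions by ideals in which a derivative costs one and `t` and the generators each count one.
The Poisson bracket appears because only the first order term of the product is antisymmetric modulo
`t²` and the linear terms of a flat section are the derivatives of its symbol.

The analysis is done in charts. `LocalGeometry` collects what a chart provides: the bivector, and
torsion-free Christoffel symbols for which it is parallel. The maps `framePull`, `loc` and `locOne`
carry sections and forms to a chart. They are needed because the lift of the connection at `y` is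
defined in the preferred chart at `y`, while differentiating it once more requires one fixed chart
in a neighbourhood; `locOne_nabla` and `locTwo_extendToOneForms` supply the required invariance. -/

noncomputable section

namespace Fedosov.Weyl

variable {m : ℕ}

/-! ### Coefficients -/

theorem ext_coef {a b : Weyl m} (h : ∀ j α, coef j α a = coef j α b) : a = b := by
  refine PowerSeries.ext fun j => MvPowerSeries.ext fun α => h j α

/-- The coefficient functional as a linear map. -/
def coefL (j : ℕ) (α : Fin m →₀ ℕ) : Weyl m →ₗ[ℂ] ℂ where
  toFun := coef j α
  map_add' a b := by simp [coef]
  map_smul' c a := by simp [coef]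

@[simp] theorem coef_zero (j : ℕ) (α : Fin m →₀ ℕ) : coef j α (0 : Weyl m) = 0 :=
  (coefL j α).map_zero
@[simp] theorem coef_add (j : ℕ) (α : Fin m →₀ ℕ) (a b : Weyl m) :
    coef j α (a + b) = coef j α a + coef j α b := (coefL j α).map_add a b
@[simp] theorem coef_sub (j : ℕ) (α : Fin m →₀ ℕ) (a b : Weyl m) :
    coef j α (a - b) = coef j α a - coef j α b := (coefL j α).map_sub a b
@[simp] theorem coef_neg (j : ℕ) (α : Fin m →₀ ℕ) (a : Weyl m) :
    coef j α (-a) = -coef j α a := (coefL j α).map_neg a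
@[simp] theorem coef_smul (j : ℕ) (α : Fin m →₀ ℕ) (c : ℂ) (a : Weyl m) :
    coef j α (c • a) = c * coef j α a := (coefL j α).map_smul c a
@[simp] theorem coef_sum {ι : Type*} (j : ℕ) (α : Fin m →₀ ℕ) (s : Finset ι) (f : ι → Weyl m) :
    coef j α (∑ i ∈ s, f i) = ∑ i ∈ s, coef j α (f i) := map_sum (coefL j α) f s
@[simp] theorem coef_ofCoef (j : ℕ) (α : Fin m →₀ ℕ) (c : ℕ → (Fin m →₀ ℕ) → ℂ) :
    coef j α (ofCoef c) = c j α := by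
  exact congrArg (MvPowerSeries.coeff α)
    (PowerSeries.coeff_mk j fun j => (fun α => c j α : MvPowerSeries (Fin m) ℂ))

theorem coef_mul (j : ℕ) (α : Fin m →₀ ℕ) (a b : Weyl m) :
    coef j α (a * b) = ∑ s ∈ Finset.HasAntidiagonal.antidiagonal j,
      ∑ q ∈ Finset.HasAntidiagonal.antidiagonal α, coef s.1 q.1 a * coef s.2 q.2 b := by
  classical
  simp only [coef, PowerSeries.coeff_mul, map_sum, MvPowerSeries.coeff_mul]

/-! ### Derivations in the generators -/

/-- `partialE k` as a derivation. -/
def partialD (k : Fin m) : Derivation ℂ (Weyl m) (Weyl m) where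
  toFun := partialE k
  map_add' a b := by ext; simp [partialE]
  map_smul' c a := by ext; simp [partialE]
  map_one_eq_zero' := by
    refine PowerSeries.ext fun j => ?_
    simp only [LinearMap.coe_mk, AddHom.coe_mk, partialE, PowerSeries.coeff_mk,
      PowerSeries.coeff_one]
    split_ifs <;> simp
  leibniz' a b := by
    refine PowerSeries.ext fun j => ?_
    simp only [LinearMap.coe_mk, AddHom.coe_mk, partialE, PowerSeries.coeff_mk,
      PowerSeries.coeff_mul, map_sum, smul_eq_mul, map_add, Derivation.leibniz,
      Finset.sum_add_distrib]
    congr 1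
    rw [← Finset.Nat.sum_antidiagonal_swap]
    simp

theorem partialD_apply (k : Fin m) (a : Weyl m) : partialD k a = partialE k a := rfl

theorem coef_partialE (k : Fin m) (j : ℕ) (α : Fin m →₀ ℕ) (a : Weyl m) :
    coef j α (partialE k a) = coef j (α + Finsupp.single k 1) a * (α k + 1) := by
  simp [coef, partialE, MvPowerSeries.coeff_pderiv]

theorem partialE_comm (k l : Fin m) (a : Weyl m) :
    partialE k (partialE l a) = partialE l (partialE k a) := by
  refine ext_coef fun j α => ?_
  simp only [coef_partialE, Finsupp.add_apply]
  rw [add_right_comm α]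
  by_cases h : k = l
  · subst h; rfl
  · simp [h, Ne.symm h]; ring

theorem pderiv_comm (k l : Fin m) (f : MvPowerSeries (Fin m) ℂ) :
    MvPowerSeries.pderiv ℂ k (MvPowerSeries.pderiv ℂ l f) =
      MvPowerSeries.pderiv ℂ l (MvPowerSeries.pderiv ℂ k f) := by
  have := congrArg (PowerSeries.coeff 0) (partialE_comm k l (PowerSeries.C f))
  simpa [partialE] using this

theorem partialE_gen (k l : Fin m) : partialE k (gen l : Weyl m) = if k = l then 1 else 0 := by
  refine PowerSeries.ext fun j => ?_
  simp only [partialE, gen, PowerSeries.coeff_mk, PowerSeries.coeff_C]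
  split_ifs with h1 h2 h2
  · subst h2; simp [h1]
  · simp [MvPowerSeries.pderiv_X_of_ne (Ne.symm h2)]
  · simp [PowerSeries.coeff_one, h1]
  · simp

/-- The derivative along a vector with constant coefficients. -/
def dirE (u : EuclideanSpace ℝ (Fin m)) : Derivation ℂ (Weyl m) (Weyl m) :=
  ∑ k, (u k : ℂ) • partialD k

theorem dirE_apply (u : EuclideanSpace ℝ (Fin m)) (a : Weyl m) :
    dirE u a = ∑ k, (u k : ℂ) • partialE k a := by
  simp [dirE, ← Derivation.coeFnAddMonoidHom_apply, map_sum, Finset.sum_apply, -Complex.coe_smul]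
  rfl

theorem dirE_comm (u v : EuclideanSpace ℝ (Fin m)) (a : Weyl m) :
    dirE u (dirE v a) = dirE v (dirE u a) := by
  simp only [dirE_apply, ← partialD_apply, map_sum, Derivation.map_smul, Finset.smul_sum]
  rw [Finset.sum_comm]
  refine Finset.sum_congr rfl fun k _ => Finset.sum_congr rfl fun l _ => ?_
  simp only [partialD_apply]
  rw [partialE_comm, smul_comm]

theorem dirE_single (k : Fin m) (a : Weyl m) :
    dirE (EuclideanSpace.single k 1) a = partialE k a := by
  rw [dirE_apply, Finset.sum_eq_single k] <;> simp +contextual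

theorem dirE_add_left (u v : EuclideanSpace ℝ (Fin m)) (a : Weyl m) :
    dirE (u + v) a = dirE u a + dirE v a := by
  simp [dirE_apply, add_smul, Finset.sum_add_distrib]

theorem dirE_smul_left (c : ℝ) (u : EuclideanSpace ℝ (Fin m)) (a : Weyl m) :
    dirE (c • u) a = (c : ℂ) • dirE u a := by
  simp [dirE_apply, mul_smul, Finset.smul_sum]

/-- `dirE` as a linear map of the direction. -/
def dirL (a : Weyl m) : EuclideanSpace ℝ (Fin m) →ₗ[ℝ] Weyl m where
  toFun u := dirE u a
  map_add' u v := dirE_add_left u v a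
  map_smul' c u := by
    rw [dirE_smul_left]; exact (RCLike.real_smul_eq_coe_smul (K := ℂ) c (dirE u a)).symm

theorem dirL_apply (u : EuclideanSpace ℝ (Fin m)) (a : Weyl m) : dirL a u = dirE u a := rfl

theorem dirE_gen (u : EuclideanSpace ℝ (Fin m)) (k : Fin m) :
    dirE u (gen k : Weyl m) = (u k : ℂ) • 1 := by
  rw [dirE_apply, Finset.sum_eq_single k] <;> simp +contextual [partialE_gen]

/-! ### The bidifferential operators -/

local notation "V" => MvPowerSeries (Fin m) ℂ

theorem bidiff_add_left (P : Matrix (Fin m) (Fin m) ℝ) (s : ℕ) (f f' g : V) :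
    bidiff P s (f + f') g = bidiff P s f g + bidiff P s f' g := by
  induction s generalizing f f' g with
  | zero => simp [bidiff, add_mul]
  | succ s ih => simp [bidiff, ih, Finset.sum_add_distrib]

theorem bidiff_add_right (P : Matrix (Fin m) (Fin m) ℝ) (s : ℕ) (f g g' : V) :
    bidiff P s f (g + g') = bidiff P s f g + bidiff P s f g' := by
  induction s generalizing f g g' with
  | zero => simp [bidiff, mul_add]
  | succ s ih => simp [bidiff, ih, Finset.sum_add_distrib]

theorem bidiff_smul_left (P : Matrix (Fin m) (Fin m) ℝ) (s : ℕ) (c : ℂ) (f g : V) :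
    bidiff P s (c • f) g = c • bidiff P s f g := by
  induction s generalizing f g with
  | zero => simp [bidiff]
  | succ s ih => simp only [bidiff, ih, Derivation.map_smul, Finset.smul_sum, smul_comm c]

theorem bidiff_smul_right (P : Matrix (Fin m) (Fin m) ℝ) (s : ℕ) (c : ℂ) (f g : V) :
    bidiff P s f (c • g) = c • bidiff P s f g := by
  induction s generalizing f g with
  | zero => simp [bidiff]
  | succ s ih => simp only [bidiff, ih, Derivation.map_smul, Finset.smul_sum, smul_comm c]

/-- `bidiff P s` as a bilinear map. -/
def bidiffL (P : Matrix (Fin m) (Fin m) ℝ) (s : ℕ) : V →ₗ[ℂ] V →ₗ[ℂ] V :=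
  LinearMap.mk₂ ℂ (bidiff P s) (bidiff_add_left P s) (bidiff_smul_left P s)
    (bidiff_add_right P s) (bidiff_smul_right P s)

theorem bidiffL_apply (P : Matrix (Fin m) (Fin m) ℝ) (s : ℕ) (f g : V) :
    bidiffL P s f g = bidiff P s f g := rfl

/-- Multiplication of power series is commutative, so exchanging the arguments only exchanges the
two indices of `P`. Statements about the right factor are deduced from those about the left factor
in this way. -/
theorem bidiff_transpose (P : Matrix (Fin m) (Fin m) ℝ) (s : ℕ) (f g : V) :
    bidiff P s f g = bidiff P.transpose s g f := by
  induction s generalizing f g with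
  | zero => simp [bidiff, mul_comm]
  | succ s ih =>
    simp only [bidiff]
    rw [Finset.sum_comm]
    simp [ih]

theorem bidiff_neg (P : Matrix (Fin m) (Fin m) ℝ) (s : ℕ) (f g : V) :
    bidiff (-P) s f g = (-1) ^ s • bidiff P s f g := by
  induction s generalizing f g with
  | zero => simp [bidiff]
  | succ s ih =>
    simp only [bidiff, ih, Matrix.neg_apply, pow_succ, Finset.smul_sum]
    refine Finset.sum_congr rfl fun k _ => Finset.sum_congr rfl fun l _ => ?_
    rw [mul_smul, smul_comm]
    simp

theorem bidiff_swap {P : Matrix (Fin m) (Fin m) ℝ} (hP : P.transpose = -P) (s : ℕ) (f g : V) :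
    bidiff P s g f = (-1) ^ s • bidiff P s f g := by
  rw [bidiff_transpose, hP, bidiff_neg]

/-- `P` does not depend on the generators and partial derivatives commute, so the Leibniz rule for
the ordinary product passes to every order. -/
theorem pderiv_bidiff (P : Matrix (Fin m) (Fin m) ℝ) (s : ℕ) (k : Fin m) (f g : V) :
    MvPowerSeries.pderiv ℂ k (bidiff P s f g) =
      bidiff P s (MvPowerSeries.pderiv ℂ k f) g + bidiff P s f (MvPowerSeries.pderiv ℂ k g) := by
  induction s generalizing f g with
  | zero => simp [bidiff, mul_comm, add_comm]
  | succ s ih =>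
    simp only [bidiff, map_sum, Derivation.map_smul, ih, smul_add, Finset.sum_add_distrib,
      pderiv_comm k]

/-- Each application of the bivector consumes two derivatives. This is the reason for giving `t`
degree `2`: the factor `t ^ s` restores the degree. -/
theorem coeff_bidiff_ne_zero (P : Matrix (Fin m) (Fin m) ℝ) (s : ℕ) (f g : V) (α : Fin m →₀ ℕ)
    (h : MvPowerSeries.coeff α (bidiff P s f g) ≠ 0) :
    ∃ β γ, MvPowerSeries.coeff β f ≠ 0 ∧ MvPowerSeries.coeff γ g ≠ 0 ∧
      β.degree + γ.degree = α.degree + 2 * s := by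
  classical
  induction s generalizing f g with
  | zero =>
    rw [bidiff, MvPowerSeries.coeff_mul] at h
    obtain ⟨q, hq, hne⟩ := Finset.exists_ne_zero_of_sum_ne_zero h
    refine ⟨q.1, q.2, left_ne_zero_of_mul hne, right_ne_zero_of_mul hne, ?_⟩
    rw [← Finset.HasAntidiagonal.mem_antidiagonal.1 hq]; simp
  | succ s ih =>
    rw [bidiff, map_sum] at h
    obtain ⟨k, -, h⟩ := Finset.exists_ne_zero_of_sum_ne_zero h
    rw [map_sum] at h
    obtain ⟨l, -, h⟩ := Finset.exists_ne_zero_of_sum_ne_zero h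
    rw [map_smul, smul_eq_mul] at h
    obtain ⟨β, γ, hβ, hγ, hd⟩ := ih _ _ (right_ne_zero_of_mul h)
    rw [MvPowerSeries.coeff_pderiv] at hβ hγ
    refine ⟨_, _, left_ne_zero_of_mul hβ, left_ne_zero_of_mul hγ, ?_⟩
    simp only [map_add, Finsupp.degree_single]
    omega

/-! ### The Moyal product is associative -/

open TensorProduct in
/-- `∑ P k l ∂ k ⊗ ∂ l`. -/
def tensorPoisson (P : Matrix (Fin m) (Fin m) ℝ) : Module.End ℂ (V ⊗[ℂ] V) :=
  ∑ k, ∑ l, (P k l : ℂ) • TensorProduct.map (MvPowerSeries.pderiv ℂ k : V →ₗ[ℂ] V)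
    (MvPowerSeries.pderiv ℂ l : V →ₗ[ℂ] V)

open TensorProduct in
theorem tensorPoisson_tmul (P : Matrix (Fin m) (Fin m) ℝ) (f g : V) :
    tensorPoisson P (f ⊗ₜ g) = ∑ k, ∑ l, (P k l : ℂ) •
      (MvPowerSeries.pderiv ℂ k f ⊗ₜ[ℂ] MvPowerSeries.pderiv ℂ l g) := by
  simp [tensorPoisson, -Complex.coe_smul]

open TensorProduct in
-- On the tensor square, before multiplying out, the recursion for `bidiff` is the iteration of a
-- single endomorphism. Compositions of bidifferential operators thereby become products in an
-- algebra of endomorphisms, where the binomial formula applies.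
theorem mul_tensorPoisson_pow (P : Matrix (Fin m) (Fin m) ℝ) (s : ℕ) (f g : V) :
    LinearMap.mul' ℂ V ((tensorPoisson P ^ s) (f ⊗ₜ g)) = bidiff P s f g := by
  induction s generalizing f g with
  | zero => simp [bidiff]
  | succ s ih =>
    rw [pow_succ, Module.End.mul_apply]
    simp [tensorPoisson_tmul, bidiff, ih, map_sum, -Complex.coe_smul]

section Assoc

open TensorProduct

variable (P : Matrix (Fin m) (Fin m) ℝ)

local notation "d" k => (MvPowerSeries.pderiv ℂ k : V →ₗ[ℂ] V)

/-- `∑ P k l ∂ k ⊗ ∂ l ⊗ 1`. -/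
def poisson₁₂ : Module.End ℂ ((V ⊗[ℂ] V) ⊗[ℂ] V) :=
  ∑ k, ∑ l, (P k l : ℂ) • TensorProduct.map (TensorProduct.map (d k) (d l)) LinearMap.id
/-- `∑ P k l ∂ k ⊗ 1 ⊗ ∂ l`. -/
def poisson₁₃ : Module.End ℂ ((V ⊗[ℂ] V) ⊗[ℂ] V) :=
  ∑ k, ∑ l, (P k l : ℂ) • TensorProduct.map (TensorProduct.map (d k) LinearMap.id) (d l)
/-- `∑ P k l 1 ⊗ ∂ k ⊗ ∂ l`. -/
def poisson₂₃ : Module.End ℂ ((V ⊗[ℂ] V) ⊗[ℂ] V) :=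
  ∑ k, ∑ l, (P k l : ℂ) • TensorProduct.map (TensorProduct.map LinearMap.id (d k)) (d l)

/-- The operators have constant coefficients and act through partial derivatives in the separate
tensor factors, so they commute because partial derivatives do. The same holds for the next two
statements. -/
theorem commute_poisson₁₂₁₃ : Commute (poisson₁₂ P) (poisson₁₃ P) := by
  refine Commute.sum_left _ _ _ fun k _ => Commute.sum_left _ _ _ fun l _ =>
    Commute.sum_right _ _ _ fun k' _ => Commute.sum_right _ _ _ fun l' _ =>
      Commute.smul_left (Commute.smul_right ?_ _) _
  refine TensorProduct.ext_threefold fun f g h => ?_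
  simp [pderiv_comm k]

theorem commute_poisson₁₂₂₃ : Commute (poisson₁₂ P) (poisson₂₃ P) := by
  refine Commute.sum_left _ _ _ fun k _ => Commute.sum_left _ _ _ fun l _ =>
    Commute.sum_right _ _ _ fun k' _ => Commute.sum_right _ _ _ fun l' _ =>
      Commute.smul_left (Commute.smul_right ?_ _) _
  refine TensorProduct.ext_threefold fun f g h => ?_
  simp [pderiv_comm l]

theorem commute_poisson₁₃₂₃ : Commute (poisson₁₃ P) (poisson₂₃ P) := by
  refine Commute.sum_left _ _ _ fun k _ => Commute.sum_left _ _ _ fun l _ =>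
    Commute.sum_right _ _ _ fun k' _ => Commute.sum_right _ _ _ fun l' _ =>
      Commute.smul_left (Commute.smul_right ?_ _) _
  refine TensorProduct.ext_threefold fun f g h => ?_
  simp [pderiv_comm l]

/-- `f ⊗ g ⊗ h ↦ f * g ⊗ h`. -/
def mulLeft : (V ⊗[ℂ] V) ⊗[ℂ] V →ₗ[ℂ] V ⊗[ℂ] V :=
  TensorProduct.map (LinearMap.mul' ℂ V) LinearMap.id
/-- `f ⊗ g ⊗ h ↦ f ⊗ g * h`. -/
def mulRight : (V ⊗[ℂ] V) ⊗[ℂ] V →ₗ[ℂ] V ⊗[ℂ] V :=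
  TensorProduct.map LinearMap.id (LinearMap.mul' ℂ V) ∘ₗ (TensorProduct.assoc ℂ V V V).toLinearMap

/-- This is the Leibniz rule: a derivative of the product `f * g` falls on `f`, giving `P₁₃`, or on
`g`, giving `P₂₃`. -/
theorem tensorPoisson_mulLeft (x : (V ⊗[ℂ] V) ⊗[ℂ] V) :
    tensorPoisson P (mulLeft x) = mulLeft ((poisson₁₃ P + poisson₂₃ P) x) := by
  suffices tensorPoisson P ∘ₗ mulLeft = mulLeft ∘ₗ (poisson₁₃ P + poisson₂₃ P) from
    LinearMap.congr_fun this x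
  refine TensorProduct.ext_threefold fun f g h => ?_
  simp only [tensorPoisson, mulLeft, poisson₁₃, poisson₂₃, LinearMap.comp_apply, map_tmul,
    LinearMap.sum_apply, LinearMap.smul_apply, LinearMap.add_apply, map_add, map_sum, map_smul,
    LinearMap.mul'_apply, LinearMap.id_coe, id_eq, Derivation.coeFn_coe, Derivation.leibniz,
    smul_eq_mul, TensorProduct.add_tmul, smul_add, Finset.sum_add_distrib]
  rw [add_comm]
  simp only [mul_comm g]

theorem tensorPoisson_mulRight (x : (V ⊗[ℂ] V) ⊗[ℂ] V) :
    tensorPoisson P (mulRight x) = mulRight ((poisson₁₂ P + poisson₁₃ P) x) := by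
  suffices tensorPoisson P ∘ₗ mulRight = mulRight ∘ₗ (poisson₁₂ P + poisson₁₃ P) from
    LinearMap.congr_fun this x
  refine TensorProduct.ext_threefold fun f g h => ?_
  simp only [tensorPoisson, mulRight, poisson₁₃, poisson₁₂, LinearMap.comp_apply, map_tmul,
    LinearMap.sum_apply, LinearMap.smul_apply, LinearMap.add_apply, map_add, map_sum, map_smul,
    LinearEquiv.coe_coe, TensorProduct.assoc_tmul,
    LinearMap.mul'_apply, LinearMap.id_coe, id_eq, Derivation.coeFn_coe, Derivation.leibniz,
    smul_eq_mul, TensorProduct.tmul_add, smul_add, Finset.sum_add_distrib]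
  rw [add_comm]
  simp only [mul_comm h]

theorem poisson₁₂_tmul (f g h : V) :
    poisson₁₂ P ((f ⊗ₜ g) ⊗ₜ h) = ∑ k, ∑ l, (P k l : ℂ) •
      ((MvPowerSeries.pderiv ℂ k f ⊗ₜ[ℂ] MvPowerSeries.pderiv ℂ l g) ⊗ₜ[ℂ] h) := by
  simp [poisson₁₂, -Complex.coe_smul, TensorProduct.smul_tmul']

theorem poisson₂₃_tmul (f g h : V) :
    poisson₂₃ P ((f ⊗ₜ g) ⊗ₜ h) = ∑ k, ∑ l, (P k l : ℂ) •
      ((f ⊗ₜ[ℂ] MvPowerSeries.pderiv ℂ k g) ⊗ₜ[ℂ] MvPowerSeries.pderiv ℂ l h) := by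
  simp [poisson₂₃, -Complex.coe_smul, TensorProduct.smul_tmul']

theorem mulLeft_poisson₁₂_pow (s : ℕ) (f g h : V) :
    mulLeft ((poisson₁₂ P ^ s) ((f ⊗ₜ g) ⊗ₜ h)) = bidiff P s f g ⊗ₜ h := by
  induction s generalizing f g with
  | zero => simp [bidiff, mulLeft]
  | succ s ih =>
    rw [pow_succ, Module.End.mul_apply]
    rw [poisson₁₂_tmul]
    simp [bidiff, bidiff_smul_left, ih, map_sum, -Complex.coe_smul, TensorProduct.sum_tmul, TensorProduct.smul_tmul']

theorem mulRight_poisson₂₃_pow (s : ℕ) (f g h : V) :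
    mulRight ((poisson₂₃ P ^ s) ((f ⊗ₜ g) ⊗ₜ h)) = f ⊗ₜ bidiff P s g h := by
  induction s generalizing g h with
  | zero => simp [bidiff, mulRight]
  | succ s ih =>
    rw [pow_succ, Module.End.mul_apply]
    rw [poisson₂₃_tmul]
    simp [bidiff, ih, map_sum, -Complex.coe_smul, TensorProduct.tmul_sum, TensorProduct.tmul_smul]

theorem mul_mulLeft (x : (V ⊗[ℂ] V) ⊗[ℂ] V) :
    LinearMap.mul' ℂ V (mulLeft x) = LinearMap.mul' ℂ V (mulRight x) := by
  suffices LinearMap.mul' ℂ V ∘ₗ mulLeft = LinearMap.mul' ℂ V ∘ₗ mulRight from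
    LinearMap.congr_fun this x
  refine TensorProduct.ext_threefold fun f g h => ?_
  simp [mulLeft, mulRight, mul_assoc]

/-- All multiplications are moved to the outside, so that an iterated product becomes one operator
on the triple tensor product followed by complete multiplication. -/
theorem bidiff_bidiff_left (n s : ℕ) (f g h : V) :
    bidiff P n (bidiff P s f g) h = LinearMap.mul' ℂ V (mulLeft
      (((poisson₁₃ P + poisson₂₃ P) ^ n * poisson₁₂ P ^ s) ((f ⊗ₜ g) ⊗ₜ h))) := by
  have key : ∀ n x, (tensorPoisson P ^ n) (mulLeft x) =
      mulLeft (((poisson₁₃ P + poisson₂₃ P) ^ n) x) := by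
    intro n
    induction n with
    | zero => simp
    | succ n ih => intro x; simp only [pow_succ, Module.End.mul_apply, tensorPoisson_mulLeft, ih]
  rw [← mul_tensorPoisson_pow, ← mulLeft_poisson₁₂_pow, key, Module.End.mul_apply]

theorem bidiff_bidiff_right (n s : ℕ) (f g h : V) :
    bidiff P n f (bidiff P s g h) = LinearMap.mul' ℂ V (mulLeft
      (((poisson₁₂ P + poisson₁₃ P) ^ n * poisson₂₃ P ^ s) ((f ⊗ₜ g) ⊗ₜ h))) := by
  have key : ∀ n x, (tensorPoisson P ^ n) (mulRight x) =
      mulRight (((poisson₁₂ P + poisson₁₃ P) ^ n) x) := by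
    intro n
    induction n with
    | zero => simp
    | succ n ih => intro x; simp only [pow_succ, Module.End.mul_apply, tensorPoisson_mulRight, ih]
  rw [← mul_tensorPoisson_pow, ← mulRight_poisson₂₃_pow, key, mul_mulLeft, Module.End.mul_apply]

end Assoc

/-- This is the part of order `n` of `exp(cx) exp(cy) = exp(c(x + y))` for commuting `x` and `y`. -/
theorem sum_antidiagonal_pow {A : Type*} [Semiring A] [Algebra ℂ A] {x y : A} (h : Commute x y)
    (c : ℂ) (n : ℕ) :
    ∑ q ∈ Finset.HasAntidiagonal.antidiagonal n,
      ((c ^ q.1 / (q.1.factorial : ℂ)) * (c ^ q.2 / (q.2.factorial : ℂ))) • (x ^ q.1 * y ^ q.2) =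
      (c ^ n / (n.factorial : ℂ)) • (x + y) ^ n := by
  rw [h.add_pow', Finset.smul_sum]
  refine Finset.sum_congr rfl fun q hq => ?_
  have hq' := Finset.HasAntidiagonal.mem_antidiagonal.1 hq
  subst hq'
  rw [← Nat.cast_smul_eq_nsmul ℂ, smul_smul]
  congr 1
  have h1 := Nat.add_choose_mul_factorial_mul_factorial q.1 q.2
  rw [← Nat.choose_symm_add] at h1
  have h2 : ((q.1 + q.2).factorial : ℂ) ≠ 0 := by exact_mod_cast Nat.factorial_ne_zero _
  have h3 : (q.1.factorial : ℂ) ≠ 0 := by exact_mod_cast Nat.factorial_ne_zero _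
  have h4 : (q.2.factorial : ℂ) ≠ 0 := by exact_mod_cast Nat.factorial_ne_zero _
  have h5 : (((q.1 + q.2).choose q.1 : ℕ) : ℂ) * q.1.factorial * q.2.factorial =
    (q.1 + q.2).factorial := by exact_mod_cast h1
  field_simp
  rw [← h5]; ring

/-- The operator of order `s` in the Moyal product. -/
def moyalTerm (P : Matrix (Fin m) (Fin m) ℝ) (s : ℕ) (f g : V) : V :=
  ((-Complex.I / 2) ^ s / (s.factorial : ℂ)) • bidiff P s f g

/-- Both sides are the part of order `n` of `exp(c(P₁₂ + P₁₃ + P₂₃))` applied to `f ⊗ g ⊗ h` and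
multiplied out: one bracketing groups the sum as `(P₁₃ + P₂₃) + P₁₂`, the other as `(P₁₂ + P₁₃) +
P₂₃`. -/
theorem sum_moyalTerm_assoc (P : Matrix (Fin m) (Fin m) ℝ) (n : ℕ) (f g h : V) :
    ∑ q ∈ Finset.HasAntidiagonal.antidiagonal n, moyalTerm P q.1 (moyalTerm P q.2 f g) h =
      ∑ q ∈ Finset.HasAntidiagonal.antidiagonal n, moyalTerm P q.1 f (moyalTerm P q.2 g h) := by
  have h1 := congrArg (fun T : Module.End ℂ _ => LinearMap.mul' ℂ V (mulLeft
    (T ((f ⊗ₜ[ℂ] g) ⊗ₜ[ℂ] h)))) (sum_antidiagonal_pow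
      ((commute_poisson₁₂₁₃ P).symm.add_left (commute_poisson₁₂₂₃ P).symm) (-Complex.I / 2) n)
  have h2 := congrArg (fun T : Module.End ℂ _ => LinearMap.mul' ℂ V (mulLeft
    (T ((f ⊗ₜ[ℂ] g) ⊗ₜ[ℂ] h)))) (sum_antidiagonal_pow
      ((commute_poisson₁₂₂₃ P).add_left (commute_poisson₁₃₂₃ P)) (-Complex.I / 2) n)
  simp only [LinearMap.sum_apply, LinearMap.smul_apply, map_sum, map_smul,
    ← bidiff_bidiff_left, ← bidiff_bidiff_right] at h1 h2
  simp only [moyalTerm, bidiff_smul_left, bidiff_smul_right, smul_smul]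
  rw [h1, h2]
  congr 5
  abel

end Fedosov.Weyl

namespace Fedosov.Weyl

variable {m : ℕ}

local notation "V" => MvPowerSeries (Fin m) ℂ
local notation "antidiag" => Finset.HasAntidiagonal.antidiagonal

/-! ### The Moyal product -/

theorem coeff_moyal (P : Matrix (Fin m) (Fin m) ℝ) (a b : Weyl m) (n : ℕ) :
    PowerSeries.coeff n (moyal P a b) = ∑ s ∈ antidiag n, ∑ q ∈ antidiag s.2,
      moyalTerm P s.1 (PowerSeries.coeff q.1 a) (PowerSeries.coeff q.2 b) := by
  rw [moyal, PowerSeries.coeff_mk]; rfl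

theorem coeff_smul_complex (n : ℕ) (c : ℂ) (a : Weyl m) :
    PowerSeries.coeff n (c • a) = c • PowerSeries.coeff n a := rfl

/-- `moyal P` as a bilinear map. -/
def moyalL (P : Matrix (Fin m) (Fin m) ℝ) : Weyl m →ₗ[ℂ] Weyl m →ₗ[ℂ] Weyl m :=
  LinearMap.mk₂ ℂ (moyal P)
    (fun a a' b => by
      ext1; simp only [coeff_moyal, map_add, moyalTerm, bidiff_add_left, smul_add,
        Finset.sum_add_distrib])
    (fun c a b => by
      ext1; simp only [coeff_moyal, coeff_smul_complex, moyalTerm, bidiff_smul_left, Finset.smul_sum,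
        smul_comm c])
    (fun a b b' => by
      ext1; simp only [coeff_moyal, map_add, moyalTerm, bidiff_add_right, smul_add,
        Finset.sum_add_distrib])
    (fun c a b => by
      ext1; simp only [coeff_moyal, coeff_smul_complex, moyalTerm, bidiff_smul_right, Finset.smul_sum,
        smul_comm c])

theorem moyalL_apply (P : Matrix (Fin m) (Fin m) ℝ) (a b : Weyl m) :
    moyalL P a b = moyal P a b := rfl

variable (P : Matrix (Fin m) (Fin m) ℝ)

theorem moyal_add_left (a a' b : Weyl m) : moyal P (a + a') b = moyal P a b + moyal P a' b :=
  LinearMap.map_add₂ (moyalL P) a a' b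
theorem moyal_add_right (a b b' : Weyl m) : moyal P a (b + b') = moyal P a b + moyal P a b' :=
  map_add (moyalL P a) b b'
theorem moyal_sub_left (a a' b : Weyl m) : moyal P (a - a') b = moyal P a b - moyal P a' b :=
  LinearMap.map_sub₂ (moyalL P) a a' b
theorem moyal_sub_right (a b b' : Weyl m) : moyal P a (b - b') = moyal P a b - moyal P a b' :=
  map_sub (moyalL P a) b b'
theorem moyal_smul_left (c : ℂ) (a b : Weyl m) : moyal P (c • a) b = c • moyal P a b :=
  LinearMap.map_smul₂ (moyalL P) c a b
theorem moyal_smul_right (c : ℂ) (a b : Weyl m) : moyal P a (c • b) = c • moyal P a b :=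
  map_smul (moyalL P a) c b

theorem moyal_transpose (a b : Weyl m) : moyal P a b = moyal P.transpose b a := by
  ext1 n
  simp only [coeff_moyal]
  refine Finset.sum_congr rfl fun s _ => ?_
  rw [← Finset.Nat.sum_antidiagonal_swap]
  simp only [moyalTerm, Prod.fst_swap, Prod.snd_swap]
  exact Finset.sum_congr rfl fun q _ => by rw [bidiff_transpose]

theorem moyal_X_mul_left (a b : Weyl m) :
    moyal P (PowerSeries.X * a) b = PowerSeries.X * moyal P a b := by
  have key : ∀ s k, ∑ q ∈ antidiag (k + 1), moyalTerm P s
      (PowerSeries.coeff q.1 (PowerSeries.X * a)) (PowerSeries.coeff q.2 b) =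
      ∑ q ∈ antidiag k, moyalTerm P s (PowerSeries.coeff q.1 a) (PowerSeries.coeff q.2 b) := by
    intro s k
    rw [Finset.Nat.sum_antidiagonal_succ]
    simp only [PowerSeries.coeff_zero_X_mul, PowerSeries.coeff_succ_X_mul]
    rw [moyalTerm, ← bidiffL_apply, map_zero, LinearMap.zero_apply, smul_zero, zero_add]
  have key0 : ∀ s, ∑ q ∈ antidiag 0, moyalTerm P s
      (PowerSeries.coeff q.1 (PowerSeries.X * a)) (PowerSeries.coeff q.2 b) = 0 := by
    intro s
    rw [Finset.HasAntidiagonal.antidiagonal_zero, Finset.sum_singleton, PowerSeries.coeff_zero_X_mul,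
      moyalTerm, ← bidiffL_apply, map_zero, LinearMap.zero_apply, smul_zero]
  ext1 n
  rcases n with _ | n
  · rw [PowerSeries.coeff_zero_X_mul, coeff_moyal, Finset.HasAntidiagonal.antidiagonal_zero,
      Finset.sum_singleton]
    exact key0 _
  · rw [PowerSeries.coeff_succ_X_mul, coeff_moyal, coeff_moyal, Finset.Nat.sum_antidiagonal_succ']
    dsimp only
    rw [key0, zero_add]
    exact Finset.sum_congr rfl fun s _ => key _ _

theorem moyal_X_mul_right (a b : Weyl m) :
    moyal P a (PowerSeries.X * b) = PowerSeries.X * moyal P a b := by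
  rw [moyal_transpose, moyal_X_mul_left, ← moyal_transpose]

theorem coeff_moyal_C (f g : V) (n : ℕ) :
    PowerSeries.coeff n (moyal P (PowerSeries.C f) (PowerSeries.C g)) = moyalTerm P n f g := by
  rw [coeff_moyal, Finset.sum_eq_single (n, 0)]
  · simp
  · rintro ⟨s, k⟩ hs hne
    refine Finset.sum_eq_zero fun q hq => ?_
    have h1 := Finset.HasAntidiagonal.mem_antidiagonal.1 hs
    have h2 := Finset.HasAntidiagonal.mem_antidiagonal.1 hq
    simp only at h1 h2
    have : k ≠ 0 := by rintro rfl; exact hne (by simp [← h1])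
    simp only [PowerSeries.coeff_C, moyalTerm]
    by_cases h : q.1 = 0
    · rw [if_neg (by omega : ¬ q.2 = 0), ← bidiffL_apply, map_zero, smul_zero]
    · rw [if_neg h, ← bidiffL_apply, map_zero, LinearMap.zero_apply, smul_zero]
  · simp

theorem moyal_C_left (f : V) (b : Weyl m) (n : ℕ) :
    PowerSeries.coeff n (moyal P (PowerSeries.C f) b) =
      ∑ q ∈ antidiag n, moyalTerm P q.1 f (PowerSeries.coeff q.2 b) := by
  rw [coeff_moyal]
  refine Finset.sum_congr rfl fun s _ => ?_
  rw [Finset.sum_eq_single (0, s.2)]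
  · simp
  · rintro ⟨i, j⟩ hs hne
    have h1 := Finset.HasAntidiagonal.mem_antidiagonal.1 hs
    simp only at h1
    have : i ≠ 0 := by rintro rfl; exact hne (by simp [← h1])
    rw [PowerSeries.coeff_C, if_neg this, moyalTerm, ← bidiffL_apply, map_zero,
      LinearMap.zero_apply, smul_zero]
  · simp

theorem moyal_C_right (a : Weyl m) (g : V) (n : ℕ) :
    PowerSeries.coeff n (moyal P a (PowerSeries.C g)) =
      ∑ q ∈ antidiag n, moyalTerm P q.1 (PowerSeries.coeff q.2 a) g := by
  rw [moyal_transpose, moyal_C_left]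
  refine Finset.sum_congr rfl fun s _ => ?_
  rw [moyalTerm, ← bidiff_transpose, moyalTerm]

/-- A `t`-linear operator on power series in `t` which vanishes on constants is zero. -/
theorem addHom_eq_zero_of_C {R S : Type*} [CommRing R] [CommRing S]
    (L : PowerSeries R →+ PowerSeries S)
    (hX : ∀ a, L (PowerSeries.X * a) = PowerSeries.X * L a)
    (hC : ∀ f, L (PowerSeries.C f) = 0) (a : PowerSeries R) : L a = 0 := by
  ext1 n
  -- Splitting off the constant term of `a` leaves `X` times a shifted series, so coefficient `n +
  -- 1` of `L a` is coefficient `n` of `L` at the shift. No continuity of `L` is required.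
  induction n generalizing a with
  | zero =>
    rw [PowerSeries.eq_X_mul_shift_add_const a, map_add, hX, hC, add_zero,
      PowerSeries.coeff_zero_X_mul, map_zero]
  | succ n ih =>
    rw [PowerSeries.eq_X_mul_shift_add_const a, map_add, hX, hC, add_zero,
      PowerSeries.coeff_succ_X_mul, ih, map_zero, map_zero]

/-- The associator is additive and `t`-linear in each of its three variables, so it suffices that it
vanishes on series constant in `t`; there each coefficient is `sum_moyalTerm_assoc`. -/
theorem moyal_assoc (a b c : Weyl m) :
    moyal P (moyal P a b) c = moyal P a (moyal P b c) := by
  rw [← sub_eq_zero]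
  let L₁ (a b : Weyl m) : Weyl m →+ Weyl m := AddMonoidHom.mk'
    (fun c => moyal P (moyal P a b) c - moyal P a (moyal P b c))
    (fun c c' => by simp only [moyal_add_right]; abel)
  let L₂ (a c : Weyl m) : Weyl m →+ Weyl m := AddMonoidHom.mk'
    (fun b => moyal P (moyal P a b) c - moyal P a (moyal P b c))
    (fun c c' => by simp only [moyal_add_right, moyal_add_left]; abel)
  let L₃ (b c : Weyl m) : Weyl m →+ Weyl m := AddMonoidHom.mk'
    (fun a => moyal P (moyal P a b) c - moyal P a (moyal P b c))
    (fun c c' => by simp only [moyal_add_left]; abel)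
  refine addHom_eq_zero_of_C (L₁ a b)
    (fun c => by simp [L₁, moyal_X_mul_right, mul_sub]) (fun h => ?_) c
  refine addHom_eq_zero_of_C (L₂ a (PowerSeries.C h))
    (fun c => by simp [L₂, moyal_X_mul_right, moyal_X_mul_left, mul_sub]) (fun g => ?_) b
  refine addHom_eq_zero_of_C (L₃ (PowerSeries.C g) (PowerSeries.C h))
    (fun c => by simp [L₃, moyal_X_mul_left, mul_sub]) (fun f => ?_) a
  simp only [L₃, AddMonoidHom.mk'_apply]
  ext1 n
  rw [map_sub, moyal_C_left, moyal_C_right]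
  simp only [coeff_moyal_C]
  rw [sum_moyalTerm_assoc, sub_self, map_zero]

/-! ### The bracket -/

/-- Modulo `t` the product is commutative, so the shift in the definition loses no term. Identities
for the bracket are proved below by multiplying with `t`, which is injective by `X_mul_cancel`, and
computing with commutators. -/
theorem X_mul_bracket (a b : Weyl m) :
    PowerSeries.X * bracket P a b = Complex.I • (moyal P a b - moyal P b a) := by
  ext1 n
  rcases n with _ | n
  · have h : ∀ a b : Weyl m, PowerSeries.coeff 0 (moyal P a b) =
        PowerSeries.coeff 0 a * PowerSeries.coeff 0 b := fun a b => by
      simp [coeff_moyal, moyalTerm, bidiff]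
    rw [PowerSeries.coeff_zero_X_mul, coeff_smul_complex, map_sub, h, h, mul_comm, sub_self, smul_zero]
  · rw [PowerSeries.coeff_succ_X_mul, bracket, PowerSeries.coeff_mk]; rfl

theorem X_mul_cancel {a b : Weyl m} (h : PowerSeries.X * a = PowerSeries.X * b) : a = b := by
  ext1 n
  rw [← PowerSeries.coeff_succ_X_mul, h, PowerSeries.coeff_succ_X_mul]

/-- `bracket P` as a bilinear map. -/
def bracketL : Weyl m →ₗ[ℂ] Weyl m →ₗ[ℂ] Weyl m :=
  LinearMap.mk₂ ℂ (bracket P)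
    (fun a a' b => X_mul_cancel <| by
      simp only [mul_add, X_mul_bracket, moyal_add_left, moyal_add_right, ← smul_add]
      congr 1; abel)
    (fun c a b => X_mul_cancel <| by
      simp only [mul_smul_comm, X_mul_bracket, moyal_smul_left, moyal_smul_right, ← smul_sub]
      rw [smul_comm])
    (fun a b b' => X_mul_cancel <| by
      simp only [mul_add, X_mul_bracket, moyal_add_left, moyal_add_right, ← smul_add]
      congr 1; abel)
    (fun c a b => X_mul_cancel <| by
      simp only [mul_smul_comm, X_mul_bracket, moyal_smul_left, moyal_smul_right, ← smul_sub]
      rw [smul_comm])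

theorem bracketL_apply (a b : Weyl m) : bracketL P a b = bracket P a b := rfl

theorem bracket_add_left (a a' b : Weyl m) :
    bracket P (a + a') b = bracket P a b + bracket P a' b :=
  LinearMap.map_add₂ (bracketL P) a a' b
theorem bracket_add_right (a b b' : Weyl m) :
    bracket P a (b + b') = bracket P a b + bracket P a b' := map_add (bracketL P a) b b'
theorem bracket_sub_left (a a' b : Weyl m) :
    bracket P (a - a') b = bracket P a b - bracket P a' b :=
  LinearMap.map_sub₂ (bracketL P) a a' b
theorem bracket_sub_right (a b b' : Weyl m) :
    bracket P a (b - b') = bracket P a b - bracket P a b' := map_sub (bracketL P a) b b'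
theorem bracket_smul_left (c : ℂ) (a b : Weyl m) : bracket P (c • a) b = c • bracket P a b :=
  LinearMap.map_smul₂ (bracketL P) c a b
theorem bracket_smul_right (c : ℂ) (a b : Weyl m) : bracket P a (c • b) = c • bracket P a b :=
  map_smul (bracketL P a) c b
theorem bracket_sum_left {ι : Type*} (s : Finset ι) (f : ι → Weyl m) (b : Weyl m) :
    bracket P (∑ i ∈ s, f i) b = ∑ i ∈ s, bracket P (f i) b :=
  LinearMap.map_sum₂ (bracketL P) s f b
theorem bracket_sum_right {ι : Type*} (s : Finset ι) (f : ι → Weyl m) (b : Weyl m) :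
    bracket P b (∑ i ∈ s, f i) = ∑ i ∈ s, bracket P b (f i) := map_sum (bracketL P b) f s

theorem bracket_swap (a b : Weyl m) : bracket P b a = -bracket P a b := X_mul_cancel <| by
  rw [mul_neg, X_mul_bracket, X_mul_bracket, ← smul_neg, neg_sub]

theorem bracket_moyal_right (a b c : Weyl m) : bracket P a (moyal P b c) =
    moyal P (bracket P a b) c + moyal P b (bracket P a c) := X_mul_cancel <| by
  rw [mul_add, ← moyal_X_mul_left, ← moyal_X_mul_right]
  simp only [X_mul_bracket, moyal_smul_left, moyal_smul_right, moyal_sub_left, moyal_sub_right,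
    moyal_assoc, ← smul_add]
  congr 1; abel

theorem bracket_moyal_left (a b c : Weyl m) : bracket P (moyal P b c) a =
    moyal P (bracket P b a) c + moyal P b (bracket P c a) := by
  rw [bracket_swap, bracket_moyal_right, bracket_swap P b a, bracket_swap P c a,
    ← moyalL_apply, ← moyalL_apply, ← moyalL_apply, ← moyalL_apply]
  simp only [map_neg, LinearMap.neg_apply]; abel

/-- Bracketing with `a` is `t`-linear and a derivation of the product, hence a derivation of
commutators. -/
theorem bracket_jacobi (a b c : Weyl m) : bracket P a (bracket P b c) =
    bracket P (bracket P a b) c + bracket P b (bracket P a c) := X_mul_cancel <| by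
  have hX : ∀ a b : Weyl m, PowerSeries.X * bracket P a b = bracket P a (PowerSeries.X * b) :=
    fun a b => X_mul_cancel <| by
      rw [X_mul_bracket, X_mul_bracket, moyal_X_mul_left, moyal_X_mul_right, ← mul_sub,
        mul_smul_comm]
  rw [mul_add, X_mul_bracket P (bracket P a b) c, X_mul_bracket P b (bracket P a c), hX,
    X_mul_bracket P b c]
  simp only [bracket_smul_right, bracket_sub_right, bracket_moyal_right, ← smul_add]
  congr 1; abel

theorem moyal_eq_mul_of_right {b : Weyl m} (hb : ∀ k, partialE k b = 0) (a : Weyl m) :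
    moyal P a b = a * b := by
  have hb' : ∀ k n, MvPowerSeries.pderiv ℂ k (PowerSeries.coeff n b) = 0 := fun k n => by
    simpa [partialE] using congrArg (PowerSeries.coeff n) (hb k)
  ext1 n
  rw [coeff_moyal, Finset.sum_eq_single (0, n), PowerSeries.coeff_mul]
  · simp [moyalTerm, bidiff]
  · rintro ⟨s, k⟩ hs hne
    have h1 := Finset.HasAntidiagonal.mem_antidiagonal.1 hs
    simp only at h1
    obtain ⟨s, rfl⟩ : ∃ s', s = s' + 1 := Nat.exists_eq_succ_of_ne_zero (by
      rintro rfl; exact hne (by simp [← h1]))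
    refine Finset.sum_eq_zero fun q hq => ?_
    simp only [moyalTerm, bidiff, hb', ← bidiffL_apply, map_zero, smul_zero, Finset.sum_const_zero]
  · simp

theorem moyal_eq_mul_of_left {a : Weyl m} (ha : ∀ k, partialE k a = 0) (b : Weyl m) :
    moyal P a b = a * b := by
  rw [moyal_transpose, moyal_eq_mul_of_right _ ha, mul_comm]

theorem bracket_eq_zero_of_left {a : Weyl m} (ha : ∀ k, partialE k a = 0) (b : Weyl m) :
    bracket P a b = 0 := X_mul_cancel <| by
  rw [X_mul_bracket, moyal_eq_mul_of_left P ha, moyal_eq_mul_of_right P ha, mul_comm, sub_self,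
    smul_zero, mul_zero]

theorem partialE_moyal (k : Fin m) (a b : Weyl m) :
    partialE k (moyal P a b) = moyal P (partialE k a) b + moyal P a (partialE k b) := by
  ext1 n
  simp only [partialE, PowerSeries.coeff_mk, map_add, coeff_moyal, map_sum, moyalTerm,
    Derivation.map_smul, pderiv_bidiff, smul_add, Finset.sum_add_distrib]

theorem partialE_X_mul (k : Fin m) (a : Weyl m) :
    partialE k (PowerSeries.X * a) = PowerSeries.X * partialE k a := by
  ext1 n
  rcases n with _ | n
  · simp [partialE]
  · rw [PowerSeries.coeff_succ_X_mul, partialE, partialE, PowerSeries.coeff_mk,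
      PowerSeries.coeff_mk, PowerSeries.coeff_succ_X_mul]

theorem dirE_moyal (u : EuclideanSpace ℝ (Fin m)) (a b : Weyl m) :
    dirE u (moyal P a b) = moyal P (dirE u a) b + moyal P a (dirE u b) := by
  simp only [dirE_apply, partialE_moyal, smul_add, Finset.sum_add_distrib]
  simp only [← moyalL_apply, map_sum, map_smul, LinearMap.sum_apply, LinearMap.smul_apply]

theorem dirE_bracket (u : EuclideanSpace ℝ (Fin m)) (a b : Weyl m) :
    dirE u (bracket P a b) = bracket P (dirE u a) b + bracket P a (dirE u b) := X_mul_cancel <| by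
  have hX : PowerSeries.X * dirE u (bracket P a b) = dirE u (PowerSeries.X * bracket P a b) := by
    simp only [dirE_apply, partialE_X_mul, Finset.mul_sum, mul_smul_comm]
  rw [hX, mul_add, X_mul_bracket, X_mul_bracket, X_mul_bracket, Derivation.map_smul, map_sub,
    dirE_moyal, dirE_moyal, ← smul_add]
  congr 1; abel

/-! ### Products and brackets with generators -/

/-- The second derivatives of a generator vanish, so the exponential series stops after its first
order term. -/
theorem moyal_gen_left (k : Fin m) (b : Weyl m) : moyal P (gen k) b =
    gen k * b + PowerSeries.X * ((-Complex.I / 2) • ∑ l, (P k l : ℂ) • partialE l b) := by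
  rw [← sub_eq_zero]
  let L : Weyl m →+ Weyl m := AddMonoidHom.mk'
    (fun b => moyal P (gen k) b -
      (gen k * b + PowerSeries.X * ((-Complex.I / 2) • ∑ l, (P k l : ℂ) • partialE l b)))
    (fun c c' => by
      simp only [moyal_add_right, ← partialD_apply, map_add, mul_add, smul_add,
        Finset.sum_add_distrib]
      abel)
  refine addHom_eq_zero_of_C L (fun b => ?_) (fun f => ?_) b
  · simp only [L, AddMonoidHom.mk'_apply, moyal_X_mul_right, partialE_X_mul, mul_sub, mul_add,
      ← mul_smul_comm, ← Finset.mul_sum]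
    rw [mul_left_comm]
  · simp only [L, AddMonoidHom.mk'_apply]
    rw [sub_eq_zero]
    ext1 n
    rw [gen, coeff_moyal_C, map_add]
    have hX : ∀ s (g h : V), (∀ k, MvPowerSeries.pderiv ℂ k g = 0) → bidiff P (s + 1) g h = 0 :=
      fun s g h hg => by
        simp only [bidiff, hg, ← bidiffL_apply, map_zero, LinearMap.zero_apply, smul_zero,
          Finset.sum_const_zero]
    rcases n with _ | _ | n
    · simp [moyalTerm, bidiff]
    · rw [PowerSeries.coeff_succ_X_mul, ← map_mul, PowerSeries.coeff_C, if_neg (by simp)]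
      simp only [moyalTerm, bidiff, coeff_smul_complex, map_sum, partialE, PowerSeries.coeff_mk,
        PowerSeries.coeff_zero_C]
      rw [Finset.sum_eq_single k]
      · simp [-Complex.coe_smul]
      · intro j _ hj; simp [MvPowerSeries.pderiv_X_of_ne (Ne.symm hj)]
      · simp
    · rw [PowerSeries.coeff_succ_X_mul, ← map_mul, PowerSeries.coeff_C, if_neg (by simp)]
      have h0 : bidiff P (n + 1 + 1) (MvPowerSeries.X k) f = 0 := by
        rw [bidiff]
        refine Finset.sum_eq_zero fun i _ => Finset.sum_eq_zero fun j _ => ?_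
        rw [hX, smul_zero]
        intro k'
        by_cases h : k = i
        · subst h; simp
        · simp [MvPowerSeries.pderiv_X_of_ne h]
      rw [moyalTerm, h0, smul_zero, zero_add]
      symm
      simp only [coeff_smul_complex, map_sum, partialE, PowerSeries.coeff_mk, PowerSeries.coeff_C,
        Nat.succ_ne_zero, if_false, map_zero, smul_zero, Finset.sum_const_zero]

theorem moyal_gen_right (k : Fin m) (b : Weyl m) : moyal P b (gen k) =
    gen k * b + PowerSeries.X * ((-Complex.I / 2) • ∑ l, (P l k : ℂ) • partialE l b) := by
  rw [moyal_transpose, moyal_gen_left]; rfl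

variable {P}

theorem antisymm_apply (hP : P.transpose = -P) (k l : Fin m) : P l k = -P k l :=
  congrFun (congrFun hP k) l

theorem bracket_gen_left (hP : P.transpose = -P) (k : Fin m) (b : Weyl m) :
    bracket P (gen k) b = ∑ l, (P k l : ℂ) • partialE l b := X_mul_cancel <| by
  rw [X_mul_bracket, moyal_gen_left, moyal_gen_right]
  simp only [antisymm_apply hP k, Complex.ofReal_neg, neg_smul, Finset.sum_neg_distrib, smul_neg,
    mul_neg, add_sub_add_left_eq_sub, sub_neg_eq_add]
  rw [← two_smul ℂ, ← mul_smul_comm, ← mul_smul_comm, smul_smul, smul_smul]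
  have : Complex.I * 2 * (-Complex.I / 2) = 1 := by ring_nf; simp
  rw [this, one_smul]

/-- The commutative product of two generators differs from their Moyal product by a multiple of `t`,
which is central; the derivation property of the bracket then reduces the computation to single
generators. -/
theorem bracket_gen_mul_gen (hP : P.transpose = -P) (k l : Fin m) (b : Weyl m) :
    bracket P (gen k * gen l) b =
      gen k * (∑ i, (P l i : ℂ) • partialE i b) + gen l * ∑ i, (P k i : ℂ) • partialE i b := by
  have h1 : (gen k * gen l : Weyl m) = moyal P (gen k) (gen l) -
      PowerSeries.X * ((-Complex.I / 2) • (P k l : ℂ) • 1) := by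
    rw [moyal_gen_left, Finset.sum_eq_single l]
    · simp [partialE_gen]
    · intro i _ hi; simp [partialE_gen, hi]
    · simp
  have h2 : ∀ i, partialE i (PowerSeries.X * ((-Complex.I / 2) • (P k l : ℂ) • 1) : Weyl m) = 0 := by
    intro i
    rw [partialE_X_mul, ← partialD_apply, Derivation.map_smul, Derivation.map_smul]
    simp
  rw [h1, bracket_sub_left, bracket_eq_zero_of_left P h2, sub_zero, bracket_moyal_left,
    moyal_gen_left, moyal_gen_right, bracket_gen_left hP, bracket_gen_left hP]
  -- The two products with a generator each leave a term of order `t` with second derivatives of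
  -- `b`; antisymmetry of `P` makes them cancel.
  have h3 : (∑ j, (P j l : ℂ) • partialE j (∑ i, (P k i : ℂ) • partialE i b)) =
      -∑ j, (P k j : ℂ) • partialE j (∑ i, (P l i : ℂ) • partialE i b) := by
    simp only [← partialD_apply, map_sum, Derivation.map_smul, Finset.smul_sum]
    rw [Finset.sum_comm, ← Finset.sum_neg_distrib]
    refine Finset.sum_congr rfl fun i _ => ?_
    rw [← Finset.sum_neg_distrib]
    refine Finset.sum_congr rfl fun j _ => ?_
    rw [antisymm_apply hP l j, partialD_apply, partialD_apply, partialD_apply, partialD_apply,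
      partialE_comm, smul_comm]
    simp [-Complex.coe_smul]
  rw [h3]
  simp only [smul_neg, mul_neg]
  abel

/-- An element which commutes with the generators does not contain them. -/
theorem partialE_eq_zero_of_bracket_gen (hP : P.transpose = -P) (hdet : IsUnit P.det)
    {a : Weyl m} (h : ∀ k, bracket P a (gen k) = 0) (l : Fin m) : partialE l a = 0 := by
  have h1 : ∀ k, ∑ l, (P k l : ℂ) • partialE l a = 0 := fun k => by
    rw [← bracket_gen_left hP, bracket_swap, h, neg_zero]
  have h2 : P⁻¹ * P = 1 := Matrix.nonsing_inv_mul P hdet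
  have h3 : ∑ k, (P⁻¹ l k : ℂ) • ∑ i, (P k i : ℂ) • partialE i a = partialE l a := by
    simp only [Finset.smul_sum, smul_smul]
    rw [Finset.sum_comm]
    simp only [← Finset.sum_smul, ← Complex.ofReal_mul, ← Complex.ofReal_sum, ← Matrix.mul_apply,
      h2]
    rw [Finset.sum_eq_single l] <;> simp +contextual [eq_comm]
  rw [← h3]
  simp only [h1, smul_zero, Finset.sum_const_zero]

/-! ### Degrees -/

variable (P)

theorem coef_moyal_ne_zero {a b : Weyl m} {n : ℕ} {α : Fin m →₀ ℕ} (h : coef n α (moyal P a b) ≠ 0) :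
    ∃ i β j γ, coef i β a ≠ 0 ∧ coef j γ b ≠ 0 ∧
      (β.degree + 2 * i) + (γ.degree + 2 * j) = α.degree + 2 * n := by
  rw [coef, coeff_moyal, map_sum] at h
  obtain ⟨s, hs, h⟩ := Finset.exists_ne_zero_of_sum_ne_zero h
  rw [map_sum] at h
  obtain ⟨q, hq, h⟩ := Finset.exists_ne_zero_of_sum_ne_zero h
  rw [moyalTerm, map_smul, smul_eq_mul] at h
  obtain ⟨β, γ, hβ, hγ, hd⟩ := coeff_bidiff_ne_zero _ _ _ _ _ (right_ne_zero_of_mul h)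
  refine ⟨q.1, β, q.2, γ, hβ, hγ, ?_⟩
  have h1 := Finset.HasAntidiagonal.mem_antidiagonal.1 hs
  have h2 := Finset.HasAntidiagonal.mem_antidiagonal.1 hq
  omega

/-- The product respects the degree, and the division by `t` lowers it by two. -/
theorem coef_bracket_ne_zero {a b : Weyl m} {n : ℕ} {α : Fin m →₀ ℕ}
    (h : coef n α (bracket P a b) ≠ 0) :
    ∃ i β j γ, coef i β a ≠ 0 ∧ coef j γ b ≠ 0 ∧
      (β.degree + 2 * i) + (γ.degree + 2 * j) = α.degree + 2 * n + 2 := by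
  have h1 : coef n α (bracket P a b) = coef (n + 1) α (PowerSeries.X * bracket P a b) := by
    rw [coef, coef, PowerSeries.coeff_succ_X_mul]
  rw [h1, X_mul_bracket, coef_smul, coef_sub] at h
  have h2 := right_ne_zero_of_mul h
  by_cases h3 : coef (n + 1) α (moyal P a b) = 0
  · rw [h3, zero_sub, neg_ne_zero] at h2
    obtain ⟨i, β, j, γ, hb, ha, hd⟩ := coef_moyal_ne_zero P h2
    exact ⟨j, γ, i, β, ha, hb, by omega⟩
  · obtain ⟨i, β, j, γ, hb, ha, hd⟩ := coef_moyal_ne_zero P h3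
    exact ⟨i, β, j, γ, hb, ha, by omega⟩

/-- All terms have degree at least `n`. -/
def InFil (n : ℕ) (a : Weyl m) : Prop := ∀ j α, α.degree + 2 * j < n → coef j α a = 0

theorem InFil.add {n : ℕ} {a b : Weyl m} (ha : InFil n a) (hb : InFil n b) : InFil n (a + b) :=
  fun j α h => by rw [coef_add, ha j α h, hb j α h, add_zero]
theorem InFil.sub {n : ℕ} {a b : Weyl m} (ha : InFil n a) (hb : InFil n b) : InFil n (a - b) :=
  fun j α h => by rw [coef_sub, ha j α h, hb j α h, sub_zero]
theorem InFil.smul {n : ℕ} {a : Weyl m} (c : ℂ) (ha : InFil n a) : InFil n (c • a) :=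
  fun j α h => by rw [coef_smul, ha j α h, mul_zero]
theorem InFil.sum {n : ℕ} {ι : Type*} {s : Finset ι} {f : ι → Weyl m}
    (h : ∀ i ∈ s, InFil n (f i)) : InFil n (∑ i ∈ s, f i) := fun j α hd => by
  rw [coef_sum]; exact Finset.sum_eq_zero fun i hi => h i hi j α hd
theorem InFil.mono {n n' : ℕ} {a : Weyl m} (h : InFil n a) (hn : n' ≤ n) : InFil n' a :=
  fun j α hd => h j α (by omega)
theorem inFil_zero (a : Weyl m) : InFil 0 a := fun j α h => by omega
theorem eq_zero_of_inFil {a : Weyl m} (h : ∀ n, InFil n a) : a = 0 :=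
  ext_coef fun j α => by rw [h _ j α (Nat.lt_succ_self _), coef_zero]
theorem IsHomogeneous.inFil {n : ℕ} {a : Weyl m} (h : IsHomogeneous n a) : InFil n a :=
  fun j α hd => by
    by_contra hne
    have := h j α hne
    omega

theorem InFil.bracket {p q n : ℕ} {a b : Weyl m} (ha : InFil p a) (hb : InFil q b)
    (h : n + 2 ≤ p + q) : InFil n (bracket P a b) := fun j α hd => by
  by_contra hne
  obtain ⟨i, β, j', γ, h1, h2, h3⟩ := coef_bracket_ne_zero P hne
  by_cases h4 : β.degree + 2 * i < p
  · exact h1 (ha _ _ h4)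
  · exact h2 (hb _ _ (by omega))

theorem IsHomogeneous.bracket {p q n : ℕ} {a b : Weyl m} (ha : IsHomogeneous p a)
    (hb : IsHomogeneous q b) (h : n + 2 = p + q) : IsHomogeneous n (bracket P a b) := fun j α hne => by
  obtain ⟨i, β, j', γ, h1, h2, h3⟩ := coef_bracket_ne_zero P hne
  have := ha _ _ h1
  have := hb _ _ h2
  omega

theorem coef_gen_mul (k : Fin m) (j : ℕ) (α : Fin m →₀ ℕ) (a : Weyl m) :
    coef j α (gen k * a) =
      if Finsupp.single k 1 ≤ α then coef j (α - Finsupp.single k 1) a else 0 := by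
  rw [coef, gen, PowerSeries.coeff_C_mul, MvPowerSeries.X, MvPowerSeries.coeff_monomial_mul]
  simp [coef]

theorem coef_gen_mul_partialE (k : Fin m) (j : ℕ) (α : Fin m →₀ ℕ) (a : Weyl m) :
    coef j α (gen k * partialE k a) = α k * coef j α a := by
  rw [coef_gen_mul]
  split_ifs with h
  · have hk : 1 ≤ α k := by simpa using h k
    rw [coef_partialE, tsub_add_cancel_of_le h]
    simp only [Finsupp.tsub_apply, Finsupp.single_eq_same]
    rw [Nat.cast_sub hk]; push_cast; ring
  · have hk : α k = 0 := by
      by_contra hne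
      exact h (Finsupp.single_le_iff.2 (Nat.one_le_iff_ne_zero.2 hne))
    rw [hk]; simp

/-- Euler's identity. -/
theorem coef_sum_gen_mul_partialE (j : ℕ) (α : Fin m →₀ ℕ) (a : Weyl m) :
    coef j α (∑ k, gen k * partialE k a) = α.degree * coef j α a := by
  rw [coef_sum]
  simp only [coef_gen_mul_partialE, ← Finset.sum_mul]
  rw [Finsupp.degree_eq_sum]; push_cast; rfl

theorem InFil.gen_mul {n : ℕ} {a : Weyl m} (k : Fin m) (h : InFil n a) : InFil (n + 1) (gen k * a) :=
  fun j α hd => by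
    rw [coef_gen_mul]
    split_ifs with hk
    · refine h _ _ ?_
      have : (α - Finsupp.single k 1 + Finsupp.single k 1).degree = α.degree := by
        rw [tsub_add_cancel_of_le hk]
      rw [map_add, Finsupp.degree_single] at this
      omega
    · rfl

theorem IsHomogeneous.gen_mul {n : ℕ} {a : Weyl m} (k : Fin m) (h : IsHomogeneous n a) :
    IsHomogeneous (n + 1) (gen k * a) := fun j α hne => by
  rw [coef_gen_mul] at hne
  split_ifs at hne with hk
  · have h1 := h _ _ hne
    have : (α - Finsupp.single k 1 + Finsupp.single k 1).degree = α.degree := by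
      rw [tsub_add_cancel_of_le hk]
    rw [map_add, Finsupp.degree_single] at this
    omega
  · exact absurd rfl hne

theorem InFil.partialE {n : ℕ} {a : Weyl m} (k : Fin m) (h : InFil (n + 1) a) :
    InFil n (partialE k a) := fun j α hd => by
  rw [coef_partialE, h, zero_mul]
  rw [map_add, Finsupp.degree_single]; omega

theorem IsHomogeneous.partialE {n : ℕ} {a : Weyl m} (k : Fin m) (h : IsHomogeneous (n + 1) a) :
    IsHomogeneous n (partialE k a) := fun j α hne => by
  rw [coef_partialE] at hne
  have := h _ _ (left_ne_zero_of_mul hne)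
  rw [map_add, Finsupp.degree_single] at this; omega

theorem IsHomogeneous.add {n : ℕ} {a b : Weyl m} (ha : IsHomogeneous n a) (hb : IsHomogeneous n b) :
    IsHomogeneous n (a + b) := fun j α h => by
  by_contra hne
  exact h (by rw [coef_add, not_not.1 (mt (ha j α) hne), not_not.1 (mt (hb j α) hne), add_zero])
theorem IsHomogeneous.smul {n : ℕ} {a : Weyl m} (c : ℂ) (ha : IsHomogeneous n a) :
    IsHomogeneous n (c • a) := fun j α h => by
  rw [coef_smul] at h; exact ha j α (right_ne_zero_of_mul h)
theorem IsHomogeneous.sub {n : ℕ} {a b : Weyl m} (ha : IsHomogeneous n a) (hb : IsHomogeneous n b) :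
    IsHomogeneous n (a - b) := by
  have := ha.add (hb.smul (-1)); rwa [neg_one_smul, ← sub_eq_add_neg] at this
theorem IsHomogeneous.zero (n : ℕ) : IsHomogeneous n (0 : Weyl m) := fun j α h => by simp at h
theorem IsHomogeneous.sum {n : ℕ} {ι : Type*} {s : Finset ι} {f : ι → Weyl m}
    (h : ∀ i ∈ s, IsHomogeneous n (f i)) : IsHomogeneous n (∑ i ∈ s, f i) :=
  Finset.sum_induction _ _ (fun _ _ => IsHomogeneous.add) (IsHomogeneous.zero n) h

theorem InFil.dirE {n : ℕ} {a : Weyl m} (u : EuclideanSpace ℝ (Fin m)) (h : InFil (n + 1) a) :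
    InFil n (dirE u a) := by
  rw [dirE_apply]; exact InFil.sum fun k _ => (h.partialE k).smul _
theorem IsHomogeneous.dirE {n : ℕ} {a : Weyl m} (u : EuclideanSpace ℝ (Fin m))
    (h : IsHomogeneous (n + 1) a) : IsHomogeneous n (dirE u a) := by
  rw [dirE_apply]; exact IsHomogeneous.sum fun k _ => (h.partialE k).smul _

/-! ### Division by the degree -/

theorem coef_divDegree (c j : ℕ) (α : Fin m →₀ ℕ) (a : Weyl m) :
    coef j α (divDegree c a) = coef j α a / ((α.degree + c : ℕ) : ℂ) := by
  rw [divDegree, coef_ofCoef]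

theorem InFil.divDegree {n : ℕ} {a : Weyl m} (c : ℕ) (h : InFil n a) : InFil n (divDegree c a) :=
  fun j α hd => by rw [coef_divDegree, h j α hd, zero_div]
theorem IsHomogeneous.divDegree {n : ℕ} {a : Weyl m} (c : ℕ) (h : IsHomogeneous n a) :
    IsHomogeneous n (divDegree c a) := fun j α hd => by
  rw [coef_divDegree] at hd
  exact h j α fun h0 => hd (by rw [h0, zero_div])

/-- `divDegree` as a linear map. -/
def divDegreeL (c : ℕ) : Weyl m →ₗ[ℂ] Weyl m where
  toFun := divDegree c
  map_add' a b := ext_coef fun j α => by simp only [coef_divDegree, coef_add, add_div]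
  map_smul' r a := ext_coef fun j α => by
    simp only [coef_divDegree, coef_smul, RingHom.id_apply, mul_div_assoc]

theorem divDegreeL_apply (c : ℕ) (a : Weyl m) : divDegreeL c a = divDegree c a := rfl

/-- A derivative lowers the degree in the generators by one while the divisor attached to a term
stays the same; hence the shift of `c`. -/
theorem partialE_divDegree (c : ℕ) (k : Fin m) (a : Weyl m) :
    partialE k (divDegree c a) = divDegree (c + 1) (partialE k a) := ext_coef fun j α => by
  simp only [coef_divDegree, coef_partialE, map_add, Finsupp.degree_single]
  rw [add_right_comm, add_assoc]; ring

theorem dirE_divDegree (c : ℕ) (u : EuclideanSpace ℝ (Fin m)) (a : Weyl m) :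
    dirE u (divDegree c a) = divDegree (c + 1) (dirE u a) := by
  rw [dirE_apply, dirE_apply, ← divDegreeL_apply (c + 1), map_sum]
  exact Finset.sum_congr rfl fun k _ => by rw [map_smul, divDegreeL_apply, partialE_divDegree]

/-- By Euler's identity the operator to be inverted multiplies terms of degree `d` by `d + c`. For
`c ≠ 0` this is nonzero also at `d = 0`, so on forms, unlike on functions, no constant part is lost.
-/
theorem divDegree_euler (c : ℕ) (hc : c ≠ 0) (a : Weyl m) :
    divDegree c (∑ k, gen k * partialE k a + (c : ℂ) • a) = a := ext_coef fun j α => by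
  rw [coef_divDegree, coef_add, coef_sum_gen_mul_partialE, coef_smul, ← add_mul]
  have : ((α.degree + c : ℕ) : ℂ) ≠ 0 := by exact_mod_cast (by omega)
  push_cast at this ⊢
  rw [mul_comm, mul_div_assoc, div_self this, mul_one]

end Fedosov.Weyl

namespace Fedosov.Weyl

variable {m : ℕ}

local notation "V" => MvPowerSeries (Fin m) ℂ
local notation "antidiag" => Finset.HasAntidiagonal.antidiagonal
local notation "𝔼" => EuclideanSpace ℝ (Fin m)

/-! ### The homotopy formula -/

theorem real_smul_eq (c : ℝ) (a : Weyl m) : c • a = (c : ℂ) • a :=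
  RCLike.real_smul_eq_coe_smul (K := ℂ) c a

/-- The standard basis vector. -/
abbrev basisVec (k : Fin m) : 𝔼 := EuclideanSpace.single k (1 : ℝ)

theorem sum_smul_basisVec (u : 𝔼) : ∑ k, u k • basisVec k = u := by
  ext i
  simp [Finset.sum_apply, Pi.single_apply]

theorem map_eq_sum_basisVec {σ : 𝔼 → Weyl m} (hσ : IsLinearMap ℝ σ) (u : 𝔼) :
    σ u = ∑ k, (u k : ℂ) • σ (basisVec k) := by
  conv_lhs => rw [← sum_smul_basisVec u]
  rw [← hσ.mk'_apply, map_sum]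
  simp only [map_smul, real_smul_eq]
  rfl

/-- `δ*` of a `1`-form at a point. -/
def contract (σ : 𝔼 → Weyl m) : Weyl m := ∑ k, gen k * σ (basisVec k)

theorem contract_add (σ σ' : 𝔼 → Weyl m) : contract (σ + σ') = contract σ + contract σ' := by
  simp [contract, mul_add, Finset.sum_add_distrib]
theorem contract_sub (σ σ' : 𝔼 → Weyl m) : contract (σ - σ') = contract σ - contract σ' := by
  simp [contract, mul_sub, Finset.sum_sub_distrib]

theorem InFil.contract {n : ℕ} {σ : 𝔼 → Weyl m} (h : ∀ u, InFil n (σ u)) :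
    InFil (n + 1) (contract σ) := InFil.sum fun k _ => (h _).gen_mul k
theorem IsHomogeneous.contract {n : ℕ} {σ : 𝔼 → Weyl m} (h : ∀ u, IsHomogeneous n (σ u)) :
    IsHomogeneous (n + 1) (Weyl.contract σ) := IsHomogeneous.sum fun k _ => (h _).gen_mul k

theorem contract_dirE (a : Weyl m) :
    contract (fun u => dirE u a) = ∑ k, gen k * partialE k a := by
  simp only [contract, dirE_single]

/-- The derivative either passes to `σ` or hits the generator in the contraction. The second
contribution is the summand `q` of the factor `p + q` in `δδ* + δ*δ = p + q`. -/
theorem dirE_contract {σ : 𝔼 → Weyl m} (hσ : IsLinearMap ℝ σ) (u : 𝔼) :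
    dirE u (contract σ) = contract (fun v => dirE u (σ v)) + σ u := by
  simp only [contract, map_sum, Derivation.leibniz, smul_eq_mul, dirE_gen, Finset.sum_add_distrib]
  rw [map_eq_sum_basisVec hσ u]
  simp only [mul_smul_comm, mul_one]

/-- `δ⁻¹ δ a = a - a₀` on functions. -/
theorem divDegree_contract_dirE (a : Weyl m) :
    divDegree 0 (contract fun u => dirE u a) = a - ofCoef fun j α => if α = 0 then coef j 0 a else 0 := by
  refine ext_coef fun j α => ?_
  rw [coef_divDegree, contract_dirE, coef_sum_gen_mul_partialE, coef_sub, coef_ofCoef, add_zero]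
  -- For `α = 0` the quotient is `0 / 0`, which takes the value `0`. This agrees with the right
  -- side, where the terms free of the generators have been removed.
  split_ifs with h
  · subst h; simp
  · have : (α.degree : ℂ) ≠ 0 := by
      rw [Nat.cast_ne_zero, ne_eq, Finsupp.degree_eq_zero_iff]; exact h
    field_simp; ring

/-- `δ⁻¹ δ σ + δ δ⁻¹ σ = σ` on `1`-forms. -/
theorem homotopy_oneForm {σ : 𝔼 → Weyl m} (hσ : IsLinearMap ℝ σ) (v : 𝔼) :
    divDegree 1 (contract fun u => dirE u (σ v) - dirE v (σ u)) +
      dirE v (divDegree 0 (contract σ)) = σ v := by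
  rw [dirE_divDegree, dirE_contract hσ, ← divDegreeL_apply, ← divDegreeL_apply, ← map_add]
  have : (contract fun u => dirE u (σ v) - dirE v (σ u)) =
      contract (fun u => dirE u (σ v)) - contract fun u => dirE v (σ u) := contract_sub _ _
  rw [this, contract_dirE, divDegreeL_apply]
  have h := divDegree_euler 1 one_ne_zero (σ v)
  rw [Nat.cast_one, one_smul] at h
  rw [← add_assoc, sub_add_cancel]
  exact h

/-- `δ⁻¹ δ τ + δ δ⁻¹ τ = τ` on `2`-forms. -/
theorem homotopy_twoForm {τ : 𝔼 → 𝔼 → Weyl m} (hτ : ∀ v, IsLinearMap ℝ fun u => τ u v)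
    (halt : ∀ u v, τ v u = -τ u v) (u v : 𝔼) :
    divDegree 2 (contract fun w => dirE w (τ u v) + dirE u (τ v w) + dirE v (τ w u)) +
      (dirE u (divDegree 1 (contract fun w => τ w v)) -
        dirE v (divDegree 1 (contract fun w => τ w u))) = τ u v := by
  rw [dirE_divDegree, dirE_divDegree, dirE_contract (hτ v), dirE_contract (hτ u)]
  simp only [← divDegreeL_apply]
  rw [← map_sub, ← map_add]
  have h := divDegree_euler 2 two_ne_zero (τ u v)
  rw [← contract_dirE, ← divDegreeL_apply] at h
  refine Eq.trans ?_ h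
  congr 1
  have h1 : (contract fun w => dirE w (τ u v) + dirE u (τ v w) + dirE v (τ w u)) =
      contract (fun w => dirE w (τ u v)) - contract (fun w => dirE u (τ w v)) +
        contract (fun w => dirE v (τ w u)) := by
    rw [← contract_sub, ← contract_add]
    congr 1
    funext w
    simp only [Pi.add_apply, Pi.sub_apply]
    rw [halt w v, map_neg]; abel
  rw [h1, halt u v, Nat.cast_ofNat, two_smul]
  abel

/-! ### Formal sums -/

theorem coef_formalSum (c : ℕ → Weyl m) (j : ℕ) (α : Fin m →₀ ℕ) :
    coef j α (formalSum c) = ∑ k ∈ Finset.range (α.degree + 2 * j + 1), coef j α (c k) := by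
  rw [formalSum, coef_ofCoef]

theorem coef_formalSum_of_homogeneous {c : ℕ → Weyl m} (hc : ∀ k, IsHomogeneous (k + 2) (c k))
    {j : ℕ} {α : Fin m →₀ ℕ} {k : ℕ} (h : α.degree + 2 * j = k + 2) :
    coef j α (formalSum c) = coef j α (c k) := by
  rw [coef_formalSum, Finset.sum_eq_single k]
  · intro i _ hi
    by_contra hne
    have := hc i j α hne
    omega
  · intro hk
    exact absurd (Finset.mem_range.2 (by omega)) hk

theorem formalSum_inFil {c : ℕ → Weyl m} (hc : ∀ k, IsHomogeneous (k + 2) (c k)) :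
    InFil 2 (formalSum c) := fun j α h => by
  rw [coef_formalSum]
  refine Finset.sum_eq_zero fun k _ => ?_
  by_contra hne
  have := hc k j α hne
  omega

/-- Infinite sums are handled by truncation: a finite partial sum is exact up to any prescribed
degree, so that additive operations which respect the filtration can be exchanged with the formal
sum. -/
theorem formalSum_sub_inFil {c : ℕ → Weyl m} (hc : ∀ k, IsHomogeneous (k + 2) (c k)) (N : ℕ) :
    InFil (N + 2) (formalSum c - ∑ k ∈ Finset.range N, c k) := fun j α h => by
  rw [coef_sub, coef_sum, sub_eq_zero]
  by_cases h2 : α.degree + 2 * j < 2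
  · rw [formalSum_inFil hc j α h2, Finset.sum_eq_zero]
    intro k _
    by_contra hne
    have := hc k j α hne
    omega
  · obtain ⟨k, hk⟩ := Nat.exists_eq_add_of_le (not_lt.1 h2)
    rw [coef_formalSum_of_homogeneous hc (k := k) (by omega), Finset.sum_eq_single k]
    · intro i _ hi
      by_contra hne
      have := hc i j α hne
      omega
    · intro hk'
      exact absurd (Finset.mem_range.2 (by omega)) hk'

theorem formalSum_bracket (P : Matrix (Fin m) (Fin m) ℝ) {c : ℕ → Weyl m}
    (hc : ∀ k, IsHomogeneous (k + 2) (c k)) (a : Weyl m) :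
    (formalSum fun k => bracket P (c k) a) = bracket P (formalSum c) a := by
  refine ext_coef fun j α => ?_
  have h := (formalSum_sub_inFil hc (α.degree + 2 * j + 1)).bracket P (inFil_zero a)
    (n := α.degree + 2 * j + 1) (by omega) j α (by omega)
  rw [bracket_sub_left, coef_sub, sub_eq_zero] at h
  rw [h, coef_formalSum, bracket_sum_left, coef_sum]

theorem coef_bracket_formalSum (P : Matrix (Fin m) (Fin m) ℝ) {c d : ℕ → Weyl m}
    (hc : ∀ k, IsHomogeneous (k + 2) (c k)) (hd : ∀ k, IsHomogeneous (k + 2) (d k))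
    {j : ℕ} {α : Fin m →₀ ℕ} {k : ℕ} (h : α.degree + 2 * j = k + 2) :
    coef j α (bracket P (formalSum c) (formalSum d)) =
      coef j α (∑ p ∈ antidiag k, bracket P (c p.1) (d p.2)) := by
  -- Truncating either factor after `k + 1` terms leaves an error of degree at least `k + 3`; the
  -- other factor has degree at least `2`, which offsets the loss of `2` in the bracket. So degree
  -- `k + 2` is not affected.
  have h1 := (formalSum_sub_inFil hc (k + 1)).bracket P (formalSum_inFil hd)
    (n := k + 3) (by omega) j α (by omega)
  have h2 := (InFil.sum fun i (_ : i ∈ Finset.range (k + 1)) =>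
    ((hc i).inFil.mono (by omega : 2 ≤ i + 2))).bracket P (formalSum_sub_inFil hd (k + 1))
    (n := k + 3) (by omega) j α (by omega)
  rw [bracket_sub_left, coef_sub, sub_eq_zero] at h1
  rw [bracket_sub_right, coef_sub, sub_eq_zero] at h2
  rw [h1, h2, bracket_sum_left, coef_sum, coef_sum]
  simp only [bracket_sum_right, coef_sum]
  rw [← Finset.sum_product']
  symm
  refine Finset.sum_subset (fun p hp => ?_) fun p _ hp => ?_
  · have := Finset.HasAntidiagonal.mem_antidiagonal.1 hp
    simp only [Finset.mem_product, Finset.mem_range]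
    omega
  · by_contra hne
    have := (hc p.1).bracket P (hd p.2) (n := p.1 + p.2 + 2) (by omega) j α hne
    exact hp (Finset.HasAntidiagonal.mem_antidiagonal.2 (by omega))

/-! ### Linear changes of variables -/

theorem hasSubst_linear (L : Fin m → 𝔼) : MvPowerSeries.HasSubst
    (fun i => ∑ k, (L k i : ℂ) • (MvPowerSeries.X k : V)) :=
  MvPowerSeries.hasSubst_of_constantCoeff_zero fun i => by
    rw [map_sum]
    exact Finset.sum_eq_zero fun k _ => by
      rw [← MvPowerSeries.coeff_zero_eq_constantCoeff_apply, map_smul,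
        MvPowerSeries.coeff_zero_X, smul_zero]

/-- The substitution of linear forms as a homomorphism of algebras. -/
def pullV (L : Fin m → 𝔼) : V →ₐ[ℂ] V := MvPowerSeries.substAlgHom (hasSubst_linear L)

theorem coeff_pull (L : Fin m → 𝔼) (a : Weyl m) (j : ℕ) :
    PowerSeries.coeff j (pull L a) = pullV L (PowerSeries.coeff j a) := by
  rw [pull, PowerSeries.coeff_mk, pullV, MvPowerSeries.substAlgHom_apply]

theorem pullV_X (L : Fin m → 𝔼) (i : Fin m) :
    pullV L (MvPowerSeries.X i) = ∑ k, (L k i : ℂ) • (MvPowerSeries.X k : V) := by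
  rw [pullV, MvPowerSeries.substAlgHom_X]

/-- The coefficients of the substitution. -/
def pullKer (L : Fin m → 𝔼) (α β : Fin m →₀ ℕ) : ℂ :=
  MvPowerSeries.coeff β (pullV L (MvPowerSeries.monomial α 1))

theorem pullV_monomial (L : Fin m → 𝔼) (α : Fin m →₀ ℕ) :
    pullV L (MvPowerSeries.monomial α 1) =
      ((α.prod fun i n => (∑ k, MvPolynomial.C (L k i : ℂ) * MvPolynomial.X k) ^ n :
        MvPolynomial (Fin m) ℂ) : V) := by
  rw [pullV, MvPowerSeries.substAlgHom_monomial, map_one, one_mul]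
  simp only [Finsupp.prod]
  rw [← MvPolynomial.coeToMvPowerSeries.ringHom_apply, map_prod]
  refine Finset.prod_congr rfl fun i _ => ?_
  rw [map_pow, map_sum]
  congr 1
  refine Finset.sum_congr rfl fun k _ => ?_
  rw [MvPolynomial.coeToMvPowerSeries.ringHom_apply, MvPolynomial.coe_mul, MvPolynomial.coe_C,
    MvPolynomial.coe_X, MvPowerSeries.smul_eq_C_mul]

theorem pullKer_eq_zero (L : Fin m → 𝔼) {α β : Fin m →₀ ℕ} (h : β.degree ≠ α.degree) :
    pullKer L α β = 0 := by
  rw [pullKer, pullV_monomial, MvPolynomial.coeff_coe]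
  refine MvPolynomial.IsHomogeneous.coeff_eq_zero (n := α.degree) ?_ h
  rw [Finsupp.prod, Finsupp.degree_apply]
  refine MvPolynomial.IsHomogeneous.prod _ _ _ fun i _ => ?_
  have := (MvPolynomial.IsHomogeneous.sum Finset.univ
    (fun k => MvPolynomial.C (L k i : ℂ) * MvPolynomial.X k) 1 fun k _ => by
      simpa using (MvPolynomial.isHomogeneous_C _ (L k i : ℂ)).mul
        (MvPolynomial.isHomogeneous_X ℂ k)).pow (α i)
  simpa using this

/-- The exponents of degree `d`. -/
def degSet (d : ℕ) : Finset (Fin m →₀ ℕ) := (Finsupp.finite_of_degree_eq d).toFinset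

theorem mem_degSet {d : ℕ} {α : Fin m →₀ ℕ} : α ∈ degSet d ↔ α.degree = d := by
  simp [degSet]

/-- Substituting linear forms preserves the degree, so only the finitely many exponents of the same
degree contribute. This is what makes coefficientwise smoothness and differentiation of the
substitution elementary. -/
theorem coeff_pullV (L : Fin m → 𝔼) (f : V) (β : Fin m →₀ ℕ) :
    MvPowerSeries.coeff β (pullV L f) =
      ∑ α ∈ degSet β.degree, MvPowerSeries.coeff α f * pullKer L α β := by
  have h : ∀ α, MvPowerSeries.coeff β (α.prod fun s e =>
      (∑ k, (L k s : ℂ) • (MvPowerSeries.X k : V)) ^ e) = pullKer L α β := fun α => by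
    rw [pullKer, pullV, MvPowerSeries.substAlgHom_monomial, map_one, one_mul]
  rw [pullV, MvPowerSeries.substAlgHom_apply, MvPowerSeries.coeff_subst (hasSubst_linear L)]
  simp only [h, smul_eq_mul]
  refine finsum_eq_sum_of_support_subset _ fun α hα => ?_
  rw [Finset.mem_coe, mem_degSet]
  by_contra hne
  exact hα (by simp only [pullKer_eq_zero L (Ne.symm hne), mul_zero])

theorem coef_pull (L : Fin m → 𝔼) (a : Weyl m) (j : ℕ) (β : Fin m →₀ ℕ) :
    coef j β (pull L a) = ∑ α ∈ degSet β.degree, coef j α a * pullKer L α β := by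
  rw [coef, coeff_pull, coeff_pullV]; rfl

theorem coef_zero_pull (L : Fin m → 𝔼) (a : Weyl m) (j : ℕ) :
    coef j 0 (pull L a) = coef j 0 a := by
  rw [coef_pull, Finset.sum_eq_single 0]
  · have : pullKer L 0 0 = 1 := by
      rw [pullKer, MvPowerSeries.monomial_zero_one, map_one, MvPowerSeries.coeff_zero_one]
    rw [this, mul_one]
  · intro α hα h0
    rw [mem_degSet, map_zero, Finsupp.degree_eq_zero_iff] at hα
    exact absurd hα h0
  · intro h; exact absurd (mem_degSet.2 rfl) h

/-- `pull L` as a linear map. -/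
def pullL (L : Fin m → 𝔼) : Weyl m →ₗ[ℂ] Weyl m where
  toFun := pull L
  map_add' a b := by ext1; simp only [coeff_pull, map_add]
  map_smul' c a := by ext1; simp only [coeff_pull, coeff_smul_complex, map_smul, RingHom.id_apply]

theorem pullL_apply (L : Fin m → 𝔼) (a : Weyl m) : pullL L a = pull L a := rfl

theorem pull_mul (L : Fin m → 𝔼) (a b : Weyl m) : pull L (a * b) = pull L a * pull L b := by
  ext1; simp only [coeff_pull, PowerSeries.coeff_mul, map_sum, map_mul]

theorem pull_gen (L : Fin m → 𝔼) (i : Fin m) :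
    pull L (gen i) = ∑ k, (L k i : ℂ) • (gen k : Weyl m) := by
  ext1 n
  rw [coeff_pull, map_sum]
  simp only [coeff_smul_complex, gen, PowerSeries.coeff_C]
  split_ifs
  · rw [pullV_X]
  · simp only [map_zero, smul_zero, Finset.sum_const_zero]

theorem pull_basisVec (a : Weyl m) : pull basisVec a = a := by
  have : (fun i => ∑ k, ((basisVec k : 𝔼) i : ℂ) • (MvPowerSeries.X k : V)) = MvPowerSeries.X := by
    funext i
    rw [Finset.sum_eq_single i] <;> simp +contextual [eq_comm]
  ext1 n
  rw [pull, PowerSeries.coeff_mk, this, MvPowerSeries.subst_self, id]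

theorem pull_pull (L L' : Fin m → 𝔼) (a : Weyl m) :
    pull L' (pull L a) = pull (fun j => ∑ k, L' j k • L k) a := by
  ext1 n
  simp only [pull, PowerSeries.coeff_mk]
  rw [MvPowerSeries.subst_comp_subst_apply (hasSubst_linear L) (hasSubst_linear L')]
  congr 1
  funext i
  rw [← MvPowerSeries.substAlgHom_apply (hasSubst_linear L'), map_sum]
  simp only [map_smul, MvPowerSeries.substAlgHom_X, Finset.smul_sum, smul_smul]
  rw [Finset.sum_comm]
  refine Finset.sum_congr rfl fun k _ => ?_
  rw [← Finset.sum_smul]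
  congr 1
  simp [mul_comm]

theorem InFil.pull {n : ℕ} {a : Weyl m} (L : Fin m → 𝔼) (h : InFil n a) : InFil n (pull L a) :=
  fun j β hd => by
    rw [coef_pull]
    exact Finset.sum_eq_zero fun α hα => by rw [h j α (by rw [mem_degSet.1 hα]; exact hd), zero_mul]

theorem pull_divDegree (L : Fin m → 𝔼) (c : ℕ) (a : Weyl m) :
    pull L (divDegree c a) = divDegree c (pull L a) := ext_coef fun j β => by
  rw [coef_pull, coef_divDegree, coef_pull, Finset.sum_div]
  refine Finset.sum_congr rfl fun α hα => ?_
  rw [coef_divDegree, mem_degSet.1 hα]; ring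

theorem pull_formalSum (L : Fin m → 𝔼) (c : ℕ → Weyl m) :
    pull L (formalSum c) = formalSum fun k => pull L (c k) := ext_coef fun j β => by
  simp only [coef_pull, coef_formalSum, Finset.sum_mul]
  conv_rhs => rw [Finset.sum_comm]
  exact Finset.sum_congr rfl fun α hα => by rw [mem_degSet.1 hα]

/-- Additive operators on formal power series which agree on polynomials and for which each
coefficient of the value only depends on finitely many coefficients of the argument, are equal. -/
theorem eq_of_eq_on_polynomials {A : Type*} [AddCommGroup A] (T T' : V →+ V)
    (hT : ∀ β : Fin m →₀ ℕ, ∃ N, ∀ f : V, (∀ α, α.degree < N → MvPowerSeries.coeff α f = 0) →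
      MvPowerSeries.coeff β (T f) = 0 ∧ MvPowerSeries.coeff β (T' f) = 0)
    (h : ∀ p : MvPolynomial (Fin m) ℂ, T p = T' p) (f : V) : T f = T' f := by
  ext β
  obtain ⟨N, hN⟩ := hT β
  have hr := hN (f - (MvPowerSeries.truncTotal N f : MvPolynomial (Fin m) ℂ)) fun α hα => by
    rw [map_sub, MvPolynomial.coeff_coe, MvPowerSeries.coeff_truncTotal _ hα, sub_self]
  rw [map_sub, map_sub, map_sub, map_sub, h] at hr
  rw [sub_eq_zero.1 hr.1, sub_eq_zero.1 hr.2]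

theorem pderiv_pullV_X (L : Fin m → 𝔼) (k i : Fin m) :
    MvPowerSeries.pderiv ℂ k (pullV L (MvPowerSeries.X i)) = (L k i : ℂ) • 1 := by
  rw [pullV_X, map_sum, Finset.sum_eq_single k]
  · rw [Derivation.map_smul, MvPowerSeries.pderiv_X_self]
  · intro j _ hj; rw [Derivation.map_smul, MvPowerSeries.pderiv_X_of_ne hj, smul_zero]
  · simp

/-- The chain rule for a linear substitution. It is an induction on polynomials, extended to power
series because each coefficient depends on finitely many coefficients of the argument. -/
theorem pderiv_pullV (L : Fin m → 𝔼) (k : Fin m) (f : V) :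
    MvPowerSeries.pderiv ℂ k (pullV L f) =
      ∑ i, (L k i : ℂ) • pullV L (MvPowerSeries.pderiv ℂ i f) := by
  let T : V →+ V := ((MvPowerSeries.pderiv ℂ k : V →ₗ[ℂ] V) ∘ₗ (pullV L).toLinearMap).toAddMonoidHom
  let T' : V →+ V := (∑ i, (L k i : ℂ) •
    ((pullV L).toLinearMap ∘ₗ (MvPowerSeries.pderiv ℂ i : V →ₗ[ℂ] V))).toAddMonoidHom
  have hT : ∀ f, T f = MvPowerSeries.pderiv ℂ k (pullV L f) := fun f => rfl
  have hT' : ∀ f, T' f = ∑ i, (L k i : ℂ) • pullV L (MvPowerSeries.pderiv ℂ i f) := fun f => by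
    simp [T', -Complex.coe_smul]
  rw [← hT, ← hT']
  -- At exponent `β` both operators read only coefficients in degree `β.degree + 1`; a series
  -- vanishing below `β.degree + 2` is therefore invisible.
  refine eq_of_eq_on_polynomials (A := V) T T' (fun β => ⟨β.degree + 2, fun f hf => ?_⟩)
    (fun p => ?_) f
  · constructor
    · rw [hT, MvPowerSeries.coeff_pderiv, coeff_pullV, Finset.sum_eq_zero, zero_mul]
      intro α hα
      rw [mem_degSet, map_add, Finsupp.degree_single] at hα
      rw [hf α (by omega), zero_mul]
    · rw [hT', map_sum]
      refine Finset.sum_eq_zero fun i _ => ?_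
      rw [map_smul, coeff_pullV, Finset.sum_eq_zero, smul_zero]
      intro α hα
      rw [mem_degSet] at hα
      rw [MvPowerSeries.coeff_pderiv, hf _ (by rw [map_add, Finsupp.degree_single]; omega),
        zero_mul, zero_mul]
  · induction p using MvPolynomial.induction_on with
    | C c =>
      rw [hT, hT', MvPolynomial.coe_C, ← mul_one (MvPowerSeries.C c), ← MvPowerSeries.smul_eq_C_mul]
      simp
    | add p q hp hq => rw [MvPolynomial.coe_add, map_add, map_add, hp, hq]
    | mul_X p i hp =>
      rw [hT, hT'] at hp
      rw [hT, hT', MvPolynomial.coe_mul, MvPolynomial.coe_X]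
      simp only [map_mul, Derivation.leibniz, smul_eq_mul, hp, map_add, smul_add,
        Finset.sum_add_distrib, Finset.mul_sum, mul_smul_comm]
      congr 1
      rw [pderiv_pullV_X, Finset.sum_eq_single i]
      · rw [MvPowerSeries.pderiv_X_self, map_one, mul_smul_comm]
      · intro j _ hj
        rw [MvPowerSeries.pderiv_X_of_ne (Ne.symm hj), map_zero, mul_zero, smul_zero]
      · simp

theorem partialE_pull (L : Fin m → 𝔼) (k : Fin m) (a : Weyl m) :
    partialE k (pull L a) = pull L (dirE (L k) a) := by
  ext1 n
  rw [coeff_pull, dirE_apply, partialE, PowerSeries.coeff_mk, coeff_pull, pderiv_pullV, map_sum,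
    map_sum]
  refine Finset.sum_congr rfl fun i _ => ?_
  rw [coeff_smul_complex, map_smul, partialE, PowerSeries.coeff_mk]

theorem dirE_pull (L : Fin m → 𝔼) (u : 𝔼) (a : Weyl m) :
    dirE u (pull L a) = pull L (dirE (∑ k, u k • L k) a) := by
  rw [← dirL_apply (∑ k, u k • L k), map_sum, ← pullL_apply L (∑ _, _), map_sum, dirE_apply]
  refine Finset.sum_congr rfl fun k _ => ?_
  rw [partialE_pull, map_smul, dirL_apply, real_smul_eq, map_smul, pullL_apply]

/-- The hypothesis is the transformation law of a bivector under the change of frame `L`, so the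
factors produced by the chain rule in both slots recombine into `P`. -/
theorem pullV_bidiff {L : Fin m → 𝔼} {P P' : Matrix (Fin m) (Fin m) ℝ}
    (h : ∀ i j, P i j = ∑ k, ∑ l, P' k l * (L k i * L l j)) (s : ℕ) (f g : V) :
    pullV L (bidiff P s f g) = bidiff P' s (pullV L f) (pullV L g) := by
  induction s generalizing f g with
  | zero => simp [bidiff]
  | succ s ih =>
    simp only [bidiff, map_sum, map_smul, ih, pderiv_pullV]
    simp only [← bidiffL_apply, map_sum, LinearMap.sum_apply, map_smul, LinearMap.smul_apply,
      Finset.smul_sum, h, Complex.ofReal_sum, Complex.ofReal_mul, Finset.sum_smul, smul_smul]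
    simp only [← Finset.sum_product']
    refine Finset.sum_bij' (fun x _ => (x.2.2.1, x.2.2.2, x.2.1, x.1))
      (fun x _ => (x.2.2.2, x.2.2.1, x.1, x.2.1)) ?_ ?_ ?_ ?_ ?_
    · simp
    · simp
    · simp
    · simp
    · intro x _
      congr 1
      ring

theorem pull_moyal {L : Fin m → 𝔼} {P P' : Matrix (Fin m) (Fin m) ℝ}
    (h : ∀ i j, P i j = ∑ k, ∑ l, P' k l * (L k i * L l j)) (a b : Weyl m) :
    pull L (moyal P a b) = moyal P' (pull L a) (pull L b) := by
  ext1 n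
  rw [coeff_pull]
  simp only [coeff_moyal, map_sum, moyalTerm, map_smul, pullV_bidiff h, coeff_pull]

theorem pull_bracket {L : Fin m → 𝔼} {P P' : Matrix (Fin m) (Fin m) ℝ}
    (h : ∀ i j, P i j = ∑ k, ∑ l, P' k l * (L k i * L l j)) (a b : Weyl m) :
    pull L (bracket P a b) = bracket P' (pull L a) (pull L b) := X_mul_cancel <| by
  have hX : ∀ a : Weyl m, PowerSeries.X * pull L a = pull L (PowerSeries.X * a) := fun a => by
    ext1 n
    rcases n with _ | n
    · rw [coeff_pull, PowerSeries.coeff_zero_X_mul, PowerSeries.coeff_zero_X_mul, map_zero]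
    · rw [coeff_pull, PowerSeries.coeff_succ_X_mul, PowerSeries.coeff_succ_X_mul, coeff_pull]
  rw [hX, X_mul_bracket, X_mul_bracket, ← pull_moyal h, ← pull_moyal h, ← pullL_apply, map_smul,
    map_sub]
  rfl

end Fedosov.Weyl

namespace Fedosov.Weyl

variable {m : ℕ}

local notation "V" => MvPowerSeries (Fin m) ℂ
local notation "antidiag" => Finset.HasAntidiagonal.antidiagonal
local notation "𝔼" => EuclideanSpace ℝ (Fin m)

/-! ### Coefficientwise derivatives of functions with values in formal power series -/

/-- Coefficientwise differentiability. -/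
def DiffV (f : 𝔼 → V) (p : 𝔼) : Prop :=
  ∀ α, DifferentiableAt ℝ (fun q => MvPowerSeries.coeff α (f q)) p

/-- The coefficientwise directional derivative. -/
def dV (u : 𝔼) (f : 𝔼 → V) (p : 𝔼) : V :=
  fun α => fderiv ℝ (fun q => MvPowerSeries.coeff α (f q)) p u

theorem coeff_dV (u : 𝔼) (f : 𝔼 → V) (p : 𝔼) (α : Fin m →₀ ℕ) :
    MvPowerSeries.coeff α (dV u f p) = fderiv ℝ (fun q => MvPowerSeries.coeff α (f q)) p u := rfl

theorem DiffV.const (f : V) (p : 𝔼) : DiffV (fun _ => f) p := fun _ => differentiableAt_const _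

theorem DiffV.add {f g : 𝔼 → V} {p : 𝔼} (hf : DiffV f p) (hg : DiffV g p) :
    DiffV (fun q => f q + g q) p := fun α => by
  simp only [map_add]; exact (hf α).add (hg α)

theorem DiffV.smul {c : 𝔼 → ℂ} {f : 𝔼 → V} {p : 𝔼} (hc : DifferentiableAt ℝ c p)
    (hf : DiffV f p) : DiffV (fun q => c q • f q) p := fun α => by
  simp only [map_smul, smul_eq_mul]; exact hc.mul (hf α)

theorem DiffV.sum {ι : Type*} {s : Finset ι} {f : ι → 𝔼 → V} {p : 𝔼}
    (hf : ∀ i ∈ s, DiffV (f i) p) : DiffV (fun q => ∑ i ∈ s, f i q) p := fun α => by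
  simp only [map_sum]; exact DifferentiableAt.fun_sum fun i hi => hf i hi α

theorem DiffV.mul {f g : 𝔼 → V} {p : 𝔼} (hf : DiffV f p) (hg : DiffV g p) :
    DiffV (fun q => f q * g q) p := fun α => by
  classical
  simp only [MvPowerSeries.coeff_mul]
  exact DifferentiableAt.fun_sum fun i _ => (hf _).mul (hg _)

theorem DiffV.pderiv {f : 𝔼 → V} {p : 𝔼} (hf : DiffV f p) (k : Fin m) :
    DiffV (fun q => MvPowerSeries.pderiv ℂ k (f q)) p := fun α => by
  simp only [MvPowerSeries.coeff_pderiv]; exact (hf _).mul_const _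

theorem dV_const (u : 𝔼) (f : V) (p : 𝔼) : dV u (fun _ => f) p = 0 := by
  ext α; rw [coeff_dV, fderiv_fun_const]; rfl

theorem dV_add (u : 𝔼) {f g : 𝔼 → V} {p : 𝔼} (hf : DiffV f p) (hg : DiffV g p) :
    dV u (fun q => f q + g q) p = dV u f p + dV u g p := by
  ext α
  simp only [coeff_dV, map_add]
  rw [fderiv_fun_add (hf α) (hg α)]; rfl

theorem dV_smul (u : 𝔼) {c : 𝔼 → ℂ} {f : 𝔼 → V} {p : 𝔼} (hc : DifferentiableAt ℝ c p)
    (hf : DiffV f p) :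
    dV u (fun q => c q • f q) p = fderiv ℝ c p u • f p + c p • dV u f p := by
  ext α
  simp only [coeff_dV, map_add, map_smul, smul_eq_mul]
  rw [fderiv_fun_mul hc (hf α)]
  simp [mul_comm, add_comm]

theorem dV_const_smul (u : 𝔼) (c : ℂ) {f : 𝔼 → V} {p : 𝔼} (hf : DiffV f p) :
    dV u (fun q => c • f q) p = c • dV u f p := by
  rw [dV_smul u (differentiableAt_const c) hf, fderiv_fun_const]; simp

theorem dV_sum (u : 𝔼) {ι : Type*} {s : Finset ι} {f : ι → 𝔼 → V} {p : 𝔼}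
    (hf : ∀ i ∈ s, DiffV (f i) p) :
    dV u (fun q => ∑ i ∈ s, f i q) p = ∑ i ∈ s, dV u (f i) p := by
  ext α
  simp only [coeff_dV, map_sum]
  rw [fderiv_fun_sum fun i hi => hf i hi α]
  simp

theorem dV_mul (u : 𝔼) {f g : 𝔼 → V} {p : 𝔼} (hf : DiffV f p) (hg : DiffV g p) :
    dV u (fun q => f q * g q) p = dV u f p * g p + f p * dV u g p := by
  classical
  ext α
  simp only [coeff_dV, map_add, MvPowerSeries.coeff_mul]
  rw [fderiv_fun_sum fun i _ => (hf _).fun_mul (hg _), sum_apply,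
    ← Finset.sum_add_distrib]
  refine Finset.sum_congr rfl fun i _ => ?_
  rw [fderiv_fun_mul (hf _) (hg _)]
  simp [mul_comm, add_comm]

theorem dV_pderiv (u : 𝔼) {f : 𝔼 → V} {p : 𝔼} (hf : DiffV f p) (k : Fin m) :
    dV u (fun q => MvPowerSeries.pderiv ℂ k (f q)) p = MvPowerSeries.pderiv ℂ k (dV u f p) := by
  ext α
  simp only [coeff_dV, MvPowerSeries.coeff_pderiv]
  rw [fderiv_mul_const (hf _)]
  simp [mul_comm]

theorem differentiableAt_ofReal {c : 𝔼 → ℝ} {p : 𝔼} (h : DifferentiableAt ℝ c p) :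
    DifferentiableAt ℝ (fun q => (c q : ℂ)) p :=
  (Complex.ofRealCLM.differentiableAt).comp p h

theorem fderiv_ofReal {c : 𝔼 → ℝ} {p : 𝔼} (h : DifferentiableAt ℝ c p) (u : 𝔼) :
    fderiv ℝ (fun q => (c q : ℂ)) p u = (fderiv ℝ c p u : ℂ) := by
  have := (Complex.ofRealCLM.hasFDerivAt.comp p h.hasFDerivAt).fderiv
  exact congrArg (fun T => T u) this

theorem DiffV.bidiff {P : 𝔼 → Matrix (Fin m) (Fin m) ℝ} {p : 𝔼}
    (hP : ∀ k l, DifferentiableAt ℝ (fun q => P q k l) p) (s : ℕ) {f g : 𝔼 → V}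
    (hf : DiffV f p) (hg : DiffV g p) : DiffV (fun q => bidiff (P q) s (f q) (g q)) p := by
  induction s generalizing f g with
  | zero => exact hf.mul hg
  | succ s ih =>
    exact DiffV.sum fun k _ => DiffV.sum fun l _ =>
      DiffV.smul (differentiableAt_ofReal (hP k l)) (ih (hf.pderiv k) (hg.pderiv l))

/-- The covariant derivative in a frame, on formal functions of the generators. The vectors
`G l` are the covariant derivatives of the frame. -/
def nabV (G : Fin m → 𝔼) (u : 𝔼) (f : 𝔼 → V) (p : 𝔼) : V :=
  dV u f p - ∑ l, MvPowerSeries.X l * ∑ k, (G l k : ℂ) • MvPowerSeries.pderiv ℂ k (f p)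

/-- The derivative along `e k` also falls on the explicit generator in the Christoffel term. This
commutator is what the derivative of the bivector has to compensate in `nabV_bidiff`. -/
theorem nabV_pderiv (G : Fin m → 𝔼) (u : 𝔼) {f : 𝔼 → V} {p : 𝔼} (hf : DiffV f p) (k : Fin m) :
    nabV G u (fun q => MvPowerSeries.pderiv ℂ k (f q)) p =
      MvPowerSeries.pderiv ℂ k (nabV G u f p) +
        ∑ j, (G k j : ℂ) • MvPowerSeries.pderiv ℂ j (f p) := by
  have h : MvPowerSeries.pderiv ℂ k (∑ l, MvPowerSeries.X l * ∑ j, (G l j : ℂ) •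
      MvPowerSeries.pderiv ℂ j (f p)) = (∑ l, MvPowerSeries.X l * ∑ j, (G l j : ℂ) •
      MvPowerSeries.pderiv ℂ j (MvPowerSeries.pderiv ℂ k (f p))) +
      ∑ j, (G k j : ℂ) • MvPowerSeries.pderiv ℂ j (f p) := by
    rw [map_sum]
    simp only [Derivation.leibniz, smul_eq_mul, Finset.sum_add_distrib, map_sum,
      Derivation.map_smul, pderiv_comm k]
    congr 1
    rw [Finset.sum_eq_single k]
    · rw [MvPowerSeries.pderiv_X_self, mul_one]
    · intro l _ hl; rw [MvPowerSeries.pderiv_X_of_ne hl, mul_zero]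
    · simp
  rw [nabV, nabV, dV_pderiv u hf, map_sub, h]
  abel

/-- The condition `hG` says that the bivector is covariantly constant. Its derivative then cancels
the two commutator terms of `nabV_pderiv`, one for each slot, and the Leibniz rule survives at every
order. -/
theorem nabV_bidiff {P : 𝔼 → Matrix (Fin m) (Fin m) ℝ} {p : 𝔼} {G : Fin m → 𝔼} {u : 𝔼}
    (hP : ∀ k l, DifferentiableAt ℝ (fun q => P q k l) p)
    (hG : ∀ k l, fderiv ℝ (fun q => P q k l) p u + ∑ j, (P p j l * G j k + P p k j * G j l) = 0)
    (s : ℕ) {f g : 𝔼 → V} (hf : DiffV f p) (hg : DiffV g p) :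
    nabV G u (fun q => bidiff (P q) s (f q) (g q)) p =
      bidiff (P p) s (nabV G u f p) (g p) + bidiff (P p) s (f p) (nabV G u g p) := by
  induction s generalizing f g with
  | zero =>
    simp only [bidiff, nabV, dV_mul u hf hg, Derivation.leibniz, smul_eq_mul, smul_add,
      Finset.sum_add_distrib, sub_mul, mul_sub, mul_add, Finset.sum_mul, Finset.mul_sum,
      mul_smul_comm, smul_mul_assoc]
    have e1 : ∀ l k, (MvPowerSeries.X l : V) * (f p * MvPowerSeries.pderiv ℂ k (g p)) =
      f p * (MvPowerSeries.X l * MvPowerSeries.pderiv ℂ k (g p)) := fun l k => by ring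
    have e2 : ∀ l k, (MvPowerSeries.X l : V) * (g p * MvPowerSeries.pderiv ℂ k (f p)) =
      MvPowerSeries.X l * MvPowerSeries.pderiv ℂ k (f p) * g p := fun l k => by ring
    simp only [e1, e2]
    abel
  | succ s ih =>
    have hd : ∀ k l, DiffV (fun q => bidiff (P q) s (MvPowerSeries.pderiv ℂ k (f q))
        (MvPowerSeries.pderiv ℂ l (g q))) p := fun k l =>
      DiffV.bidiff hP s (hf.pderiv k) (hg.pderiv l)
    have hnab : ∀ F : 𝔼 → V, nabV G u F p = dV u F p - ∑ l, MvPowerSeries.X l *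
      ∑ k, (G l k : ℂ) • MvPowerSeries.pderiv ℂ k (F p) := fun F => rfl
    have key : nabV G u (fun q => bidiff (P q) (s + 1) (f q) (g q)) p =
        ∑ k, ∑ l, (((fderiv ℝ (fun q => P q k l) p u : ℝ) : ℂ) • bidiff (P p) s
          (MvPowerSeries.pderiv ℂ k (f p)) (MvPowerSeries.pderiv ℂ l (g p)) +
          (P p k l : ℂ) • nabV G u (fun q => bidiff (P q) s (MvPowerSeries.pderiv ℂ k (f q))
            (MvPowerSeries.pderiv ℂ l (g q))) p) := by
      rw [hnab]
      simp only [bidiff]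
      rw [dV_sum u fun k _ => DiffV.sum fun l _ =>
        DiffV.smul (differentiableAt_ofReal (hP k l)) (hd k l)]
      have : ∀ k, dV u (fun q => ∑ l, (P q k l : ℂ) • bidiff (P q) s
          (MvPowerSeries.pderiv ℂ k (f q)) (MvPowerSeries.pderiv ℂ l (g q))) p = _ := fun k =>
        dV_sum u fun l _ => DiffV.smul (differentiableAt_ofReal (hP k l)) (hd k l)
      simp only [this, dV_smul u (differentiableAt_ofReal (hP _ _)) (hd _ _),
        fderiv_ofReal (hP _ _), hnab, smul_sub, map_sum, Derivation.map_smul,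
        Finset.sum_add_distrib, Finset.sum_sub_distrib]
      rw [add_sub_assoc]
      congr 2
      simp only [Finset.mul_sum, Finset.smul_sum, mul_smul_comm, ← Finset.sum_product']
      refine Finset.sum_bij' (fun x _ => (x.2.2.1, x.2.2.2, x.1, x.2.1))
        (fun x _ => (x.2.2.1, x.2.2.2, x.1, x.2.1)) ?_ ?_ ?_ ?_ ?_
      · simp
      · simp
      · simp
      · simp
      · intro x _
        rw [smul_comm]
    rw [key]
    simp only [ih (hf.pderiv _) (hg.pderiv _), nabV_pderiv G u hf, nabV_pderiv G u hg,
      bidiff_add_left, bidiff_add_right, smul_add, Finset.sum_add_distrib]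
    simp only [bidiff]
    -- The derivative of `P` is replaced by Christoffel terms through `hG`; after renaming summation
    -- indices these are the negatives of the commutator terms.
    have hs : ∀ k l, ((fderiv ℝ (fun q => P q k l) p u : ℝ) : ℂ) =
        -∑ j, ((P p j l : ℂ) * (G j k : ℂ) + (P p k j : ℂ) * (G j l : ℂ)) := fun k l => by
      rw [eq_neg_of_add_eq_zero_left (hG k l)]; push_cast; rfl
    have h1 : ∑ k, ∑ l, ((fderiv ℝ (fun q => P q k l) p u : ℝ) : ℂ) • bidiff (P p) s
        (MvPowerSeries.pderiv ℂ k (f p)) (MvPowerSeries.pderiv ℂ l (g p)) +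
        (∑ k, ∑ l, (P p k l : ℂ) • bidiff (P p) s
          (∑ j, (G k j : ℂ) • MvPowerSeries.pderiv ℂ j (f p)) (MvPowerSeries.pderiv ℂ l (g p)) +
        ∑ k, ∑ l, (P p k l : ℂ) • bidiff (P p) s
          (MvPowerSeries.pderiv ℂ k (f p))
          (∑ j, (G l j : ℂ) • MvPowerSeries.pderiv ℂ j (g p))) = 0 := by
      simp only [hs, neg_smul, Finset.sum_neg_distrib, Finset.sum_smul, add_smul,
        Finset.sum_add_distrib, ← bidiffL_apply, map_sum, LinearMap.sum_apply, map_smul,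
        LinearMap.smul_apply, Finset.smul_sum, smul_smul]
      rw [neg_add_eq_zero]
      congr 1
      · simp only [← Finset.sum_product']
        refine Finset.sum_bij' (fun x _ => (x.2.2, x.2.1, x.1))
          (fun x _ => (x.2.2, x.2.1, x.1)) ?_ ?_ ?_ ?_ ?_ <;> simp
      · simp only [← Finset.sum_product']
        refine Finset.sum_bij' (fun x _ => (x.1, x.2.2, x.2.1))
          (fun x _ => (x.1, x.2.2, x.2.1)) ?_ ?_ ?_ ?_ ?_ <;> simp
    rw [← sub_eq_zero]
    rw [← h1]
    abel

/-! ### Coefficientwise derivatives of functions with values in the Weyl algebra -/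

/-- Coefficientwise differentiability. -/
def DiffW (A : 𝔼 → Weyl m) (p : 𝔼) : Prop :=
  ∀ j α, DifferentiableAt ℝ (fun q => coef j α (A q)) p

/-- The coefficientwise directional derivative. -/
def dW (u : 𝔼) (A : 𝔼 → Weyl m) (p : 𝔼) : Weyl m :=
  ofCoef fun j α => fderiv ℝ (fun q => coef j α (A q)) p u

theorem coef_dW (u : 𝔼) (A : 𝔼 → Weyl m) (p : 𝔼) (j : ℕ) (α : Fin m →₀ ℕ) :
    coef j α (dW u A p) = fderiv ℝ (fun q => coef j α (A q)) p u := coef_ofCoef _ _ _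

theorem coeff_dW (u : 𝔼) (A : 𝔼 → Weyl m) (p : 𝔼) (j : ℕ) :
    PowerSeries.coeff j (dW u A p) = dV u (fun q => PowerSeries.coeff j (A q)) p :=
  MvPowerSeries.ext fun α => coef_dW u A p j α

theorem DiffW.coeff {A : 𝔼 → Weyl m} {p : 𝔼} (h : DiffW A p) (j : ℕ) :
    DiffV (fun q => PowerSeries.coeff j (A q)) p := fun α => h j α

theorem DiffW.sub {A B : 𝔼 → Weyl m} {p : 𝔼} (hA : DiffW A p) (hB : DiffW B p) :
    DiffW (fun q => A q - B q) p := fun j α => by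
  simp only [coef_sub]; exact (hA j α).sub (hB j α)
theorem DiffW.sum {ι : Type*} {s : Finset ι} {A : ι → 𝔼 → Weyl m} {p : 𝔼}
    (hA : ∀ i ∈ s, DiffW (A i) p) : DiffW (fun q => ∑ i ∈ s, A i q) p := fun j α => by
  simp only [coef_sum]; exact DifferentiableAt.fun_sum fun i hi => hA i hi j α
theorem DiffW.smul {c : 𝔼 → ℂ} {A : 𝔼 → Weyl m} {p : 𝔼} (hc : DifferentiableAt ℝ c p)
    (hA : DiffW A p) : DiffW (fun q => c q • A q) p := fun j α => by
  simp only [coef_smul]; exact hc.mul (hA j α)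
theorem DiffW.partialE {A : 𝔼 → Weyl m} {p : 𝔼} (hA : DiffW A p) (k : Fin m) :
    DiffW (fun q => partialE k (A q)) p := fun j α => by
  simp only [coef_partialE]; exact (hA _ _).mul_const _
theorem DiffW.gen_mul {A : 𝔼 → Weyl m} {p : 𝔼} (hA : DiffW A p) (k : Fin m) :
    DiffW (fun q => gen k * A q) p := fun j α => by
  simp only [coef_gen_mul]; split_ifs
  · exact hA _ _
  · exact differentiableAt_const _

theorem dW_const (u : 𝔼) (a : Weyl m) (p : 𝔼) : dW u (fun _ => a) p = 0 := ext_coef fun j α => by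
  rw [coef_dW, fderiv_fun_const, coef_zero]; rfl
theorem dW_add (u : 𝔼) {A B : 𝔼 → Weyl m} {p : 𝔼} (hA : DiffW A p) (hB : DiffW B p) :
    dW u (fun q => A q + B q) p = dW u A p + dW u B p := ext_coef fun j α => by
  simp only [coef_dW, coef_add]
  rw [fderiv_fun_add (hA j α) (hB j α)]; rfl
theorem dW_sub (u : 𝔼) {A B : 𝔼 → Weyl m} {p : 𝔼} (hA : DiffW A p) (hB : DiffW B p) :
    dW u (fun q => A q - B q) p = dW u A p - dW u B p := ext_coef fun j α => by
  simp only [coef_dW, coef_sub]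
  rw [fderiv_fun_sub (hA j α) (hB j α)]; rfl
theorem dW_sum (u : 𝔼) {ι : Type*} {s : Finset ι} {A : ι → 𝔼 → Weyl m} {p : 𝔼}
    (hA : ∀ i ∈ s, DiffW (A i) p) :
    dW u (fun q => ∑ i ∈ s, A i q) p = ∑ i ∈ s, dW u (A i) p := ext_coef fun j α => by
  simp only [coef_dW, coef_sum]
  rw [fderiv_fun_sum fun i hi => hA i hi j α]
  simp
theorem dW_smul (u : 𝔼) {c : 𝔼 → ℂ} {A : 𝔼 → Weyl m} {p : 𝔼} (hc : DifferentiableAt ℝ c p)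
    (hA : DiffW A p) :
    dW u (fun q => c q • A q) p = fderiv ℝ c p u • A p + c p • dW u A p := ext_coef fun j α => by
  simp only [coef_dW, coef_add, coef_smul]
  rw [fderiv_fun_mul hc (hA j α)]
  simp [mul_comm, add_comm]
theorem dW_partialE (u : 𝔼) {A : 𝔼 → Weyl m} {p : 𝔼} (hA : DiffW A p) (k : Fin m) :
    dW u (fun q => partialE k (A q)) p = partialE k (dW u A p) := ext_coef fun j α => by
  simp only [coef_dW, coef_partialE]
  rw [fderiv_mul_const (hA _ _)]
  simp [mul_comm]
theorem dW_gen_mul (u : 𝔼) {A : 𝔼 → Weyl m} {p : 𝔼} (k : Fin m) :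
    dW u (fun q => gen k * A q) p = gen k * dW u A p := ext_coef fun j α => by
  simp only [coef_dW, coef_gen_mul]
  split_ifs
  · rfl
  · rw [fderiv_fun_const]; rfl

theorem dW_congr (u : 𝔼) {A B : 𝔼 → Weyl m} {p : 𝔼} (h : A =ᶠ[nhds p] B) :
    dW u A p = dW u B p := ext_coef fun j α => by
  rw [coef_dW, coef_dW, Filter.EventuallyEq.fderiv_eq (h.mono fun q hq => by rw [hq])]

theorem dW_comp (u : 𝔼) {A : 𝔼 → Weyl m} {τ : 𝔼 → 𝔼} {p : 𝔼} (hA : DiffW A (τ p))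
    (hτ : DifferentiableAt ℝ τ p) :
    dW u (fun q => A (τ q)) p = dW (fderiv ℝ τ p u) A (τ p) := ext_coef fun j α => by
  rw [coef_dW, coef_dW]
  exact congrArg (fun T => T u) (fderiv_comp p (hA j α) hτ)

theorem DiffW.comp {A : 𝔼 → Weyl m} {τ : 𝔼 → 𝔼} {p : 𝔼} (hA : DiffW A (τ p))
    (hτ : DifferentiableAt ℝ τ p) : DiffW (fun q => A (τ q)) p := fun j α => (hA j α).comp p hτ

/-! ### The derivative of a linear change of variables -/

/-- The derivative of `f ↦ pullV L f` in the direction `L'`. -/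
def pullDer (L L' : Fin m → 𝔼) : V →ₗ[ℂ] V :=
  ∑ k, LinearMap.mulLeft ℂ (MvPowerSeries.X k) ∘ₗ (pullV L).toLinearMap ∘ₗ
    ∑ i, (L' k i : ℂ) • (MvPowerSeries.pderiv ℂ i : V →ₗ[ℂ] V)

theorem pullDer_apply (L L' : Fin m → 𝔼) (f : V) : pullDer L L' f =
    ∑ k, MvPowerSeries.X k * pullV L (∑ i, (L' k i : ℂ) • MvPowerSeries.pderiv ℂ i f) := by
  simp [pullDer, LinearMap.sum_apply, -Complex.coe_smul, Finset.mul_sum]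

theorem pullDer_X (L L' : Fin m → 𝔼) (i : Fin m) :
    pullDer L L' (MvPowerSeries.X i) = ∑ k, (L' k i : ℂ) • (MvPowerSeries.X k : V) := by
  rw [pullDer_apply]
  refine Finset.sum_congr rfl fun k _ => ?_
  rw [Finset.sum_eq_single i]
  · rw [MvPowerSeries.pderiv_X_self, map_smul, map_one, mul_smul_comm, mul_one]
  · intro j _ hj; rw [MvPowerSeries.pderiv_X_of_ne (Ne.symm hj), smul_zero]
  · simp

theorem pullDer_mul (L L' : Fin m → 𝔼) (f g : V) :
    pullDer L L' (f * g) = pullDer L L' f * pullV L g + pullV L f * pullDer L L' g := by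
  simp only [pullDer_apply, Derivation.leibniz, smul_eq_mul, smul_add, Finset.sum_add_distrib,
    map_add, map_sum, map_smul, map_mul, mul_add, Finset.mul_sum, Finset.sum_mul]
  rw [add_comm]
  congr 1 <;>
  · refine Finset.sum_congr rfl fun k _ => Finset.sum_congr rfl fun i _ => ?_
    simp only [mul_smul_comm, smul_mul_assoc]
    congr 1
    ring

theorem coeff_pullDer_eq_zero (L L' : Fin m → 𝔼) (f : V) (β : Fin m →₀ ℕ)
    (hf : ∀ α, α.degree = β.degree → MvPowerSeries.coeff α f = 0) :
    MvPowerSeries.coeff β (pullDer L L' f) = 0 := by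
  rw [pullDer_apply, map_sum]
  refine Finset.sum_eq_zero fun k _ => ?_
  rw [MvPowerSeries.X, MvPowerSeries.coeff_monomial_mul]
  split_ifs with h
  · have hd : (β - Finsupp.single k 1).degree + 1 = β.degree := by
      conv_rhs => rw [← tsub_add_cancel_of_le h, map_add, Finsupp.degree_single]
    rw [coeff_pullV, Finset.sum_eq_zero, mul_zero]
    intro α hα
    rw [mem_degSet] at hα
    rw [map_sum, Finset.sum_eq_zero, zero_mul]
    intro i _
    rw [map_smul, MvPowerSeries.coeff_pderiv, hf, zero_mul, smul_zero]
    rw [map_add, Finsupp.degree_single, hα, hd]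
  · rfl

/-- The derivative of the substitution and `pullDer` satisfy the same Leibniz rule over `pullV`
(`pullDer_mul`) and agree on the generators, so they agree on polynomials by induction. -/
theorem dV_pullV_const {L : 𝔼 → Fin m → 𝔼} {L' : Fin m → 𝔼} {p u : 𝔼}
    (hL : ∀ k i, DifferentiableAt ℝ (fun q => L q k i) p)
    (hL' : ∀ k i, fderiv ℝ (fun q => L q k i) p u = L' k i) (f : MvPolynomial (Fin m) ℂ) :
    DiffV (fun q => pullV (L q) f) p ∧
      dV u (fun q => pullV (L q) f) p = pullDer (L p) L' f := by
  induction f using MvPolynomial.induction_on with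
  | C c =>
    have h : ((MvPolynomial.C c : MvPolynomial (Fin m) ℂ) : V) = algebraMap ℂ V c := by
      rw [MvPolynomial.coe_C]; rfl
    simp only [h, AlgHom.commutes]
    refine ⟨DiffV.const _ _, ?_⟩
    rw [dV_const, pullDer_apply]
    simp
  | add f g hf hg =>
    simp only [MvPolynomial.coe_add, map_add]
    exact ⟨hf.1.add hg.1, by rw [dV_add u hf.1 hg.1, hf.2, hg.2]⟩
  | mul_X f i hf =>
    have hX : DiffV (fun q => pullV (L q) (MvPowerSeries.X i)) p := by
      simp only [pullV_X]
      exact DiffV.sum fun k _ => DiffV.smul (differentiableAt_ofReal (hL k i)) (DiffV.const _ _)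
    simp only [MvPolynomial.coe_mul, MvPolynomial.coe_X, map_mul]
    refine ⟨hf.1.mul hX, ?_⟩
    rw [dV_mul u hf.1 hX, hf.2, pullDer_mul, pullDer_X]
    congr 2
    simp only [pullV_X]
    rw [dV_sum u fun k _ => DiffV.smul (differentiableAt_ofReal (hL k i)) (DiffV.const _ _)]
    refine Finset.sum_congr rfl fun k _ => ?_
    rw [dV_smul u (differentiableAt_ofReal (hL k i)) (DiffV.const _ _), dV_const,
      fderiv_ofReal (hL k i), hL']
    simp

theorem differentiableAt_pullKer {L : 𝔼 → Fin m → 𝔼} {p : 𝔼}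
    (hL : ∀ k i, DifferentiableAt ℝ (fun q => L q k i) p) (α β : Fin m →₀ ℕ) :
    DifferentiableAt ℝ (fun q => pullKer (L q) α β) p := by
  have := (dV_pullV_const (u := 0) (L' := 0) hL (by simp) (MvPolynomial.monomial α 1)).1 β
  simpa only [pullKer, MvPolynomial.coe_monomial] using this

theorem fderiv_pullKer {L : 𝔼 → Fin m → 𝔼} {L' : Fin m → 𝔼} {p u : 𝔼}
    (hL : ∀ k i, DifferentiableAt ℝ (fun q => L q k i) p)
    (hL' : ∀ k i, fderiv ℝ (fun q => L q k i) p u = L' k i) (α β : Fin m →₀ ℕ) :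
    fderiv ℝ (fun q => pullKer (L q) α β) p u =
      MvPowerSeries.coeff β (pullDer (L p) L' (MvPowerSeries.monomial α 1)) := by
  have := congrArg (MvPowerSeries.coeff β) (dV_pullV_const hL hL' (MvPolynomial.monomial α 1)).2
  simpa only [pullKer, MvPolynomial.coe_monomial, coeff_dV] using this

theorem coeff_pullDer (L L' : Fin m → 𝔼) (f : V) (β : Fin m →₀ ℕ) :
    MvPowerSeries.coeff β (pullDer L L' f) = ∑ α ∈ degSet β.degree,
      MvPowerSeries.coeff α f *
        MvPowerSeries.coeff β (pullDer L L' (MvPowerSeries.monomial α 1)) := by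
  classical
  have h := coeff_pullDer_eq_zero L L' (f - ∑ α ∈ degSet β.degree,
    MvPowerSeries.coeff α f • MvPowerSeries.monomial α 1) β fun γ hγ => by
      rw [map_sub, map_sum, Finset.sum_eq_single γ]
      · rw [map_smul, MvPowerSeries.coeff_monomial_same, smul_eq_mul, mul_one, sub_self]
      · intro α _ hα
        rw [map_smul, MvPowerSeries.coeff_monomial_ne (Ne.symm hα), smul_zero]
      · intro h; exact absurd (mem_degSet.2 hγ) h
  rw [map_sub, map_sub, sub_eq_zero] at h
  rw [h, map_sum, map_sum]
  simp only [map_smul, smul_eq_mul]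

/-- The coefficients of `A` and the frame are both differentiated. The second contribution is a
fibrewise linear vector field, the shape of a Christoffel term; in `locNabla_change` it matches the
inhomogeneous part of the transformation law of the Christoffel symbols. -/
theorem dW_pull {L : 𝔼 → Fin m → 𝔼} {L' : Fin m → 𝔼} {p u : 𝔼} {A : 𝔼 → Weyl m}
    (hL : ∀ k i, DifferentiableAt ℝ (fun q => L q k i) p)
    (hL' : ∀ k i, fderiv ℝ (fun q => L q k i) p u = L' k i) (hA : DiffW A p) :
    dW u (fun q => pull (L q) (A q)) p =
      pull (L p) (dW u A p) + ∑ k, gen k * pull (L p) (dirE (L' k) (A p)) := by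
  have h2 : ∀ j, PowerSeries.coeff j (∑ k, gen k * pull (L p) (dirE (L' k) (A p))) =
      pullDer (L p) L' (PowerSeries.coeff j (A p)) := fun j => by
    rw [map_sum, pullDer_apply]
    refine Finset.sum_congr rfl fun k _ => ?_
    rw [gen, PowerSeries.coeff_C_mul, coeff_pull, dirE_apply, map_sum]
    simp only [coeff_smul_complex, partialE, PowerSeries.coeff_mk]
  refine ext_coef fun j β => ?_
  rw [coef_dW, coef_add]
  simp only [coef_pull]
  rw [coef, h2, coeff_pullDer, fderiv_fun_sum fun α _ =>
    (hA j α).fun_mul (differentiableAt_pullKer hL α β), sum_apply, ← Finset.sum_add_distrib]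
  refine Finset.sum_congr rfl fun α _ => ?_
  rw [fderiv_fun_mul (hA j α) (differentiableAt_pullKer hL α β), coef_dW]
  simp only [add_apply, smul_apply, smul_eq_mul, fderiv_pullKer hL hL']
  rw [add_comm, mul_comm (pullKer _ _ _)]
  rfl

/-! ### The covariant derivative in a frame -/

/-- The covariant derivative with Christoffel symbols `Γ` along the constant vector field `u`. -/
def locNabla (Γ : 𝔼 → 𝔼 → 𝔼 → 𝔼) (u : 𝔼) (A : 𝔼 → Weyl m) (p : 𝔼) : Weyl m :=
  dW u A p - ∑ l, gen l * dirE (Γ p u (basisVec l)) (A p)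

theorem coeff_locNabla (Γ : 𝔼 → 𝔼 → 𝔼 → 𝔼) (u : 𝔼) (A : 𝔼 → Weyl m) (p : 𝔼) (j : ℕ) :
    PowerSeries.coeff j (locNabla Γ u A p) =
      nabV (fun l => Γ p u (basisVec l)) u (fun q => PowerSeries.coeff j (A q)) p := by
  rw [locNabla, nabV, map_sub, coeff_dW, map_sum]
  congr 1
  refine Finset.sum_congr rfl fun l _ => ?_
  rw [gen, PowerSeries.coeff_C_mul, dirE_apply, map_sum]
  simp only [coeff_smul_complex, partialE, PowerSeries.coeff_mk]

theorem locNabla_congr (Γ : 𝔼 → 𝔼 → 𝔼 → 𝔼) (u : 𝔼) {A B : 𝔼 → Weyl m} {p : 𝔼}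
    (h : A =ᶠ[nhds p] B) : locNabla Γ u A p = locNabla Γ u B p := by
  rw [locNabla, locNabla, dW_congr u h, h.self_of_nhds]

theorem locNabla_add (Γ : 𝔼 → 𝔼 → 𝔼 → 𝔼) (u : 𝔼) {A B : 𝔼 → Weyl m} {p : 𝔼}
    (hA : DiffW A p) (hB : DiffW B p) :
    locNabla Γ u (fun q => A q + B q) p = locNabla Γ u A p + locNabla Γ u B p := by
  simp only [locNabla, dW_add u hA hB, map_add, mul_add, Finset.sum_add_distrib]
  abel

theorem locNabla_sub (Γ : 𝔼 → 𝔼 → 𝔼 → 𝔼) (u : 𝔼) {A B : 𝔼 → Weyl m} {p : 𝔼}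
    (hA : DiffW A p) (hB : DiffW B p) :
    locNabla Γ u (fun q => A q - B q) p = locNabla Γ u A p - locNabla Γ u B p := by
  simp only [locNabla, dW_sub u hA hB, map_sub, mul_sub, Finset.sum_sub_distrib]
  abel

theorem locNabla_sum (Γ : 𝔼 → 𝔼 → 𝔼 → 𝔼) (u : 𝔼) {ι : Type*} {s : Finset ι}
    {A : ι → 𝔼 → Weyl m} {p : 𝔼} (hA : ∀ i ∈ s, DiffW (A i) p) :
    locNabla Γ u (fun q => ∑ i ∈ s, A i q) p = ∑ i ∈ s, locNabla Γ u (A i) p := by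
  simp only [locNabla, dW_sum u hA, map_sum, Finset.mul_sum, Finset.sum_sub_distrib]
  rw [Finset.sum_comm]

theorem locNabla_smul (Γ : 𝔼 → 𝔼 → 𝔼 → 𝔼) (u : 𝔼) {c : 𝔼 → ℂ} {A : 𝔼 → Weyl m} {p : 𝔼}
    (hc : DifferentiableAt ℝ c p) (hA : DiffW A p) :
    locNabla Γ u (fun q => c q • A q) p = fderiv ℝ c p u • A p + c p • locNabla Γ u A p := by
  simp only [locNabla, dW_smul u hc hA, Derivation.map_smul, smul_sub, Finset.smul_sum,
    mul_smul_comm]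
  abel

/-- The compatibility of the Christoffel symbols with the bivector `P` at `p`. -/
def Compatible (P : 𝔼 → Matrix (Fin m) (Fin m) ℝ) (Γ : 𝔼 → 𝔼 → 𝔼 → 𝔼) (p : 𝔼) : Prop :=
  (∀ k l, DifferentiableAt ℝ (fun q => P q k l) p) ∧
    ∀ u k l, fderiv ℝ (fun q => P q k l) p u +
      ∑ j, (P p j l * Γ p u (basisVec j) k + P p k j * Γ p u (basisVec j) l) = 0

theorem locNabla_moyal {P : 𝔼 → Matrix (Fin m) (Fin m) ℝ} {Γ : 𝔼 → 𝔼 → 𝔼 → 𝔼} {p : 𝔼}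
    (h : Compatible P Γ p) (u : 𝔼) {A B : 𝔼 → Weyl m} (hA : DiffW A p) (hB : DiffW B p) :
    locNabla Γ u (fun q => moyal (P q) (A q) (B q)) p =
      moyal (P p) (locNabla Γ u A p) (B p) + moyal (P p) (A p) (locNabla Γ u B p) := by
  ext1 n
  rw [map_add, coeff_locNabla]
  have hd : ∀ s i j, DiffV (fun q => bidiff (P q) s (PowerSeries.coeff i (A q))
      (PowerSeries.coeff j (B q))) p := fun s i j => DiffV.bidiff h.1 s (hA.coeff i) (hB.coeff j)
  have hnab : ∀ (G : Fin m → 𝔼) (F : 𝔼 → V), nabV G u F p = dV u F p - ∑ l, MvPowerSeries.X l *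
      ∑ k, (G l k : ℂ) • MvPowerSeries.pderiv ℂ k (F p) := fun G F => rfl
  have nab_sum : ∀ (G : Fin m → 𝔼) {ι : Type} (s : Finset ι) (F : ι → 𝔼 → V),
      (∀ i ∈ s, DiffV (F i) p) →
      nabV G u (fun q => ∑ i ∈ s, F i q) p = ∑ i ∈ s, nabV G u (F i) p := by
    intro G ι s F hF
    simp only [hnab, dV_sum u hF, map_sum, Finset.smul_sum, Finset.mul_sum,
      Finset.sum_sub_distrib]
    congr 1
    conv_rhs => rw [Finset.sum_comm]
    refine Finset.sum_congr rfl fun l _ => ?_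
    rw [Finset.sum_comm]
  have nab_smul : ∀ (G : Fin m → 𝔼) (c : ℂ) (F : 𝔼 → V), DiffV F p →
      nabV G u (fun q => c • F q) p = c • nabV G u F p := by
    intro G c F hF
    simp only [hnab, dV_const_smul u c hF, Derivation.map_smul, smul_sub, Finset.smul_sum,
      Finset.mul_sum, mul_smul_comm, smul_comm c]
  simp only [coeff_moyal, moyalTerm]
  rw [nab_sum _ _ _ fun s _ => DiffV.sum fun q _ =>
    DiffV.smul (differentiableAt_const _) (hd _ _ _), ← Finset.sum_add_distrib]
  refine Finset.sum_congr rfl fun s _ => ?_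
  rw [nab_sum _ _ _ fun q _ => DiffV.smul (differentiableAt_const _) (hd _ _ _),
    ← Finset.sum_add_distrib]
  refine Finset.sum_congr rfl fun q _ => ?_
  rw [nab_smul _ _ _ (hd _ _ _), nabV_bidiff h.1 (h.2 u) _ (hA.coeff _) (hB.coeff _), smul_add,
    coeff_locNabla, coeff_locNabla]

theorem DiffW.moyal {P : 𝔼 → Matrix (Fin m) (Fin m) ℝ} {p : 𝔼}
    (hP : ∀ k l, DifferentiableAt ℝ (fun q => P q k l) p) {A B : 𝔼 → Weyl m}
    (hA : DiffW A p) (hB : DiffW B p) : DiffW (fun q => moyal (P q) (A q) (B q)) p := by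
  intro n
  suffices DiffV (fun q => PowerSeries.coeff n (Weyl.moyal (P q) (A q) (B q))) p from this
  simp only [coeff_moyal, moyalTerm]
  exact DiffV.sum fun s _ => DiffV.sum fun q _ => DiffV.smul (differentiableAt_const _)
    (DiffV.bidiff hP _ (hA.coeff _) (hB.coeff _))

theorem coef_succ_X_mul (a : Weyl m) (j : ℕ) (α : Fin m →₀ ℕ) :
    coef (j + 1) α (PowerSeries.X * a) = coef j α a := by
  rw [coef, coef, PowerSeries.coeff_succ_X_mul]

theorem coef_bracket (P : Matrix (Fin m) (Fin m) ℝ) (a b : Weyl m) (j : ℕ) (α : Fin m →₀ ℕ) :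
    coef j α (bracket P a b) =
      Complex.I * (coef (j + 1) α (moyal P a b) - coef (j + 1) α (moyal P b a)) := by
  rw [← coef_succ_X_mul, X_mul_bracket, coef_smul, coef_sub]

theorem locNabla_X_mul (Γ : 𝔼 → 𝔼 → 𝔼 → 𝔼) (u : 𝔼) (A : 𝔼 → Weyl m) (p : 𝔼) :
    locNabla Γ u (fun q => PowerSeries.X * A q) p = PowerSeries.X * locNabla Γ u A p := by
  ext1 n
  rcases n with _ | n
  · rw [coeff_locNabla, PowerSeries.coeff_zero_X_mul]
    simp only [PowerSeries.coeff_zero_X_mul, nabV, dV_const]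
    simp
  · rw [coeff_locNabla, PowerSeries.coeff_succ_X_mul, coeff_locNabla]
    simp only [PowerSeries.coeff_succ_X_mul]

theorem locNabla_bracket {P : 𝔼 → Matrix (Fin m) (Fin m) ℝ} {Γ : 𝔼 → 𝔼 → 𝔼 → 𝔼} {p : 𝔼}
    (h : Compatible P Γ p) (u : 𝔼) {A B : 𝔼 → Weyl m} (hA : DiffW A p) (hB : DiffW B p) :
    locNabla Γ u (fun q => bracket (P q) (A q) (B q)) p =
      bracket (P p) (locNabla Γ u A p) (B p) + bracket (P p) (A p) (locNabla Γ u B p) :=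
  X_mul_cancel <| by
    rw [← locNabla_X_mul, mul_add]
    simp only [X_mul_bracket]
    rw [locNabla_smul Γ u (differentiableAt_const _)
      ((hA.moyal h.1 hB).sub (hB.moyal h.1 hA)), locNabla_sub Γ u (hA.moyal h.1 hB)
      (hB.moyal h.1 hA), locNabla_moyal h u hA hB, locNabla_moyal h u hB hA, fderiv_fun_const,
      ← smul_add]
    simp only [Pi.zero_apply, zero_apply, zero_smul, zero_add]
    congr 1
    abel

end Fedosov.Weyl

namespace Fedosov.Weyl

variable {m : ℕ}

local notation "V" => MvPowerSeries (Fin m) ℂ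
local notation "antidiag" => Finset.HasAntidiagonal.antidiagonal
local notation "𝔼" => EuclideanSpace ℝ (Fin m)

/-! ### Filtrations by ideals of smooth functions -/

/-- A decreasing filtration of the smooth functions on `U` by ideals, such that directional
derivatives lower the index by at most one. -/
structure IdealFil (U : Set 𝔼) (I : ℕ → (𝔼 → ℂ) → Prop) : Prop where
  isOpen : IsOpen U
  smooth : ∀ {n f}, I n f → ContDiffOn ℝ ∞ f U
  zero : ∀ n, I n fun _ => 0
  add : ∀ {n f g}, I n f → I n g → I n fun p => f p + g p
  mul : ∀ {n f g}, ContDiffOn ℝ ∞ g U → I n f → I n fun p => g p * f p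
  anti : ∀ {n k f}, n ≤ k → I k f → I n f
  deriv : ∀ {n f}, I n f → ∀ u, I (n - 1) fun p => fderiv ℝ f p u
  congr : ∀ {n f g}, I n f → (∀ p ∈ U, g p = f p) → I n g

theorem IdealFil.sum {U : Set 𝔼} {I : ℕ → (𝔼 → ℂ) → Prop} (hI : IdealFil U I) {n : ℕ}
    {ι : Type*} {s : Finset ι} {f : ι → 𝔼 → ℂ} (hf : ∀ i ∈ s, I n (f i)) :
    I n fun p => ∑ i ∈ s, f i p := by
  classical
  induction s using Finset.induction_on with
  | empty => simpa using hI.zero n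
  | insert i s hi ih =>
    simp only [Finset.sum_insert hi]
    exact hI.add (hf i (Finset.mem_insert_self i s))
      (ih fun j hj => hf j (Finset.mem_insert_of_mem hj))

theorem IdealFil.const_mul {U : Set 𝔼} {I : ℕ → (𝔼 → ℂ) → Prop} (hI : IdealFil U I) {n : ℕ}
    {f : 𝔼 → ℂ} (c : ℂ) (hf : I n f) : I n fun p => c * f p := hI.mul contDiffOn_const hf

theorem contDiffOn_fderiv_apply {U : Set 𝔼} (hU : IsOpen U) {F : Type*} [NormedAddCommGroup F]
    [NormedSpace ℝ F] {f : 𝔼 → F} (hf : ContDiffOn ℝ ∞ f U) (u : 𝔼) :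
    ContDiffOn ℝ ∞ (fun p => fderiv ℝ f p u) U :=
  (hf.fderiv_of_isOpen hU (m := ∞) (by simp)).clm_apply contDiffOn_const

/-- The constant filtration. -/
theorem idealFil_contDiffOn {U : Set 𝔼} (hU : IsOpen U) :
    IdealFil U fun _ f => ContDiffOn ℝ ∞ f U where
  isOpen := hU
  smooth := id
  zero _ := contDiffOn_const
  add := ContDiffOn.add
  mul := ContDiffOn.mul
  anti _ := id
  deriv hf u := contDiffOn_fderiv_apply hU hf u
  congr := ContDiffOn.congr

/-- Coefficientwise membership in a filtration, where the generators count once. -/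
def JetV (I : ℕ → (𝔼 → ℂ) → Prop) (n : ℕ) (f : 𝔼 → V) : Prop :=
  ∀ α, I (n - α.degree) fun p => MvPowerSeries.coeff α (f p)

section JetV

variable {U : Set (EuclideanSpace ℝ (Fin m))} {I : ℕ → (EuclideanSpace ℝ (Fin m) → ℂ) → Prop}

theorem JetV.mono (hI : IdealFil U I) {n k : ℕ} {f : 𝔼 → V} (hf : JetV I n f) (h : k ≤ n) :
    JetV I k f := fun α => hI.anti (by omega) (hf α)

theorem JetV.sum (hI : IdealFil U I) {n : ℕ} {ι : Type*} {s : Finset ι} {f : ι → 𝔼 → V}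
    (hf : ∀ i ∈ s, JetV I n (f i)) : JetV I n fun p => ∑ i ∈ s, f i p := fun α => by
  simp only [map_sum]; exact hI.sum fun i hi => hf i hi α

theorem JetV.smul (hI : IdealFil U I) {n : ℕ} {c : 𝔼 → ℂ} (hc : ContDiffOn ℝ ∞ c U) {f : 𝔼 → V}
    (hf : JetV I n f) : JetV I n fun p => c p • f p := fun α => hI.mul hc (hf α)

theorem JetV.pderiv (hI : IdealFil U I) {n : ℕ} {f : 𝔼 → V} (hf : JetV I n f) (k : Fin m) :
    JetV I (n - 1) fun p => MvPowerSeries.pderiv ℂ k (f p) := fun α => by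
  simp only [MvPowerSeries.coeff_pderiv, mul_comm _ ((_ : ℂ) + 1)]
  refine hI.const_mul _ (hI.anti ?_ (hf _))
  rw [map_add, Finsupp.degree_single]; omega

theorem degree_le_of_mem_antidiag {α : Fin m →₀ ℕ} {q : (Fin m →₀ ℕ) × (Fin m →₀ ℕ)}
    (h : q ∈ antidiag α) : q.2.degree ≤ α.degree := by
  rw [Finset.HasAntidiagonal.mem_antidiagonal] at h
  rw [← h, map_add]; omega

theorem JetV.mul (hI : IdealFil U I) {n : ℕ} {f g : 𝔼 → V}
    (hf : JetV (fun _ f => ContDiffOn ℝ ∞ f U) 0 f) (hg : JetV I n g) :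
    JetV I n fun p => f p * g p := fun α => by
  classical
  simp only [MvPowerSeries.coeff_mul]
  refine hI.sum fun q hq => hI.mul (hf q.1) (hI.anti ?_ (hg q.2))
  have := degree_le_of_mem_antidiag hq
  omega

/-- Only derivatives along the fibre occur, and each order puts one on `g`. A derivative in a
generator lowers the index by one because generators count once. The other factor merely has to be
smooth, since the filtration consists of ideals. -/
theorem JetV.bidiff (hI : IdealFil U I) {P : 𝔼 → Matrix (Fin m) (Fin m) ℝ}
    (hP : ∀ k l, ContDiffOn ℝ ∞ (fun p => P p k l) U) (s : ℕ) {n : ℕ} {f g : 𝔼 → V}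
    (hf : JetV (fun _ f => ContDiffOn ℝ ∞ f U) 0 f) (hg : JetV I n g) :
    JetV I (n - s) fun p => Weyl.bidiff (P p) s (f p) (g p) := by
  induction s generalizing f g n with
  | zero => exact hf.mul hI hg
  | succ s ih =>
    refine JetV.sum hI fun k _ => JetV.sum hI fun l _ => JetV.smul hI
      (Complex.ofRealCLM.contDiff.comp_contDiffOn (hP k l)) ?_
    have := ih (hf.pderiv (idealFil_contDiffOn hI.isOpen) k) (hg.pderiv hI l)
    rwa [Nat.sub_sub, add_comm 1 s] at this

end JetV

/-- Coefficientwise membership in a filtration, where `t` and the generators count once. -/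
def JetW (I : ℕ → (𝔼 → ℂ) → Prop) (n : ℕ) (A : 𝔼 → Weyl m) : Prop :=
  ∀ j α, I (n - j - α.degree) fun p => coef j α (A p)

/-- Coefficientwise smoothness on `U`. -/
def SmoothW (U : Set 𝔼) (A : 𝔼 → Weyl m) : Prop :=
  ∀ j α, ContDiffOn ℝ ∞ (fun p => coef j α (A p)) U

section JetW

variable {U : Set (EuclideanSpace ℝ (Fin m))} {I : ℕ → (EuclideanSpace ℝ (Fin m) → ℂ) → Prop} {n : ℕ}

theorem JetW.smooth (hI : IdealFil U I) {A : 𝔼 → Weyl m} (hA : JetW I n A) : SmoothW U A :=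
  fun j α => hI.smooth (hA j α)

theorem JetW.coeff {A : 𝔼 → Weyl m} (hA : JetW I n A) (j : ℕ) :
    JetV I (n - j) fun p => PowerSeries.coeff j (A p) := fun α => hA j α

theorem JetW.mono (hI : IdealFil U I) {k : ℕ} {A : 𝔼 → Weyl m} (hA : JetW I n A) (h : k ≤ n) :
    JetW I k A := fun j α => hI.anti (by omega) (hA j α)

theorem JetW.congr (hI : IdealFil U I) {A B : 𝔼 → Weyl m} (hA : JetW I n A)
    (h : ∀ p ∈ U, B p = A p) : JetW I n B := fun j α =>
  hI.congr (hA j α) fun p hp => by rw [h p hp]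

theorem JetW.add (hI : IdealFil U I) {A B : 𝔼 → Weyl m} (hA : JetW I n A) (hB : JetW I n B) :
    JetW I n fun p => A p + B p := fun j α => by
  simp only [coef_add]; exact hI.add (hA j α) (hB j α)

theorem JetW.smul (hI : IdealFil U I) {c : 𝔼 → ℂ} (hc : ContDiffOn ℝ ∞ c U) {A : 𝔼 → Weyl m}
    (hA : JetW I n A) : JetW I n fun p => c p • A p := fun j α => by
  simp only [coef_smul]; exact hI.mul hc (hA j α)

theorem JetW.neg (hI : IdealFil U I) {A : 𝔼 → Weyl m} (hA : JetW I n A) :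
    JetW I n fun p => -A p := by
  simpa using hA.smul hI (c := fun _ => -1) contDiffOn_const

theorem JetW.sub (hI : IdealFil U I) {A B : 𝔼 → Weyl m} (hA : JetW I n A) (hB : JetW I n B) :
    JetW I n fun p => A p - B p := by
  simpa only [sub_eq_add_neg] using hA.add hI (hB.neg hI)

theorem JetW.sum (hI : IdealFil U I) {ι : Type*} {s : Finset ι} {A : ι → 𝔼 → Weyl m}
    (hA : ∀ i ∈ s, JetW I n (A i)) : JetW I n fun p => ∑ i ∈ s, A i p := fun j α => by
  simp only [coef_sum]; exact hI.sum fun i hi => hA i hi j α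

theorem JetW.gen_mul (hI : IdealFil U I) {A : 𝔼 → Weyl m} (hA : JetW I n A) (k : Fin m) :
    JetW I (n + 1) fun p => gen k * A p := fun j α => by
  simp only [coef_gen_mul]
  split_ifs with h
  · refine hI.anti ?_ (hA j _)
    have hd : (α - Finsupp.single k 1).degree + 1 = α.degree := by
      conv_rhs => rw [← tsub_add_cancel_of_le h, map_add, Finsupp.degree_single]
    omega
  · exact hI.zero _

theorem JetW.partialE (hI : IdealFil U I) {A : 𝔼 → Weyl m} (hA : JetW I n A) (k : Fin m) :
    JetW I (n - 1) fun p => partialE k (A p) := fun j α => by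
  simp only [coef_partialE, mul_comm _ ((_ : ℂ) + 1)]
  refine hI.const_mul _ (hI.anti ?_ (hA j _))
  rw [map_add, Finsupp.degree_single]; omega

theorem JetW.dirE (hI : IdealFil U I) {A : 𝔼 → Weyl m} (hA : JetW I n A) {G : 𝔼 → 𝔼}
    (hG : ContDiffOn ℝ ∞ G U) : JetW I (n - 1) fun p => dirE (G p) (A p) := by
  simp only [dirE_apply]
  exact JetW.sum hI fun k _ => (hA.partialE hI k).smul hI
    (Complex.ofRealCLM.contDiff.comp_contDiffOn (contDiffOn_euclidean.1 hG k))

theorem JetW.divDegree (hI : IdealFil U I) {A : 𝔼 → Weyl m} (hA : JetW I n A) (c : ℕ) :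
    JetW I n fun p => divDegree c (A p) := fun j α => by
  simp only [coef_divDegree, div_eq_inv_mul]
  exact hI.const_mul _ (hA j α)

theorem JetW.dW (hI : IdealFil U I) {A : 𝔼 → Weyl m} (hA : JetW I n A) (u : 𝔼) :
    JetW I (n - 1) fun p => dW u A p := fun j α => by
  simp only [coef_dW]
  exact hI.anti (by omega) (hI.deriv (hA j α) u)

theorem JetW.locNabla (hI : IdealFil U I) {Γ : 𝔼 → 𝔼 → 𝔼 → 𝔼}
    (hΓ : ∀ u v, ContDiffOn ℝ ∞ (fun p => Γ p u v) U) {A : 𝔼 → Weyl m} (hA : JetW I n A)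
    (u : 𝔼) : JetW I (n - 1) fun p => locNabla Γ u A p :=
  (hA.dW hI u).sub hI (JetW.sum hI fun l _ =>
    ((hA.dirE hI (hΓ u (basisVec l))).gen_mul hI l).mono hI (by omega))

/-- The term of order `s` loses `s` steps by `JetV.bidiff` and carries `t ^ s`. Counting `t` once,
and not twice as in the degree, balances this exactly; this weight leads to the bound `l` on the
order of derivatives in the `l`-th coefficient of the star-product. -/
theorem JetW.moyal (hI : IdealFil U I) {P : 𝔼 → Matrix (Fin m) (Fin m) ℝ}
    (hP : ∀ k l, ContDiffOn ℝ ∞ (fun p => P p k l) U) {A B : 𝔼 → Weyl m} (hA : SmoothW U A)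
    (hB : JetW I n B) : JetW I n fun p => moyal (P p) (A p) (B p) := by
  intro j
  suffices JetV I (n - j) fun p => PowerSeries.coeff j (Weyl.moyal (P p) (A p) (B p)) from this
  simp only [coeff_moyal, moyalTerm]
  refine JetV.sum hI fun s hs => JetV.sum hI fun q hq => JetV.smul hI contDiffOn_const ?_
  rw [Finset.HasAntidiagonal.mem_antidiagonal] at hs hq
  exact (JetV.bidiff hI hP _ (fun α => hA _ α) (hB.coeff q.2)).mono hI (by omega)

theorem JetW.moyal' (hI : IdealFil U I) {P : 𝔼 → Matrix (Fin m) (Fin m) ℝ}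
    (hP : ∀ k l, ContDiffOn ℝ ∞ (fun p => P p k l) U) {A B : 𝔼 → Weyl m} (hA : SmoothW U A)
    (hB : JetW I n B) : JetW I n fun p => Weyl.moyal (P p) (B p) (A p) := by
  simp only [moyal_transpose _ (B _)]
  exact hB.moyal hI (fun k l => hP l k) hA

theorem JetW.bracket (hI : IdealFil U I) {P : 𝔼 → Matrix (Fin m) (Fin m) ℝ}
    (hP : ∀ k l, ContDiffOn ℝ ∞ (fun p => P p k l) U) {A B : 𝔼 → Weyl m} (hA : SmoothW U A)
    (hB : JetW I n B) : JetW I (n - 1) fun p => bracket (P p) (A p) (B p) := fun j α => by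
  simp only [coef_bracket]
  refine hI.const_mul _ ?_
  simp only [← coef_sub]
  exact hI.anti (by omega) (((hB.moyal hI hP hA).sub hI (hB.moyal' hI hP hA)) (j + 1) α)

end JetW

section SmoothW

variable {U : Set (EuclideanSpace ℝ (Fin m))}

theorem SmoothW.diffW (hU : IsOpen U) {A : 𝔼 → Weyl m} (hA : SmoothW U A) {p : 𝔼} (hp : p ∈ U) :
    DiffW A p := fun j α =>
  (((hA j α) p hp).contDiffAt (hU.mem_nhds hp)).differentiableAt (by simp)

theorem SmoothW.jetW {A : 𝔼 → Weyl m} (hA : SmoothW U A) (n : ℕ) :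
    JetW (fun _ f => ContDiffOn ℝ ∞ f U) n A := hA

theorem SmoothW.const (a : Weyl m) : SmoothW U fun _ => a := fun _ _ => contDiffOn_const
theorem SmoothW.congr {A B : 𝔼 → Weyl m} (hA : SmoothW U A)
    (h : ∀ p ∈ U, B p = A p) : SmoothW U B := fun j α =>
  (hA j α).congr fun p hp => by rw [h p hp]
theorem SmoothW.add {A B : 𝔼 → Weyl m} (hA : SmoothW U A)
    (hB : SmoothW U B) : SmoothW U fun p => A p + B p := fun j α => by
  simp only [coef_add]; exact (hA j α).add (hB j α)
theorem SmoothW.sub {A B : 𝔼 → Weyl m} (hA : SmoothW U A)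
    (hB : SmoothW U B) : SmoothW U fun p => A p - B p := fun j α => by
  simp only [coef_sub]; exact (hA j α).sub (hB j α)
theorem SmoothW.sum {ι : Type*} {s : Finset ι} {A : ι → 𝔼 → Weyl m}
    (hA : ∀ i ∈ s, SmoothW U (A i)) : SmoothW U fun p => ∑ i ∈ s, A i p := fun j α => by
  simp only [coef_sum]; exact ContDiffOn.sum fun i hi => hA i hi j α
theorem SmoothW.smul {c : 𝔼 → ℂ} (hc : ContDiffOn ℝ ∞ c U)
    {A : 𝔼 → Weyl m} (hA : SmoothW U A) : SmoothW U fun p => c p • A p := fun j α => by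
  simp only [coef_smul]; exact hc.mul (hA j α)
theorem SmoothW.gen_mul (hU : IsOpen U) {A : 𝔼 → Weyl m} (hA : SmoothW U A) (k : Fin m) :
    SmoothW U fun p => gen k * A p := JetW.gen_mul (n := 0) (idealFil_contDiffOn hU) hA k
theorem SmoothW.dirE (hU : IsOpen U) {A : 𝔼 → Weyl m} (hA : SmoothW U A) {G : 𝔼 → 𝔼}
    (hG : ContDiffOn ℝ ∞ G U) : SmoothW U fun p => dirE (G p) (A p) :=
  JetW.dirE (n := 0) (idealFil_contDiffOn hU) hA hG
theorem SmoothW.divDegree (hU : IsOpen U) {A : 𝔼 → Weyl m} (hA : SmoothW U A) (c : ℕ) :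
    SmoothW U fun p => divDegree c (A p) := JetW.divDegree (n := 0) (idealFil_contDiffOn hU) hA c
theorem SmoothW.dW (hU : IsOpen U) {A : 𝔼 → Weyl m} (hA : SmoothW U A) (u : 𝔼) :
    SmoothW U fun p => dW u A p := JetW.dW (n := 0) (idealFil_contDiffOn hU) hA u
theorem SmoothW.locNabla (hU : IsOpen U) {Γ : 𝔼 → 𝔼 → 𝔼 → 𝔼}
    (hΓ : ∀ u v, ContDiffOn ℝ ∞ (fun p => Γ p u v) U) {A : 𝔼 → Weyl m} (hA : SmoothW U A)
    (u : 𝔼) : SmoothW U fun p => locNabla Γ u A p :=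
  JetW.locNabla (n := 0) (idealFil_contDiffOn hU) hΓ hA u
theorem SmoothW.moyal (hU : IsOpen U) {P : 𝔼 → Matrix (Fin m) (Fin m) ℝ}
    (hP : ∀ k l, ContDiffOn ℝ ∞ (fun p => P p k l) U) {A B : 𝔼 → Weyl m} (hA : SmoothW U A)
    (hB : SmoothW U B) : SmoothW U fun p => moyal (P p) (A p) (B p) :=
  JetW.moyal (n := 0) (idealFil_contDiffOn hU) hP hA hB
theorem SmoothW.bracket (hU : IsOpen U) {P : 𝔼 → Matrix (Fin m) (Fin m) ℝ}
    (hP : ∀ k l, ContDiffOn ℝ ∞ (fun p => P p k l) U) {A B : 𝔼 → Weyl m} (hA : SmoothW U A)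
    (hB : SmoothW U B) : SmoothW U fun p => bracket (P p) (A p) (B p) :=
  JetW.bracket (n := 0) (idealFil_contDiffOn hU) hP hA hB

theorem SmoothW.formalSum {A : ℕ → 𝔼 → Weyl m} (hA : ∀ k, SmoothW U (A k)) :
    SmoothW U fun p => formalSum fun k => A k p := fun j α => by
  simp only [coef_formalSum]
  exact ContDiffOn.sum fun k _ => hA k j α

theorem contDiffAt_pullV {L : 𝔼 → Fin m → 𝔼} {p : 𝔼}
    (hL : ∀ k, ContDiffAt ℝ ∞ (fun q => L q k) p)
    (f : MvPolynomial (Fin m) ℂ) (β : Fin m →₀ ℕ) :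
    ContDiffAt ℝ ∞ (fun q => MvPowerSeries.coeff β (pullV (L q) f)) p := by
  classical
  induction f using MvPolynomial.induction_on generalizing β with
  | C c =>
    have h : ((MvPolynomial.C c : MvPolynomial (Fin m) ℂ) : V) = algebraMap ℂ V c := by
      rw [MvPolynomial.coe_C]; rfl
    simp only [h, AlgHom.commutes]
    exact contDiffAt_const
  | add f g hf hg =>
    simp only [MvPolynomial.coe_add, map_add]
    exact (hf β).add (hg β)
  | mul_X f i hf =>
    simp only [MvPolynomial.coe_mul, MvPolynomial.coe_X, map_mul, MvPowerSeries.coeff_mul]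
    refine ContDiffAt.sum fun q _ => (hf q.1).mul ?_
    simp only [pullV_X, map_sum, map_smul, smul_eq_mul]
    exact ContDiffAt.sum fun k _ => (Complex.ofRealCLM.contDiff.contDiffAt.comp p
      (contDiffAt_euclidean.1 (hL k) i)).mul contDiffAt_const

theorem contDiffAt_pull {L : 𝔼 → Fin m → 𝔼} {p : 𝔼}
    (hL : ∀ k, ContDiffAt ℝ ∞ (fun q => L q k) p) {A : 𝔼 → Weyl m}
    (hA : ∀ j α, ContDiffAt ℝ ∞ (fun q => coef j α (A q)) p) (j : ℕ) (β : Fin m →₀ ℕ) :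
    ContDiffAt ℝ ∞ (fun q => coef j β (Weyl.pull (L q) (A q))) p := by
  simp only [coef_pull]
  refine ContDiffAt.sum fun α _ => (hA j α).mul ?_
  have := contDiffAt_pullV hL (MvPolynomial.monomial α 1) β
  simpa only [pullKer, MvPolynomial.coe_monomial] using this

theorem dW_comm (hU : IsOpen U) {A : 𝔼 → Weyl m} (hA : SmoothW U A) {p : 𝔼} (hp : p ∈ U)
    (u v : 𝔼) : dW u (fun q => Weyl.dW v A q) p = Weyl.dW v (fun q => Weyl.dW u A q) p :=
  ext_coef fun j α => by
    have hf := ((hA j α) p hp).contDiffAt (hU.mem_nhds hp)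
    have hd : DifferentiableAt ℝ (fderiv ℝ fun q => coef j α (A q)) p :=
      (hf.fderiv_right (m := 1) (by norm_cast)).differentiableAt (by simp)
    simp only [coef_dW]
    have h : ∀ w z : 𝔼, fderiv ℝ (fun q => fderiv ℝ (fun q => coef j α (A q)) q w) p z =
        fderiv ℝ (fderiv ℝ fun q => coef j α (A q)) p z w := fun w z => by
      rw [fderiv_clm_apply hd (differentiableAt_const _)]
      simp
    rw [h, h]
    exact (hf.isSymmSndFDerivAt (by simp; exact WithTop.coe_le_coe.2 le_top)).eq u v

end SmoothW

/-! ### Linear vector fields on the fibres -/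

/-- The derivation `∑ l, e l ∂_{G l}`. -/
def conW (G : Fin m → 𝔼) (a : Weyl m) : Weyl m := ∑ l, gen l * dirE (G l) a

theorem locNabla_eq (Γ : 𝔼 → 𝔼 → 𝔼 → 𝔼) (u : 𝔼) (A : 𝔼 → Weyl m) (p : 𝔼) :
    locNabla Γ u A p = dW u A p - conW (fun l => Γ p u (basisVec l)) (A p) := rfl

theorem conW_sub (G : Fin m → 𝔼) (a b : Weyl m) : conW G (a - b) = conW G a - conW G b := by
  simp only [conW, map_sub, mul_sub, Finset.sum_sub_distrib]

theorem dirE_sub_left (u v : 𝔼) (a : Weyl m) : dirE (u - v) a = dirE u a - dirE v a :=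
  (dirL a).map_sub u v

theorem dirE_sum_left {ι : Type*} (s : Finset ι) (u : ι → 𝔼) (a : Weyl m) :
    dirE (∑ i ∈ s, u i) a = ∑ i ∈ s, dirE (u i) a := map_sum (dirL a) u s

theorem conW_sub_left (G H : Fin m → 𝔼) (a : Weyl m) :
    conW (fun l => G l - H l) a = conW G a - conW H a := by
  simp only [conW, dirE_sub_left, mul_sub, Finset.sum_sub_distrib]

theorem dirE_conW (u : 𝔼) (G : Fin m → 𝔼) (a : Weyl m) :
    dirE u (conW G a) = conW G (dirE u a) + dirE (∑ l, u l • G l) a := by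
  simp only [conW, map_sum, Derivation.leibniz, dirE_gen, smul_eq_mul, Finset.sum_add_distrib,
    dirE_sum_left, dirE_smul_left, mul_smul_comm, mul_one, dirE_comm u]

/-- The second order parts of the two compositions agree, so the commutator of linear vector fields
on the fibre is again a linear vector field, given by the commutator of matrices. -/
theorem conW_conW (G H : Fin m → 𝔼) (a : Weyl m) :
    conW G (conW H a) - conW H (conW G a) =
      conW (fun l => ∑ k, G l k • H k - ∑ k, H l k • G k) a := by
  have h : ∀ G H : Fin m → 𝔼, conW G (conW H a) =
      ∑ l, ∑ k, gen l * (gen k * dirE (H k) (dirE (G l) a)) +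
        conW (fun l => ∑ k, G l k • H k) a := fun G H => by
    rw [conW]
    simp only [dirE_conW, mul_add, Finset.sum_add_distrib]
    congr 1
    simp only [conW, Finset.mul_sum]
  rw [conW_sub_left, h G H, h H G, Finset.sum_comm]
  have : ∀ k l, gen l * (gen k * dirE (H k) (dirE (G l) a)) =
      gen k * (gen l * dirE (G l) (dirE (H k) a)) := fun k l => by
    rw [dirE_comm (H k)]; ring
  simp only [this]
  abel

theorem dW_conW (u : 𝔼) {G : 𝔼 → Fin m → 𝔼} {p : 𝔼}
    (hG : ∀ l, DifferentiableAt ℝ (fun q => G q l) p) {A : 𝔼 → Weyl m} (hA : DiffW A p) :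
    dW u (fun q => conW (G q) (A q)) p =
      conW (fun l => fderiv ℝ (fun q => G q l) p u) (A p) + conW (G p) (dW u A p) := by
  have hc : ∀ l k, DifferentiableAt ℝ (fun q => G q l k) p := fun l k =>
    differentiableAt_euclidean.1 (hG l) k
  have hc' : ∀ l k, fderiv ℝ (fun q => G q l k) p u = fderiv ℝ (fun q => G q l) p u k := fun l k =>
    congrArg (fun T : 𝔼 →L[ℝ] ℝ => T u) ((EuclideanSpace.proj k :
      𝔼 →L[ℝ] ℝ).hasFDerivAt.comp p (hG l).hasFDerivAt).fderiv
  have h1 : ∀ l k, DiffW (fun q => (G q l k : ℂ) • partialE k (A q)) p := fun l k =>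
    DiffW.smul (differentiableAt_ofReal (hc l k)) (hA.partialE k)
  simp only [conW, dirE_apply]
  rw [dW_sum u fun l _ => (DiffW.sum fun k _ => h1 l k).gen_mul l, ← Finset.sum_add_distrib]
  refine Finset.sum_congr rfl fun l _ => ?_
  rw [dW_gen_mul, dW_sum u fun k _ => h1 l k, ← mul_add, ← Finset.sum_add_distrib]
  congr 1
  refine Finset.sum_congr rfl fun k _ => ?_
  rw [dW_smul u (differentiableAt_ofReal (hc l k)) (hA.partialE k), dW_partialE u hA,
    fderiv_ofReal (hc l k), hc']

theorem DiffW.conW {G : 𝔼 → Fin m → 𝔼} {p : 𝔼}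
    (hG : ∀ l, DifferentiableAt ℝ (fun q => G q l) p) {A : 𝔼 → Weyl m} (hA : DiffW A p) :
    DiffW (fun q => Weyl.conW (G q) (A q)) p := by
  simp only [Weyl.conW, dirE_apply]
  exact DiffW.sum fun l _ => (DiffW.sum fun k _ => DiffW.smul (differentiableAt_ofReal
    (differentiableAt_euclidean.1 (hG l) k)) (hA.partialE k)).gen_mul l

end Fedosov.Weyl

namespace Fedosov.Weyl

variable {m : ℕ}

local notation "V" => MvPowerSeries (Fin m) ℂ
local notation "antidiag" => Finset.HasAntidiagonal.antidiagonal
local notation "𝔼" => EuclideanSpace ℝ (Fin m)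

/-! ### Curvature and the Bianchi identity in a frame -/

/-- A nondegenerate bivector field and compatible torsion-free Christoffel symbols on `U`. -/
structure LocalGeometry (U : Set 𝔼) (P : 𝔼 → Matrix (Fin m) (Fin m) ℝ)
    (Γ : 𝔼 → 𝔼 → 𝔼 → 𝔼) : Prop where
  isOpen : IsOpen U
  smoothP : ∀ k l, ContDiffOn ℝ ∞ (fun p => P p k l) U
  smoothΓ : ∀ u v, ContDiffOn ℝ ∞ (fun p => Γ p u v) U
  antisymm : ∀ p ∈ U, (P p).transpose = -P p
  isUnit : ∀ p ∈ U, IsUnit (P p).det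
  linear : ∀ p ∈ U, ∀ u, IsLinearMap ℝ (Γ p u)
  symm : ∀ p ∈ U, ∀ u v, Γ p u v = Γ p v u
  compatible : ∀ p ∈ U, Compatible P Γ p

/-- The curvature of the Christoffel symbols on constant vector fields. -/
def locRiem (Γ : 𝔼 → 𝔼 → 𝔼 → 𝔼) (u v w : 𝔼) (p : 𝔼) : 𝔼 :=
  fderiv ℝ (fun q => Γ q v w) p u - fderiv ℝ (fun q => Γ q u w) p v +
    (Γ p u (Γ p v w) - Γ p v (Γ p u w))

/-- The quadratic element `(1/2) W k n (G l) n e k e l`. -/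
def quadratic (W : Matrix (Fin m) (Fin m) ℝ) (G : Fin m → 𝔼) : Weyl m :=
  ∑ k, ∑ l, (((∑ n, W k n * G l n) / 2 : ℝ) : ℂ) • (gen k * gen l)

/-- A linear vector field preserving the Poisson structure is generated by a quadratic Hamiltonian.
The hypothesis `hG` is infinitesimal preservation of `P`; there are no corrections in `t` because
the Hamiltonian is quadratic. -/
theorem bracket_quadratic {P : Matrix (Fin m) (Fin m) ℝ} (hP : P.transpose = -P)
    (hdet : IsUnit P.det) {G : Fin m → 𝔼}
    (hG : ∀ k l, ∑ j, (P j l * G j k + P k j * G j l) = 0) (a : Weyl m) :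
    bracket P (quadratic P⁻¹ G) a = -conW G a := by
  set M : Matrix (Fin m) (Fin m) ℝ := Matrix.of fun k j => G j k with hM
  set S : Matrix (Fin m) (Fin m) ℝ := P⁻¹ * M with hS
  have hMP : M * P + P * M.transpose = 0 := by
    ext k l
    rw [Matrix.add_apply, Matrix.mul_apply, Matrix.mul_apply, ← Finset.sum_add_distrib,
      Matrix.zero_apply, ← hG k l]
    refine Finset.sum_congr rfl fun j _ => ?_
    rw [Matrix.transpose_apply, hM, Matrix.of_apply, Matrix.of_apply, mul_comm]
  have hPP : P * P⁻¹ = 1 := Matrix.mul_nonsing_inv P hdet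
  have hPP' : P⁻¹ * P = 1 := Matrix.nonsing_inv_mul P hdet
  have hPt : P⁻¹.transpose = -P⁻¹ := by
    rw [Matrix.transpose_nonsing_inv, hP, Matrix.inv_eq_left_inv (B := -P⁻¹)]
    rw [neg_mul_neg, hPP']
  -- A quadratic element only sees the symmetric part of its coefficient matrix. The relation `M P +
  -- P Mᵀ = 0` makes `P⁻¹ M` symmetric, so `M` can be recovered from the quadratic element.
  have hsym : S.transpose = S := by
    have h1 : P⁻¹ * (M * P + P * M.transpose) * P⁻¹ = 0 := by rw [hMP]; simp
    rw [Matrix.mul_add, Matrix.add_mul, ← Matrix.mul_assoc, Matrix.mul_assoc (P⁻¹ * M), hPP,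
      Matrix.mul_one, ← Matrix.mul_assoc P⁻¹ P, hPP', Matrix.one_mul] at h1
    rw [hS, Matrix.transpose_mul, hPt, Matrix.mul_neg, ← eq_neg_of_add_eq_zero_left h1]
  have hPS : ∀ l i, ∑ k, S k l * P k i = -(G l i) := fun l i => by
    have : (P.transpose * S) i l = -M i l := by
      rw [hP, hS, Matrix.neg_mul, ← Matrix.mul_assoc, hPP, Matrix.one_mul, Matrix.neg_apply]
    rw [Matrix.mul_apply] at this
    rw [hM, Matrix.of_apply] at this
    rw [← this]
    exact Finset.sum_congr rfl fun k _ => by rw [Matrix.transpose_apply, mul_comm]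
  have hentry : ∀ k l, ∑ n, P⁻¹ k n * G l n = S k l := fun k l => by rw [hS, Matrix.mul_apply]; rfl
  have h2 : ∀ k l, (((S k l / 2 : ℝ)) : ℂ) • bracket P (gen k * gen l) a =
      (((S l k / 2 : ℝ)) : ℂ) • (gen k * ∑ i, (P l i : ℂ) • partialE i a) +
        (((S k l / 2 : ℝ)) : ℂ) • (gen l * ∑ i, (P k i : ℂ) • partialE i a) := fun k l => by
    rw [bracket_gen_mul_gen hP, smul_add]
    congr 3
    rw [← hsym, Matrix.transpose_apply, hsym]
  rw [quadratic, bracket_sum_left]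
  simp only [bracket_sum_left, bracket_smul_left, hentry, h2, Finset.sum_add_distrib]
  rw [Finset.sum_comm (f := fun k l => (((S k l / 2 : ℝ)) : ℂ) •
    (gen l * ∑ i, (P k i : ℂ) • partialE i a)), ← Finset.sum_add_distrib, conW,
    ← Finset.sum_neg_distrib]
  refine Finset.sum_congr rfl fun l _ => ?_
  rw [← Finset.sum_add_distrib]
  have h3 : ∀ k, (((S k l / 2 : ℝ)) : ℂ) • (gen l * ∑ i, (P k i : ℂ) • partialE i a) +
      (((S k l / 2 : ℝ)) : ℂ) • (gen l * ∑ i, (P k i : ℂ) • partialE i a) =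
      gen l * ∑ i, ((S k l * P k i : ℝ) : ℂ) • partialE i a := fun k => by
    rw [← add_smul, ← mul_smul_comm, Finset.smul_sum]
    congr 1
    refine Finset.sum_congr rfl fun i _ => ?_
    rw [smul_smul]
    congr 1
    push_cast
    ring
  simp only [h3]
  rw [← Finset.mul_sum, Finset.sum_comm, dirE_apply, ← mul_neg, ← Finset.sum_neg_distrib]
  congr 1
  refine Finset.sum_congr rfl fun i _ => ?_
  rw [← Finset.sum_smul, ← Complex.ofReal_sum, hPS]
  push_cast
  rw [neg_smul]

namespace LocalGeometry

variable {U : Set (EuclideanSpace ℝ (Fin m))}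
  {P : EuclideanSpace ℝ (Fin m) → Matrix (Fin m) (Fin m) ℝ}
  {Γ : EuclideanSpace ℝ (Fin m) → EuclideanSpace ℝ (Fin m) →
    EuclideanSpace ℝ (Fin m) → EuclideanSpace ℝ (Fin m)}

theorem differentiableAtΓ (h : LocalGeometry U P Γ) {p : 𝔼} (hp : p ∈ U) (u v : 𝔼) :
    DifferentiableAt ℝ (fun q => Γ q u v) p :=
  ((h.smoothΓ u v p hp).contDiffAt (h.isOpen.mem_nhds hp)).differentiableAt (by simp)

theorem linear_left (h : LocalGeometry U P Γ) {p : 𝔼} (hp : p ∈ U) (v : 𝔼) :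
    IsLinearMap ℝ fun u => Γ p u v where
  map_add u u' := by rw [h.symm p hp, (h.linear p hp v).map_add, h.symm p hp v, h.symm p hp v]
  map_smul c u := by rw [h.symm p hp, (h.linear p hp v).map_smul, h.symm p hp v]

theorem sum_smul_Γ (h : LocalGeometry U P Γ) {p : 𝔼} (hp : p ∈ U) (u w : 𝔼) :
    ∑ k, w k • Γ p u (basisVec k) = Γ p u w := by
  conv_rhs => rw [← sum_smul_basisVec w]
  change _ = (h.linear p hp u).mk' _ _
  rw [map_sum]
  simp only [map_smul]
  rfl

theorem locNabla_comm (h : LocalGeometry U P Γ) {A : 𝔼 → Weyl m} (hA : SmoothW U A) {p : 𝔼}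
    (hp : p ∈ U) (u v : 𝔼) :
    locNabla Γ u (fun q => locNabla Γ v A q) p - locNabla Γ v (fun q => locNabla Γ u A q) p =
      -conW (fun l => locRiem Γ u v (basisVec l) p) (A p) := by
  have hG : ∀ v l, DifferentiableAt ℝ (fun q => Γ q v (basisVec l)) p := fun v l =>
    h.differentiableAtΓ hp v _
  have h1 : ∀ u v, locNabla Γ u (fun q => locNabla Γ v A q) p =
      dW u (fun q => dW v A q) p - (conW (fun l => fderiv ℝ (fun q => Γ q v (basisVec l)) p u) (A p)
        + conW (fun l => Γ p v (basisVec l)) (dW u A p)) -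
        conW (fun l => Γ p u (basisVec l)) (dW v A p) +
        conW (fun l => Γ p u (basisVec l)) (conW (fun l => Γ p v (basisVec l)) (A p)) :=
      fun u v => by
    rw [locNabla_eq]
    simp only [locNabla_eq Γ v A]
    rw [dW_sub u ((hA.dW h.isOpen v).diffW h.isOpen hp)
      (DiffW.conW (hG v) (hA.diffW h.isOpen hp)), dW_conW u (hG v) (hA.diffW h.isOpen hp), conW_sub]
    abel
  have h2 := conW_conW (fun l => Γ p u (basisVec l)) (fun l => Γ p v (basisVec l)) (A p)
  simp only [h.sum_smul_Γ hp] at h2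
  have h3 : conW (fun l => locRiem Γ u v (basisVec l) p) (A p) =
      conW (fun l => fderiv ℝ (fun q => Γ q v (basisVec l)) p u) (A p) -
      conW (fun l => fderiv ℝ (fun q => Γ q u (basisVec l)) p v) (A p) -
      conW (fun l => Γ p v (Γ p u (basisVec l)) - Γ p u (Γ p v (basisVec l))) (A p) := by
    rw [← conW_sub_left, ← conW_sub_left]
    congr 1
    funext l
    rw [locRiem]
    abel
  rw [h1, h1, h3, ← h2, dW_comm h.isOpen hA hp u v]
  abel

/-- Differentiating the generator in the Christoffel term leaves the derivative along `Γ p v u`. Its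
symmetry in `u` and `v`, that is, the absence of torsion, is what makes `δ` and `∇` anticommute. -/
theorem dirE_locNabla (Γ : 𝔼 → 𝔼 → 𝔼 → 𝔼) {A : 𝔼 → Weyl m} {p : 𝔼} (hA : DiffW A p) (u v : 𝔼) :
    dirE u (locNabla Γ v A p) = locNabla Γ v (fun q => dirE u (A q)) p -
      dirE (∑ l, u l • Γ p v (basisVec l)) (A p) := by
  have : dW v (fun q => dirE u (A q)) p = dirE u (dW v A p) := by
    simp only [dirE_apply]
    rw [dW_sum v fun k _ => DiffW.smul (differentiableAt_const _) (hA.partialE k)]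
    refine Finset.sum_congr rfl fun k _ => ?_
    rw [dW_smul v (differentiableAt_const _) (hA.partialE k), dW_partialE v hA, fderiv_fun_const]
    simp
  rw [locNabla_eq, locNabla_eq, map_sub, dirE_conW, this]
  abel

/-- The quadratic curvature element. -/
def curv (P : 𝔼 → Matrix (Fin m) (Fin m) ℝ) (Γ : 𝔼 → 𝔼 → 𝔼 → 𝔼) (u v p : 𝔼) : Weyl m :=
  quadratic (P p)⁻¹ fun l => locRiem Γ u v (basisVec l) p

/-- Covariant derivatives are derivations of the bracket, hence so is the linear vector field that
is their commutator. Applied to the bracket of two generators, a scalar function which such a field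
annihilates, this says that the curvature takes values in the symplectic Lie algebra. -/
theorem locRiem_compatible (h : LocalGeometry U P Γ) {p : 𝔼} (hp : p ∈ U) (u v : 𝔼)
    (k l : Fin m) : ∑ j, (P p j l * locRiem Γ u v (basisVec j) p k +
      P p k j * locRiem Γ u v (basisVec j) p l) = 0 := by
  have hgen : ∀ i, SmoothW U fun _ => (gen i : Weyl m) := fun i => SmoothW.const _
  have hc : ∀ q ∈ U, bracket (P q) (gen k) (gen l) = (P q k l : ℂ) • (1 : Weyl m) := fun q hq => by
    rw [bracket_gen_left (h.antisymm q hq), Finset.sum_eq_single l]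
    · rw [partialE_gen, if_pos rfl]
    · intro j _ hj; rw [partialE_gen, if_neg hj, smul_zero]
    · simp
  have hd : ∀ w (A B : 𝔼 → Weyl m), SmoothW U A → SmoothW U B → ∀ q ∈ U,
      locNabla Γ w (fun q => bracket (P q) (A q) (B q)) q =
      bracket (P q) (locNabla Γ w A q) (B q) + bracket (P q) (A q) (locNabla Γ w B q) :=
    fun w A B hA hB q hq => locNabla_bracket (h.compatible q hq) w (hA.diffW h.isOpen hq)
      (hB.diffW h.isOpen hq)
  have hev : ∀ {f g : 𝔼 → Weyl m}, (∀ q ∈ U, f q = g q) → f =ᶠ[nhds p] g := fun hfg =>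
    Filter.eventually_of_mem (h.isOpen.mem_nhds hp) hfg
  have hdd : ∀ w z, locNabla Γ w (fun q => locNabla Γ z
        (fun q => bracket (P q) (gen k) (gen l)) q) p =
      bracket (P p) (locNabla Γ w (fun q => locNabla Γ z (fun _ => gen k) q) p) (gen l) +
      bracket (P p) (locNabla Γ z (fun _ => gen k) p) (locNabla Γ w (fun _ => gen l) p) +
      (bracket (P p) (locNabla Γ w (fun _ => gen k) p) (locNabla Γ z (fun _ => gen l) p) +
      bracket (P p) (gen k) (locNabla Γ w (fun q => locNabla Γ z (fun _ => gen l) q) p)) := by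
    intro w z
    have s1 := fun i => (hgen i).locNabla h.isOpen h.smoothΓ z
    rw [locNabla_congr Γ w (hev (hd z _ _ (hgen k) (hgen l))), locNabla_add Γ w
      (((s1 k).bracket h.isOpen h.smoothP (hgen l)).diffW h.isOpen hp)
      (((hgen k).bracket h.isOpen h.smoothP (s1 l)).diffW h.isOpen hp),
      hd w _ _ (s1 k) (hgen l) p hp, hd w _ _ (hgen k) (s1 l) p hp]
  have hb : SmoothW U fun q => bracket (P q) (gen k) (gen l) :=
    (hgen k).bracket h.isOpen h.smoothP (hgen l)
  have key : -conW (fun l => locRiem Γ u v (basisVec l) p) (bracket (P p) (gen k) (gen l)) =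
      bracket (P p) (-conW (fun l => locRiem Γ u v (basisVec l) p) (gen k)) (gen l) +
      bracket (P p) (gen k) (-conW (fun l => locRiem Γ u v (basisVec l) p) (gen l)) := by
    rw [← h.locNabla_comm hb hp, ← h.locNabla_comm (hgen k) hp, ← h.locNabla_comm (hgen l) hp,
      hdd, hdd, bracket_sub_left, bracket_sub_right]
    abel
  have hcon : ∀ i, -conW (fun l => locRiem Γ u v (basisVec l) p) (gen i) =
      ∑ j, (-(locRiem Γ u v (basisVec j) p i : ℂ)) • gen j := fun i => by
    rw [conW, ← Finset.sum_neg_distrib]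
    refine Finset.sum_congr rfl fun j _ => ?_
    rw [dirE_gen, mul_smul_comm, mul_one, neg_smul]
  have hbb : ∀ i j, bracket (P p) (gen i) (gen j) = (P p i j : ℂ) • (1 : Weyl m) := fun i j => by
    rw [bracket_gen_left (h.antisymm p hp), Finset.sum_eq_single j]
    · rw [partialE_gen, if_pos rfl]
    · intro j' _ hj; rw [partialE_gen, if_neg hj, smul_zero]
    · simp
  have hone : conW (fun l => locRiem Γ u v (basisVec l) p) ((P p k l : ℂ) • (1 : Weyl m)) = 0 := by
    simp [conW]
  rw [hbb, hone, hcon, hcon, bracket_sum_left, bracket_sum_right] at key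
  simp only [bracket_smul_left, bracket_smul_right, hbb, smul_smul] at key
  rw [← Finset.sum_add_distrib, neg_zero] at key
  have := congrArg (coef 0 0) key
  simp only [coef_zero, coef_sum, coef_add, coef_smul] at this
  have h1 : coef 0 0 (1 : Weyl m) = 1 := by simp [coef]
  simp only [h1, mul_one] at this
  rw [← Complex.ofReal_inj, Complex.ofReal_zero, ← neg_eq_zero, this]
  push_cast
  rw [← Finset.sum_neg_distrib]
  exact Finset.sum_congr rfl fun j _ => by ring

theorem locNabla_comm_curv (h : LocalGeometry U P Γ) {A : 𝔼 → Weyl m} (hA : SmoothW U A) {p : 𝔼}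
    (hp : p ∈ U) (u v : 𝔼) :
    locNabla Γ u (fun q => locNabla Γ v A q) p - locNabla Γ v (fun q => locNabla Γ u A q) p =
      bracket (P p) (curv P Γ u v p) (A p) := by
  rw [h.locNabla_comm hA hp, curv, bracket_quadratic (h.antisymm p hp) (h.isUnit p hp)
    (h.locRiem_compatible hp u v)]

end LocalGeometry

end Fedosov.Weyl

/-! ### The connections `-δ + ∇` and `D` on a coordinate domain and their Bianchi identities -/

namespace Fedosov.Weyl

variable {m : ℕ}

local notation "V" => MvPowerSeries (Fin m) ℂ
local notation "antidiag" => Finset.HasAntidiagonal.antidiagonal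
local notation "𝔼" => EuclideanSpace ℝ (Fin m)

theorem contDiffOn_det {ι : Type*} [Fintype ι] [DecidableEq ι] {U : Set 𝔼}
    {A : 𝔼 → Matrix ι ι ℝ} (hA : ∀ k l, ContDiffOn ℝ ∞ (fun p => A p k l) U) :
    ContDiffOn ℝ ∞ (fun p => (A p).det) U := by
  simp only [Matrix.det_apply']
  exact ContDiffOn.sum fun σ _ => contDiffOn_const.mul
    (contDiffOn_prod fun i _ => hA (σ i) i)

theorem contDiffOn_matrix_inv {ι : Type*} [Fintype ι] [DecidableEq ι] {U : Set 𝔼}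
    {A : 𝔼 → Matrix ι ι ℝ} (hA : ∀ k l, ContDiffOn ℝ ∞ (fun p => A p k l) U)
    (hdet : ∀ p ∈ U, IsUnit (A p).det) (k l : ι) :
    ContDiffOn ℝ ∞ (fun p => (A p)⁻¹ k l) U := by
  simp only [Matrix.inv_def, Ring.inverse_eq_inv', Matrix.smul_apply, smul_eq_mul,
    Matrix.adjugate_apply]
  refine ((contDiffOn_det hA).inv fun p hp => (hdet p hp).ne_zero).mul (contDiffOn_det fun i j => ?_)
  simp only [Matrix.updateRow_apply]
  split_ifs
  · exact contDiffOn_const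
  · exact hA i j

theorem isHomogeneous_gen (k : Fin m) : IsHomogeneous 1 (gen k : Weyl m) := by
  have h1 : IsHomogeneous 0 (1 : Weyl m) := fun j α h => by
    simp only [coef, PowerSeries.coeff_one] at h
    split_ifs at h with hj
    · rw [MvPowerSeries.coeff_one] at h
      split_ifs at h with hα
      · simp [hj, hα]
      · exact absurd rfl h
    · simp at h
  simpa using h1.gen_mul k

theorem isHomogeneous_quadratic (W : Matrix (Fin m) (Fin m) ℝ) (G : Fin m → 𝔼) :
    IsHomogeneous 2 (quadratic W G) :=
  IsHomogeneous.sum fun k _ => IsHomogeneous.sum fun l _ =>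
    ((isHomogeneous_gen l).gen_mul k).smul _

theorem coef_zero_gen_mul (j : ℕ) (k : Fin m) (a : Weyl m) : coef j 0 (gen k * a) = 0 := by
  rw [coef_gen_mul, if_neg]
  intro h
  simpa using h k

theorem coef_zero_conW (j : ℕ) (G : Fin m → 𝔼) (a : Weyl m) : coef j 0 (conW G a) = 0 := by
  rw [conW, coef_sum]
  exact Finset.sum_eq_zero fun l _ => coef_zero_gen_mul j l _

theorem coef_zero_quadratic (W : Matrix (Fin m) (Fin m) ℝ) (G : Fin m → 𝔼) (j : ℕ) :
    coef j 0 (quadratic W G) = 0 := by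
  simp only [quadratic, coef_sum, coef_smul, coef_zero_gen_mul, mul_zero, Finset.sum_const_zero]

theorem coef_zero_partialE_quadratic (W : Matrix (Fin m) (Fin m) ℝ) (G : Fin m → 𝔼) (j : ℕ)
    (i : Fin m) : coef j 0 (partialE i (quadratic W G)) = 0 := by
  by_contra h
  have := (isHomogeneous_quadratic W G).partialE i j 0 h
  simp at this

theorem eq_zero_of_partialE {a : Weyl m} (h : ∀ k, partialE k a = 0) (h0 : ∀ j, coef j 0 a = 0) :
    a = 0 := ext_coef fun j α => by
  rw [coef_zero]
  by_cases hα : α = 0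
  · rw [hα, h0]
  · obtain ⟨k, hk⟩ := Finsupp.ne_iff.1 hα
    have h1 := congrArg (coef j (α - Finsupp.single k 1)) (h k)
    rw [coef_partialE, coef_zero, tsub_add_cancel_of_le] at h1
    · exact (mul_eq_zero.1 h1).resolve_right (Nat.cast_add_one_ne_zero _)
    · rw [Finsupp.single_le_iff]; exact Nat.one_le_iff_ne_zero.2 hk

/-- The operator `-δ + ∇` in a frame. -/
def locE (Γ : 𝔼 → 𝔼 → 𝔼 → 𝔼) (u : 𝔼) (A : 𝔼 → Weyl m) (p : 𝔼) : Weyl m :=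
  locNabla Γ u A p - dirE u (A p)

/-- The operator `-δ + ∇ + (i / t) [ρ, ·]` in a frame. -/
def locD (P : 𝔼 → Matrix (Fin m) (Fin m) ℝ) (Γ : 𝔼 → 𝔼 → 𝔼 → 𝔼) (ρ : 𝔼 → 𝔼 → Weyl m) (u : 𝔼)
    (A : 𝔼 → Weyl m) (p : 𝔼) : Weyl m :=
  locE Γ u A p + bracket (P p) (ρ u p) (A p)

theorem locE_congr (Γ : 𝔼 → 𝔼 → 𝔼 → 𝔼) (u : 𝔼) {A B : 𝔼 → Weyl m} {p : 𝔼}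
    (h : A =ᶠ[nhds p] B) : locE Γ u A p = locE Γ u B p := by
  rw [locE, locE, locNabla_congr Γ u h, h.self_of_nhds]

theorem locE_add (Γ : 𝔼 → 𝔼 → 𝔼 → 𝔼) (u : 𝔼) {A B : 𝔼 → Weyl m} {p : 𝔼} (hA : DiffW A p)
    (hB : DiffW B p) : locE Γ u (fun q => A q + B q) p = locE Γ u A p + locE Γ u B p := by
  rw [locE, locNabla_add Γ u hA hB, map_add, locE, locE]; abel

theorem locE_sub (Γ : 𝔼 → 𝔼 → 𝔼 → 𝔼) (u : 𝔼) {A B : 𝔼 → Weyl m} {p : 𝔼} (hA : DiffW A p)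
    (hB : DiffW B p) : locE Γ u (fun q => A q - B q) p = locE Γ u A p - locE Γ u B p := by
  rw [locE, locNabla_sub Γ u hA hB, map_sub, locE, locE]; abel

theorem SmoothW.locE {U : Set 𝔼} (hU : IsOpen U) {Γ : 𝔼 → 𝔼 → 𝔼 → 𝔼}
    (hΓ : ∀ u v, ContDiffOn ℝ ∞ (fun p => Γ p u v) U) {A : 𝔼 → Weyl m} (hA : SmoothW U A)
    (u : 𝔼) : SmoothW U fun p => locE Γ u A p :=
  (hA.locNabla hU hΓ u).sub (hA.dirE hU contDiffOn_const)

/-- The curvature of `-δ + ∇ + (i / t) [ρ, ·]` in a frame. -/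
def locOmega (P : 𝔼 → Matrix (Fin m) (Fin m) ℝ) (Γ : 𝔼 → 𝔼 → 𝔼 → 𝔼) (ρ : 𝔼 → 𝔼 → Weyl m)
    (u v p : 𝔼) : Weyl m :=
  LocalGeometry.curv P Γ u v p + (locE Γ u (ρ v) p - locE Γ v (ρ u) p) +
    bracket (P p) (ρ u p) (ρ v p)

namespace LocalGeometry

variable {U : Set (EuclideanSpace ℝ (Fin m))}
  {P : EuclideanSpace ℝ (Fin m) → Matrix (Fin m) (Fin m) ℝ}
  {Γ : EuclideanSpace ℝ (Fin m) → EuclideanSpace ℝ (Fin m) →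
    EuclideanSpace ℝ (Fin m) → EuclideanSpace ℝ (Fin m)}

theorem smoothW_curv (h : LocalGeometry U P Γ) (u v : 𝔼) : SmoothW U (curv P Γ u v) := by
  have hR : ∀ w, ContDiffOn ℝ ∞ (fun p => locRiem Γ u v w p) U := fun w => by
    have hΓΓ : ∀ u v, ContDiffOn ℝ ∞ (fun p => Γ p u (Γ p v w)) U := fun u v => by
      have : ContDiffOn ℝ ∞ (fun p => ∑ k, Γ p v w k • Γ p u (basisVec k)) U :=
        ContDiffOn.sum fun k _ => (contDiffOn_euclidean.1 (h.smoothΓ v w) k).smul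
          (h.smoothΓ u (basisVec k))
      exact this.congr fun p hp => (h.sum_smul_Γ hp u _).symm
    exact ((contDiffOn_fderiv_apply h.isOpen (h.smoothΓ v w) u).sub
      (contDiffOn_fderiv_apply h.isOpen (h.smoothΓ u w) v)).add ((hΓΓ u v).sub (hΓΓ v u))
  change SmoothW U fun p => ∑ k, ∑ l, (((∑ n, (P p)⁻¹ k n * locRiem Γ u v (basisVec l) p n) / 2 :
    ℝ) : ℂ) • (gen k * gen l)
  refine SmoothW.sum fun k _ => SmoothW.sum fun l _ => SmoothW.smul
    (c := fun p => (((∑ n, (P p)⁻¹ k n * locRiem Γ u v (basisVec l) p n) / 2 : ℝ) : ℂ))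
    (Complex.ofRealCLM.contDiff.comp_contDiffOn ((ContDiffOn.sum fun n _ =>
      (contDiffOn_matrix_inv h.smoothP h.isUnit k n).mul
        (contDiffOn_euclidean.1 (hR (basisVec l)) n)).div_const 2)) (SmoothW.const _)

/-- Since `δ² = 0` and the mixed terms cancel by the symmetry of the Christoffel symbols, adding
`-δ` does not change the curvature of `∇`. -/
theorem locE_comm (h : LocalGeometry U P Γ) {A : 𝔼 → Weyl m} (hA : SmoothW U A) {p : 𝔼}
    (hp : p ∈ U) (u v : 𝔼) :
    locE Γ u (fun q => locE Γ v A q) p - locE Γ v (fun q => locE Γ u A q) p =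
      bracket (P p) (curv P Γ u v p) (A p) := by
  have h1 : ∀ u v, locE Γ u (fun q => locE Γ v A q) p =
      locNabla Γ u (fun q => locNabla Γ v A q) p - locNabla Γ u (fun q => dirE v (A q)) p -
        (locNabla Γ v (fun q => dirE u (A q)) p - dirE (Γ p v u) (A p)) +
          dirE u (dirE v (A p)) := fun u v => by
    rw [locE]
    simp only [locE]
    rw [locNabla_sub Γ u ((hA.locNabla h.isOpen h.smoothΓ v).diffW h.isOpen hp)
      ((hA.dirE h.isOpen contDiffOn_const).diffW h.isOpen hp), map_sub,
      dirE_locNabla Γ (hA.diffW h.isOpen hp), h.sum_smul_Γ hp]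
    abel
  rw [← h.locNabla_comm_curv hA hp, h1, h1, h.symm p hp u v, dirE_comm u v]
  abel

theorem locE_bracket (h : LocalGeometry U P Γ) {A B : 𝔼 → Weyl m} (hA : SmoothW U A)
    (hB : SmoothW U B) {p : 𝔼} (hp : p ∈ U) (u : 𝔼) :
    locE Γ u (fun q => bracket (P q) (A q) (B q)) p =
      bracket (P p) (locE Γ u A p) (B p) + bracket (P p) (A p) (locE Γ u B p) := by
  rw [locE, locNabla_bracket (h.compatible p hp) u (hA.diffW h.isOpen hp) (hB.diffW h.isOpen hp),
    dirE_bracket, locE, locE, bracket_sub_left, bracket_sub_right]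
  abel

theorem locE_congr_on (h : LocalGeometry U P Γ) {A B : 𝔼 → Weyl m} (hAB : ∀ q ∈ U, A q = B q)
    {p : 𝔼} (hp : p ∈ U) (u : 𝔼) : locE Γ u A p = locE Γ u B p :=
  locE_congr Γ u (Filter.eventually_of_mem (h.isOpen.mem_nhds hp) hAB)

/-- The Jacobi identity for the three operators shows that the cyclic sum commutes with every
generator; as its part free of generators also vanishes, it is zero. The algebraic identity `δR = 0`
and the differential one `∇R = 0` are obtained together. -/
theorem bianchi_curv (h : LocalGeometry U P Γ) {p : 𝔼} (hp : p ∈ U) (a b c : 𝔼) :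
    locE Γ a (curv P Γ b c) p + locE Γ b (curv P Γ c a) p + locE Γ c (curv P Γ a b) p = 0 := by
  have key : ∀ A : 𝔼 → Weyl m, SmoothW U A → ∀ a b c,
      bracket (P p) (locE Γ a (curv P Γ b c) p) (A p) =
      locE Γ a (fun q => locE Γ b (fun q => locE Γ c A q) q) p -
      locE Γ a (fun q => locE Γ c (fun q => locE Γ b A q) q) p -
      (locE Γ b (fun q => locE Γ c (fun q => locE Γ a A q) q) p -
      locE Γ c (fun q => locE Γ b (fun q => locE Γ a A q) q) p) := by
    intro A hA a b c
    have s1 := fun u => hA.locE h.isOpen h.smoothΓ u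
    have s2 := fun u v => (s1 v).locE h.isOpen h.smoothΓ u
    rw [h.locE_comm (s1 a) hp, ← locE_sub Γ a ((s2 b c).diffW h.isOpen hp)
      ((s2 c b).diffW h.isOpen hp), h.locE_congr_on (fun q hq => h.locE_comm hA hq b c) hp,
      h.locE_bracket (h.smoothW_curv b c) hA hp]
    abel
  refine eq_zero_of_partialE (partialE_eq_zero_of_bracket_gen (h.antisymm p hp) (h.isUnit p hp)
    fun k => ?_) fun j => ?_
  · have hk := key (fun _ => gen k) (SmoothW.const _)
    rw [bracket_add_left, bracket_add_left, hk a b c, hk b c a, hk c a b]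
    abel
  · have h0 : ∀ a b c, coef j 0 (locE Γ a (curv P Γ b c) p) = 0 := fun a b c => by
      rw [locE, locNabla_eq, coef_sub, coef_sub, coef_dW, coef_zero_conW]
      simp only [curv, coef_zero_quadratic, fderiv_fun_const, dirE_apply, coef_sum, coef_smul,
        coef_zero_partialE_quadratic]
      simp
    rw [coef_add, coef_add, h0, h0, h0, add_zero, add_zero]

variable {ρ : EuclideanSpace ℝ (Fin m) → EuclideanSpace ℝ (Fin m) → Weyl m}

theorem smoothW_locD (h : LocalGeometry U P Γ) (hρ : ∀ u, SmoothW U (ρ u)) {A : 𝔼 → Weyl m}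
    (hA : SmoothW U A) (u : 𝔼) : SmoothW U (locD P Γ ρ u A) :=
  (hA.locE h.isOpen h.smoothΓ u).add ((hρ u).bracket h.isOpen h.smoothP hA)

theorem locD_comm (h : LocalGeometry U P Γ) (hρ : ∀ u, SmoothW U (ρ u)) {A : 𝔼 → Weyl m}
    (hA : SmoothW U A) {p : 𝔼} (hp : p ∈ U) (u v : 𝔼) :
    locD P Γ ρ u (locD P Γ ρ v A) p - locD P Γ ρ v (locD P Γ ρ u A) p =
      bracket (P p) (locOmega P Γ ρ u v p) (A p) := by
  have h1 : ∀ u v, locD P Γ ρ u (locD P Γ ρ v A) p =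
      locE Γ u (fun q => locE Γ v A q) p + (bracket (P p) (locE Γ u (ρ v) p) (A p) +
        bracket (P p) (ρ v p) (locE Γ u A p)) + (bracket (P p) (ρ u p) (locE Γ v A p) +
        bracket (P p) (ρ u p) (bracket (P p) (ρ v p) (A p))) := fun u v => by
    rw [locD, locD, bracket_add_right, ← h.locE_bracket (hρ v) hA hp, ← locE_add Γ u
      ((hA.locE h.isOpen h.smoothΓ v).diffW h.isOpen hp)
      (((hρ v).bracket h.isOpen h.smoothP hA).diffW h.isOpen hp)]
    rfl
  rw [h1, h1, locOmega, bracket_add_left, bracket_add_left, bracket_sub_left,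
    ← h.locE_comm hA hp, bracket_jacobi _ (ρ u p)]
  abel

/-- Commutators of operators would give this identity only up to a central term, so it is expanded
directly. The curvature terms vanish by `bianchi_curv`, the second derivatives of `ρ` reduce by
`locE_comm` to brackets with the curvature, which cancel, and the cubic terms vanish by the Jacobi
identity. -/
theorem bianchi_locOmega (h : LocalGeometry U P Γ) (hρ : ∀ u, SmoothW U (ρ u)) {p : 𝔼}
    (hp : p ∈ U) (a b c : 𝔼) :
    locD P Γ ρ a (locOmega P Γ ρ b c) p + locD P Γ ρ b (locOmega P Γ ρ c a) p +
      locD P Γ ρ c (locOmega P Γ ρ a b) p = 0 := by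
  have h1 : ∀ a b c, locD P Γ ρ a (locOmega P Γ ρ b c) p =
      locE Γ a (curv P Γ b c) p + (locE Γ a (fun q => locE Γ b (ρ c) q) p -
        locE Γ a (fun q => locE Γ c (ρ b) q) p) + (bracket (P p) (locE Γ a (ρ b) p) (ρ c p) +
        bracket (P p) (ρ b p) (locE Γ a (ρ c) p)) + bracket (P p) (ρ a p) (curv P Γ b c p) +
        (bracket (P p) (ρ a p) (locE Γ b (ρ c) p) - bracket (P p) (ρ a p) (locE Γ c (ρ b) p)) +
        bracket (P p) (ρ a p) (bracket (P p) (ρ b p) (ρ c p)) := fun a b c => by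
    have s0 := (h.smoothW_curv b c).diffW h.isOpen hp
    have s1 := ((hρ c).locE h.isOpen h.smoothΓ b)
    have s2 := ((hρ b).locE h.isOpen h.smoothΓ c)
    have s3 := ((hρ b).bracket h.isOpen h.smoothP (hρ c))
    have e : locE Γ a (locOmega P Γ ρ b c) p = locE Γ a (curv P Γ b c) p +
        (locE Γ a (fun q => locE Γ b (ρ c) q) p - locE Γ a (fun q => locE Γ c (ρ b) q) p) +
        locE Γ a (fun q => bracket (P q) (ρ b q) (ρ c q)) p := by
      rw [← locE_sub Γ a (s1.diffW h.isOpen hp) (s2.diffW h.isOpen hp),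
        ← locE_add Γ a s0 ((s1.sub s2).diffW h.isOpen hp), ← locE_add Γ a
        (((h.smoothW_curv b c).add (s1.sub s2)).diffW h.isOpen hp) (s3.diffW h.isOpen hp)]
      rfl
    rw [locD, e, h.locE_bracket (hρ b) (hρ c) hp, locOmega, bracket_add_right,
      bracket_add_right, bracket_sub_right]
    abel
  have h2 : ∀ a b c, locE Γ a (fun q => locE Γ b (ρ c) q) p =
      locE Γ b (fun q => locE Γ a (ρ c) q) p - bracket (P p) (ρ c p) (curv P Γ a b p) :=
      fun a b c => by
    rw [sub_eq_add_neg, ← bracket_swap, ← h.locE_comm (hρ c) hp]; abel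
  have hsw : ∀ x y, bracket (P p) x y = -bracket (P p) y x := fun x y => bracket_swap _ _ _
  rw [h1, h1, h1, ← h.bianchi_curv hp a b c, h2 a b c, h2 b c a, h2 c a b,
    bracket_jacobi _ (ρ a p) (ρ b p) (ρ c p), hsw (ρ c p) (bracket (P p) (ρ a p) (ρ b p)),
    hsw (ρ c p) (ρ a p), hsw (locE Γ a (ρ b) p) (ρ c p), hsw (locE Γ b (ρ c) p) (ρ a p),
    hsw (locE Γ c (ρ a) p) (ρ b p)]
  simp only [← bracketL_apply, map_neg]
  abel

end LocalGeometry

end Fedosov.Weyl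

namespace Fedosov

variable {m : ℕ} {M : Type*} [TopologicalSpace M] [ChartedSpace (EuclideanSpace ℝ (Fin m)) M]

local notation "𝔼" => EuclideanSpace ℝ (Fin m)

open Weyl

/-! ### Charts and frames -/

/-- The transition map between the preferred charts at `x` and at `y`. -/
def trans (x y : M) (p : EuclideanSpace ℝ (Fin m)) : EuclideanSpace ℝ (Fin m) :=
  chartAt (EuclideanSpace ℝ (Fin m)) y ((chartAt (EuclideanSpace ℝ (Fin m)) x).symm p)

/-- The domain of the transition map. -/
def transDom (x y : M) : Set (EuclideanSpace ℝ (Fin m)) :=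
  (chartAt (EuclideanSpace ℝ (Fin m)) x).target ∩
    (chartAt (EuclideanSpace ℝ (Fin m)) x).symm ⁻¹' (chartAt (EuclideanSpace ℝ (Fin m)) y).source

theorem isOpen_transDom (x y : M) : IsOpen (transDom (m := m) x y) :=
  (chartAt 𝔼 x).isOpen_inter_preimage_symm (chartAt 𝔼 y).open_source

theorem chartAt_mem_transDom {x y z : M} (hx : z ∈ (chartAt 𝔼 x).source)
    (hy : z ∈ (chartAt 𝔼 y).source) : chartAt 𝔼 x z ∈ transDom (m := m) x y :=
  ⟨(chartAt 𝔼 x).map_source hx, by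
    rw [Set.mem_preimage, (chartAt 𝔼 x).left_inv hx]; exact hy⟩

theorem trans_chartAt {x y z : M} (hx : z ∈ (chartAt 𝔼 x).source) :
    trans x y (chartAt 𝔼 x z) = chartAt 𝔼 y z := by
  rw [trans, (chartAt 𝔼 x).left_inv hx]

theorem trans_trans {x y : M} {p : 𝔼} (hp : p ∈ transDom (m := m) x y) :
    trans y x (trans x y p) = p := by
  rw [trans, trans, (chartAt 𝔼 y).left_inv hp.2, (chartAt 𝔼 x).right_inv hp.1]

variable [IsManifold (𝓡 m) ∞ M]

theorem contDiffOn_trans (x y : M) : ContDiffOn ℝ ∞ (trans x y) (transDom (m := m) x y) := by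
  have h := contDiffOn_ext_coord_change (I := 𝓡 m) (n := ∞) y x
  refine (h.mono fun p hp => ?_).congr fun p hp => ?_
  · simpa [transDom, mfld_simps] using hp
  · simp [trans, mfld_simps]

theorem contDiffAt_trans {x y : M} {p : 𝔼} (hp : p ∈ transDom (m := m) x y) :
    ContDiffAt ℝ ∞ (trans x y) p :=
  (contDiffOn_trans x y p hp).contDiffAt ((isOpen_transDom x y).mem_nhds hp)

theorem contDiffAt_fderiv_trans {x y : M} {p : 𝔼} (hp : p ∈ transDom (m := m) x y) (v : 𝔼) :
    ContDiffAt ℝ ∞ (fun q => fderiv ℝ (trans x y) q v) p :=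
  (contDiffOn_fderiv_apply (isOpen_transDom x y) (contDiffOn_trans x y) v p hp).contDiffAt
    ((isOpen_transDom x y).mem_nhds hp)

theorem fderiv_fderiv_trans_symm {x y : M} {p : 𝔼} (hp : p ∈ transDom (m := m) x y) (u v : 𝔼) :
    fderiv ℝ (fun q => fderiv ℝ (trans x y) q v) p u =
      fderiv ℝ (fun q => fderiv ℝ (trans x y) q u) p v := by
  have hf := contDiffAt_trans hp
  have hd : DifferentiableAt ℝ (fderiv ℝ (trans x y)) p :=
    (hf.fderiv_right (m := 1) (by norm_cast)).differentiableAt (by simp)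
  have h : ∀ w z : 𝔼, fderiv ℝ (fun q => fderiv ℝ (trans x y) q w) p z =
      fderiv ℝ (fderiv ℝ (trans x y)) p z w := fun w z => by
    rw [fderiv_clm_apply hd (differentiableAt_const _)]
    simp
  rw [h, h]
  exact (hf.isSymmSndFDerivAt (by simp; exact WithTop.coe_le_coe.2 le_top)).eq u v

theorem tangentCoordChange_eq (x y z : M) :
    tangentCoordChange (𝓡 m) x y z = fderiv ℝ (trans x y) (chartAt 𝔼 x z) := by
  rw [tangentCoordChange_def]
  simp only [modelWithCornersSelf_coe, Set.range_id, fderivWithin_univ]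
  rfl

theorem fderiv_trans_trans {x y w z : M} (hx : z ∈ (chartAt 𝔼 x).source)
    (hy : z ∈ (chartAt 𝔼 y).source) (hw : z ∈ (chartAt 𝔼 w).source) (v : 𝔼) :
    fderiv ℝ (trans y w) (chartAt 𝔼 y z) (fderiv ℝ (trans x y) (chartAt 𝔼 x z) v) =
      fderiv ℝ (trans x w) (chartAt 𝔼 x z) v := by
  rw [← tangentCoordChange_eq, ← tangentCoordChange_eq, ← tangentCoordChange_eq]
  exact tangentCoordChange_comp (by simp only [extChartAt_source]; exact ⟨⟨hx, hy⟩, hw⟩)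

theorem fderiv_trans_self {x z : M} (hx : z ∈ (chartAt 𝔼 x).source) (v : 𝔼) :
    fderiv ℝ (trans x x) (chartAt 𝔼 x z) v = v := by
  rw [← tangentCoordChange_eq]
  exact tangentCoordChange_self (by rwa [extChartAt_source])

/-- The coordinates at `y`, in the preferred chart at `y`, of the vector which has coordinates `v`
in the preferred chart at `x`. -/
def frame (x y : M) : EuclideanSpace ℝ (Fin m) →L[ℝ] EuclideanSpace ℝ (Fin m) :=
  fderiv ℝ (trans x y) (chartAt (EuclideanSpace ℝ (Fin m)) x y)

theorem frame_self (x : M) (v : 𝔼) : frame x x v = v := fderiv_trans_self (mem_chart_source _ x) v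

theorem frame_fderiv_trans {x y z : M} (hx : z ∈ (chartAt 𝔼 x).source)
    (hy : z ∈ (chartAt 𝔼 y).source) (v : 𝔼) :
    frame y z (fderiv ℝ (trans x y) (chartAt 𝔼 x z) v) = frame x z v :=
  fderiv_trans_trans hx hy (mem_chart_source _ z) v

/-- The inverse of the frame. -/
def coframe (x y : M) : EuclideanSpace ℝ (Fin m) →L[ℝ] EuclideanSpace ℝ (Fin m) :=
  fderiv ℝ (trans y x) (chartAt (EuclideanSpace ℝ (Fin m)) y y)

theorem coframe_frame {x y : M} (hy : y ∈ (chartAt 𝔼 x).source) (v : 𝔼) :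
    coframe x y (frame x y v) = v := by
  rw [coframe, frame, fderiv_trans_trans hy (mem_chart_source _ y) hy, fderiv_trans_self hy]

theorem frame_coframe {x y : M} (hy : y ∈ (chartAt 𝔼 x).source) (v : 𝔼) :
    frame x y (coframe x y v) = v := by
  rw [coframe, frame, fderiv_trans_trans (mem_chart_source _ y) hy (mem_chart_source _ y),
    fderiv_trans_self (mem_chart_source _ y)]

theorem trivializationAt_snd (x y : M) (v : TangentSpace (𝓡 m) y) :
    (trivializationAt 𝔼 (TangentSpace (𝓡 m)) x ⟨y, v⟩).2 = coframe x y v := by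
  change fderivWithin ℝ _ (Set.range (𝓡 m)) _ v = _
  simp only [modelWithCornersSelf_coe, Set.range_id, fderivWithin_univ]
  rfl

theorem extendVec_eq {x y : M} (hy : y ∈ (chartAt 𝔼 x).source) (v : TangentSpace (𝓡 m) x) :
    extendVec v y = frame x y v := by
  have h1 : (trivializationAt 𝔼 (TangentSpace (𝓡 m)) x ⟨x, v⟩).2 = v := by
    rw [trivializationAt_snd]
    exact frame_self x v
  have h2 := Bundle.Trivialization.symmL_apply (R := ℝ)
    (trivializationAt 𝔼 (TangentSpace (𝓡 m)) x) (b := y) hy (v : 𝔼)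
  have h3 : extendVec v y = (trivializationAt 𝔼 (TangentSpace (𝓡 m)) x).symm y (v : 𝔼) :=
    congrArg ((trivializationAt 𝔼 (TangentSpace (𝓡 m)) x).symm y) h1
  rw [h3, ← h2, TangentBundle.symmL_trivializationAt_eq_core hy]
  exact congrArg (fun T : 𝔼 →L[ℝ] 𝔼 => T v) (tangentCoordChange_eq x y y)

section

variable {F : Type*} [NormedAddCommGroup F] [NormedSpace ℝ F]

theorem contMDiffAt_iff_chart {f : M → F} {x y : M} (hy : y ∈ (chartAt 𝔼 x).source) {n : ℕ∞} :
    ContMDiffAt (𝓡 m) 𝓘(ℝ, F) n f y ↔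
      ContDiffAt ℝ n (fun p => f ((chartAt 𝔼 x).symm p)) (chartAt 𝔼 x y) := by
  have : IsManifold (𝓡 m) n M := IsManifold.of_le (n := ∞) (by exact_mod_cast le_top)
  rw [contMDiffAt_iff_source_of_mem_source (x := x) hy]
  simp only [mfld_simps]
  rw [contMDiffWithinAt_univ, contMDiffAt_iff_contDiffAt]
  rfl

theorem contMDiffOn_iff_chart {f : M → F} {x : M} {n : ℕ∞} :
    (∀ y ∈ (chartAt 𝔼 x).source, ContMDiffAt (𝓡 m) 𝓘(ℝ, F) n f y) ↔
      ContDiffOn ℝ n (fun p => f ((chartAt 𝔼 x).symm p)) (chartAt 𝔼 x).target := by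
  constructor
  · intro h p hp
    have := (contMDiffAt_iff_chart ((chartAt 𝔼 x).map_target hp)).1 (h _ ((chartAt 𝔼 x).map_target hp))
    rw [(chartAt 𝔼 x).right_inv hp] at this
    exact this.contDiffWithinAt
  · intro h y hy
    rw [contMDiffAt_iff_chart hy]
    exact (h _ ((chartAt 𝔼 x).map_source hy)).contDiffAt
      ((chartAt 𝔼 x).open_target.mem_nhds ((chartAt 𝔼 x).map_source hy))

theorem contMDiffAt_vectorField_iff {s : ∀ y : M, TangentSpace (𝓡 m) y} {x y : M}
    (hy : y ∈ (chartAt 𝔼 x).source) :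
    ContMDiffAt (𝓡 m) ((𝓡 m).prod 𝓘(ℝ, 𝔼)) ∞ (fun z => Bundle.TotalSpace.mk' 𝔼 z (s z)) y ↔
      ContDiffAt ℝ ∞ (fun p => coframe x ((chartAt 𝔼 x).symm p) (s ((chartAt 𝔼 x).symm p)))
        (chartAt 𝔼 x y) := by
  have := Bundle.Trivialization.contMDiffAt_section_iff (n := ∞) (IB := 𝓡 m) (s := s)
    (trivializationAt 𝔼 (TangentSpace (𝓡 m)) x) (x₀ := y) hy
  refine this.trans ?_
  simp only [trivializationAt_snd]
  exact contMDiffAt_iff_chart (f := fun z => coframe x z (s z)) hy (n := ⊤)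

theorem mfderiv_eq_chart {f : M → F} {x : M}
    (hf : DifferentiableAt ℝ (fun p => f ((chartAt 𝔼 x).symm p)) (chartAt 𝔼 x x))
    (v : TangentSpace (𝓡 m) x) : mfderiv (𝓡 m) 𝓘(ℝ, F) f x v =
      fderiv ℝ (fun p => f ((chartAt 𝔼 x).symm p)) (chartAt 𝔼 x x) v := by
  have hc : ContinuousAt f x := by
    have h1 : ContinuousAt (fun y => f ((chartAt 𝔼 x).symm (chartAt 𝔼 x y))) x :=
      ContinuousAt.comp (f := chartAt 𝔼 x) hf.continuousAt
        ((chartAt 𝔼 x).continuousAt (mem_chart_source 𝔼 x))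
    refine h1.congr ?_
    filter_upwards [(chartAt 𝔼 x).open_source.mem_nhds (mem_chart_source 𝔼 x)] with y hy
    rw [(chartAt 𝔼 x).left_inv hy]
  have hd : MDifferentiableAt (𝓡 m) 𝓘(ℝ, F) f x := by
    rw [mdifferentiableAt_iff]
    refine ⟨hc, ?_⟩
    simp only [mfld_simps]
    rw [differentiableWithinAt_univ]
    exact hf
  rw [hd.mfderiv]
  simp only [writtenInExtChartAt, mfld_simps, fderivWithin_univ]
  rfl

end

end Fedosov

/-! ### Covariant derivatives of frame fields and the transformation of connection coefficients -/

namespace Fedosov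

variable {m : ℕ} {M : Type*} [TopologicalSpace M] [ChartedSpace (EuclideanSpace ℝ (Fin m)) M]

local notation "𝔼" => EuclideanSpace ℝ (Fin m)

open Weyl

variable [IsManifold (𝓡 m) ∞ M]

theorem mdifferentiableAt_of_chart {F : Type*} [NormedAddCommGroup F] [NormedSpace ℝ F] {f : M → F}
    {x y : M} (hy : y ∈ (chartAt 𝔼 x).source)
    (hf : DifferentiableAt ℝ (fun p => f ((chartAt 𝔼 x).symm p)) (chartAt 𝔼 x y)) :
    MDifferentiableAt (𝓡 m) 𝓘(ℝ, F) f y := by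
  have h1 : MDifferentiableAt (𝓡 m) 𝓘(ℝ, 𝔼) (chartAt 𝔼 x) y :=
    mdifferentiableAt_atlas (chart_mem_atlas 𝔼 x) hy
  refine (hf.mdifferentiableAt.comp y h1).congr_of_eventuallyEq ?_
  filter_upwards [(chartAt 𝔼 x).open_source.mem_nhds hy] with z hz
  simp [(chartAt 𝔼 x).left_inv hz]

/-- The vector field with coefficients `g` in the frame of the preferred chart at `x`. -/
def frameField (x : M) (g : M → EuclideanSpace ℝ (Fin m)) : ∀ z : M, TangentSpace (𝓡 m) z :=
  fun z => frame x z (g z)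

theorem mdifferentiableAt_frameField {x y : M} (hy : y ∈ (chartAt 𝔼 x).source) {g : M → 𝔼}
    (hg : DifferentiableAt ℝ (fun p => g ((chartAt 𝔼 x).symm p)) (chartAt 𝔼 x y)) :
    MDifferentiableAt (𝓡 m) ((𝓡 m).prod 𝓘(ℝ, 𝔼))
      (fun z => Bundle.TotalSpace.mk' 𝔼 z (frameField x g z)) y := by
  have := Bundle.Trivialization.mdifferentiableAt_section_iff (𝓡 m)
    (trivializationAt 𝔼 (TangentSpace (𝓡 m)) x) (frameField x g) (b₀ := y) hy
  refine this.2 ?_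
  simp only [trivializationAt_snd]
  refine (mdifferentiableAt_of_chart hy hg).congr_of_eventuallyEq ?_
  filter_upwards [(chartAt 𝔼 x).open_source.mem_nhds hy] with z hz
  exact coframe_frame hz _

theorem frameField_eq_sum (x : M) (g : M → 𝔼) :
    frameField x g = ∑ i, (fun z => g z i) • frameField x fun _ => basisVec i := by
  funext z
  rw [Finset.sum_apply]
  change frame x z (g z) = ∑ i, g z i • frame x z (basisVec i)
  conv_lhs => rw [← sum_smul_basisVec (g z)]
  rw [map_sum]
  simp only [map_smul]

theorem conn_sum (conn : Connection m M) {ι : Type*} (s : Finset ι)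
    {X : ι → ∀ z : M, TangentSpace (𝓡 m) z} {y : M}
    (hX : ∀ i ∈ s, MDifferentiableAt (𝓡 m) ((𝓡 m).prod 𝓘(ℝ, 𝔼))
      (fun z => Bundle.TotalSpace.mk' 𝔼 z (X i z)) y) :
    MDifferentiableAt (𝓡 m) ((𝓡 m).prod 𝓘(ℝ, 𝔼))
      (fun z => Bundle.TotalSpace.mk' 𝔼 z ((∑ i ∈ s, X i) z)) y ∧
    conn (∑ i ∈ s, X i) y = ∑ i ∈ s, conn (X i) y := by
  classical
  induction s using Finset.induction_on with
  | empty =>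
    simp only [Finset.sum_empty]
    exact ⟨Bundle.mdifferentiableAt_zeroSection .., by rw [conn.zero]; rfl⟩
  | insert i s hi ih =>
    have h := ih fun j hj => hX j (Finset.mem_insert_of_mem hj)
    rw [Finset.sum_insert hi, Finset.sum_insert hi]
    exact ⟨mdifferentiableAt_add_section (hX i (Finset.mem_insert_self i s)) h.1,
      by rw [conn.isCovariantDerivativeOnUniv.add (hX i (Finset.mem_insert_self i s)) h.1, h.2]⟩

/-- The covariant derivative of the field `X` at `y` along `W`, in coordinates. -/
def cov (conn : Connection m M) (X : ∀ z : M, TangentSpace (𝓡 m) z) (y : M)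
    (W : EuclideanSpace ℝ (Fin m)) : EuclideanSpace ℝ (Fin m) := conn X y W

/-- The field is expanded in the coordinate frame and the Leibniz rule is applied to each
coefficient. At the center `y` of its own chart the frame is the standard basis, so the derivatives
of the coefficients are already components. -/
theorem cov_frameField (conn : Connection m M) {y : M} {g : M → 𝔼}
    (hg : DifferentiableAt ℝ (fun p => g ((chartAt 𝔼 y).symm p)) (chartAt 𝔼 y y)) (W : 𝔼) :
    cov conn (frameField y g) y W = ∑ i, g y i • cov conn (frameField y fun _ => basisVec i) y W +
      fderiv ℝ (fun p => g ((chartAt 𝔼 y).symm p)) (chartAt 𝔼 y y) W := by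
  have hy := mem_chart_source 𝔼 y
  have hgi : ∀ i, DifferentiableAt ℝ (fun p => g ((chartAt 𝔼 y).symm p) i) (chartAt 𝔼 y y) :=
    fun i => differentiableAt_euclidean.1 hg i
  have hS : ∀ i : Fin m, MDifferentiableAt (𝓡 m) ((𝓡 m).prod 𝓘(ℝ, 𝔼))
      (fun z => Bundle.TotalSpace.mk' 𝔼 z (frameField y (fun _ => basisVec i) z)) y := fun i =>
    mdifferentiableAt_frameField hy (differentiableAt_const _)
  have hm : ∀ i, MDifferentiableAt (𝓡 m) 𝓘(ℝ, ℝ) (fun z => g z i) y := fun i =>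
    mdifferentiableAt_of_chart hy (hgi i)
  have hsm : ∀ i ∈ Finset.univ, MDifferentiableAt (𝓡 m) ((𝓡 m).prod 𝓘(ℝ, 𝔼))
      (fun z => Bundle.TotalSpace.mk' 𝔼 z (((fun z => g z i) •
        frameField y fun _ => basisVec i) z)) y := fun i _ => (hm i).smul_section (hS i)
  have h1 : ∀ i, cov conn ((fun z => g z i) • frameField y fun _ => basisVec i) y W =
      g y i • cov conn (frameField y fun _ => basisVec i) y W +
        fderiv ℝ (fun p => g ((chartAt 𝔼 y).symm p) i) (chartAt 𝔼 y y) W • basisVec i :=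
      fun i => by
    have h3 : frameField y (fun _ => basisVec i) y = (basisVec i : 𝔼) := frame_self y _
    have h4 := mfderiv_eq_chart (f := fun z => g z i) (hgi i) W
    have h5 := conn.isCovariantDerivativeOnUniv.leibniz (hS i) (hm i)
    rw [cov, h5]
    exact congrArg₂ (fun (a : ℝ) (b : 𝔼) =>
      g y i • cov conn (frameField y fun _ => basisVec i) y W + a • b) h4 h3
  have h2 : cov conn (frameField y g) y W =
      ∑ i, cov conn ((fun z => g z i) • frameField y fun _ => basisVec i) y W := by
    conv_lhs => rw [frameField_eq_sum y g, cov, (conn_sum conn Finset.univ hsm).2]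
    exact ContinuousLinearMap.sum_apply ..
  rw [h2, Finset.sum_congr rfl fun i _ => h1 i, Finset.sum_add_distrib]
  congr 1
  conv_rhs => rw [← sum_smul_basisVec (fderiv ℝ (fun p => g ((chartAt 𝔼 y).symm p))
    (chartAt 𝔼 y y) W)]
  refine Finset.sum_congr rfl fun i _ => ?_
  congr 1
  exact congrArg (fun T : 𝔼 →L[ℝ] ℝ => T W) ((EuclideanSpace.proj i :
      𝔼 →L[ℝ] ℝ).hasFDerivAt.comp _ hg.hasFDerivAt).fderiv

theorem conn_congr (conn : Connection m M) {X Y : ∀ z : M, TangentSpace (𝓡 m) z} {y : M}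
    (hX : MDifferentiableAt (𝓡 m) ((𝓡 m).prod 𝓘(ℝ, 𝔼))
      (fun z => Bundle.TotalSpace.mk' 𝔼 z (X z)) y) (h : ∀ᶠ z in nhds y, Y z = X z) :
    conn Y y = conn X y := by
  refine conn.isCovariantDerivativeOnUniv.congr_of_eventuallyEq ?_ hX Filter.univ_mem h
  exact hX.congr_of_eventuallyEq (h.mono fun z hz => by simp only [hz])

theorem eventually_mem_source {x y : M} (hy : y ∈ (chartAt 𝔼 x).source) :
    ∀ᶠ z in nhds y, z ∈ (chartAt 𝔼 x).source := (chartAt 𝔼 x).open_source.mem_nhds hy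

/-- The connection coefficients `∇_U (extendVec V)` at the center of a chart. -/
def connCoef (conn : Connection m M) (y : M) (U V : EuclideanSpace ℝ (Fin m)) :
    EuclideanSpace ℝ (Fin m) :=
  conn (extendVec (x := y) V) y U

theorem conn_extendVec (conn : Connection m M) {x y : M} (hy : y ∈ (chartAt 𝔼 x).source)
    (V : TangentSpace (𝓡 m) x) : conn (extendVec V) y = conn (frameField x fun _ => V) y :=
  conn_congr conn (mdifferentiableAt_frameField hy (differentiableAt_const _))
    ((eventually_mem_source hy).mono fun z hz => extendVec_eq hz V)

theorem connCoef_eq_sum (conn : Connection m M) (y : M) (U V : 𝔼) :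
    connCoef conn y U V = ∑ i, V i • cov conn (frameField y fun _ => basisVec i) y U := by
  have := cov_frameField conn (y := y) (g := fun _ => V) (differentiableAt_const _) U
  rw [fderiv_fun_const] at this
  refine Eq.trans ?_ (this.trans (add_zero _))
  exact congrArg (fun T : 𝔼 →L[ℝ] 𝔼 => T U)
    (conn_extendVec conn (mem_chart_source 𝔼 y) (V : TangentSpace (𝓡 m) y))

theorem isLinearMap_connCoef (conn : Connection m M) (y : M) (U : 𝔼) :
    IsLinearMap ℝ (connCoef conn y U) where
  map_add V V' := by
    simp only [connCoef_eq_sum, PiLp.add_apply, add_smul, Finset.sum_add_distrib]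
  map_smul c V := by
    simp only [connCoef_eq_sum, PiLp.smul_apply, smul_eq_mul, mul_smul, Finset.smul_sum]

theorem cov_of_eventuallyEq (conn : Connection m M) {y : M} {g : M → 𝔼}
    (hg : DifferentiableAt ℝ (fun p => g ((chartAt 𝔼 y).symm p)) (chartAt 𝔼 y y))
    {X : ∀ z : M, TangentSpace (𝓡 m) z} (hX : ∀ᶠ z in nhds y, X z = frame y z (g z)) (W : 𝔼) :
    cov conn X y W = connCoef conn y W (g y) +
      fderiv ℝ (fun p => g ((chartAt 𝔼 y).symm p)) (chartAt 𝔼 y y) W := by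
  rw [cov, conn_congr conn (mdifferentiableAt_frameField (mem_chart_source 𝔼 y) hg) hX,
    connCoef_eq_sum]
  exact cov_frameField conn hg W

/-- The transformation law of the connection coefficients. -/
theorem cov_frame (conn : Connection m M) {x y : M} (hy : y ∈ (chartAt 𝔼 x).source) (u v : 𝔼) :
    cov conn (extendVec (x := x) v) y (frame x y u) =
      connCoef conn y (frame x y u) (frame x y v) +
        fderiv ℝ (fun p => fderiv ℝ (trans x y) p v) (chartAt 𝔼 x y) u := by
  have hd : chartAt 𝔼 x y ∈ transDom x y := chartAt_mem_transDom hy (mem_chart_source 𝔼 y)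
  have hd' : chartAt 𝔼 y y ∈ transDom y x := chartAt_mem_transDom (mem_chart_source 𝔼 y) hy
  have e : trans y x (chartAt 𝔼 y y) = chartAt 𝔼 x y := trans_chartAt (mem_chart_source 𝔼 y)
  have hG : DifferentiableAt ℝ (fun p => fderiv ℝ (trans x y) p v) (trans y x (chartAt 𝔼 y y)) := by
    rw [e]; exact (contDiffAt_fderiv_trans hd v).differentiableAt (by simp)
  have hτ : DifferentiableAt ℝ (trans y x) (chartAt 𝔼 y y) :=
    (contDiffAt_trans hd').differentiableAt (by simp)
  have h := cov_of_eventuallyEq conn (y := y)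
    (g := fun z => fderiv ℝ (trans x y) (chartAt 𝔼 x z) v) (hG.comp (chartAt 𝔼 y y) hτ)
    (X := extendVec (x := x) v) (((eventually_mem_source hy).and
      (eventually_mem_source (mem_chart_source 𝔼 y))).mono fun z hz => by
        rw [frame_fderiv_trans hz.1 hz.2]; exact extendVec_eq hz.1 v) (frame x y u)
  refine h.trans ?_
  congr 1
  have h2 := congrArg (fun T : 𝔼 →L[ℝ] 𝔼 => T (frame x y u))
    (hG.hasFDerivAt.comp (chartAt 𝔼 y y) hτ.hasFDerivAt).fderiv
  refine h2.trans ?_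
  rw [e]
  change fderiv ℝ (fun p => fderiv ℝ (trans x y) p v) (chartAt 𝔼 x y)
    (coframe x y (frame x y u)) = _
  rw [coframe_frame hy]

theorem mpullback_extendVec (x : M) (w : TangentSpace (𝓡 m) x) {p : 𝔼}
    (hp : p ∈ (chartAt 𝔼 x).target) : VectorField.mpullbackWithin 𝓘(ℝ, 𝔼) (𝓡 m)
      (extChartAt (𝓡 m) x).symm (extendVec w) (Set.range (𝓡 m)) p = (w : 𝔼) := by
  have hy := (chartAt 𝔼 x).map_target hp
  have e : extChartAt (𝓡 m) x ((chartAt 𝔼 x).symm p) = p := (chartAt 𝔼 x).right_inv hp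
  have h1 := TangentBundle.symmL_trivializationAt (I := 𝓡 m) hy
  rw [e] at h1
  rw [VectorField.mpullbackWithin_apply]
  have h2 : mfderivWithin 𝓘(ℝ, 𝔼) (𝓡 m) (extChartAt (𝓡 m) x).symm (Set.range (𝓡 m)) p =
      frame x ((chartAt 𝔼 x).symm p) := by
    rw [← h1]
    rw [TangentBundle.symmL_trivializationAt_eq_core hy]
    exact tangentCoordChange_eq x _ _
  have h3 : extendVec w ((extChartAt (𝓡 m) x).symm p) = frame x ((chartAt 𝔼 x).symm p) w :=
    extendVec_eq hy w
  have h4 : ContinuousLinearMap.inverse (frame x ((chartAt 𝔼 x).symm p)) =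
      coframe x ((chartAt 𝔼 x).symm p) :=
    ContinuousLinearMap.inverse_eq
      (by ext1 v; exact frame_coframe hy v) (by ext1 v; exact coframe_frame hy v)
  refine (congrArg (fun T : 𝔼 →L[ℝ] 𝔼 => ContinuousLinearMap.inverse T
    (extendVec w ((extChartAt (𝓡 m) x).symm p))) h2).trans ?_
  refine (congrArg (ContinuousLinearMap.inverse (frame x ((chartAt 𝔼 x).symm p))) h3).trans ?_
  rw [h4]
  exact coframe_frame hy w

theorem lieBracketWithin_eq_zero_of_eventually_const {X Y : 𝔼 → 𝔼} {u v p : 𝔼}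
    (hX : X =ᶠ[nhds p] fun _ => u) (hY : Y =ᶠ[nhds p] fun _ => v) :
    VectorField.lieBracketWithin ℝ X Y Set.univ p = 0 := by
  rw [VectorField.lieBracketWithin_univ, hX.lieBracket_vectorField_eq hY]
  simp [VectorField.lieBracket]

/-- In the preferred chart at `x` both fields are constant. The bracket terms in the definitions of
the torsion, of the curvature and of the extension of a connection to `1`-forms therefore drop out.
-/
theorem mlieBracket_extendVec (x : M) (u v : TangentSpace (𝓡 m) x) :
    VectorField.mlieBracket (𝓡 m) (extendVec u) (extendVec v) x = 0 := by
  have h : ∀ w : TangentSpace (𝓡 m) x, VectorField.mpullbackWithin 𝓘(ℝ, 𝔼) (𝓡 m)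
      (extChartAt (𝓡 m) x).symm (extendVec w) (Set.range (𝓡 m)) =ᶠ[nhds (extChartAt (𝓡 m) x x)]
      fun _ => (w : 𝔼) := fun w => by
    filter_upwards [(chartAt 𝔼 x).open_target.mem_nhds (mem_chart_target 𝔼 x)] with p hp
    exact mpullback_extendVec x w hp
  have h2 := lieBracketWithin_eq_zero_of_eventually_const (h u) (h v)
  rw [← VectorField.mlieBracketWithin_univ, VectorField.mlieBracketWithin_apply]
  have h4 : (extChartAt (𝓡 m) x).symm ⁻¹' Set.univ ∩ Set.range (𝓡 m) = Set.univ := by simp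
  rw [h4]
  exact (congrArg (ContinuousLinearMap.inverse (mfderiv (𝓡 m) 𝓘(ℝ, 𝔼) (extChartAt (𝓡 m) x) x))
    h2).trans (map_zero _)

theorem connCoef_symm (conn : Connection m M) (h : conn.torsion = 0) (y : M)
    (U V : TangentSpace (𝓡 m) y) : connCoef conn y U V = connCoef conn y V U := by
  have h1 := conn.torsion_apply_eq_extend (x := y) U V
  rw [h, FiberBundle.extend_apply_self, FiberBundle.extend_apply_self] at h1
  have h2 := mlieBracket_extendVec y U V
  have h3 : connCoef conn y U V - connCoef conn y V U = 0 := by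
    refine Eq.trans ?_ h1.symm
    refine (sub_zero _).symm.trans ?_
    exact congrArg (fun b : 𝔼 => connCoef conn y U V - connCoef conn y V U - b) h2.symm
  exact sub_eq_zero.1 h3

end Fedosov

/-! ### Christoffel symbols and the symplectic form in a chart -/

namespace Fedosov

variable {m : ℕ} {M : Type*} [TopologicalSpace M] [ChartedSpace (EuclideanSpace ℝ (Fin m)) M]

local notation "𝔼" => EuclideanSpace ℝ (Fin m)

open Weyl

theorem exists_bump [T2Space M] {x y : M} (hy : y ∈ (chartAt 𝔼 x).source)
    [IsManifold (𝓡 m) ∞ M] :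
    ∃ χ : M → ℝ, ContMDiff (𝓡 m) 𝓘(ℝ, ℝ) ∞ χ ∧ (∀ᶠ z in nhds y, χ z = 1) ∧
      tsupport χ ⊆ (chartAt 𝔼 x).source := by
  obtain ⟨f, -, hf⟩ := (SmoothBumpFunction.nhds_basis_tsupport (I := 𝓡 m) y).mem_iff.1
    ((chartAt 𝔼 x).open_source.mem_nhds hy)
  exact ⟨f, f.contMDiff, f.eventuallyEq_one, hf⟩

variable [IsManifold (𝓡 m) ∞ M]

/-- The hypotheses on the connection and on the symplectic form concern globally smooth vector
fields. Cutting off a coordinate field with a bump function makes them applicable near a point;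
Hausdorffness provides the bump function. -/
theorem exists_smoothVF [T2Space M] {x y : M} (hy : y ∈ (chartAt 𝔼 x).source) (w : 𝔼) :
    ∃ X : ∀ z : M, TangentSpace (𝓡 m) z, IsSmoothVF m X ∧ ∀ᶠ z in nhds y, X z = frame x z w := by
  obtain ⟨χ, hχ, h1, hs⟩ := exists_bump hy
  refine ⟨fun z => χ z • frame x z w, fun z => ?_, h1.mono fun z hz => ?_⟩
  · by_cases hz : z ∈ (chartAt 𝔼 x).source
    · refine (contMDiffAt_vectorField_iff (s := fun z => (χ z • frame x z w : 𝔼)) hz).2 ?_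
      have h2 : ContDiffAt ℝ ∞ (fun p => χ ((chartAt 𝔼 x).symm p)) (chartAt 𝔼 x z) :=
        (contMDiffAt_iff_chart (n := ⊤) hz).1 (hχ z)
      refine (h2.smul (contDiffAt_const (c := w))).congr_of_eventuallyEq ?_
      filter_upwards [(chartAt 𝔼 x).open_target.mem_nhds ((chartAt 𝔼 x).map_source hz)] with p hp
      refine (map_smul (coframe x ((chartAt 𝔼 x).symm p)) (χ ((chartAt 𝔼 x).symm p)) _).trans ?_
      rw [coframe_frame ((chartAt 𝔼 x).map_target hp)]
      rfl
    · have h0 : ContMDiffAt (𝓡 m) ((𝓡 m).prod 𝓘(ℝ, 𝔼)) ∞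
          (Bundle.zeroSection 𝔼 (TangentSpace (𝓡 m) : M → Type _)) z :=
        Bundle.contMDiff_zeroSection ℝ _ z
      refine h0.congr_of_eventuallyEq ?_
      have : z ∉ tsupport χ := fun h => hz (hs h)
      filter_upwards [(isClosed_tsupport χ).isOpen_compl.mem_nhds this] with q hq
      have hq0 : χ q = 0 := image_eq_zero_of_notMem_tsupport hq
      have : (χ q • frame x q w : 𝔼) = 0 := by rw [hq0, zero_smul]
      exact congrArg (fun v : 𝔼 => Bundle.TotalSpace.mk' 𝔼 (E := TangentSpace (𝓡 m)) q v) this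
  · have : (χ z • frame x z w : 𝔼) = frame x z w := by rw [hz, one_smul]
    exact this

theorem contMDiffAt_cov [T2Space M] (conn : Connection m M) [conn.ContMDiffCovariantDerivative ∞]
    {X Y : ∀ z : M, TangentSpace (𝓡 m) z} (hX : IsSmoothVF m X) (hY : IsSmoothVF m Y) :
    IsSmoothVF m fun z => conn X z (Y z) := fun z => by
  have h1 := (‹conn.ContMDiffCovariantDerivative ∞›.contMDiff.contMDiff (σ := X)
    (ContMDiff.contMDiffOn hX)).contMDiffAt Filter.univ_mem (x := z)
  exact ContMDiffAt.clm_bundle_apply h1 (hY z)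

/-- The Christoffel symbols in the preferred chart at `x`. -/
def christoffel (conn : Connection m M) (x : M) (p u w : EuclideanSpace ℝ (Fin m)) :
    EuclideanSpace ℝ (Fin m) :=
  coframe x ((chartAt (EuclideanSpace ℝ (Fin m)) x).symm p)
    (cov conn (extendVec (x := x) w) ((chartAt (EuclideanSpace ℝ (Fin m)) x).symm p)
      (frame x ((chartAt (EuclideanSpace ℝ (Fin m)) x).symm p) u))

theorem frame_christoffel (conn : Connection m M) {x y : M} (hy : y ∈ (chartAt 𝔼 x).source)
    (u w : 𝔼) : frame x y (christoffel conn x (chartAt 𝔼 x y) u w) =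
      cov conn (extendVec (x := x) w) y (frame x y u) := by
  rw [christoffel, (chartAt 𝔼 x).left_inv hy, frame_coframe hy]

theorem christoffel_center (conn : Connection m M) (y : M) (u w : 𝔼) :
    christoffel conn y (chartAt 𝔼 y y) u w = connCoef conn y u w := by
  have h := frame_christoffel conn (mem_chart_source 𝔼 y) u w
  rw [frame_self, frame_self] at h
  exact h

theorem frame_christoffel_eq (conn : Connection m M) {x y : M} (hy : y ∈ (chartAt 𝔼 x).source)
    (u w : 𝔼) : frame x y (christoffel conn x (chartAt 𝔼 x y) u w) =
      christoffel conn y (chartAt 𝔼 y y) (frame x y u) (frame x y w) +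
        fderiv ℝ (fun p => fderiv ℝ (trans x y) p w) (chartAt 𝔼 x y) u := by
  rw [frame_christoffel conn hy, cov_frame conn hy, christoffel_center]

theorem frame_injective {x y : M} (hy : y ∈ (chartAt 𝔼 x).source) {u v : 𝔼}
    (h : frame x y u = frame x y v) : u = v := by
  rw [← coframe_frame hy u, h, coframe_frame hy]

theorem forall_target {x : M} {Q : EuclideanSpace ℝ (Fin m) → Prop}
    (h : ∀ y ∈ (chartAt 𝔼 x).source, Q (chartAt 𝔼 x y)) : ∀ p ∈ (chartAt 𝔼 x).target, Q p :=
  fun p hp => by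
    rw [← (chartAt 𝔼 x).right_inv hp]
    exact h _ ((chartAt 𝔼 x).map_target hp)

/-- The linear part comes from the coefficients at the center of the chart at `y`. In the
inhomogeneous part, symmetry of the second derivative of the transition map moves `w` into the outer
derivative, where linearity is evident. -/
theorem isLinearMap_christoffel (conn : Connection m M) (x : M) :
    ∀ p ∈ (chartAt 𝔼 x).target, ∀ u, IsLinearMap ℝ (christoffel conn x p u) :=
  forall_target fun y hy u => by
    have hd : chartAt 𝔼 x y ∈ transDom x y := chartAt_mem_transDom hy (mem_chart_source 𝔼 y)
    have hl := isLinearMap_connCoef conn y (frame x y u)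
    constructor
    · intro v w
      refine frame_injective hy ?_
      rw [map_add, frame_christoffel_eq conn hy, frame_christoffel_eq conn hy,
        frame_christoffel_eq conn hy, map_add, christoffel_center, hl.map_add,
        fderiv_fderiv_trans_symm hd, map_add, fderiv_fderiv_trans_symm hd v,
        fderiv_fderiv_trans_symm hd w, christoffel_center, christoffel_center]
      abel
    · intro c v
      refine frame_injective hy ?_
      rw [map_smul, frame_christoffel_eq conn hy, frame_christoffel_eq conn hy, map_smul]
      rw [christoffel_center, hl.map_smul, smul_add, fderiv_fderiv_trans_symm hd, map_smul,
        fderiv_fderiv_trans_symm hd v, christoffel_center]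

theorem christoffel_symm (conn : Connection m M) (h : conn.torsion = 0) (x : M) :
    ∀ p ∈ (chartAt 𝔼 x).target, ∀ u v, christoffel conn x p u v = christoffel conn x p v u :=
  forall_target fun y hy u v => by
    have hd : chartAt 𝔼 x y ∈ transDom x y := chartAt_mem_transDom hy (mem_chart_source 𝔼 y)
    refine frame_injective hy ?_
    rw [frame_christoffel_eq conn hy, frame_christoffel_eq conn hy, christoffel_center,
      christoffel_center, fderiv_fderiv_trans_symm hd]
    exact congrArg (fun a : 𝔼 => a + _) (connCoef_symm conn h y _ _)

/-- Near a point the coordinate fields agree with globally smooth fields, and a connection only sees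
germs, so smoothness of the connection gives smoothness of its coefficients. -/
theorem contDiffOn_christoffel [T2Space M] (conn : Connection m M)
    [conn.ContMDiffCovariantDerivative ∞] (x : M) (u w : 𝔼) :
    ContDiffOn ℝ ∞ (fun p => christoffel conn x p u w) (chartAt 𝔼 x).target := by
  refine fun p hp => ContDiffAt.contDiffWithinAt ?_
  revert p
  refine forall_target fun y hy => ?_
  obtain ⟨X, hX, hX'⟩ := exists_smoothVF hy u
  obtain ⟨Y, hY, hY'⟩ := exists_smoothVF hy w
  have h1 := (contMDiffAt_vectorField_iff hy).1 (contMDiffAt_cov conn hY hX y)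
  refine h1.congr_of_eventuallyEq ?_
  have h2 : Filter.Tendsto (chartAt 𝔼 x).symm (nhds (chartAt 𝔼 x y)) (nhds y) := by
    have := (chartAt 𝔼 x).continuousAt_symm ((chartAt 𝔼 x).map_source hy)
    rwa [ContinuousAt, (chartAt 𝔼 x).left_inv hy] at this
  filter_upwards [h2.eventually hX', h2.eventually hY'.eventually_nhds,
    (chartAt 𝔼 x).open_target.mem_nhds ((chartAt 𝔼 x).map_source hy)] with q h3 h4 h5
  rw [christoffel, h3]
  have h6 := (chartAt 𝔼 x).map_target h5
  have h7 : conn Y ((chartAt 𝔼 x).symm q) =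
      conn (extendVec (x := x) w) ((chartAt 𝔼 x).symm q) :=
    (conn_congr conn (mdifferentiableAt_frameField h6 (differentiableAt_const _)) h4).trans
      (conn_extendVec conn h6 _).symm
  rw [h7]
  rfl

/-! ### The symplectic form in charts -/

/-- The symplectic form as a function of coordinates. -/
def formV (Ω : SymplecticForm m M) (y : M) (u v : EuclideanSpace ℝ (Fin m)) : ℝ := Ω.form y u v

theorem formV_add_left (Ω : SymplecticForm m M) (y : M) (u u' v : 𝔼) :
    formV Ω y (u + u') v = formV Ω y u v + formV Ω y u' v :=
  congrArg (fun T : 𝔼 →L[ℝ] ℝ => T v) ((Ω.form y).map_add u u')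

theorem formV_smul_left (Ω : SymplecticForm m M) (y : M) (c : ℝ) (u v : 𝔼) :
    formV Ω y (c • u) v = c * formV Ω y u v :=
  congrArg (fun T : 𝔼 →L[ℝ] ℝ => T v) ((Ω.form y).map_smul c u)

theorem formV_self (Ω : SymplecticForm m M) (y : M) (u : 𝔼) : formV Ω y u u = 0 :=
  Ω.alternating y u

theorem formV_add_right (Ω : SymplecticForm m M) (y : M) (u v v' : 𝔼) :
    formV Ω y u (v + v') = formV Ω y u v + formV Ω y u v' :=
  (Ω.form y u).map_add v v'

theorem formV_smul_right (Ω : SymplecticForm m M) (y : M) (c : ℝ) (u v : 𝔼) :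
    formV Ω y u (c • v) = c * formV Ω y u v :=
  (Ω.form y u).map_smul c v

theorem formV_swap (Ω : SymplecticForm m M) (y : M) (u v : 𝔼) :
    formV Ω y v u = -formV Ω y u v := by
  have h := formV_self Ω y (u + v)
  rw [formV_add_left, formV_add_right, formV_add_right, formV_self, formV_self] at h
  linarith

theorem formV_sum_left (Ω : SymplecticForm m M) (y : M) {ι : Type*} (s : Finset ι) (u : ι → 𝔼)
    (v : 𝔼) : formV Ω y (∑ i ∈ s, u i) v = ∑ i ∈ s, formV Ω y (u i) v := by
  classical
  induction s using Finset.induction_on with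
  | empty =>
    have := formV_smul_left Ω y 0 (0 : 𝔼) v
    simpa using this
  | insert i s hi ih => rw [Finset.sum_insert hi, Finset.sum_insert hi, formV_add_left, ih]

theorem formV_sum_right (Ω : SymplecticForm m M) (y : M) {ι : Type*} (s : Finset ι) (u : ι → 𝔼)
    (v : 𝔼) : formV Ω y v (∑ i ∈ s, u i) = ∑ i ∈ s, formV Ω y v (u i) := by
  rw [← neg_neg (formV Ω y v _), ← formV_swap, formV_sum_left, ← Finset.sum_neg_distrib]
  exact Finset.sum_congr rfl fun i _ => (formV_swap Ω y v (u i) ▸ neg_neg _)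

/-- The matrix of the symplectic form in the preferred chart at `x`. -/
def symplMat (Ω : SymplecticForm m M) (x : M) (p : EuclideanSpace ℝ (Fin m)) :
    Matrix (Fin m) (Fin m) ℝ :=
  Matrix.of fun k l => formV Ω ((chartAt (EuclideanSpace ℝ (Fin m)) x).symm p)
    (frame x ((chartAt (EuclideanSpace ℝ (Fin m)) x).symm p) (basisVec k))
    (frame x ((chartAt (EuclideanSpace ℝ (Fin m)) x).symm p) (basisVec l))

theorem symplMat_apply (Ω : SymplecticForm m M) {x y : M} (hy : y ∈ (chartAt 𝔼 x).source)
    (k l : Fin m) : symplMat Ω x (chartAt 𝔼 x y) k l =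
      formV Ω y (frame x y (basisVec k)) (frame x y (basisVec l)) := by
  rw [symplMat, (chartAt 𝔼 x).left_inv hy, Matrix.of_apply]

theorem formV_eq_sum (Ω : SymplecticForm m M) {x y : M} (hy : y ∈ (chartAt 𝔼 x).source)
    (u v : 𝔼) : formV Ω y (frame x y u) (frame x y v) =
      ∑ k, ∑ l, u k * (symplMat Ω x (chartAt 𝔼 x y) k l * v l) := by
  conv_lhs => rw [← sum_smul_basisVec u, ← sum_smul_basisVec v, map_sum, map_sum, formV_sum_left]
  refine Finset.sum_congr rfl fun k _ => ?_
  rw [map_smul, formV_smul_left, formV_sum_right, Finset.mul_sum]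
  refine Finset.sum_congr rfl fun l _ => ?_
  rw [map_smul, formV_smul_right, symplMat_apply Ω hy, mul_comm (v l)]

theorem isUnit_det_symplMat (Ω : SymplecticForm m M) (x : M) :
    ∀ p ∈ (chartAt 𝔼 x).target, IsUnit (symplMat Ω x p).det :=
  forall_target fun y hy => by
    rw [isUnit_iff_ne_zero]
    intro h
    obtain ⟨v, hv, h0⟩ := Matrix.exists_mulVec_eq_zero_iff.2 h
    refine hv ?_
    have h1 : ∀ u : 𝔼, formV Ω y (frame x y u) (frame x y (WithLp.toLp 2 v)) = 0 := fun u => by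
      rw [formV_eq_sum Ω hy]
      refine Finset.sum_eq_zero fun k _ => ?_
      rw [← Finset.mul_sum]
      exact mul_eq_zero_of_right _ (congrFun h0 k)
    have h2 : frame x y (WithLp.toLp 2 v) = 0 :=
      Ω.nondegenerate y _ fun w => by
        have h2 : formV Ω y w (frame x y (WithLp.toLp 2 v)) = 0 :=
          (congrArg (fun a => formV Ω y a _) (frame_coframe hy w)).symm.trans (h1 (coframe x y w))
        exact (formV_swap Ω y w _).trans (neg_eq_zero.2 h2)
    have h3 : (WithLp.toLp 2 v : 𝔼) = 0 := frame_injective hy (h2.trans (map_zero _).symm)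
    funext k
    exact congrArg (fun w : 𝔼 => w k) h3

theorem symplMat_transpose (Ω : SymplecticForm m M) (x : M) (p : 𝔼) :
    (symplMat Ω x p).transpose = -symplMat Ω x p := by
  ext k l
  exact formV_swap ..

/-- The matrix of the Poisson bivector in the preferred chart at `x`. -/
def poissonMat (Ω : SymplecticForm m M) (x : M) (p : EuclideanSpace ℝ (Fin m)) :
    Matrix (Fin m) (Fin m) ℝ := (symplMat Ω x p)⁻¹

theorem symplMat_center (Ω : SymplecticForm m M) (y : M) :
    symplMat Ω y (chartAt 𝔼 y y) =
      Matrix.of fun k l => Ω.form y (coordVec y k) (coordVec y l) := by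
  ext k l
  rw [symplMat_apply Ω (mem_chart_source 𝔼 y), frame_self, frame_self]
  rfl

theorem poissonMat_center (Ω : SymplecticForm m M) (y : M) :
    poissonMat Ω y (chartAt 𝔼 y y) = Ω.poissonMatrix y := by
  rw [poissonMat, symplMat_center]
  rfl

theorem poissonMat_transpose (Ω : SymplecticForm m M) (x : M) (p : 𝔼) :
    (poissonMat Ω x p).transpose = -poissonMat Ω x p := by
  rw [poissonMat, Matrix.transpose_nonsing_inv, symplMat_transpose]
  by_cases h : IsUnit (symplMat Ω x p).det
  · refine Matrix.inv_eq_left_inv ?_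
    rw [neg_mul_neg, Matrix.nonsing_inv_mul _ h]
  -- Away from the target of the chart the matrix may be singular. Both inverses then have the
  -- default value `0`, so antisymmetry holds without restriction on `p`.
  · rw [Matrix.nonsing_inv_apply_not_isUnit _ h, neg_zero, Matrix.nonsing_inv_apply_not_isUnit]
    rw [Matrix.det_neg]
    intro h'
    exact h (isUnit_of_mul_isUnit_right h')

/-- Inverting the congruence `W = L W' Lᵀ` between the matrices of the form gives `W'⁻¹ = Lᵀ W⁻¹ L`.
This is the hypothesis under which `pull_moyal` and `pull_bracket` respect the products. -/
theorem poissonMatrix_eq (Ω : SymplecticForm m M) {x y : M} (hy : y ∈ (chartAt 𝔼 x).source)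
    (i j : Fin m) : Ω.poissonMatrix y i j = ∑ k, ∑ l, poissonMat Ω x (chartAt 𝔼 x y) k l *
      (frame x y (basisVec k) i * frame x y (basisVec l) j) := by
  set L : Matrix (Fin m) (Fin m) ℝ := Matrix.of fun k i => frame x y (basisVec k) i with hL
  set W := symplMat Ω x (chartAt 𝔼 x y) with hW
  set W' := symplMat Ω y (chartAt 𝔼 y y) with hW'
  have h1 : W = L * W' * L.transpose := by
    ext k l
    have := formV_eq_sum Ω (mem_chart_source 𝔼 y) (frame x y (basisVec k)) (frame x y (basisVec l))
    rw [frame_self, frame_self] at this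
    rw [hW, symplMat_apply Ω hy, this, Matrix.mul_assoc, Matrix.mul_apply]
    simp only [Matrix.mul_apply, Finset.mul_sum]
    rfl
  have hu : IsUnit W.det := isUnit_det_symplMat Ω x _ ((chartAt 𝔼 x).map_source hy)
  have hu' : IsUnit W'.det :=
    isUnit_det_symplMat Ω y _ ((chartAt 𝔼 y).map_source (mem_chart_source 𝔼 y))
  have hL1 : IsUnit L.det := by
    rw [h1, Matrix.det_mul, Matrix.det_mul] at hu
    exact isUnit_of_mul_isUnit_left (isUnit_of_mul_isUnit_left hu)
  have hL2 : IsUnit L.transpose.det := by rwa [Matrix.det_transpose]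
  have h2 : L.transpose * W⁻¹ * L = W'⁻¹ := by
    rw [h1, Matrix.mul_inv_rev, Matrix.mul_inv_rev, ← Matrix.mul_assoc, ← Matrix.mul_assoc,
      Matrix.mul_nonsing_inv _ hL2, Matrix.one_mul, Matrix.mul_assoc, Matrix.nonsing_inv_mul _ hL1,
      Matrix.mul_one]
  rw [← poissonMat_center, poissonMat, ← hW', ← h2, Matrix.mul_assoc, Matrix.mul_apply]
  simp only [Matrix.mul_apply, Finset.mul_sum]
  refine Finset.sum_congr rfl fun k _ => Finset.sum_congr rfl fun l _ => ?_
  change frame x y (basisVec k) i * (_ * frame x y (basisVec l) j) = _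
  rw [poissonMat]
  ring

theorem contMDiffAt_form (Ω : SymplecticForm m M) {X Y : ∀ z : M, TangentSpace (𝓡 m) z}
    (hX : IsSmoothVF m X) (hY : IsSmoothVF m Y) (z : M) :
    ContMDiffAt (𝓡 m) 𝓘(ℝ, ℝ) ∞ (fun y => Ω.form y (X y) (Y y)) z := by
  have := ContMDiffAt.clm_bundle_apply₂ (F₃ := ℝ) (E₃ := Bundle.Trivial M ℝ)
    (Ω.smooth z) (hX z) (hY z)
  rw [Bundle.contMDiffAt_totalSpace] at this
  exact this.2

theorem tendsto_chart_symm {x y : M} (hy : y ∈ (chartAt 𝔼 x).source) :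
    Filter.Tendsto (chartAt 𝔼 x).symm (nhds (chartAt 𝔼 x y)) (nhds y) := by
  have := (chartAt 𝔼 x).continuousAt_symm ((chartAt 𝔼 x).map_source hy)
  rwa [ContinuousAt, (chartAt 𝔼 x).left_inv hy] at this

theorem fderiv_chart_change {F : Type*} [NormedAddCommGroup F] [NormedSpace ℝ F] {f : M → F}
    {x y : M} (hy : y ∈ (chartAt 𝔼 x).source)
    (hf : DifferentiableAt ℝ (fun p => f ((chartAt 𝔼 y).symm p)) (chartAt 𝔼 y y)) (u : 𝔼) :
    fderiv ℝ (fun p => f ((chartAt 𝔼 x).symm p)) (chartAt 𝔼 x y) u =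
      fderiv ℝ (fun p => f ((chartAt 𝔼 y).symm p)) (chartAt 𝔼 y y) (frame x y u) := by
  have hd : chartAt 𝔼 x y ∈ transDom x y := chartAt_mem_transDom hy (mem_chart_source 𝔼 y)
  have e : trans x y (chartAt 𝔼 x y) = chartAt 𝔼 y y := trans_chartAt hy
  have hτ : DifferentiableAt ℝ (trans x y) (chartAt 𝔼 x y) :=
    (contDiffAt_trans hd).differentiableAt (by simp)
  rw [← e] at hf
  have h1 := congrArg (fun T : 𝔼 →L[ℝ] F => T u)
    (hf.hasFDerivAt.comp (chartAt 𝔼 x y) hτ.hasFDerivAt).fderiv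
  rw [e] at h1
  refine Eq.trans ?_ h1
  refine congrArg (fun T : 𝔼 →L[ℝ] F => T u) (Filter.EventuallyEq.fderiv_eq ?_)
  filter_upwards [(isOpen_transDom x y).mem_nhds hd] with q hq
  change _ = f ((chartAt 𝔼 y).symm (trans x y q))
  rw [trans, (chartAt 𝔼 y).left_inv hq.2]

theorem contDiffOn_symplMat [T2Space M] (Ω : SymplecticForm m M) (x : M) (k l : Fin m) :
    ContDiffOn ℝ ∞ (fun p => symplMat Ω x p k l) (chartAt 𝔼 x).target := by
  refine fun p hp => ContDiffAt.contDiffWithinAt ?_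
  revert p
  refine forall_target fun y hy => ?_
  obtain ⟨X, hX, hX'⟩ := exists_smoothVF hy (basisVec k)
  obtain ⟨Y, hY, hY'⟩ := exists_smoothVF hy (basisVec l)
  have h1 := (contMDiffAt_iff_chart (n := ⊤) hy).1 (contMDiffAt_form Ω hX hY y)
  refine h1.congr_of_eventuallyEq ?_
  filter_upwards [(tendsto_chart_symm hy).eventually hX', (tendsto_chart_symm hy).eventually hY']
    with q h3 h4
  rw [h3, h4]
  rfl

/-- This is `∇ω = 0` in coordinates, obtained by evaluating the hypothesis on cut-off coordinate
fields. -/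
theorem fderiv_symplMat [T2Space M] {Ω : SymplecticForm m M} {conn : Connection m M}
    (h : IsSymplecticConnection Ω conn) (x : M) : ∀ p ∈ (chartAt 𝔼 x).target, ∀ u k l,
      fderiv ℝ (fun q => symplMat Ω x q k l) p u =
        ∑ j, (christoffel conn x p u (basisVec k) j * symplMat Ω x p j l +
          symplMat Ω x p k j * christoffel conn x p u (basisVec l) j) :=
  forall_target fun y hy u k l => by
    obtain ⟨X, hX, hX'⟩ := exists_smoothVF hy u
    obtain ⟨Y, hY, hY'⟩ := exists_smoothVF hy (basisVec k)
    obtain ⟨Z, hZ, hZ'⟩ := exists_smoothVF hy (basisVec l)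
    have hd : DifferentiableAt ℝ (fun p => Ω.form ((chartAt 𝔼 y).symm p)
        (Y ((chartAt 𝔼 y).symm p)) (Z ((chartAt 𝔼 y).symm p))) (chartAt 𝔼 y y) :=
      ((contMDiffAt_iff_chart (n := ⊤) (mem_chart_source 𝔼 y)).1
        (contMDiffAt_form Ω hY hZ y)).differentiableAt (by simp)
    have h1 := h X Y Z hX hY hZ y
    rw [lieD, mfderiv_eq_chart hd] at h1
    have h2 : ∀ {W : ∀ z : M, TangentSpace (𝓡 m) z} {w : 𝔼},
        (∀ᶠ z in nhds y, W z = frame x z w) → conn W y (X y) =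
          frame x y (christoffel conn x (chartAt 𝔼 x y) u w) := fun {W w} hW => by
      rw [frame_christoffel conn hy, hX'.self_of_nhds]
      exact congrArg (fun T : 𝔼 →L[ℝ] 𝔼 => T (frame x y u)) ((conn_congr conn
        (mdifferentiableAt_frameField hy (differentiableAt_const _)) hW).trans
          (conn_extendVec conn hy _).symm)
    rw [h2 hY', h2 hZ', hY'.self_of_nhds, hZ'.self_of_nhds, hX'.self_of_nhds] at h1
    have h3 := (fderiv_chart_change (f := fun z => Ω.form z (Y z) (Z z)) hy hd u).trans h1
    have h4 : fderiv ℝ (fun q => symplMat Ω x q k l) (chartAt 𝔼 x y) u = _ :=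
      (congrArg (fun T : 𝔼 →L[ℝ] ℝ => T u) (Filter.EventuallyEq.fderiv_eq (by
        filter_upwards [(tendsto_chart_symm hy).eventually hY',
          (tendsto_chart_symm hy).eventually hZ'] with q h5 h6
        rw [h5, h6]
        rfl))).trans h3
    refine h4.trans ?_
    have h5 := formV_eq_sum Ω hy (christoffel conn x (chartAt 𝔼 x y) u (basisVec k)) (basisVec l)
    have h6 := formV_eq_sum Ω hy (basisVec k) (christoffel conn x (chartAt 𝔼 x y) u (basisVec l))
    refine (congrArg₂ (fun a b : ℝ => a + b) h5 h6).trans ?_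
    rw [Finset.sum_add_distrib]
    congr 1
    · refine Finset.sum_congr rfl fun j _ => ?_
      simp
    · rw [Finset.sum_eq_single k]
      · simp
      · intro b _ hb
        simp [hb]
      · simp

/-- Differentiating `W⁻¹ W = 1` turns covariant constancy of the form into that of the bivector,
which is what the Leibniz rule for the Moyal product requires. -/
theorem fderiv_inv_of_fderiv {U : Set (EuclideanSpace ℝ (Fin m))} (hU : IsOpen U)
    {W : EuclideanSpace ℝ (Fin m) → Matrix (Fin m) (Fin m) ℝ}
    (hW : ∀ k l, ContDiffOn ℝ ∞ (fun p => W p k l) U) (hdet : ∀ p ∈ U, IsUnit (W p).det)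
    {p u : EuclideanSpace ℝ (Fin m)} (hp : p ∈ U) {A : Matrix (Fin m) (Fin m) ℝ}
    (hA : ∀ k l, fderiv ℝ (fun q => W q k l) p u =
      (A.transpose * W p + W p * A) k l) (k l : Fin m) :
    fderiv ℝ (fun q => (W q)⁻¹ k l) p u = -((A * (W p)⁻¹ + (W p)⁻¹ * A.transpose) k l) := by
  have hd : ∀ k l, DifferentiableAt ℝ (fun q => W q k l) p := fun k l =>
    ((hW k l p hp).contDiffAt (hU.mem_nhds hp)).differentiableAt (by simp)
  have hd' : ∀ k l, DifferentiableAt ℝ (fun q => (W q)⁻¹ k l) p := fun k l =>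
    ((contDiffOn_matrix_inv hW hdet k l p hp).contDiffAt (hU.mem_nhds hp)).differentiableAt
      (by simp)
  set B : Matrix (Fin m) (Fin m) ℝ := Matrix.of fun k l => fderiv ℝ (fun q => (W q)⁻¹ k l) p u
    with hB
  have h1 : B * W p + (W p)⁻¹ * (A.transpose * W p + W p * A) = 0 := by
    ext i j
    have h2 : fderiv ℝ (fun q => ∑ n, (W q)⁻¹ i n * W q n j) p u = 0 := by
      have : (fun q => ∑ n, (W q)⁻¹ i n * W q n j) =ᶠ[nhds p]
          fun _ => (1 : Matrix (Fin m) (Fin m) ℝ) i j := by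
        filter_upwards [hU.mem_nhds hp] with q hq
        rw [← Matrix.mul_apply, Matrix.nonsing_inv_mul _ (hdet q hq)]
      rw [this.fderiv_eq, fderiv_fun_const]
      rfl
    rw [fderiv_fun_sum fun n _ => (hd' i n).fun_mul (hd n j), ContinuousLinearMap.sum_apply] at h2
    rw [Matrix.add_apply, Matrix.mul_apply, Matrix.mul_apply, ← Finset.sum_add_distrib]
    refine Eq.trans (Finset.sum_congr rfl fun n _ => ?_) h2
    rw [fderiv_fun_mul (hd' i n) (hd n j)]
    simp only [ContinuousLinearMap.add_apply, ContinuousLinearMap.smul_apply, smul_eq_mul, hA]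
    rw [hB, Matrix.of_apply]
    ring
  have h2 : B = -(A * (W p)⁻¹ + (W p)⁻¹ * A.transpose) := by
    have h3 : B * W p = -((W p)⁻¹ * (A.transpose * W p + W p * A)) := eq_neg_of_add_eq_zero_left h1
    rw [Matrix.mul_add, ← Matrix.mul_assoc, ← Matrix.mul_assoc, Matrix.nonsing_inv_mul _ (hdet p hp),
      Matrix.one_mul] at h3
    calc B = B * W p * (W p)⁻¹ := by
          rw [Matrix.mul_assoc, Matrix.mul_nonsing_inv _ (hdet p hp), Matrix.mul_one]
      _ = _ := by
          rw [h3, Matrix.neg_mul, Matrix.add_mul, Matrix.mul_assoc _ (W p),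
            Matrix.mul_nonsing_inv _ (hdet p hp), Matrix.mul_one, add_comm]
  exact congrFun (congrFun h2 k) l

/-- This is the passage from the manifold to charts: the identities proved for a `LocalGeometry` now
hold in the preferred chart at every point. -/
theorem localGeometry [T2Space M] {Ω : SymplecticForm m M} {conn : Connection m M}
    [conn.ContMDiffCovariantDerivative ∞] (ht : conn.torsion = 0)
    (h : IsSymplecticConnection Ω conn) (x : M) :
    LocalGeometry (chartAt 𝔼 x).target (poissonMat Ω x) (christoffel conn x) where
  isOpen := (chartAt 𝔼 x).open_target
  smoothP := contDiffOn_matrix_inv (contDiffOn_symplMat Ω x) (isUnit_det_symplMat Ω x)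
  smoothΓ := contDiffOn_christoffel conn x
  antisymm p _ := poissonMat_transpose Ω x p
  isUnit p hp := by
    have := Matrix.isUnit_nonsing_inv_det_iff.2 (isUnit_det_symplMat Ω x p hp)
    exact this
  linear := isLinearMap_christoffel conn x
  symm := christoffel_symm conn ht x
  compatible p hp := by
    refine ⟨fun k l => ((contDiffOn_matrix_inv (contDiffOn_symplMat Ω x)
      (isUnit_det_symplMat Ω x) k l p hp).contDiffAt
        ((chartAt 𝔼 x).open_target.mem_nhds hp)).differentiableAt (by simp), fun u k l => ?_⟩
    have h1 := fderiv_inv_of_fderiv (chartAt 𝔼 x).open_target (contDiffOn_symplMat Ω x)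
      (isUnit_det_symplMat Ω x) hp (u := u)
      (A := Matrix.of fun j k => christoffel conn x p u (basisVec k) j) (fun k l => by
        rw [fderiv_symplMat h x p hp, Matrix.add_apply, Matrix.mul_apply, Matrix.mul_apply,
          ← Finset.sum_add_distrib]
        rfl) k l
    refine (congrArg (fun a : ℝ => a + _) h1).trans ?_
    rw [Matrix.add_apply, Matrix.mul_apply, Matrix.mul_apply, ← Finset.sum_add_distrib,
      neg_add_eq_zero]
    refine Finset.sum_congr rfl fun j _ => ?_
    simp only [Matrix.of_apply, Matrix.transpose_apply, poissonMat]
    ring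

end Fedosov

namespace Fedosov

variable {m : ℕ} {M : Type*} [TopologicalSpace M] [ChartedSpace (EuclideanSpace ℝ (Fin m)) M]

local notation "𝔼" => EuclideanSpace ℝ (Fin m)

open Weyl

variable [IsManifold (𝓡 m) ∞ M]

/-! ### Sections and forms in charts -/

/-- An element of the fibre at `y`, written in the frame of the preferred chart at `x`. -/
def framePull (x y : M) (a : Weyl m) : Weyl m := pull (fun k => frame x y (basisVec k)) a

/-- The linear map underlying `framePull`. -/
def framePullL (x y : M) : Weyl m →ₗ[ℂ] Weyl m := pullL fun k => frame x y (basisVec k)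

theorem framePull_add (x y : M) (a b : Weyl m) :
    framePull x y (a + b) = framePull x y a + framePull x y b := (framePullL x y).map_add a b

theorem framePull_sub (x y : M) (a b : Weyl m) :
    framePull x y (a - b) = framePull x y a - framePull x y b := (framePullL x y).map_sub a b

theorem framePull_smul (x y : M) (c : ℂ) (a : Weyl m) :
    framePull x y (c • a) = c • framePull x y a := (framePullL x y).map_smul c a

theorem framePull_sum (x y : M) {ι : Type*} (s : Finset ι) (a : ι → Weyl m) :
    framePull x y (∑ i ∈ s, a i) = ∑ i ∈ s, framePull x y (a i) := map_sum (framePullL x y) a s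

theorem framePull_self (y : M) (a : Weyl m) : framePull y y a = a := by
  rw [framePull]
  simp only [frame_self]
  exact pull_basisVec a

theorem sum_smul_map_basisVec (T : EuclideanSpace ℝ (Fin m) →L[ℝ] EuclideanSpace ℝ (Fin m))
    (v : 𝔼) : ∑ k, v k • T (basisVec k) = T v := by
  conv_rhs => rw [← sum_smul_basisVec v, map_sum]
  simp only [map_smul]

theorem dirE_framePull (x y : M) (u : 𝔼) (a : Weyl m) :
    dirE u (framePull x y a) = framePull x y (dirE (frame x y u) a) := by
  rw [framePull, dirE_pull, sum_smul_map_basisVec]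
  rfl

theorem framePull_divDegree (x y : M) (c : ℕ) (a : Weyl m) :
    framePull x y (divDegree c a) = divDegree c (framePull x y a) := pull_divDegree _ c a

theorem framePull_formalSum (x y : M) (c : ℕ → Weyl m) :
    framePull x y (formalSum c) = formalSum fun k => framePull x y (c k) := pull_formalSum _ c

/-- The generators and the coordinate vectors transform contragrediently, so the contraction
defining `δ*` does not depend on the frame. -/
theorem framePull_contract (x y : M) {σ : 𝔼 → Weyl m} (hσ : IsLinearMap ℝ σ) :
    framePull x y (contract σ) = contract fun u => framePull x y (σ (frame x y u)) := by
  rw [contract, contract, framePull_sum]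
  have h1 : ∀ i, framePull x y (gen i * σ (basisVec i)) =
      ∑ k, gen k * ((frame x y (basisVec k) i : ℂ) • framePull x y (σ (basisVec i))) := fun i => by
    rw [framePull, pull_mul, pull_gen, Finset.sum_mul]
    exact Finset.sum_congr rfl fun k _ => by rw [smul_mul_assoc, mul_smul_comm]; rfl
  rw [Finset.sum_congr rfl fun i _ => h1 i, Finset.sum_comm]
  refine Finset.sum_congr rfl fun k _ => ?_
  rw [map_eq_sum_basisVec hσ (frame x y (basisVec k)), framePull_sum, Finset.mul_sum]
  simp only [framePull_smul]

theorem framePull_moyal (Ω : SymplecticForm m M) {x y : M} (hy : y ∈ (chartAt 𝔼 x).source)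
    (a b : Weyl m) : framePull x y (moyal (Ω.poissonMatrix y) a b) =
      moyal (poissonMat Ω x (chartAt 𝔼 x y)) (framePull x y a) (framePull x y b) :=
  pull_moyal (poissonMatrix_eq Ω hy) a b

theorem framePull_bracket (Ω : SymplecticForm m M) {x y : M} (hy : y ∈ (chartAt 𝔼 x).source)
    (a b : Weyl m) : framePull x y (bracket (Ω.poissonMatrix y) a b) =
      bracket (poissonMat Ω x (chartAt 𝔼 x y)) (framePull x y a) (framePull x y b) :=
  pull_bracket (poissonMatrix_eq Ω hy) a b

theorem framePull_eq {x w z : M} (hx : z ∈ (chartAt 𝔼 x).source) (hw : z ∈ (chartAt 𝔼 w).source)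
    (a : Weyl m) : framePull x z a =
      pull (fun k => fderiv ℝ (trans x w) (chartAt 𝔼 x z) (basisVec k)) (framePull w z a) := by
  rw [framePull, framePull, pull_pull]
  congr 1
  funext j
  rw [sum_smul_map_basisVec, frame_fderiv_trans hx hw]

/-- The inverse of `framePull`. -/
def coframePull (x y : M) (a : Weyl m) : Weyl m := pull (fun k => coframe x y (basisVec k)) a

theorem framePull_coframePull {x y : M} (hy : y ∈ (chartAt 𝔼 x).source) (a : Weyl m) :
    framePull x y (coframePull x y a) = a := by
  rw [framePull, coframePull, pull_pull]
  conv_rhs => rw [← pull_basisVec a]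
  congr 1
  funext j
  rw [sum_smul_map_basisVec, coframe_frame hy]

/-- A section in the preferred chart at `x`. -/
def loc (x : M) (a : M → Weyl m) (p : EuclideanSpace ℝ (Fin m)) : Weyl m :=
  framePull x ((chartAt (EuclideanSpace ℝ (Fin m)) x).symm p)
    (a ((chartAt (EuclideanSpace ℝ (Fin m)) x).symm p))

/-- A `1`-form evaluated on constant vector fields in the preferred chart at `x`. -/
def locOne (x : M) (σ : OneForm m M) (u p : EuclideanSpace ℝ (Fin m)) : Weyl m :=
  framePull x ((chartAt (EuclideanSpace ℝ (Fin m)) x).symm p)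
    (σ ((chartAt (EuclideanSpace ℝ (Fin m)) x).symm p)
      (frame x ((chartAt (EuclideanSpace ℝ (Fin m)) x).symm p) u))

theorem loc_chartAt {x y : M} (hy : y ∈ (chartAt 𝔼 x).source) (a : M → Weyl m) :
    loc x a (chartAt 𝔼 x y) = framePull x y (a y) := by
  rw [loc, (chartAt 𝔼 x).left_inv hy]

theorem locOne_chartAt {x y : M} (hy : y ∈ (chartAt 𝔼 x).source) (σ : OneForm m M) (u : 𝔼) :
    locOne x σ u (chartAt 𝔼 x y) = framePull x y (σ y (frame x y u)) := by
  rw [locOne, (chartAt 𝔼 x).left_inv hy]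

theorem loc_center (y : M) (a : M → Weyl m) : loc y a (chartAt 𝔼 y y) = a y := by
  rw [loc_chartAt (mem_chart_source 𝔼 y), framePull_self]

theorem locOne_center (y : M) (σ : OneForm m M) (u : 𝔼) :
    locOne y σ u (chartAt 𝔼 y y) = σ y u := by
  rw [locOne_chartAt (mem_chart_source 𝔼 y), framePull_self, frame_self]

theorem inFrame_eq {x y : M} (hy : y ∈ (chartAt 𝔼 x).source) (a : M → Weyl m) :
    inFrame x a y = framePull x y (a y) := by
  rw [inFrame, framePull]
  congr 1
  funext k
  exact extendVec_eq hy _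

/-- Smoothness at a point of a function with values in the Weyl algebra. -/
def SmoothWAt (A : EuclideanSpace ℝ (Fin m) → Weyl m) (p : EuclideanSpace ℝ (Fin m)) : Prop :=
  ∀ j α, ContDiffAt ℝ ∞ (fun q => coef j α (A q)) p

theorem SmoothWAt.diffW {A : 𝔼 → Weyl m} {p : 𝔼} (h : SmoothWAt A p) : DiffW A p :=
  fun j α => (h j α).differentiableAt (by simp)

theorem SmoothWAt.congr {A B : 𝔼 → Weyl m} {p : 𝔼} (h : SmoothWAt A p)
    (hAB : ∀ᶠ q in nhds p, B q = A q) : SmoothWAt B p := fun j α =>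
  (h j α).congr_of_eventuallyEq (hAB.mono fun q hq => by simp only [hq])

theorem SmoothWAt.sum {ι : Type*} {s : Finset ι} {A : ι → 𝔼 → Weyl m} {p : 𝔼}
    (h : ∀ i ∈ s, SmoothWAt (A i) p) : SmoothWAt (fun q => ∑ i ∈ s, A i q) p := fun j α => by
  have h1 : (fun q => coef j α (∑ i ∈ s, A i q)) = fun q => ∑ i ∈ s, coef j α (A i q) :=
    funext fun q => map_sum (coefL j α) _ s
  rw [h1]
  exact ContDiffAt.sum fun i hi => h i hi j α

theorem SmoothWAt.smul {c : 𝔼 → ℝ} {A : 𝔼 → Weyl m} {p : 𝔼} (hc : ContDiffAt ℝ ∞ c p)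
    (h : SmoothWAt A p) : SmoothWAt (fun q => (c q : ℂ) • A q) p := fun j α => by
  have h1 : (fun q => coef j α ((c q : ℂ) • A q)) = fun q => (c q : ℂ) * coef j α (A q) :=
    funext fun q => (coefL j α).map_smul _ _
  rw [h1]
  exact (Complex.ofRealCLM.contDiff.contDiffAt.comp p hc).mul (h j α)

theorem Weyl.SmoothW.smoothWAt {U : Set (EuclideanSpace ℝ (Fin m))} (hU : IsOpen U)
    {A : EuclideanSpace ℝ (Fin m) → Weyl m} (hA : SmoothW U A) {p : EuclideanSpace ℝ (Fin m)}
    (hp : p ∈ U) : SmoothWAt A p := fun j α => (hA j α p hp).contDiffAt (hU.mem_nhds hp)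

theorem smoothW_of_smoothWAt {U : Set (EuclideanSpace ℝ (Fin m))}
    {A : EuclideanSpace ℝ (Fin m) → Weyl m} (hA : ∀ p ∈ U, SmoothWAt A p) : SmoothW U A :=
  fun j α p hp => (hA p hp j α).contDiffWithinAt

theorem eventually_transDom {x y : M} (hy : y ∈ (chartAt 𝔼 x).source) {w : M}
    (hw : y ∈ (chartAt 𝔼 w).source) :
    ∀ᶠ q in nhds (chartAt 𝔼 x y), q ∈ transDom (m := m) x w :=
  (isOpen_transDom x w).mem_nhds (chartAt_mem_transDom hy hw)

theorem loc_eq_pull {x w : M} (a : M → Weyl m) {q : 𝔼} (hq : q ∈ transDom (m := m) x w) :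
    loc x a q = pull (fun k => fderiv ℝ (trans x w) q (basisVec k)) (loc w a (trans x w q)) := by
  have h1 := (chartAt 𝔼 x).map_target hq.1
  have e := (chartAt 𝔼 x).right_inv hq.1
  rw [loc, framePull_eq h1 hq.2, e, loc, trans, (chartAt 𝔼 w).left_inv hq.2]

theorem smoothWAt_loc_change {x w y : M} (hx : y ∈ (chartAt 𝔼 x).source)
    (hw : y ∈ (chartAt 𝔼 w).source) {a : M → Weyl m} (h : SmoothWAt (loc w a) (chartAt 𝔼 w y)) :
    SmoothWAt (loc x a) (chartAt 𝔼 x y) := by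
  have hd := chartAt_mem_transDom (m := m) hx hw
  have e : trans x w (chartAt 𝔼 x y) = chartAt 𝔼 w y := trans_chartAt hx
  rw [← e] at h
  refine SmoothWAt.congr (fun j β => ?_)
    ((eventually_transDom hx hw).mono fun q hq => loc_eq_pull a hq)
  exact contDiffAt_pull (fun k => contDiffAt_fderiv_trans hd _)
    (fun j α => (h j α).comp (chartAt 𝔼 x y) (contDiffAt_trans hd)) j β

/-- Smoothness at `y` is defined through the chart centered at `y`. Being able to test it in any
chart around `y` is what allows one fixed chart to be used on an open set. -/
theorem isSmoothAt_iff {a : M → Weyl m} {x y : M} (hx : y ∈ (chartAt 𝔼 x).source) :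
    IsSmoothAt a y ↔ SmoothWAt (loc x a) (chartAt 𝔼 x y) := by
  have hy := mem_chart_source 𝔼 y
  have h1 : IsSmoothAt a y ↔ SmoothWAt (loc y a) (chartAt 𝔼 y y) := by
    refine forall_congr' fun j => forall_congr' fun α => ?_
    refine (contMDiffAt_iff_chart (n := ⊤) hy).trans ?_
    have e : (fun p => coef j α (inFrame y a ((chartAt 𝔼 y).symm p))) =ᶠ[nhds (chartAt 𝔼 y y)]
        fun p => coef j α (loc y a p) := by
      filter_upwards [(chartAt 𝔼 y).open_target.mem_nhds (mem_chart_target 𝔼 y)] with p hp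
      rw [inFrame_eq ((chartAt 𝔼 y).map_target hp)]
      rfl
    exact ⟨fun h => h.congr_of_eventuallyEq e.symm, fun h => h.congr_of_eventuallyEq e⟩
  exact h1.trans ⟨smoothWAt_loc_change hx hy, smoothWAt_loc_change hy hx⟩

theorem IsSmoothSection.loc {a : M → Weyl m} (h : IsSmoothSection a) (x : M) :
    SmoothW (chartAt 𝔼 x).target (Fedosov.loc x a) :=
  smoothW_of_smoothWAt (forall_target fun y hy => (isSmoothAt_iff hy).1 (h y))

theorem isSmoothSection_of_loc {a : M → Weyl m}
    (h : ∀ x, SmoothWAt (loc x a) (chartAt 𝔼 x x)) : IsSmoothSection a := fun x =>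
  (isSmoothAt_iff (mem_chart_source 𝔼 x)).2 (h x)

theorem isLinearMap_frame {y : M} {s : TangentSpace (𝓡 m) y → Weyl m} (hs : IsLinearMap ℝ s)
    (w : M) : IsLinearMap ℝ fun v : EuclideanSpace ℝ (Fin m) => s (frame w y v) :=
  ⟨fun u v => (congrArg s (map_add (frame w y) u v)).trans (hs.map_add _ _),
    fun c v => (congrArg s (map_smul (frame w y) c v)).trans (hs.map_smul _ _)⟩

theorem isLinearMap_framePull (x y : M) {s : 𝔼 → Weyl m} (hs : IsLinearMap ℝ s) :
    IsLinearMap ℝ fun v => framePull x y (s v) :=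
  ⟨fun u v => by rw [hs.map_add, framePull_add],
    fun c v => by rw [hs.map_smul, real_smul_eq, framePull_smul, real_smul_eq]⟩

theorem isLinearMap_locOne (x : M) {σ : OneForm m M} (hσ : ∀ x, IsLinearMap ℝ (σ x)) (p : 𝔼) :
    IsLinearMap ℝ fun u => locOne x σ u p :=
  isLinearMap_framePull x _ (isLinearMap_frame (hσ _) x)

theorem locOne_sum (x : M) {σ : OneForm m M} (hσ : ∀ x, IsLinearMap ℝ (σ x)) (u p : 𝔼) :
    locOne x σ u p = ∑ i, (u i : ℂ) • locOne x σ (basisVec i) p :=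
  map_eq_sum_basisVec (isLinearMap_locOne x hσ p) u

/-- Smoothness of a form is only assumed on the frame fields of each chart. Constant fields of
another chart are combinations of these with derivatives of the transition map as smooth
coefficients. -/
theorem locOne_eq_sum {x w : M} {σ : OneForm m M} (hσ : ∀ x, IsLinearMap ℝ (σ x)) (u : 𝔼) {q : 𝔼}
    (hq : q ∈ transDom (m := m) x w) : locOne x σ u q =
      ∑ i, (fderiv ℝ (trans x w) q u i : ℂ) • loc x (fun z => σ z (frame w z (basisVec i))) q := by
  have h1 := (chartAt 𝔼 x).map_target hq.1
  have e := (chartAt 𝔼 x).right_inv hq.1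
  have h2 := frame_fderiv_trans h1 hq.2 u
  rw [e] at h2
  have h3 := isLinearMap_frame (hσ ((chartAt 𝔼 x).symm q)) w
  rw [locOne, ← h2]
  refine (congrArg _ (map_eq_sum_basisVec h3 _)).trans ?_
  rw [framePull_sum]
  exact Finset.sum_congr rfl fun i _ => framePull_smul ..

theorem IsSmoothOneForm.locOne {σ : OneForm m M} (h : IsSmoothOneForm σ) (x : M) (u : 𝔼) :
    SmoothW (chartAt 𝔼 x).target (Fedosov.locOne x σ u) := by
  refine smoothW_of_smoothWAt (forall_target fun y hy => ?_)
  have hs := mem_chart_source 𝔼 y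
  have hd := chartAt_mem_transDom (m := m) hy hs
  refine SmoothWAt.congr (SmoothWAt.sum fun i _ => SmoothWAt.smul
    (contDiffAt_euclidean.1 (contDiffAt_fderiv_trans hd u) i) ?_)
    ((eventually_transDom hy hs).mono fun q hq => locOne_eq_sum h.1 u hq)
  refine SmoothWAt.congr ((isSmoothAt_iff hy).1 (h.2 y (coordVec y i))) ?_
  filter_upwards [eventually_transDom hy hs] with q hq
  rw [Fedosov.loc, Fedosov.loc]
  congr 2
  exact (extendVec_eq hq.2 _).symm

theorem isSmoothOneForm_of_locOne {σ : OneForm m M} (hl : ∀ x, IsLinearMap ℝ (σ x))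
    (h : ∀ x u, SmoothWAt (locOne x σ u) (chartAt 𝔼 x x)) : IsSmoothOneForm σ := by
  refine ⟨hl, fun x v => (isSmoothAt_iff (mem_chart_source 𝔼 x)).2 ((h x v).congr ?_)⟩
  filter_upwards [(chartAt 𝔼 x).open_target.mem_nhds (mem_chart_target 𝔼 x)] with p hp
  exact congrArg (fun w => framePull x _ (σ _ w)) (extendVec_eq ((chartAt 𝔼 x).map_target hp) _)

/-- Weyl algebra valued functions with constant coefficients near a point of a chart. -/
theorem exists_section [T2Space M] {x y : M} (hy : y ∈ (chartAt 𝔼 x).source) (b : Weyl m) :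
    ∃ a : M → Weyl m, IsSmoothSection a ∧ ∀ᶠ q in nhds (chartAt 𝔼 x y), loc x a q = b := by
  obtain ⟨χ, hχ, h1, hs⟩ := exists_bump hy
  refine ⟨fun z => (χ z : ℂ) • coframePull x z b, fun z => ?_, ?_⟩
  · by_cases hz : z ∈ (chartAt 𝔼 x).source
    · rw [isSmoothAt_iff hz]
      have h2 : ContDiffAt ℝ ∞ (fun p => χ ((chartAt 𝔼 x).symm p)) (chartAt 𝔼 x z) :=
        (contMDiffAt_iff_chart (n := ⊤) hz).1 (hχ z)
      refine (SmoothWAt.smul h2 (A := fun _ => b) fun j α => contDiffAt_const).congr ?_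
      filter_upwards [(chartAt 𝔼 x).open_target.mem_nhds ((chartAt 𝔼 x).map_source hz)] with p hp
      rw [loc, framePull_smul, framePull_coframePull ((chartAt 𝔼 x).map_target hp)]
    · have hz' : z ∉ tsupport χ := fun h => hz (hs h)
      rw [isSmoothAt_iff (mem_chart_source 𝔼 z)]
      refine SmoothWAt.congr (A := fun _ => 0) (fun j α => contDiffAt_const) ?_
      filter_upwards [(tendsto_chart_symm (mem_chart_source 𝔼 z)).eventually
        ((isClosed_tsupport χ).isOpen_compl.mem_nhds hz')] with q hq
      have hq0 : χ ((chartAt 𝔼 z).symm q) = 0 := image_eq_zero_of_notMem_tsupport hq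
      rw [loc, hq0, Complex.ofReal_zero, zero_smul]
      exact (framePullL z _).map_zero
  · filter_upwards [(tendsto_chart_symm hy).eventually h1,
      (chartAt 𝔼 x).open_target.mem_nhds ((chartAt 𝔼 x).map_source hy)] with q hq hq'
    rw [loc, hq, Complex.ofReal_one, one_smul,
      framePull_coframePull ((chartAt 𝔼 x).map_target hq')]

/-! ### The connection in charts -/

theorem fiberDeriv_eq {x : M} (v : TangentSpace (𝓡 m) x) (a : Weyl m) :
    fiberDeriv v a = dirE (v : 𝔼) a :=
  (dirE_apply (m := m) v a).symm

theorem nabla_eq (conn : Connection m M) {a : M → Weyl m} {y : M}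
    (h : DiffW (loc y a) (chartAt 𝔼 y y)) (u : 𝔼) :
    nabla conn a y u = locNabla (christoffel conn y) u (loc y a) (chartAt 𝔼 y y) := by
  rw [locNabla, loc_center]
  refine congrArg₂ (fun a b : Weyl m => a - b) ?_ ?_
  · refine ext_coef fun j α => ?_
    rw [coef_dW, coef_ofCoef]
    have e : (fun p => coef j α (inFrame y a ((chartAt 𝔼 y).symm p))) =ᶠ[nhds (chartAt 𝔼 y y)]
        fun p => coef j α (loc y a p) := by
      filter_upwards [(chartAt 𝔼 y).open_target.mem_nhds (mem_chart_target 𝔼 y)] with p hp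
      rw [inFrame_eq ((chartAt 𝔼 y).map_target hp)]
      rfl
    refine (mfderiv_eq_chart (f := fun z => coef j α (inFrame y a z))
      ((h j α).congr_of_eventuallyEq e) u).trans ?_
    rw [e.fderiv_eq]
  · refine Finset.sum_congr rfl fun k _ => ?_
    rw [fiberDeriv_eq, christoffel_center]
    rfl

/-- The transformation law of the covariant derivative under a change of charts. -/
theorem locNabla_change (conn : Connection m M) {x y : M} (hy : y ∈ (chartAt 𝔼 x).source)
    {A B : 𝔼 → Weyl m} (hB : DiffW B (chartAt 𝔼 y y)) (hA : ∀ᶠ q in nhds (chartAt 𝔼 x y),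
      A q = pull (fun k => fderiv ℝ (trans x y) q (basisVec k)) (B (trans x y q))) (u : 𝔼) :
    locNabla (christoffel conn x) u A (chartAt 𝔼 x y) =
      framePull x y (locNabla (christoffel conn y) (frame x y u) B (chartAt 𝔼 y y)) := by
  have hs := mem_chart_source 𝔼 y
  have hd := chartAt_mem_transDom (m := m) hy hs
  have e : trans x y (chartAt 𝔼 x y) = chartAt 𝔼 y y := trans_chartAt hy
  have hL : ∀ k : Fin m, DifferentiableAt ℝ (fun q => fderiv ℝ (trans x y) q (basisVec k))
      (chartAt 𝔼 x y) := fun k => (contDiffAt_fderiv_trans hd _).differentiableAt (by simp)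
  have hτ : DifferentiableAt ℝ (trans x y) (chartAt 𝔼 x y) :=
    (contDiffAt_trans hd).differentiableAt (by simp)
  rw [← e] at hB
  have hA0 := hA.self_of_nhds
  rw [locNabla, dW_congr u hA, dW_pull (A := fun q => B (trans x y q))
    (L' := fun k => fderiv ℝ (fun q => fderiv ℝ (trans x y) q (basisVec k)) (chartAt 𝔼 x y) u)
    (fun k i => differentiableAt_euclidean.1 (hL k) i)
    (fun k i => congrArg (fun T : 𝔼 →L[ℝ] ℝ => T u) ((EuclideanSpace.proj i :
      𝔼 →L[ℝ] ℝ).hasFDerivAt.comp _ (hL k).hasFDerivAt).fderiv) (hB.comp hτ), dW_comp u hB hτ, hA0,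
    locNabla, framePull_sub, e, add_sub_assoc, sub_eq_add_neg]
  refine Eq.trans (congrArg (HAdd.hAdd _) ?_) (sub_eq_add_neg _ _).symm
  have hlin : IsLinearMap ℝ fun w => dirE (christoffel conn y (chartAt 𝔼 y y) (frame x y u) w)
      (B (chartAt 𝔼 y y)) := by
    have := isLinearMap_christoffel conn y _ ((chartAt 𝔼 y).map_source hs) (frame x y u)
    exact ⟨fun v w => by rw [this.map_add, dirE_add_left],
      fun c v => by rw [this.map_smul, dirE_smul_left, real_smul_eq]⟩
  have h3 := framePull_contract x y hlin
  rw [contract] at h3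
  rw [h3, contract, ← sub_eq_add_neg, sub_eq_iff_eq_add, neg_add_eq_sub, eq_sub_iff_add_eq,
    ← Finset.sum_add_distrib]
  refine Finset.sum_congr rfl fun k _ => ?_
  rw [← mul_add]
  congr 1
  change framePull x y _ + framePull x y _ = dirE _ (framePull x y _)
  -- The inhomogeneous term in the transformation law of the Christoffel symbols is exactly the
  -- derivative of the frame produced by `dW_pull`, so the covariant derivative has no correction
  -- left.
  rw [dirE_framePull, frame_christoffel_eq conn hy, dirE_add_left, framePull_add, add_comm]

/-- The covariant derivative of a section in a chart. -/
theorem locOne_nabla (conn : Connection m M) {a : M → Weyl m} {x y : M}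
    (hy : y ∈ (chartAt 𝔼 x).source) (h : IsSmoothAt a y) (u : 𝔼) :
    framePull x y (nabla conn a y (frame x y u)) =
      locNabla (christoffel conn x) u (loc x a) (chartAt 𝔼 x y) := by
  have hs := mem_chart_source 𝔼 y
  have hB := ((isSmoothAt_iff hs).1 h).diffW
  rw [nabla_eq conn hB, locNabla_change conn hy hB
    ((eventually_transDom hy hs).mono fun q hq => loc_eq_pull a hq)]

theorem locNabla_sum_smul (Γ : 𝔼 → 𝔼 → 𝔼 → 𝔼) (u : 𝔼) {ι : Type*} {s : Finset ι} {c : ι → 𝔼 → ℝ}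
    {A : ι → 𝔼 → Weyl m} {p : 𝔼} (hc : ∀ i ∈ s, DifferentiableAt ℝ (c i) p)
    (hA : ∀ i ∈ s, DiffW (A i) p) : locNabla Γ u (fun q => ∑ i ∈ s, (c i q : ℂ) • A i q) p =
      ∑ i ∈ s, ((fderiv ℝ (c i) p u : ℂ) • A i p + (c i p : ℂ) • locNabla Γ u (A i) p) := by
  rw [locNabla_sum Γ u (A := fun i q => (c i q : ℂ) • A i q) fun i hi =>
    DiffW.smul (differentiableAt_ofReal (hc i hi)) (hA i hi)]
  refine Finset.sum_congr rfl fun i hi => ?_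
  rw [locNabla_smul Γ u (differentiableAt_ofReal (hc i hi)) (hA i hi), fderiv_ofReal (hc i hi)]

theorem extendToOneForms_nabla_center (conn : Connection m M) {σ : OneForm m M}
    (h : IsSmoothOneForm σ) (y : M) (u v : 𝔼) : extendToOneForms (nabla conn) σ y u v =
      locNabla (christoffel conn y) u (locOne y σ v) (chartAt 𝔼 y y) -
        locNabla (christoffel conn y) v (locOne y σ u) (chartAt 𝔼 y y) := by
  have h1 : ∀ w : TangentSpace (𝓡 m) y, ∀ᶠ q in nhds (chartAt 𝔼 y y),
      loc y (fun z => σ z (extendVec w z)) q = locOne y σ w q := fun w => by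
    filter_upwards [(chartAt 𝔼 y).open_target.mem_nhds (mem_chart_target 𝔼 y)] with p hp
    exact congrArg (fun w => framePull y _ (σ _ w)) (extendVec_eq ((chartAt 𝔼 y).map_target hp) _)
  have h2 : ∀ w : TangentSpace (𝓡 m) y, ∀ u : 𝔼, nabla conn (fun z => σ z (extendVec w z)) y u =
      locNabla (christoffel conn y) u (locOne y σ w) (chartAt 𝔼 y y) := fun w u => by
    rw [nabla_eq conn ((isSmoothAt_iff (mem_chart_source 𝔼 y)).1 (h.2 y w)).diffW,
      locNabla_congr _ _ (h1 w)]
  have h3 : σ y (VectorField.mlieBracket (𝓡 m) (extendVec (x := y) u) (extendVec (x := y) v) y) = 0 :=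
    (congrArg (σ y) (mlieBracket_extendVec y u v)).trans (h.1 y).map_zero
  refine Eq.trans ?_ (congrArg₂ (fun a b : Weyl m => a - b) (h2 v u) (h2 u v))
  exact (congrArg (fun a : Weyl m => _ - a) h3).trans (sub_zero _)

/-- The exterior covariant derivative of a `1`-form in a chart. -/
theorem locTwo_extendToOneForms (conn : Connection m M) {σ : OneForm m M}
    (h : IsSmoothOneForm σ) {x y : M} (hy : y ∈ (chartAt 𝔼 x).source) (u v : 𝔼) :
    framePull x y (extendToOneForms (nabla conn) σ y (frame x y u) (frame x y v)) =
      locNabla (christoffel conn x) u (locOne x σ v) (chartAt 𝔼 x y) -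
        locNabla (christoffel conn x) v (locOne x σ u) (chartAt 𝔼 x y) := by
  have hs := mem_chart_source 𝔼 y
  have hd := chartAt_mem_transDom (m := m) hy hs
  have hd' := chartAt_mem_transDom (m := m) hs hy
  have e : trans y x (chartAt 𝔼 y y) = chartAt 𝔼 x y := trans_chartAt hs
  have hτ : DifferentiableAt ℝ (trans y x) (chartAt 𝔼 y y) :=
    (contDiffAt_trans hd').differentiableAt (by simp)
  have hσ : ∀ w, DiffW (locOne y σ w) (chartAt 𝔼 y y) := fun w =>
    (h.locOne y w).diffW (chartAt 𝔼 y).open_target (mem_chart_target 𝔼 y)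
  -- Constant fields of the chart at `x` have varying coefficients in the chart at `y`. Their
  -- derivative contributes `σ` at the second derivative of the transition map, which is symmetric
  -- in `u` and `v` and cancels in the antisymmetrized expression.
  have key : ∀ u v : 𝔼, locNabla (christoffel conn x) u (locOne x σ v) (chartAt 𝔼 x y) =
      framePull x y (σ y (fderiv ℝ (fun q => fderiv ℝ (trans x y) q v) (chartAt 𝔼 x y) u) +
        locNabla (christoffel conn y) (frame x y u) (locOne y σ (frame x y v))
          (chartAt 𝔼 y y)) := fun u v => by
    have hG : DifferentiableAt ℝ (fun p => fderiv ℝ (trans x y) p v)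
        (trans y x (chartAt 𝔼 y y)) := by
      rw [e]; exact (contDiffAt_fderiv_trans hd v).differentiableAt (by simp)
    have hg : DifferentiableAt ℝ (fun q => fderiv ℝ (trans x y) (trans y x q) v)
      (chartAt 𝔼 y y) := hG.comp _ hτ
    have hgi := differentiableAt_euclidean.1 hg
    rw [locNabla_change conn hy (B := fun q => ∑ i, (fderiv ℝ (trans x y) (trans y x q) v i : ℂ) •
      locOne y σ (basisVec i) q) (DiffW.sum fun i _ => DiffW.smul (differentiableAt_ofReal (hgi i))
        (hσ _)), locNabla_sum_smul _ _ (c := fun i q => fderiv ℝ (trans x y) (trans y x q) v i)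
          (fun i _ => hgi i) (fun i _ => hσ _), Finset.sum_add_distrib]
    · congr 2
      · have h2 : ∀ i, fderiv ℝ (fun q => fderiv ℝ (trans x y) (trans y x q) v i) (chartAt 𝔼 y y)
            (frame x y u) = fderiv ℝ (fun q => fderiv ℝ (trans x y) q v) (chartAt 𝔼 x y) u i :=
              fun i => by
          refine (congrArg (fun T : 𝔼 →L[ℝ] ℝ => T (frame x y u)) ((EuclideanSpace.proj i :
            𝔼 →L[ℝ] ℝ).hasFDerivAt.comp _ hg.hasFDerivAt).fderiv).trans ?_
          have h3 := congrArg (fun T : 𝔼 →L[ℝ] 𝔼 => T (frame x y u))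
            (hG.hasFDerivAt.comp (chartAt 𝔼 y y) hτ.hasFDerivAt).fderiv
          refine (congrArg (fun w : 𝔼 => w i) h3).trans ?_
          rw [e]
          change fderiv ℝ (fun p => fderiv ℝ (trans x y) p v) (chartAt 𝔼 x y)
            (coframe x y (frame x y u)) i = _
          rw [coframe_frame hy]
        refine Eq.trans ?_ (map_eq_sum_basisVec (h.1 y) _).symm
        exact Finset.sum_congr rfl fun i _ => by rw [h2, locOne_center]
      · have h4 : locOne y σ (frame x y v) = fun q => ∑ i, (frame x y v i : ℂ) •
            locOne y σ (basisVec i) q := funext fun q => locOne_sum y h.1 _ q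
        rw [h4, locNabla_sum_smul _ _ (c := fun i _ => frame x y v i)
          (fun i _ => differentiableAt_const _) (fun i _ => hσ _)]
        refine Finset.sum_congr rfl fun i _ => ?_
        rw [e, fderiv_fun_const]
        simp [frame]
    · filter_upwards [eventually_transDom hy hs] with q hq
      rw [locOne_eq_sum h.1 v hq, trans_trans hq]
      have h5 : ∀ i, loc x (fun z => σ z (frame y z (basisVec i))) q =
          pull (fun k => fderiv ℝ (trans x y) q (basisVec k))
            (locOne y σ (basisVec i) (trans x y q)) := fun i => loc_eq_pull _ hq
      rw [← pullL_apply, map_sum]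
      refine Finset.sum_congr rfl fun i _ => ?_
      rw [map_smul, pullL_apply, h5]
  rw [key, key, extendToOneForms_nabla_center conn h, fderiv_fderiv_trans_symm hd u v,
    ← framePull_sub, add_sub_add_left_eq_sub]

end Fedosov

namespace Fedosov

namespace Weyl

variable {m : ℕ}

local notation "𝔼" => EuclideanSpace ℝ (Fin m)

/-! ### Components of a given degree -/

/-- The component of degree `n` vanishes. -/
def ZeroIn (n : ℕ) (a : Weyl m) : Prop := ∀ j α, α.degree + 2 * j = n → coef j α a = 0

theorem ZeroIn.add {n : ℕ} {a b : Weyl m} (ha : ZeroIn n a) (hb : ZeroIn n b) :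
    ZeroIn n (a + b) := fun j α h => by rw [coef_add, ha j α h, hb j α h, add_zero]

theorem ZeroIn.sub {n : ℕ} {a b : Weyl m} (ha : ZeroIn n a) (hb : ZeroIn n b) :
    ZeroIn n (a - b) := fun j α h => by rw [coef_sub, ha j α h, hb j α h, sub_zero]

theorem ZeroIn.smul {n : ℕ} {a : Weyl m} (c : ℂ) (ha : ZeroIn n a) : ZeroIn n (c • a) :=
  fun j α h => by rw [coef_smul, ha j α h, mul_zero]

theorem ZeroIn.sum {n : ℕ} {ι : Type*} {s : Finset ι} {a : ι → Weyl m}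
    (ha : ∀ i ∈ s, ZeroIn n (a i)) : ZeroIn n (∑ i ∈ s, a i) := fun j α h => by
  rw [coef_sum]
  exact Finset.sum_eq_zero fun i hi => ha i hi j α h

theorem ZeroIn.partialE {n : ℕ} {a : Weyl m} (k : Fin m) (ha : ZeroIn (n + 1) a) :
    ZeroIn n (partialE k a) := fun j α h => by
  rw [coef_partialE, ha j _ (by rw [map_add, Finsupp.degree_single]; omega), zero_mul]

theorem ZeroIn.dirE {n : ℕ} {a : Weyl m} (u : 𝔼) (ha : ZeroIn (n + 1) a) :
    ZeroIn n (dirE u a) := by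
  rw [dirE_apply]
  exact ZeroIn.sum fun k _ => (ha.partialE k).smul _

theorem ZeroIn.gen_mul {n : ℕ} {a : Weyl m} (k : Fin m)
    (ha : ∀ i, i + 1 = n → ZeroIn i a) : ZeroIn n (gen k * a) := fun j α h => by
  rw [coef_gen_mul]
  split_ifs with hk
  · have h1 := congrArg Finsupp.degree (tsub_add_cancel_of_le hk)
    rw [map_add, Finsupp.degree_single] at h1
    exact ha (n - 1) (by omega) j _ (by omega)
  · rfl

theorem ZeroIn.conW {n : ℕ} {a : Weyl m} (G : Fin m → 𝔼) (ha : ZeroIn n a) :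
    ZeroIn n (conW G a) :=
  ZeroIn.sum fun l _ => ZeroIn.gen_mul l fun i hi => ZeroIn.dirE _ (by rwa [hi])

theorem ZeroIn.pull {n : ℕ} {a : Weyl m} (L : Fin m → 𝔼) (ha : ZeroIn n a) :
    ZeroIn n (pull L a) := fun j β h => by
  rw [coef_pull]
  refine Finset.sum_eq_zero fun α hα => ?_
  rw [ha j α (by rw [mem_degSet.1 hα, h]), zero_mul]

theorem isHomogeneous_iff {n : ℕ} {a : Weyl m} :
    IsHomogeneous n a ↔ ∀ k, k ≠ n → ZeroIn k a := by
  constructor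
  · intro h k hk j α hα
    by_contra h0
    exact hk (hα.symm.trans (h j α h0))
  · intro h j α h0
    by_contra hα
    exact h0 (h _ hα j α rfl)

theorem zeroIn_formalSum {c : ℕ → Weyl m} (hc : ∀ k, IsHomogeneous (k + 2) (c k)) (k : ℕ) :
    ZeroIn (k + 2) (formalSum c - c k) := fun j α h => by
  rw [coef_sub, coef_formalSum_of_homogeneous hc h, sub_self]

/-- Differentiation acts on each coefficient separately and the Christoffel term preserves the
degree, so one component of the argument determines the same component of the result. -/
theorem ZeroIn.locNabla {n : ℕ} {A B : 𝔼 → Weyl m} {p : 𝔼}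
    (h : ∀ᶠ q in nhds p, ZeroIn n (A q - B q))
    (Γ : 𝔼 → 𝔼 → 𝔼 → 𝔼) (u : 𝔼) : ZeroIn n (locNabla Γ u A p - locNabla Γ u B p) := by
  have h1 : Weyl.locNabla Γ u A p - Weyl.locNabla Γ u B p =
      (dW u A p - dW u B p) - Weyl.conW (fun l => Γ p u (basisVec l)) (A p - B p) := by
    rw [locNabla_eq, locNabla_eq, conW_sub]
    abel
  rw [h1]
  refine ZeroIn.sub (fun j α hα => ?_) (h.self_of_nhds.conW _)
  have h2 : (fun q => coef j α (A q)) =ᶠ[nhds p] fun q => coef j α (B q) := h.mono fun q hq => by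
    have := hq j α hα
    rwa [coef_sub, sub_eq_zero] at this
  rw [coef_sub, coef_dW, coef_dW, h2.fderiv_eq, sub_self]

theorem locNabla_zero (Γ : 𝔼 → 𝔼 → 𝔼 → 𝔼) (u p : 𝔼) : locNabla Γ u (fun _ => 0) p = 0 := by
  rw [locNabla, dW_const]
  simp

theorem InFil.locNabla {n : ℕ} {A : 𝔼 → Weyl m} {p : 𝔼} (h : ∀ᶠ q in nhds p, InFil n (A q))
    (Γ : 𝔼 → 𝔼 → 𝔼 → 𝔼) (u : 𝔼) : InFil n (Weyl.locNabla Γ u A p) := fun j α hα => by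
  have h2 := ZeroIn.locNabla (A := A) (B := fun _ => 0) (n := α.degree + 2 * j)
    (h.mono fun q hq j' α' h' => by rw [sub_zero]; exact hq j' α' (by omega)) Γ u j α rfl
  rwa [locNabla_zero, sub_zero] at h2

theorem IsHomogeneous.pull {n : ℕ} {a : Weyl m} (L : Fin m → 𝔼) (ha : IsHomogeneous n a) :
    IsHomogeneous n (pull L a) :=
  isHomogeneous_iff.2 fun k hk => (isHomogeneous_iff.1 ha k hk).pull L

theorem IsHomogeneous.locNabla {n : ℕ} {A : 𝔼 → Weyl m} (h : ∀ q, IsHomogeneous n (A q))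
    (Γ : 𝔼 → 𝔼 → 𝔼 → 𝔼) (u p : 𝔼) : IsHomogeneous n (Weyl.locNabla Γ u A p) := by
  refine isHomogeneous_iff.2 fun k hk => ?_
  have h1 := ZeroIn.locNabla (A := A) (B := fun _ => 0) (n := k)
    (Filter.Eventually.of_forall fun q => by
      rw [sub_zero]; exact isHomogeneous_iff.1 (h q) k hk) Γ u (p := p)
  rwa [locNabla_zero, sub_zero] at h1

theorem eq_zero_of_isHomogeneous {n : ℕ} {a : Weyl m} (h : IsHomogeneous n a) (h' : ZeroIn n a) :
    a = 0 := ext_coef fun j α => by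
  by_contra h0
  exact h0 (h' j α (h j α h0))

theorem eq_zero_of_bracket_gen {P : Matrix (Fin m) (Fin m) ℝ} (hP : P.transpose = -P)
    (hdet : IsUnit P.det) {a : Weyl m} (h : ∀ k, bracket P a (gen k) = 0)
    (h0 : ∀ j, coef j 0 a = 0) : a = 0 :=
  eq_zero_of_partialE (partialE_eq_zero_of_bracket_gen hP hdet h) h0

theorem isLinearMap_dW (A : 𝔼 → Weyl m) (p : 𝔼) : IsLinearMap ℝ fun u => dW u A p :=
  ⟨fun u v => ext_coef fun j α => by simp only [coef_add, coef_dW, map_add],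
    fun c u => ext_coef fun j α => by
      rw [real_smul_eq, coef_smul, coef_dW, coef_dW, map_smul, Complex.real_smul]⟩

theorem isLinearMap_dirE (a : Weyl m) : IsLinearMap ℝ fun u : 𝔼 => dirE u a :=
  ⟨fun u v => dirE_add_left u v a, fun c u => by rw [dirE_smul_left, real_smul_eq]⟩

theorem isLinearMap_locNabla {Γ : 𝔼 → 𝔼 → 𝔼 → 𝔼} {p : 𝔼}
    (hΓ : ∀ v, IsLinearMap ℝ fun u => Γ p u v) (A : 𝔼 → Weyl m) :
    IsLinearMap ℝ fun u => locNabla Γ u A p := by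
  constructor
  · intro u v
    simp only [locNabla, (isLinearMap_dW A p).map_add, (hΓ _).map_add, dirE_add_left, mul_add,
      Finset.sum_add_distrib]
    abel
  · intro c u
    simp only [locNabla, (isLinearMap_dW A p).map_smul, (hΓ _).map_smul, dirE_smul_left,
      mul_smul_comm, smul_sub, Finset.smul_sum, real_smul_eq]

theorem isLinearMap_bracket (P : Matrix (Fin m) (Fin m) ℝ) {σ : 𝔼 → Weyl m}
    (hσ : IsLinearMap ℝ σ) (a : Weyl m) : IsLinearMap ℝ fun u => bracket P (σ u) a :=
  ⟨fun u v => by rw [hσ.map_add, bracket_add_left],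
    fun c u => by rw [hσ.map_smul, real_smul_eq, bracket_smul_left, real_smul_eq]⟩

theorem isLinearMap_formalSum {σ : ℕ → 𝔼 → Weyl m} (hσ : ∀ k, IsLinearMap ℝ (σ k)) :
    IsLinearMap ℝ fun u => formalSum fun k => σ k u :=
  ⟨fun u v => ext_coef fun j α => by
      simp only [coef_add, coef_formalSum, (hσ _).map_add, Finset.sum_add_distrib],
    fun c u => ext_coef fun j α => by
      simp only [coef_formalSum, (hσ _).map_smul, real_smul_eq, coef_smul, Finset.mul_sum]⟩

theorem isLinearMap_add {σ τ : 𝔼 → Weyl m} (hσ : IsLinearMap ℝ σ) (hτ : IsLinearMap ℝ τ) :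
    IsLinearMap ℝ fun u => σ u + τ u :=
  ⟨fun u v => by rw [hσ.map_add, hτ.map_add]; abel,
    fun c u => by rw [hσ.map_smul, hτ.map_smul, smul_add]⟩

theorem isLinearMap_sub {σ τ : 𝔼 → Weyl m} (hσ : IsLinearMap ℝ σ) (hτ : IsLinearMap ℝ τ) :
    IsLinearMap ℝ fun u => σ u - τ u :=
  ⟨fun u v => by rw [hσ.map_add, hτ.map_add]; abel,
    fun c u => by rw [hσ.map_smul, hτ.map_smul, smul_sub]⟩

end Weyl

variable {m : ℕ} {M : Type*} [TopologicalSpace M] [ChartedSpace (EuclideanSpace ℝ (Fin m)) M]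

local notation "𝔼" => EuclideanSpace ℝ (Fin m)

open Weyl

variable [IsManifold (𝓡 m) ∞ M]

/-! ### Curvature in charts -/

theorem riemann_eq [T2Space M] (conn : Connection m M) [conn.ContMDiffCovariantDerivative ∞]
    (y : M) (u v w : 𝔼) : riemann conn y u v w =
      locRiem (christoffel conn y) u v w (chartAt 𝔼 y y) := by
  have hs := mem_chart_source 𝔼 y
  have h1 : ∀ u v : 𝔼, cov conn (fun z => conn (extendVec (x := y) w) z (extendVec (x := y) v z)) y u
      = christoffel conn y (chartAt 𝔼 y y) u (christoffel conn y (chartAt 𝔼 y y) v w) +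
        fderiv ℝ (fun q => christoffel conn y q v w) (chartAt 𝔼 y y) u := fun u v => by
    have e : (fun p => christoffel conn y (chartAt 𝔼 y ((chartAt 𝔼 y).symm p)) v w)
        =ᶠ[nhds (chartAt 𝔼 y y)] fun p => christoffel conn y p v w := by
      filter_upwards [(chartAt 𝔼 y).open_target.mem_nhds (mem_chart_target 𝔼 y)] with p hp
      rw [(chartAt 𝔼 y).right_inv hp]
    have hd : DifferentiableAt ℝ (fun p => christoffel conn y p v w) (chartAt 𝔼 y y) :=
      ((contDiffOn_christoffel conn y v w _ (mem_chart_target 𝔼 y)).contDiffAt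
        ((chartAt 𝔼 y).open_target.mem_nhds (mem_chart_target 𝔼 y))).differentiableAt (by simp)
    rw [cov_of_eventuallyEq conn (g := fun z => christoffel conn y (chartAt 𝔼 y z) v w)
      (hd.congr_of_eventuallyEq e), e.fderiv_eq]
    · rw [christoffel_center, christoffel_center]
    filter_upwards [eventually_mem_source hs] with z hz
    rw [frame_christoffel conn hz]
    exact congrArg (fun V => conn (extendVec (x := y) w) z V) (extendVec_eq hz _)
  have h2 : cov conn (extendVec (x := y) w) y
      (VectorField.mlieBracket (𝓡 m) (extendVec (x := y) u) (extendVec (x := y) v) y) = 0 :=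
    (congrArg (cov conn (extendVec (x := y) w) y) (mlieBracket_extendVec y u v)).trans
      (map_zero (conn (extendVec (x := y) w) y))
  refine (congrArg₂ (fun a b : 𝔼 => a - b) (congrArg₂ (fun a b : 𝔼 => a - b) (h1 u v) (h1 v u))
    h2).trans ?_
  rw [locRiem, sub_zero]
  abel

theorem curvatureForm_center [T2Space M] (Ω : SymplecticForm m M) (conn : Connection m M)
    [conn.ContMDiffCovariantDerivative ∞] (y : M) (u v : 𝔼) :
    curvatureForm Ω conn y u v =
      LocalGeometry.curv (poissonMat Ω y) (christoffel conn y) u v (chartAt 𝔼 y y) := by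
  rw [LocalGeometry.curv, quadratic, poissonMat, Matrix.nonsing_inv_nonsing_inv _
    (isUnit_det_symplMat Ω y _ (mem_chart_target 𝔼 y))]
  refine Finset.sum_congr rfl fun k _ => Finset.sum_congr rfl fun l _ => ?_
  have h := formV_eq_sum Ω (mem_chart_source 𝔼 y) (basisVec k)
    (locRiem (christoffel conn y) u v (basisVec l) (chartAt 𝔼 y y))
  rw [frame_self, frame_self, Finset.sum_eq_single k (by intro b _ hb; simp [hb]) (by simp)] at h
  simp only [EuclideanSpace.single_apply, if_true, one_mul] at h
  rw [← h, ← riemann_eq]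
  rfl

section

variable [T2Space M] {Ω : SymplecticForm m M} {conn : Connection m M}
  [conn.ContMDiffCovariantDerivative ∞]

theorem isLinearMap_nabla (ht : conn.torsion = 0) (hs : IsSymplecticConnection Ω conn)
    {a : M → Weyl m} {y : M} (h : IsSmoothAt a y) : IsLinearMap ℝ (nabla conn a y) := by
  have h1 : nabla conn a y = fun u : 𝔼 =>
      locNabla (christoffel conn y) u (loc y a) (chartAt 𝔼 y y) :=
    funext fun u => nabla_eq conn ((isSmoothAt_iff (mem_chart_source 𝔼 y)).1 h).diffW u
  rw [h1]
  exact isLinearMap_locNabla ((localGeometry ht hs y).linear_left (mem_chart_target 𝔼 y)) _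

theorem IsSmoothSection.nabla (ht : conn.torsion = 0) (hs : IsSymplecticConnection Ω conn)
    {a : M → Weyl m} (h : IsSmoothSection a) : IsSmoothOneForm (nabla conn a) := by
  refine isSmoothOneForm_of_locOne (fun x => isLinearMap_nabla ht hs (h x)) fun x u => ?_
  refine ((SmoothW.locNabla (chartAt 𝔼 x).open_target (contDiffOn_christoffel conn x)
    (h.loc x) u).smoothWAt (chartAt 𝔼 x).open_target (mem_chart_target 𝔼 x)).congr ?_
  filter_upwards [(chartAt 𝔼 x).open_target.mem_nhds (mem_chart_target 𝔼 x)] with p hp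
  revert p
  refine forall_target fun y hy => ?_
  rw [locOne_chartAt hy, locOne_nabla conn hy (h y)]

theorem extend_nabla_nabla (ht : conn.torsion = 0) (hs : IsSymplecticConnection Ω conn)
    {a : M → Weyl m} (h : IsSmoothSection a) {x y : M} (hy : y ∈ (chartAt 𝔼 x).source) (u v : 𝔼) :
    framePull x y (extendToOneForms (nabla conn) (nabla conn a) y (frame x y u) (frame x y v)) =
      bracket (poissonMat Ω x (chartAt 𝔼 x y))
        (LocalGeometry.curv (poissonMat Ω x) (christoffel conn x) u v (chartAt 𝔼 x y))
        (loc x a (chartAt 𝔼 x y)) := by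
  have hp := (chartAt 𝔼 x).map_source hy
  have h1 : ∀ u, ∀ᶠ q in nhds (chartAt 𝔼 x y), locOne x (nabla conn a) u q =
      locNabla (christoffel conn x) u (loc x a) q := fun u => by
    filter_upwards [(chartAt 𝔼 x).open_target.mem_nhds hp] with p hp
    revert p
    refine forall_target fun y hy => ?_
    rw [locOne_chartAt hy, locOne_nabla conn hy (h y)]
  rw [locTwo_extendToOneForms conn (h.nabla ht hs) hy, locNabla_congr _ _ (h1 v),
    locNabla_congr _ _ (h1 u)]
  exact (localGeometry ht hs x).locNabla_comm_curv (h.loc x) hp u v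

/-- The curvature in a chart. -/
theorem framePull_curvatureForm (ht : conn.torsion = 0) (hs : IsSymplecticConnection Ω conn)
    {x y : M} (hy : y ∈ (chartAt 𝔼 x).source) (u v : 𝔼) :
    framePull x y (curvatureForm Ω conn y (frame x y u) (frame x y v)) =
      LocalGeometry.curv (poissonMat Ω x) (christoffel conn x) u v (chartAt 𝔼 x y) := by
  have hp := (chartAt 𝔼 x).map_source hy
  rw [← sub_eq_zero]
  -- The transformation of the curvature is not computed. Both sides have the same bracket with each
  -- generator, because both express the square of `∇` on a section equal to that generator near the
  -- point, and neither has a part free of generators.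
  refine eq_zero_of_bracket_gen ((localGeometry ht hs x).antisymm _ hp)
    ((localGeometry ht hs x).isUnit _ hp) (fun k => ?_) fun j => ?_
  · obtain ⟨a, ha, ha'⟩ := exists_section hy (gen k : Weyl m)
    have h1 := extend_nabla_nabla ht hs ha hy u v
    have h2 := extend_nabla_nabla ht hs ha (mem_chart_source 𝔼 y) (frame x y u) (frame x y v)
    rw [← curvatureForm_center, framePull_self, frame_self, frame_self, loc_center,
      poissonMat_center] at h2
    rw [h2, framePull_bracket Ω hy, ← loc_chartAt hy, ha'.self_of_nhds] at h1
    rw [bracket_sub_left, h1, sub_self]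
  · rw [coef_sub, framePull, coef_zero_pull, LocalGeometry.curv, coef_zero_quadratic,
      curvatureForm_center, LocalGeometry.curv, coef_zero_quadratic, sub_zero]

end

/-! ### The connection `D` in charts -/

/-- The sum of a sequence of `1`-forms of increasing degrees. -/
def totalForm (ρ : ℕ → OneForm m M) : OneForm m M := fun x v => formalSum fun k => ρ k x v

/-- A sequence of smooth `1`-forms of degrees `k + 2`. -/
structure IsGraded (ρ : ℕ → OneForm m M) : Prop where
  smooth : ∀ k, IsSmoothOneForm (ρ k)
  homogeneous : ∀ k x v, Weyl.IsHomogeneous (k + 2) (ρ k x v)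

theorem locOne_totalForm (ρ : ℕ → OneForm m M) (x : M) (u p : 𝔼) :
    locOne x (totalForm ρ) u p = formalSum fun k => locOne x (ρ k) u p :=
  framePull_formalSum _ _ _

theorem IsGraded.totalForm {ρ : ℕ → OneForm m M} (h : IsGraded ρ) :
    IsSmoothOneForm (totalForm ρ) := by
  refine isSmoothOneForm_of_locOne (fun x => isLinearMap_formalSum fun k => (h.smooth k).1 x)
    fun x u => ?_
  have h1 : locOne x (Fedosov.totalForm ρ) u = fun p => formalSum fun k => locOne x (ρ k) u p :=
    funext fun p => locOne_totalForm ρ x u p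
  rw [h1]
  exact (SmoothW.formalSum fun k => (h.smooth k).locOne x u).smoothWAt
    (chartAt 𝔼 x).open_target (mem_chart_target 𝔼 x)

theorem fedosovD_eq (Ω : SymplecticForm m M) (conn : Connection m M) {ρ : ℕ → OneForm m M}
    (h : IsGraded ρ) (a : M → Weyl m) (x : M) (v : 𝔼) :
    fedosovD conn (fun k => adOp Ω (ρ k)) a x v =
      nabla conn a x v - dirE v (a x) + bracket (Ω.poissonMatrix x) (totalForm ρ x v) (a x) := by
  have h1 : (formalSum fun k => adOp Ω (ρ k) a x v) =
      bracket (Ω.poissonMatrix x) (totalForm ρ x v) (a x) :=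
    formalSum_bracket _ (fun k => h.homogeneous k x v) (a x)
  have h2 : fedosovD conn (fun k => adOp Ω (ρ k)) a x v = -fiberDeriv (x := x) v (a x) +
    (nabla conn a x v + formalSum fun k => adOp Ω (ρ k) a x v) := rfl
  refine h2.trans ((congrArg₂ (fun a b : Weyl m => -a + (_ + b)) (fiberDeriv_eq (x := x) v _)
    h1).trans ?_)
  abel

theorem framePull_fedosovD (Ω : SymplecticForm m M) (conn : Connection m M) {ρ : ℕ → OneForm m M}
    (h : IsGraded ρ) {a : M → Weyl m} {x y : M} (hy : y ∈ (chartAt 𝔼 x).source)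
    (ha : IsSmoothAt a y) (u : 𝔼) :
    framePull x y (fedosovD conn (fun k => adOp Ω (ρ k)) a y (frame x y u)) =
      locD (poissonMat Ω x) (christoffel conn x) (locOne x (totalForm ρ)) u (loc x a)
        (chartAt 𝔼 x y) := by
  rw [fedosovD_eq Ω conn h, framePull_add, framePull_sub, locOne_nabla conn hy ha,
    framePull_bracket Ω hy, ← dirE_framePull, locD, locE, loc_chartAt hy, locOne_chartAt hy]

section

variable [T2Space M] {Ω : SymplecticForm m M} {conn : Connection m M}
  [conn.ContMDiffCovariantDerivative ∞] {ρ : ℕ → OneForm m M}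

theorem isSmoothOneForm_fedosovD (ht : conn.torsion = 0) (hs : IsSymplecticConnection Ω conn)
    (h : IsGraded ρ) {a : M → Weyl m} (ha : IsSmoothSection a) :
    IsSmoothOneForm (fedosovD conn (fun k => adOp Ω (ρ k)) a) := by
  refine isSmoothOneForm_of_locOne (fun x => ?_) fun x u => ?_
  · have h1 : fedosovD conn (fun k => adOp Ω (ρ k)) a x = fun v : 𝔼 => nabla conn a x v -
        dirE v (a x) + bracket (Ω.poissonMatrix x) (totalForm ρ x v) (a x) :=
      funext fun v => fedosovD_eq Ω conn h a x v
    rw [h1]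
    exact isLinearMap_add (isLinearMap_sub (isLinearMap_nabla ht hs (ha x)) (isLinearMap_dirE _))
      (isLinearMap_bracket _ (h.totalForm.1 x) _)
  · refine (((localGeometry ht hs x).smoothW_locD (h.totalForm.locOne x) (ha.loc x) u).smoothWAt
      (chartAt 𝔼 x).open_target (mem_chart_target 𝔼 x)).congr ?_
    filter_upwards [(chartAt 𝔼 x).open_target.mem_nhds (mem_chart_target 𝔼 x)] with p hp
    revert p
    refine forall_target fun y hy => ?_
    rw [locOne_chartAt hy, framePull_fedosovD Ω conn h hy (ha y)]

/-- The form `R - δ ρ + ∇ ρ + (i / t) ρ ∘ ρ` for `ρ = ∑ k, ρ k`. -/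
def totalCurvature (Ω : SymplecticForm m M) (conn : Connection m M) (ρ : ℕ → OneForm m M) :
    TwoForm m M := fun x u v => curvatureForm Ω conn x u v +
  (extendToOneForms (nabla conn) (totalForm ρ) x u v - delta₁ (totalForm ρ) x u v) +
    bracket (Ω.poissonMatrix x) (totalForm ρ x u) (totalForm ρ x v)

theorem delta₁_eq (σ : OneForm m M) (y : M) (u v : 𝔼) :
    delta₁ σ y u v = dirE u (σ y v) - dirE v (σ y u) :=
  congrArg₂ (fun a b : Weyl m => a - b) (fiberDeriv_eq (x := y) u _) (fiberDeriv_eq (x := y) v _)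

theorem totalCurvature_eq (Ω : SymplecticForm m M) (conn : Connection m M) (ρ : ℕ → OneForm m M)
    (y : M) (u v : 𝔼) : totalCurvature Ω conn ρ y u v = curvatureForm Ω conn y u v +
      (extendToOneForms (nabla conn) (totalForm ρ) y u v - delta₁ (totalForm ρ) y u v) +
        bracket (Ω.poissonMatrix y) (totalForm ρ y u) (totalForm ρ y v) := rfl

theorem framePull_totalCurvature (ht : conn.torsion = 0) (hs : IsSymplecticConnection Ω conn)
    (h : IsGraded ρ) {x y : M} (hy : y ∈ (chartAt 𝔼 x).source) (u v : 𝔼) :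
    framePull x y (totalCurvature Ω conn ρ y (frame x y u) (frame x y v)) =
      locOmega (poissonMat Ω x) (christoffel conn x) (locOne x (totalForm ρ)) u v
        (chartAt 𝔼 x y) := by
  rw [totalCurvature_eq, framePull_add, framePull_add, framePull_sub, framePull_bracket Ω hy,
    framePull_curvatureForm ht hs hy, locTwo_extendToOneForms conn h.totalForm hy, delta₁_eq,
    framePull_sub, ← dirE_framePull, ← dirE_framePull, ← locOne_chartAt hy, ← locOne_chartAt hy,
    locOmega, locE, locE]
  abel

theorem totalCurvature_center (ht : conn.torsion = 0) (hs : IsSymplecticConnection Ω conn)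
    (h : IsGraded ρ) (y : M) (u v : 𝔼) : totalCurvature Ω conn ρ y u v =
      locOmega (poissonMat Ω y) (christoffel conn y) (locOne y (totalForm ρ)) u v
        (chartAt 𝔼 y y) := by
  have h1 := framePull_totalCurvature ht hs h (mem_chart_source 𝔼 y) u v
  rwa [framePull_self, frame_self, frame_self] at h1

theorem extend_fedosovD (ht : conn.torsion = 0) (hs : IsSymplecticConnection Ω conn)
    (h : IsGraded ρ) {σ : OneForm m M} (hσ : IsSmoothOneForm σ) (y : M) (u v : 𝔼) :
    extendToOneForms (fedosovD conn fun k => adOp Ω (ρ k)) σ y u v =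
      locD (poissonMat Ω y) (christoffel conn y) (locOne y (totalForm ρ)) u (locOne y σ v)
        (chartAt 𝔼 y y) -
      locD (poissonMat Ω y) (christoffel conn y) (locOne y (totalForm ρ)) v (locOne y σ u)
        (chartAt 𝔼 y y) := by
  have hy := mem_chart_source 𝔼 y
  have h1 : ∀ w : TangentSpace (𝓡 m) y, ∀ᶠ q in nhds (chartAt 𝔼 y y),
      loc y (fun z => σ z (extendVec w z)) q = locOne y σ w q := fun w => by
    filter_upwards [(chartAt 𝔼 y).open_target.mem_nhds (mem_chart_target 𝔼 y)] with p hp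
    exact congrArg (fun w => framePull y _ (σ _ w)) (extendVec_eq ((chartAt 𝔼 y).map_target hp) _)
  have h2 : ∀ w : TangentSpace (𝓡 m) y, ∀ u : 𝔼,
      fedosovD conn (fun k => adOp Ω (ρ k)) (fun z => σ z (extendVec w z)) y u =
      locD (poissonMat Ω y) (christoffel conn y) (locOne y (totalForm ρ)) u (locOne y σ w)
        (chartAt 𝔼 y y) := fun w u => by
    have h3 := framePull_fedosovD Ω conn h hy (hσ.2 y w) u
    rw [framePull_self, frame_self] at h3
    rw [h3, locD, locD, locE_congr _ _ (h1 w), (h1 w).self_of_nhds]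
  have h3 : σ y (VectorField.mlieBracket (𝓡 m) (extendVec (x := y) u) (extendVec (x := y) v) y) = 0 :=
    (congrArg (σ y) (mlieBracket_extendVec y u v)).trans (hσ.1 y).map_zero
  refine Eq.trans ?_ (congrArg₂ (fun a b : Weyl m => a - b) (h2 v u) (h2 u v))
  exact (congrArg (fun a : Weyl m => _ - a) h3).trans (sub_zero _)

theorem extend_fedosovD_fedosovD (ht : conn.torsion = 0) (hs : IsSymplecticConnection Ω conn)
    (h : IsGraded ρ) {a : M → Weyl m} (ha : IsSmoothSection a) (y : M) (u v : 𝔼) :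
    extendToOneForms (fedosovD conn fun k => adOp Ω (ρ k))
      (fedosovD conn (fun k => adOp Ω (ρ k)) a) y u v =
        bracket (Ω.poissonMatrix y) (totalCurvature Ω conn ρ y u v) (a y) := by
  have h1 : ∀ u, ∀ᶠ q in nhds (chartAt 𝔼 y y),
      locOne y (fedosovD conn (fun k => adOp Ω (ρ k)) a) u q =
        locD (poissonMat Ω y) (christoffel conn y) (locOne y (totalForm ρ)) u (loc y a) q :=
      fun u => by
    filter_upwards [(chartAt 𝔼 y).open_target.mem_nhds (mem_chart_target 𝔼 y)] with p hp
    revert p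
    refine forall_target fun z hz => ?_
    rw [locOne_chartAt hz, framePull_fedosovD Ω conn h hz (ha z)]
  rw [extend_fedosovD ht hs h (isSmoothOneForm_fedosovD ht hs h ha)]
  rw [locD, locD, locE_congr _ _ (h1 u), locE_congr _ _ (h1 v), (h1 u).self_of_nhds,
    (h1 v).self_of_nhds, ← locD, ← locD, (localGeometry ht hs y).locD_comm (h.totalForm.locOne y)
      (ha.loc y) (mem_chart_target 𝔼 y), loc_center, poissonMat_center,
    totalCurvature_center ht hs h]

/-! ### The components of the curvature -/

theorem zeroIn_extend (h : IsGraded ρ) (k : ℕ) (y : M) (u v : 𝔼) :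
    ZeroIn (k + 2) (extendToOneForms (nabla conn) (totalForm ρ) y u v -
      extendToOneForms (nabla conn) (ρ k) y u v) := by
  rw [extendToOneForms_nabla_center conn h.totalForm, extendToOneForms_nabla_center conn (h.smooth k),
    sub_sub_sub_comm]
  have h1 : ∀ v q, ZeroIn (k + 2) (locOne y (totalForm ρ) v q - locOne y (ρ k) v q) :=
    fun v q => by
      rw [locOne, locOne, ← framePull_sub]
      exact (zeroIn_formalSum (fun k => h.homogeneous k _ _) k).pull _
  exact (ZeroIn.locNabla (Filter.Eventually.of_forall (h1 v)) _ _).sub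
    (ZeroIn.locNabla (Filter.Eventually.of_forall (h1 u)) _ _)

theorem isHomogeneous_extend {σ : OneForm m M} (hσ : IsSmoothOneForm σ) {n : ℕ}
    (h : ∀ x v, IsHomogeneous n (σ x v)) (y : M) (u v : 𝔼) :
    IsHomogeneous n (extendToOneForms (nabla conn) σ y u v) := by
  rw [extendToOneForms_nabla_center conn hσ]
  exact (IsHomogeneous.locNabla (fun q => (h _ _).pull _) _ _ _).sub
    (IsHomogeneous.locNabla (fun q => (h _ _).pull _) _ _ _)

theorem isHomogeneous_curvatureForm (y : M) (u v : 𝔼) :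
    IsHomogeneous 2 (curvatureForm Ω conn y u v) := by
  rw [curvatureForm_center]
  exact isHomogeneous_quadratic _ _

theorem isHomogeneous_fedosovSource (h : IsGraded ρ) (k : ℕ) (y : M) (u v : 𝔼) :
    IsHomogeneous (k + 2) (fedosovSource Ω conn ρ k y u v) := by
  refine IsHomogeneous.add (IsHomogeneous.add ?_
    (isHomogeneous_extend (h.smooth k) (h.homogeneous k) y u v)) ?_
  · split_ifs with hk
    · subst hk
      exact isHomogeneous_curvatureForm y u v
    · exact IsHomogeneous.zero _
  · refine IsHomogeneous.sum fun p hp => ?_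
    refine IsHomogeneous.bracket _ (h.homogeneous _ _ _) (h.homogeneous _ _ _) ?_
    have := Finset.HasAntidiagonal.mem_antidiagonal.1 hp
    omega

theorem isHomogeneous_curvatureLift (h : IsGraded ρ) (k : ℕ) (y : M) (u v : 𝔼) :
    IsHomogeneous (k + 2) (curvatureLift Ω conn ρ k y u v) := by
  refine IsHomogeneous.sub (isHomogeneous_fedosovSource h k y u v) ?_
  rw [delta₁_eq]
  exact ((h.homogeneous (k + 1) _ _).dirE _).sub ((h.homogeneous (k + 1) _ _).dirE _)

/-- Here the degrees are matched: `∇` preserves the degree, `δ` lowers it by one and so involves `ρ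
(k + 1)`, and the bracket of parts of degrees `p + 2` and `q + 2` has degree `p + q + 2`. The
equation in degree `k + 2` thus expresses `δ ρ (k + 1)` through forms of index at most `k`. -/
theorem zeroIn_totalCurvature_sub (h : IsGraded ρ) (k : ℕ) (y : M) (u v : 𝔼) :
    ZeroIn (k + 2) (totalCurvature Ω conn ρ y u v - curvatureLift Ω conn ρ k y u v) := by
  have h1 : curvatureLift Ω conn ρ k y u v =
      (if k = 0 then curvatureForm Ω conn else 0) y u v +
        extendToOneForms (nabla conn) (ρ k) y u v +
        ∑ p ∈ Finset.HasAntidiagonal.antidiagonal k,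
          bracket (Ω.poissonMatrix y) (ρ p.1 y u) (ρ p.2 y v) - delta₁ (ρ (k + 1)) y u v := rfl
  have h2 : totalCurvature Ω conn ρ y u v - curvatureLift Ω conn ρ k y u v =
      (curvatureForm Ω conn y u v - (if k = 0 then curvatureForm Ω conn else 0) y u v) +
      (extendToOneForms (nabla conn) (totalForm ρ) y u v -
        extendToOneForms (nabla conn) (ρ k) y u v) -
      (delta₁ (totalForm ρ) y u v - delta₁ (ρ (k + 1)) y u v) +
      (bracket (Ω.poissonMatrix y) (totalForm ρ y u) (totalForm ρ y v) -
        ∑ p ∈ Finset.HasAntidiagonal.antidiagonal k,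
          bracket (Ω.poissonMatrix y) (ρ p.1 y u) (ρ p.2 y v)) := by
    rw [h1, totalCurvature_eq]
    abel
  rw [h2]
  refine ZeroIn.add (ZeroIn.sub (ZeroIn.add ?_ (zeroIn_extend h k y u v)) ?_) fun j α hα => ?_
  · split_ifs with hk
    · rw [sub_self]
      exact fun j α _ => coef_zero j α
    · refine ZeroIn.sub (isHomogeneous_iff.1 (isHomogeneous_curvatureForm y u v) _ (by omega)) ?_
      exact fun j α _ => coef_zero j α
  · rw [delta₁_eq, delta₁_eq, sub_sub_sub_comm, ← map_sub, ← map_sub]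
    exact ((zeroIn_formalSum (fun k => h.homogeneous k _ _) (k + 1)).dirE u).sub
      ((zeroIn_formalSum (fun k => h.homogeneous k _ _) (k + 1)).dirE v)
  · rw [coef_sub, sub_eq_zero]
    exact coef_bracket_formalSum _ (fun k => h.homogeneous k y u) (fun k => h.homogeneous k y v) hα

/-- With `ρ 0 = 0` the form starts in degree `3`. Bracketing with it therefore raises the degree by
at least one. -/
theorem inFil_totalForm (h : IsGraded ρ) (h0 : ρ 0 = 0) (y : M) (u : 𝔼) :
    InFil 3 (totalForm ρ y u) := by
  have h1 := formalSum_sub_inFil (fun k => h.homogeneous k y u) 1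
  rw [Finset.sum_range_one, h0] at h1
  exact (sub_zero (totalForm ρ y u)) ▸ h1

/-- No component lies below degree `2`, so the lifts indexed by `k ≥ 0`, of degrees `k + 2`,
together account for the whole curvature. -/
theorem inFil_totalCurvature (h : IsGraded ρ) (h0 : ρ 0 = 0) (y : M) (u v : 𝔼) :
    InFil 2 (totalCurvature Ω conn ρ y u v) := by
  refine InFil.add (InFil.add (isHomogeneous_curvatureForm y u v).inFil (InFil.sub ?_ ?_))
    (InFil.bracket _ (inFil_totalForm h h0 y u) (inFil_totalForm h h0 y v) (by norm_num))
  · rw [extendToOneForms_nabla_center conn h.totalForm]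
    have h1 : ∀ u v : 𝔼, InFil 2 (locNabla (christoffel conn y) u (locOne y (totalForm ρ) v)
        (chartAt 𝔼 y y)) := fun u v => InFil.locNabla (Filter.Eventually.of_forall fun q =>
      InFil.pull _ ((inFil_totalForm h h0 _ _).mono (by norm_num))) _ _
    exact (h1 u v).sub (h1 v u)
  · rw [delta₁_eq]
    exact ((inFil_totalForm h h0 y v).dirE u).sub ((inFil_totalForm h h0 y u).dirE v)

theorem totalCurvature_eq_zero_iff (h : IsGraded ρ) (h0 : ρ 0 = 0) :
    (∀ y u v, totalCurvature Ω conn ρ y u v = 0) ↔ ∀ k, curvatureLift Ω conn ρ k = 0 := by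
  constructor
  · intro hz k
    funext y u v
    refine eq_zero_of_isHomogeneous (isHomogeneous_curvatureLift h k y u v) fun j α hα => ?_
    have := zeroIn_totalCurvature_sub (Ω := Ω) (conn := conn) h k y u v j α hα
    rw [hz y u v, zero_sub, coef_neg, neg_eq_zero] at this
    exact this
  · intro hz y u v
    refine ext_coef fun j α => ?_
    by_cases hα : α.degree + 2 * j < 2
    · rw [inFil_totalCurvature h h0 y u v j α hα, coef_zero]
    · have := zeroIn_totalCurvature_sub (Ω := Ω) (conn := conn) h (α.degree + 2 * j - 2) y u v j α
        (by omega)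
      rw [hz] at this
      exact ((congrArg (coef j α) (sub_zero (totalCurvature Ω conn ρ y u v))).symm.trans
        this).trans (coef_zero j α).symm

/-- A sequence of forms is a Fedosov potential if and only if the curvature vanishes. -/
theorem isFedosovPotential_iff (ht : conn.torsion = 0) (hs : IsSymplecticConnection Ω conn) :
    IsFedosovPotential Ω conn ρ ↔ ρ 0 = 0 ∧ IsGraded ρ ∧ (∀ k, deltaStar₁ (ρ k) = 0) ∧
      ∀ y u v, totalCurvature Ω conn ρ y u v = 0 := by
  constructor
  · intro hρ
    have hg : IsGraded ρ := ⟨hρ.smooth, hρ.homogeneous⟩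
    refine ⟨hρ.zero, hg, hρ.deltaStar, fun y u v => ?_⟩
    have hp := mem_chart_target 𝔼 y
    have hanti := (localGeometry ht hs y).antisymm _ hp
    have hunit := (localGeometry ht hs y).isUnit _ hp
    rw [poissonMat_center] at hanti hunit
    -- Flatness tested on sections that equal a generator near `y` shows that the curvature is
    -- central; the normalization takes care of the central part.
    refine eq_zero_of_bracket_gen hanti hunit (fun k => ?_) fun j => ?_
    · obtain ⟨a, ha, ha'⟩ := exists_section (mem_chart_source 𝔼 y) (gen k : Weyl m)
      have h1 := extend_fedosovD_fedosovD ht hs hg ha y u v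
      rw [hρ.flat a ha] at h1
      have h2 := ha'.self_of_nhds
      rw [loc_center] at h2
      rw [h2] at h1
      exact h1.symm
    -- A central term `t ^ j` has degree `2 * j`, hence belongs to the component `k = 2 * j - 2` if
    -- `j ≥ 1`. For `j = 0` it lies below degree `2`, where the curvature vanishes anyway.
    · by_cases hj : j = 0
      · subst hj
        exact inFil_totalCurvature hg hρ.zero y u v 0 0 (by simp)
      · have h1 := zeroIn_totalCurvature_sub (Ω := Ω) (conn := conn) hg (2 * j - 2) y u v j 0
          (by rw [map_zero]; omega)
        rwa [coef_sub, hρ.normalized, sub_zero] at h1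
  · rintro ⟨h0, hg, hd, hz⟩
    refine ⟨h0, hg.smooth, hg.homogeneous, hd, fun a ha => ?_, fun k x u v j => ?_⟩
    · funext y u v
      rw [extend_fedosovD_fedosovD ht hs hg ha y u v, hz]
      exact LinearMap.map_zero₂ (bracketL (Ω.poissonMatrix y)) (a y)
    · rw [(totalCurvature_eq_zero_iff hg h0).1 hz k]
      exact coef_zero j 0

end

end Fedosov

/-! ### The recursion for the forms `ρ k`: uniqueness, then vanishing of the curvature -/

namespace Fedosov

namespace Weyl

variable {m : ℕ}

local notation "𝔼" => EuclideanSpace ℝ (Fin m)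

theorem ZeroIn.contract {n : ℕ} {σ : 𝔼 → Weyl m} (h : ∀ u, ZeroIn n (σ u)) :
    ZeroIn (n + 1) (contract σ) :=
  ZeroIn.sum fun k _ => ZeroIn.gen_mul k fun i hi => by
    obtain rfl : i = n := by omega
    exact h _

theorem ZeroIn.divDegree {n : ℕ} {a : Weyl m} (c : ℕ) (h : ZeroIn n a) :
    ZeroIn n (divDegree c a) := fun j α hα => by rw [coef_divDegree, h j α hα, zero_div]

theorem gen_mul_divDegree (k : Fin m) (a : Weyl m) :
    gen k * divDegree 1 a = divDegree 0 (gen k * a) := ext_coef fun j α => by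
  rw [coef_divDegree, coef_gen_mul, coef_gen_mul]
  split_ifs with hk
  · have h1 := congrArg Finsupp.degree (tsub_add_cancel_of_le hk)
    rw [map_add, Finsupp.degree_single] at h1
    rw [coef_divDegree, h1, add_zero]
  · rw [zero_div]

/-- This is `δ*δ* = 0`: the symmetric products of generators are contracted with an antisymmetric
form. It gives the condition `δ*ρ = 0` for forms defined by `δ⁻¹`. -/
theorem contract_divDegree_contract {τ : 𝔼 → 𝔼 → Weyl m} (h : ∀ u v, τ v u = -τ u v) :
    contract (fun v => divDegree 1 (contract fun w => τ w v)) = 0 := by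
  simp only [contract, gen_mul_divDegree, Finset.mul_sum]
  simp only [← divDegreeL_apply]
  rw [← map_sum]
  have h1 : ∑ k : Fin m, ∑ l : Fin m, gen k * (gen l * τ (basisVec l) (basisVec k)) =
      -∑ k : Fin m, ∑ l : Fin m, gen k * (gen l * τ (basisVec l) (basisVec k)) := by
    conv_lhs => rw [Finset.sum_comm]
    rw [← Finset.sum_neg_distrib]
    refine Finset.sum_congr rfl fun k _ => ?_
    rw [← Finset.sum_neg_distrib]
    refine Finset.sum_congr rfl fun l _ => ?_
    rw [h (basisVec l) (basisVec k)]
    ring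
  have h2 : ∑ k : Fin m, ∑ l : Fin m, gen k * (gen l * τ (basisVec l) (basisVec k)) = 0 :=
    ext_coef fun j α => by
      have h3 := congrArg (coef j α) h1
      rw [coef_neg] at h3
      rw [self_eq_neg.1 h3, coef_zero]
  rw [h2, map_zero]

theorem InFil.of_add_cyclic {n : ℕ} {a b c a' b' c' : Weyl m} (h : a + b + c = 0)
    (h' : InFil n (a + a' + (b + b') + (c + c'))) : InFil n (a' + b' + c') := by
  have e : a + a' + (b + b') + (c + c') = (a + b + c) + (a' + b' + c') := by abel
  rwa [e, h, zero_add] at h'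

theorem locRiem_swap (Γ : 𝔼 → 𝔼 → 𝔼 → 𝔼) (u v w p : 𝔼) :
    locRiem Γ v u w p = -locRiem Γ u v w p := by
  rw [locRiem, locRiem]
  abel

theorem divDegree_zero (c : ℕ) : divDegree c (0 : Weyl m) = 0 := (divDegreeL c).map_zero

theorem isLinearMap_divDegree (c : ℕ) {σ : 𝔼 → Weyl m} (h : IsLinearMap ℝ σ) :
    IsLinearMap ℝ fun u => divDegree c (σ u) :=
  ⟨fun u v => by rw [h.map_add]; exact (divDegreeL c).map_add _ _,
    fun r u => by rw [h.map_smul, real_smul_eq, real_smul_eq]; exact (divDegreeL c).map_smul _ _⟩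

theorem isLinearMap_contract {τ : 𝔼 → 𝔼 → Weyl m} (h : ∀ u, IsLinearMap ℝ (τ u)) :
    IsLinearMap ℝ fun v => contract fun u => τ u v :=
  ⟨fun u v => by simp only [contract, (h _).map_add, mul_add, Finset.sum_add_distrib],
    fun c u => by simp only [contract, (h _).map_smul, mul_smul_comm, Finset.smul_sum]⟩

theorem isLinearMap_neg {σ : 𝔼 → Weyl m} (hσ : IsLinearMap ℝ σ) : IsLinearMap ℝ fun u => -σ u :=
  ⟨fun u v => by rw [hσ.map_add]; abel, fun c u => by rw [hσ.map_smul, smul_neg]⟩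

theorem isLinearMap_sum {ι : Type*} {s : Finset ι} {σ : ι → 𝔼 → Weyl m}
    (hσ : ∀ i ∈ s, IsLinearMap ℝ (σ i)) : IsLinearMap ℝ fun u => ∑ i ∈ s, σ i u :=
  ⟨fun u v => by
      rw [← Finset.sum_add_distrib]
      exact Finset.sum_congr rfl fun i hi => (hσ i hi).map_add u v,
    fun c u => by
      rw [Finset.smul_sum]
      exact Finset.sum_congr rfl fun i hi => (hσ i hi).map_smul c u⟩

theorem isLinearMap_comp_dirE (v : 𝔼) {σ : 𝔼 → Weyl m} (hσ : IsLinearMap ℝ σ) :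
    IsLinearMap ℝ fun u => dirE v (σ u) :=
  ⟨fun u v => by rw [hσ.map_add, map_add],
    fun c u => by rw [hσ.map_smul, real_smul_eq, (dirE v).map_smul, real_smul_eq]⟩

theorem LocalGeometry.isLinearMap_curl {U : Set 𝔼} {P : 𝔼 → Matrix (Fin m) (Fin m) ℝ}
    {Γ : 𝔼 → 𝔼 → 𝔼 → 𝔼} (h : LocalGeometry U P Γ) {σ : 𝔼 → 𝔼 → Weyl m}
    (hl : ∀ q ∈ U, IsLinearMap ℝ fun u => σ u q) (hs : ∀ u, SmoothW U (σ u)) {p : 𝔼} (hp : p ∈ U)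
    (v : 𝔼) : IsLinearMap ℝ fun u => locNabla Γ u (σ v) p - locNabla Γ v (σ u) p := by
  refine isLinearMap_sub (isLinearMap_locNabla (h.linear_left hp) _) ⟨fun u w => ?_, fun c u => ?_⟩
  · rw [← locNabla_add Γ v ((hs u).diffW h.isOpen hp) ((hs w).diffW h.isOpen hp)]
    refine locNabla_congr Γ v ?_
    filter_upwards [h.isOpen.mem_nhds hp] with q hq
    exact (hl q hq).map_add u w
  · have h1 := locNabla_smul Γ v (c := fun _ => (c : ℂ)) (differentiableAt_const _)
      ((hs u).diffW h.isOpen hp)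
    rw [fderiv_fun_const] at h1
    rw [real_smul_eq]
    refine Eq.trans (locNabla_congr Γ v ?_) (h1.trans (by simp))
    filter_upwards [h.isOpen.mem_nhds hp] with q hq
    rw [(hl q hq).map_smul, real_smul_eq]

end Weyl

variable {m : ℕ} {M : Type*} [TopologicalSpace M] [ChartedSpace (EuclideanSpace ℝ (Fin m)) M]

local notation "𝔼" => EuclideanSpace ℝ (Fin m)

open Weyl

variable [IsManifold (𝓡 m) ∞ M]

section

variable [T2Space M] {Ω : SymplecticForm m M} {conn : Connection m M}
  [conn.ContMDiffCovariantDerivative ∞] {ρ : ℕ → OneForm m M}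

theorem isLinearMap_extend (ht : conn.torsion = 0) (hs : IsSymplecticConnection Ω conn)
    {σ : OneForm m M} (hσ : IsSmoothOneForm σ) (y : M) (v : 𝔼) :
    IsLinearMap ℝ fun u : 𝔼 => extendToOneForms (nabla conn) σ y u v := by
  have h1 : (fun u : 𝔼 => extendToOneForms (nabla conn) σ y u v) = fun u =>
      locNabla (christoffel conn y) u (locOne y σ v) (chartAt 𝔼 y y) -
        locNabla (christoffel conn y) v (locOne y σ u) (chartAt 𝔼 y y) :=
    funext fun u => extendToOneForms_nabla_center conn hσ y u v
  rw [h1]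
  exact (localGeometry ht hs y).isLinearMap_curl (fun q _ => isLinearMap_locOne y hσ.1 q)
    (hσ.locOne y) (mem_chart_target 𝔼 y) v

theorem extend_swap {σ : OneForm m M} (hσ : IsSmoothOneForm σ) (y : M) (u v : 𝔼) :
    extendToOneForms (nabla conn) σ y v u = -extendToOneForms (nabla conn) σ y u v := by
  rw [extendToOneForms_nabla_center conn hσ, extendToOneForms_nabla_center conn hσ, neg_sub]

theorem curvatureForm_swap (y : M) (u v : 𝔼) :
    curvatureForm Ω conn y v u = -curvatureForm Ω conn y u v := by
  have h1 : ∀ w, riemann conn y v u w = (-riemann conn y u v w : 𝔼) := fun w => by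
    exact (riemann_eq conn y v u w).trans ((locRiem_swap _ u v w _).trans
      (congrArg (fun a : 𝔼 => -a) (riemann_eq conn y u v w)).symm)
  have h2 : ∀ k l, Ω.form y (coordVec y k) (riemann conn y v u (coordVec y l)) =
      -Ω.form y (coordVec y k) (riemann conn y u v (coordVec y l)) := fun k l =>
    (congrArg (Ω.form y (coordVec y k)) (h1 _)).trans (map_neg (Ω.form y (coordVec y k)) _)
  have h3 : ∀ u v : 𝔼, curvatureForm Ω conn y u v = ∑ k, ∑ l,
      ((Ω.form y (coordVec y k) (riemann conn y u v (coordVec y l)) / 2 : ℝ) : ℂ) •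
        (gen k * gen l) := fun u v => rfl
  rw [h3, h3, ← Finset.sum_neg_distrib]
  refine Finset.sum_congr rfl fun k _ => ?_
  rw [← Finset.sum_neg_distrib]
  refine Finset.sum_congr rfl fun l _ => ?_
  rw [h2, neg_div, Complex.ofReal_neg, neg_smul]

/-- The curvature is defined through extensions of vectors, which hides linearity. The commutator of
covariant derivatives is visibly linear, so the defect of linearity is central; it has no part free
of generators, hence vanishes. -/
theorem isLinearMap_curvatureForm (ht : conn.torsion = 0) (hs : IsSymplecticConnection Ω conn)
    (y : M) (v : 𝔼) : IsLinearMap ℝ fun u : 𝔼 => curvatureForm Ω conn y u v := by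
  have hp := mem_chart_target 𝔼 y
  have hG := localGeometry ht hs y
  have key : ∀ {a : Weyl m}, (∀ b, bracket (poissonMat Ω y (chartAt 𝔼 y y)) a b = 0) →
      (∀ j, coef j 0 a = 0) → a = 0 := fun h h0 =>
    eq_zero_of_bracket_gen (hG.antisymm _ hp) (hG.isUnit _ hp) (fun k => h (gen k)) h0
  have hl : ∀ b, IsLinearMap ℝ fun u : 𝔼 => bracket (poissonMat Ω y (chartAt 𝔼 y y))
      (curvatureForm Ω conn y u v) b := fun b => by
    have h1 := hG.isLinearMap_curl (σ := fun u q => locNabla (christoffel conn y) u (fun _ => b) q)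
      (fun q hq => isLinearMap_locNabla (hG.linear_left hq) _)
      (fun u => SmoothW.locNabla hG.isOpen hG.smoothΓ (SmoothW.const b) u) hp v
    refine (congrArg (IsLinearMap ℝ) (funext fun u => ?_)).mp h1
    rw [hG.locNabla_comm_curv (SmoothW.const b) hp, curvatureForm_center]
  have h0 : ∀ u : 𝔼, ∀ j, coef j 0 (curvatureForm Ω conn y u v) = 0 := fun u j => by
    rw [curvatureForm_center]
    exact coef_zero_quadratic _ _ _
  constructor
  · intro u w
    rw [← sub_eq_zero]
    refine key (fun b => ?_) fun j => ?_
    · rw [bracket_sub_left, bracket_add_left, (hl b).map_add, sub_self]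
    · rw [coef_sub, coef_add, h0, h0, h0]
      simp
  · intro c u
    rw [real_smul_eq, ← sub_eq_zero]
    refine key (fun b => ?_) fun j => ?_
    · rw [bracket_sub_left, bracket_smul_left, (hl b).map_smul, real_smul_eq, sub_self]
    · rw [coef_sub, coef_smul, h0, h0]
      simp

theorem fedosovSource_eq (Ω : SymplecticForm m M) (conn : Connection m M) (ρ : ℕ → OneForm m M)
    (k : ℕ) (y : M) (u v : 𝔼) : fedosovSource Ω conn ρ k y u v =
      (if k = 0 then curvatureForm Ω conn y u v else 0) +
        extendToOneForms (nabla conn) (ρ k) y u v +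
        ∑ p ∈ Finset.HasAntidiagonal.antidiagonal k,
          bracket (Ω.poissonMatrix y) (ρ p.1 y u) (ρ p.2 y v) := by
  by_cases hk : k = 0
  · rw [if_pos hk, fedosovSource, if_pos hk]; rfl
  · rw [if_neg hk, fedosovSource, if_neg hk]; rfl

theorem sum_bracket_swap (P : Matrix (Fin m) (Fin m) ℝ) (k : ℕ) (f g : ℕ → Weyl m) :
    ∑ p ∈ Finset.HasAntidiagonal.antidiagonal k, bracket P (g p.1) (f p.2) =
      -∑ p ∈ Finset.HasAntidiagonal.antidiagonal k, bracket P (f p.1) (g p.2) := by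
  rw [← Finset.Nat.sum_antidiagonal_swap, ← Finset.sum_neg_distrib]
  exact Finset.sum_congr rfl fun p _ => bracket_swap P _ _

theorem fedosovSource_swap (h : IsGraded ρ) (k : ℕ) (y : M) (u v : 𝔼) :
    fedosovSource Ω conn ρ k y v u = -fedosovSource Ω conn ρ k y u v := by
  rw [fedosovSource_eq, fedosovSource_eq, extend_swap (h.smooth k),
    sum_bracket_swap _ k (fun i => ρ i y u) (fun i => ρ i y v), curvatureForm_swap y u v]
  split_ifs <;> abel

theorem isLinearMap_fedosovSource (ht : conn.torsion = 0) (hs : IsSymplecticConnection Ω conn)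
    (h : IsGraded ρ) (k : ℕ) (y : M) (v : 𝔼) :
    IsLinearMap ℝ fun u : 𝔼 => fedosovSource Ω conn ρ k y u v := by
  simp only [fedosovSource_eq]
  refine isLinearMap_add (isLinearMap_add ?_ (isLinearMap_extend ht hs (h.smooth k) y v))
    (isLinearMap_sum fun p _ => isLinearMap_bracket _ ((h.smooth p.1).1 y) _)
  split_ifs
  · exact isLinearMap_curvatureForm ht hs y v
  · exact ⟨fun _ _ => (add_zero _).symm, fun _ _ => (smul_zero _).symm⟩

theorem isLinearMap_fedosovSource_right (ht : conn.torsion = 0)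
    (hs : IsSymplecticConnection Ω conn) (h : IsGraded ρ) (k : ℕ) (y : M) (u : 𝔼) :
    IsLinearMap ℝ fun v : 𝔼 => fedosovSource Ω conn ρ k y u v := by
  have h1 : (fun v : 𝔼 => fedosovSource Ω conn ρ k y u v) = fun v =>
      -fedosovSource Ω conn ρ k y v u := funext fun v => fedosovSource_swap h k y v u
  rw [h1]
  exact isLinearMap_neg (isLinearMap_fedosovSource ht hs h k y u)

theorem framePull_fedosovSource (ht : conn.torsion = 0) (hs : IsSymplecticConnection Ω conn)
    (h : IsGraded ρ) (k : ℕ) {x y : M} (hy : y ∈ (chartAt 𝔼 x).source) (u v : 𝔼) :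
    framePull x y (fedosovSource Ω conn ρ k y (frame x y u) (frame x y v)) =
      (if k = 0 then LocalGeometry.curv (poissonMat Ω x) (christoffel conn x) u v (chartAt 𝔼 x y)
        else 0) +
      (locNabla (christoffel conn x) u (locOne x (ρ k) v) (chartAt 𝔼 x y) -
        locNabla (christoffel conn x) v (locOne x (ρ k) u) (chartAt 𝔼 x y)) +
      ∑ p ∈ Finset.HasAntidiagonal.antidiagonal k, bracket (poissonMat Ω x (chartAt 𝔼 x y))
        (locOne x (ρ p.1) u (chartAt 𝔼 x y)) (locOne x (ρ p.2) v (chartAt 𝔼 x y)) := by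
  rw [fedosovSource_eq, framePull_add, framePull_add, framePull_sum,
    locTwo_extendToOneForms conn (h.smooth k) hy]
  simp only [framePull_bracket Ω hy, ← locOne_chartAt hy]
  congr 2
  split_ifs
  · exact framePull_curvatureForm ht hs hy u v
  · exact (framePullL x y).map_zero

/-- The forms given by the recursion formula are smooth. -/
theorem isSmoothOneForm_deltaInv₂_fedosovSource (ht : conn.torsion = 0)
    (hs : IsSymplecticConnection Ω conn) (h : IsGraded ρ) (k : ℕ) :
    IsSmoothOneForm (deltaInv₂ (fedosovSource Ω conn ρ k)) := by
  have h0 : ∀ y (v : 𝔼), deltaInv₂ (fedosovSource Ω conn ρ k) y v =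
      divDegree 1 (contract fun w => fedosovSource Ω conn ρ k y w v) := fun y v => rfl
  refine isSmoothOneForm_of_locOne (fun y => isLinearMap_divDegree 1
    (isLinearMap_contract (isLinearMap_fedosovSource_right ht hs h k y))) fun x u => ?_
  have hG := localGeometry ht hs x
  have h2 : ∀ w : 𝔼, SmoothW (chartAt 𝔼 x).target fun p =>
      (if k = 0 then LocalGeometry.curv (poissonMat Ω x) (christoffel conn x) w u p else 0) +
      (locNabla (christoffel conn x) w (locOne x (ρ k) u) p -
        locNabla (christoffel conn x) u (locOne x (ρ k) w) p) +
      ∑ q ∈ Finset.HasAntidiagonal.antidiagonal k, bracket (poissonMat Ω x p)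
        (locOne x (ρ q.1) w p) (locOne x (ρ q.2) u p) := fun w => by
    refine SmoothW.add (SmoothW.add ?_ (SmoothW.sub
      (SmoothW.locNabla hG.isOpen hG.smoothΓ ((h.smooth k).locOne x u) w)
      (SmoothW.locNabla hG.isOpen hG.smoothΓ ((h.smooth k).locOne x w) u)))
      (SmoothW.sum fun q _ => SmoothW.bracket hG.isOpen hG.smoothP ((h.smooth q.1).locOne x w)
        ((h.smooth q.2).locOne x u))
    split_ifs
    · exact hG.smoothW_curv w u
    · exact SmoothW.const 0
  refine (SmoothW.smoothWAt hG.isOpen (SmoothW.divDegree hG.isOpen (SmoothW.sum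
    (s := Finset.univ) fun i _ => SmoothW.gen_mul hG.isOpen (h2 (basisVec i)) i) 1)
      (mem_chart_target 𝔼 x)).congr ?_
  filter_upwards [(chartAt 𝔼 x).open_target.mem_nhds (mem_chart_target 𝔼 x)] with p hp
  revert p
  refine forall_target fun y hy => ?_
  rw [locOne_chartAt hy, h0, framePull_divDegree,
    framePull_contract x y (isLinearMap_fedosovSource ht hs h k y _), contract]
  simp only [framePull_fedosovSource ht hs h k hy]

theorem isHomogeneous_deltaInv₂_fedosovSource (h : IsGraded ρ) (k : ℕ) (y : M) (v : 𝔼) :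
    IsHomogeneous (k + 1 + 2) (deltaInv₂ (fedosovSource Ω conn ρ k) y v) :=
  (IsHomogeneous.contract (σ := fun w => fedosovSource Ω conn ρ k y w v) fun w =>
    isHomogeneous_fedosovSource h k y w v).divDegree 1

theorem deltaStar₁_deltaInv₂_fedosovSource (h : IsGraded ρ) (k : ℕ) :
    deltaStar₁ (deltaInv₂ (fedosovSource Ω conn ρ k)) = 0 :=
  funext fun y => contract_divDegree_contract (τ := fun u v => fedosovSource Ω conn ρ k y u v)
    fun u v => fedosovSource_swap h k y u v

/-- In degree `k + 2` only forms of index at most `k` enter, so the recursion is well founded and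
determines the sequence. -/
theorem fedosovSource_congr {ρ' : ℕ → OneForm m M} {k : ℕ} (h : ∀ i ≤ k, ρ i = ρ' i) :
    fedosovSource Ω conn ρ k = fedosovSource Ω conn ρ' k := by
  funext y u v
  refine (fedosovSource_eq Ω conn ρ k y u v).trans
    (Eq.trans ?_ (fedosovSource_eq Ω conn ρ' k y u v).symm)
  rw [h k le_rfl]
  congr 1
  refine Finset.sum_congr rfl fun p hp => ?_
  have := Finset.HasAntidiagonal.mem_antidiagonal.1 hp
  rw [h p.1 (by omega), h p.2 (by omega)]

/-- In the homotopy formula `δ⁻¹δσ + δδ⁻¹σ = σ` the second term vanishes, because `δ⁻¹σ` is a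
rescaling of `δ*σ = 0`. This is the only role of the condition on `δ*` in the uniqueness proof. -/
theorem deltaInv₂_delta₁ {σ : OneForm m M} (hl : ∀ y, IsLinearMap ℝ (σ y))
    (h : deltaStar₁ σ = 0) : deltaInv₂ (delta₁ σ) = σ := by
  funext y v
  have h1 := homotopy_oneForm (hl y) v
  have h2 : contract (σ y) = 0 := congrFun h y
  rw [h2, divDegree_zero, map_zero, add_zero] at h1
  refine Eq.trans ?_ h1
  change divDegree 1 (contract fun w : 𝔼 => delta₁ σ y w v) = _
  congr 2
  exact funext fun w => delta₁_eq σ y w v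

theorem deltaInv₂_sub (τ τ' : TwoForm m M) : deltaInv₂ (τ - τ') = deltaInv₂ τ - deltaInv₂ τ' := by
  funext y v
  change divDegree 1 (contract fun w => τ y w v - τ' y w v) =
    divDegree 1 (contract fun w => τ y w v) - divDegree 1 (contract fun w => τ' y w v)
  rw [← divDegreeL_apply, ← divDegreeL_apply, ← divDegreeL_apply, ← map_sub, ← contract_sub]
  rfl

/-- The graded equations satisfied by a Fedosov potential. -/
theorem IsFedosovPotential.graded (ht : conn.torsion = 0) (hs : IsSymplecticConnection Ω conn)
    (h : IsFedosovPotential Ω conn ρ) (k : ℕ) :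
    delta₁ (ρ (k + 1)) = fedosovSource Ω conn ρ k ∧
      ρ (k + 1) = deltaInv₂ (fedosovSource Ω conn ρ k) := by
  obtain ⟨h0, hg, hd, hz⟩ := (isFedosovPotential_iff ht hs).1 h
  have h1 := (totalCurvature_eq_zero_iff hg h0).1 hz k
  rw [curvatureLift, sub_eq_zero] at h1
  refine ⟨h1.symm, ?_⟩
  rw [h1, deltaInv₂_delta₁ (hg.smooth (k + 1)).1 (hd (k + 1))]

theorem IsFedosovPotential.unique (ht : conn.torsion = 0) (hs : IsSymplecticConnection Ω conn)
    {ρ' : ℕ → OneForm m M} (h : IsFedosovPotential Ω conn ρ) (h' : IsFedosovPotential Ω conn ρ') :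
    ρ = ρ' := by
  funext k
  induction k using Nat.strong_induction_on with
  | _ k ih =>
    cases k with
    | zero => rw [h.zero, h'.zero]
    | succ k =>
      rw [(h.graded ht hs k).2, (h'.graded ht hs k).2,
        fedosovSource_congr fun i hi => ih i (by omega)]

/-! ### Existence -/

variable (Ω conn) in
/-- The first `n` forms given by the recursion formula. -/
def fedosovPartial : ℕ → ℕ → OneForm m M
  | 0 => 0
  | n + 1 => Function.update (fedosovPartial n) (n + 1)
      (deltaInv₂ (fedosovSource Ω conn (fedosovPartial n) n))

variable (Ω conn) in
/-- The forms given by the recursion formula. -/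
def fedosovForm (k : ℕ) : OneForm m M := fedosovPartial Ω conn k k

/-- Each stage is a complete sequence, zero beyond index `n`, so that smoothness and degrees can be
propagated along the recursion before they are known for the final sequence. -/
theorem isGraded_fedosovPartial (ht : conn.torsion = 0) (hs : IsSymplecticConnection Ω conn)
    (n : ℕ) : IsGraded (fedosovPartial Ω conn n) := by
  induction n with
  | zero =>
    refine ⟨fun k => isSmoothOneForm_of_locOne (fun x => ⟨fun _ _ => (add_zero _).symm,
      fun _ _ => (smul_zero _).symm⟩) fun x u => ?_, fun k x v => IsHomogeneous.zero _⟩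
    refine SmoothWAt.congr (A := fun _ => 0) (fun j α => contDiffAt_const)
      (Filter.Eventually.of_forall fun q => ?_)
    exact (framePullL x _).map_zero
  | succ n ih =>
    constructor
    · intro k
      by_cases hk : k = n + 1
      · subst hk
        rw [fedosovPartial, Function.update_self]
        exact isSmoothOneForm_deltaInv₂_fedosovSource ht hs ih n
      · rw [fedosovPartial, Function.update_of_ne hk]
        exact ih.smooth k
    · intro k x v
      by_cases hk : k = n + 1
      · subst hk
        rw [fedosovPartial, Function.update_self]
        exact isHomogeneous_deltaInv₂_fedosovSource ih n x v
      · rw [fedosovPartial, Function.update_of_ne hk]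
        exact ih.homogeneous k x v

theorem isGraded_fedosovForm (ht : conn.torsion = 0) (hs : IsSymplecticConnection Ω conn) :
    IsGraded (fedosovForm Ω conn) :=
  ⟨fun k => (isGraded_fedosovPartial ht hs k).smooth k,
    fun k => (isGraded_fedosovPartial ht hs k).homogeneous k⟩

theorem fedosovPartial_eq (n : ℕ) : ∀ i ≤ n, fedosovPartial Ω conn n i = fedosovForm Ω conn i := by
  induction n with
  | zero => intro i hi; rw [Nat.le_zero.1 hi]; rfl
  | succ n ih =>
    intro i hi
    by_cases hk : i = n + 1
    · rw [hk]; rfl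
    · rw [fedosovPartial, Function.update_of_ne hk, ih i (by omega)]

theorem fedosovForm_succ (k : ℕ) :
    fedosovForm Ω conn (k + 1) = deltaInv₂ (fedosovSource Ω conn (fedosovForm Ω conn) k) := by
  rw [fedosovForm, fedosovPartial, Function.update_self, fedosovSource_congr (fedosovPartial_eq k)]

theorem deltaStar₁_fedosovForm (ht : conn.torsion = 0) (hs : IsSymplecticConnection Ω conn)
    (k : ℕ) : deltaStar₁ (fedosovForm Ω conn k) = 0 := by
  cases k with
  | zero =>
    funext y
    change ∑ k, gen k * (0 : Weyl m) = 0
    simp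
  | succ k =>
    rw [fedosovForm_succ]
    exact deltaStar₁_deltaInv₂_fedosovSource (isGraded_fedosovForm ht hs) k

theorem totalCurvature_swap (h : IsGraded ρ) (y : M) (u v : 𝔼) :
    totalCurvature Ω conn ρ y v u = -totalCurvature Ω conn ρ y u v := by
  rw [totalCurvature_eq, totalCurvature_eq, curvatureForm_swap y u v, extend_swap h.totalForm,
    delta₁_eq, delta₁_eq, bracket_swap]
  abel

theorem isLinearMap_totalCurvature (ht : conn.torsion = 0) (hs : IsSymplecticConnection Ω conn)
    (h : IsGraded ρ) (y : M) (v : 𝔼) :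
    IsLinearMap ℝ fun u : 𝔼 => totalCurvature Ω conn ρ y u v := by
  simp only [totalCurvature_eq, delta₁_eq]
  exact isLinearMap_add (isLinearMap_add (isLinearMap_curvatureForm ht hs y v)
    (isLinearMap_sub (isLinearMap_extend ht hs h.totalForm y v)
      (isLinearMap_sub (isLinearMap_dirE _) (isLinearMap_comp_dirE v (h.totalForm.1 y)))))
    (isLinearMap_bracket _ (h.totalForm.1 y) _)

/-- Degree by degree, `δ⁻¹` of `source_k - δρ_{k+1}` is `ρ_{k+1} - ρ_{k+1}`: the first term by the
recursion, the second because `δ*ρ_{k+1} = 0`. This is weaker than the vanishing of the curvature,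
which needs the Bianchi identity. -/
theorem deltaInv₂_totalCurvature (ht : conn.torsion = 0) (hs : IsSymplecticConnection Ω conn)
    (y : M) (v : 𝔼) :
    divDegree 1 (contract fun w => totalCurvature Ω conn (fedosovForm Ω conn) y w v) = 0 := by
  have hg := isGraded_fedosovForm (Ω := Ω) ht hs
  have h1 : ∀ k, deltaInv₂ (curvatureLift Ω conn (fedosovForm Ω conn) k) = 0 := fun k => by
    rw [curvatureLift, deltaInv₂_sub, deltaInv₂_delta₁ (hg.smooth (k + 1)).1
      (deltaStar₁_fedosovForm ht hs (k + 1)), ← fedosovForm_succ, sub_self]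
  refine ext_coef fun j α => ?_
  rw [coef_zero]
  by_cases hα : α.degree + 2 * j < 3
  · exact (InFil.contract (fun w => inFil_totalCurvature hg rfl y w v)).divDegree 1 j α hα
  -- The contraction raises the degree by one, so degree `k + 3` of the result comes from the
  -- curvature component of degree `k + 2`.
  · set k := α.degree + 2 * j - 3 with hk
    have h2 : ZeroIn (k + 2 + 1) (divDegree 1 (contract fun w : 𝔼 =>
        totalCurvature Ω conn (fedosovForm Ω conn) y w v -
          curvatureLift Ω conn (fedosovForm Ω conn) k y w v)) :=
      (ZeroIn.contract fun w => zeroIn_totalCurvature_sub hg k y w v).divDegree 1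
    have h3 : (contract fun w : 𝔼 => totalCurvature Ω conn (fedosovForm Ω conn) y w v -
        curvatureLift Ω conn (fedosovForm Ω conn) k y w v) =
        (contract fun w => totalCurvature Ω conn (fedosovForm Ω conn) y w v) -
        contract fun w => curvatureLift Ω conn (fedosovForm Ω conn) k y w v :=
      contract_sub _ _
    have h4 : divDegree 1 (contract fun w =>
        curvatureLift Ω conn (fedosovForm Ω conn) k y w v) = 0 := congrFun (congrFun (h1 k) y) v
    have h5 := h2 j α (by omega)
    rw [h3, ← divDegreeL_apply, map_sub, divDegreeL_apply, divDegreeL_apply, h4, sub_zero] at h5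
    exact h5

/-- Since `δ⁻¹Ω = 0`, the homotopy formula gives `Ω = δ⁻¹δΩ`, and the Bianchi identity replaces `δΩ`
by `(D + δ)Ω`. If `Ω` starts in degree `n`, so does `(D + δ)Ω`, and `δ⁻¹` raises the degree by one;
by induction `Ω` starts arbitrarily high. -/
theorem inFil_totalCurvature_fedosovForm (ht : conn.torsion = 0)
    (hs : IsSymplecticConnection Ω conn) (n : ℕ) : ∀ (y : M) (u v : 𝔼),
      InFil n (totalCurvature Ω conn (fedosovForm Ω conn) y u v) := by
  have hg := isGraded_fedosovForm (Ω := Ω) ht hs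
  induction n with
  | zero => exact fun y u v => inFil_zero _
  | succ n ih =>
    intro y u v
    have hG := localGeometry ht hs y
    have hp := mem_chart_target 𝔼 y
    have h1 := homotopy_twoForm (τ := fun u v => totalCurvature Ω conn (fedosovForm Ω conn) y u v)
      (isLinearMap_totalCurvature ht hs hg y) (totalCurvature_swap hg y) u v
    rw [deltaInv₂_totalCurvature ht hs, deltaInv₂_totalCurvature ht hs, map_zero, map_zero,
      sub_self, add_zero] at h1
    rw [← h1]
    refine (InFil.contract fun w => ?_).divDegree 2
    have h2 := hG.bianchi_locOmega (hg.totalForm.locOne y) hp w u v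
    have h3 : ∀ a b c : 𝔼, InFil n (locD (poissonMat Ω y) (christoffel conn y)
        (locOne y (totalForm (fedosovForm Ω conn))) a (locOmega (poissonMat Ω y)
          (christoffel conn y) (locOne y (totalForm (fedosovForm Ω conn))) b c) (chartAt 𝔼 y y) +
        dirE a (totalCurvature Ω conn (fedosovForm Ω conn) y b c)) := fun a b c => by
      -- The covariant derivative needs the bound in a neighbourhood, in the frame of one chart. The
      -- induction hypothesis holds at all points and is carried over by the change of frame, which
      -- preserves degrees.
      have h4 : ∀ᶠ q in nhds (chartAt 𝔼 y y), InFil n (locOmega (poissonMat Ω y)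
          (christoffel conn y) (locOne y (totalForm (fedosovForm Ω conn))) b c q) := by
        filter_upwards [(chartAt 𝔼 y).open_target.mem_nhds hp] with q hq
        revert q
        refine forall_target fun z hz => ?_
        rw [← framePull_totalCurvature ht hs hg hz]
        exact (ih z _ _).pull _
      rw [locD, locE, ← totalCurvature_center ht hs hg, add_right_comm, sub_add_cancel,
        totalCurvature_center ht hs hg]
      refine (InFil.locNabla h4 _ _).add (InFil.bracket (p := 3) (q := n) _ ?_ h4.self_of_nhds
        (by omega))
      rw [locOne_center]
      exact inFil_totalForm hg rfl y a
    have h4 := ((h3 w u v).add (h3 u v w)).add (h3 v w u)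
    exact InFil.of_add_cyclic h2 h4

/-- The forms given by the recursion formula define a flat connection. -/
theorem isFedosovPotential_fedosovForm (ht : conn.torsion = 0)
    (hs : IsSymplecticConnection Ω conn) : IsFedosovPotential Ω conn (fedosovForm Ω conn) :=
  (isFedosovPotential_iff ht hs).2 ⟨rfl, isGraded_fedosovForm ht hs, deltaStar₁_fedosovForm ht hs,
    fun y u v => eq_zero_of_inFil fun n => inFil_totalCurvature_fedosovForm ht hs n y u v⟩

end

end Fedosov

/-! ### Flat sections as fixed points of `A ↦ a + δ⁻¹(∇A + r₁A + r₂A + …)` -/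

namespace Fedosov

namespace Weyl

variable {m : ℕ}

local notation "𝔼" => EuclideanSpace ℝ (Fin m)

/-- The element `∑ j, z j * t ^ j`. -/
def ofScalars (z : ℕ → ℂ) : Weyl m := ofCoef fun j α => if α = 0 then z j else 0

theorem coef_ofScalars (z : ℕ → ℂ) (j : ℕ) (α : Fin m →₀ ℕ) :
    coef j α (ofScalars z) = if α = 0 then z j else 0 := coef_ofCoef j α _

theorem coef_zero_ofScalars (z : ℕ → ℂ) (j : ℕ) : coef j 0 (ofScalars z : Weyl m) = z j := by
  rw [coef_ofScalars, if_pos rfl]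

theorem partialE_ofScalars (z : ℕ → ℂ) (k : Fin m) : partialE k (ofScalars z) = 0 :=
  ext_coef fun j α => by
    have h : α + Finsupp.single k 1 ≠ 0 := fun h => by
      have := DFunLike.congr_fun h k
      simp at this
    rw [coef_partialE, coef_ofScalars, if_neg h, zero_mul, coef_zero]

theorem dirE_ofScalars (z : ℕ → ℂ) (u : 𝔼) : dirE u (ofScalars z) = 0 := by
  rw [dirE_apply]
  exact Finset.sum_eq_zero fun k _ => by rw [partialE_ofScalars, smul_zero]

theorem pull_ofScalars (L : Fin m → 𝔼) (z : ℕ → ℂ) : pull L (ofScalars z) = ofScalars z :=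
  ext_coef fun j β => by
    by_cases hβ : β = 0
    · rw [hβ, coef_zero_pull]
    · rw [coef_pull, coef_ofScalars, if_neg hβ]
      refine Finset.sum_eq_zero fun α hα => ?_
      have h : α ≠ 0 := fun h => hβ (by
        have h1 := mem_degSet.1 hα
        rw [h, map_zero] at h1
        exact (Finsupp.degree_eq_zero_iff β).1 h1.symm)
      rw [coef_ofScalars, if_neg h, zero_mul]

theorem divDegree_contract_dirE_eq (a : Weyl m) :
    divDegree 0 (contract fun u => dirE u a) = a - ofScalars fun j => coef j 0 a :=
  divDegree_contract_dirE a

/-- The operator `A ↦ δ⁻¹ (∇ A + (i / t) [σ, A])` in a chart. -/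
def locStep (P : 𝔼 → Matrix (Fin m) (Fin m) ℝ) (Γ : 𝔼 → 𝔼 → 𝔼 → 𝔼) (σ : 𝔼 → 𝔼 → Weyl m)
    (A : 𝔼 → Weyl m) (p : 𝔼) : Weyl m :=
  divDegree 0 (contract fun u => locNabla Γ u A p + bracket (P p) (σ u p) (A p))

/-- The covariant derivative costs one step, and the bracket costs one because of the division by
`t`; the generator introduced by `δ⁻¹` gains it back. The iteration therefore stays inside one step
of any such filtration. -/
theorem JetW.locStep {U : Set 𝔼} {I : ℕ → (𝔼 → ℂ) → Prop} (hI : IdealFil U I) {n : ℕ}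
    {P : 𝔼 → Matrix (Fin m) (Fin m) ℝ} (hP : ∀ k l, ContDiffOn ℝ ∞ (fun p => P p k l) U)
    {Γ : 𝔼 → 𝔼 → 𝔼 → 𝔼} (hΓ : ∀ u v, ContDiffOn ℝ ∞ (fun p => Γ p u v) U)
    {σ : 𝔼 → 𝔼 → Weyl m} (hσ : ∀ u, SmoothW U (σ u)) {A : 𝔼 → Weyl m} (hA : JetW I n A) :
    JetW I n (Weyl.locStep P Γ σ A) :=
  (JetW.sum hI (s := Finset.univ) fun k _ => JetW.mono hI (JetW.gen_mul hI
    (JetW.add hI (JetW.locNabla hI hΓ hA (basisVec k)) (JetW.bracket hI hP (hσ (basisVec k)) hA))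
      k) (by omega : n ≤ n - 1 + 1)).divDegree hI 0

theorem SmoothW.locStep {U : Set 𝔼} (hU : IsOpen U)
    {P : 𝔼 → Matrix (Fin m) (Fin m) ℝ} (hP : ∀ k l, ContDiffOn ℝ ∞ (fun p => P p k l) U)
    {Γ : 𝔼 → 𝔼 → 𝔼 → 𝔼} (hΓ : ∀ u v, ContDiffOn ℝ ∞ (fun p => Γ p u v) U)
    {σ : 𝔼 → 𝔼 → Weyl m} (hσ : ∀ u, SmoothW U (σ u)) {A : 𝔼 → Weyl m} (hA : SmoothW U A) :
    SmoothW U (Weyl.locStep P Γ σ A) :=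
  ((hA.jetW 0).locStep (idealFil_contDiffOn hU) hP hΓ hσ).smooth (idealFil_contDiffOn hU)

/-- The covariant derivative keeps the degree, the bracket with a form of degree at least `2` does
not lower it, and `δ⁻¹` raises it by one. The step is thus a contraction for the degree filtration.
-/
theorem InFil.locStep_sub {n : ℕ} (P : 𝔼 → Matrix (Fin m) (Fin m) ℝ) (Γ : 𝔼 → 𝔼 → 𝔼 → 𝔼)
    {σ : 𝔼 → 𝔼 → Weyl m} {p : 𝔼} (hσ : ∀ u, InFil 2 (σ u p)) {A B : 𝔼 → Weyl m}
    (hA : DiffW A p) (hB : DiffW B p) (h : ∀ᶠ q in nhds p, InFil n (A q - B q)) :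
    InFil (n + 1) (Weyl.locStep P Γ σ A p - Weyl.locStep P Γ σ B p) := by
  rw [Weyl.locStep, Weyl.locStep, ← divDegreeL_apply, ← divDegreeL_apply, ← map_sub,
    divDegreeL_apply, ← contract_sub]
  refine (InFil.contract fun u => ?_).divDegree 0
  rw [Pi.sub_apply, add_sub_add_comm, ← locNabla_sub Γ u hA hB, ← bracket_sub_right]
  exact (InFil.locNabla h Γ u).add (InFil.bracket _ (hσ u) h.self_of_nhds (by omega))

end Weyl

variable {m : ℕ} {M : Type*} [TopologicalSpace M] [ChartedSpace (EuclideanSpace ℝ (Fin m)) M]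

local notation "𝔼" => EuclideanSpace ℝ (Fin m)

open Weyl

variable [IsManifold (𝓡 m) ∞ M]

theorem framePull_ofScalars (x y : M) (z : ℕ → ℂ) :
    framePull x y (ofScalars z : Weyl m) = ofScalars z := pull_ofScalars _ z

theorem coef_zero_framePull (x y : M) (a : Weyl m) (j : ℕ) :
    coef j 0 (framePull x y a) = coef j 0 a := coef_zero_pull _ a j

theorem Weyl.InFil.framePull {n : ℕ} {a : Weyl m} (h : InFil n a) (x y : M) :
    InFil n (Fedosov.framePull x y a) := h.pull _

/-- The terms free of the generators of a smooth section are smooth functions. -/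
def symbol {a : M → Weyl m} (ha : IsSmoothSection a) (j : ℕ) : SmoothFun m M :=
  ⟨fun x => coef j 0 (a x), fun x => (contMDiffAt_iff_chart (n := ⊤) (mem_chart_source 𝔼 x)).2 <|
    ((((isSmoothAt_iff (mem_chart_source 𝔼 x)).1 (ha x)) j 0).congr_of_eventuallyEq <|
      Filter.Eventually.of_forall fun _ => (coef_zero_framePull _ _ _ j).symm)⟩

theorem symbol_apply {a : M → Weyl m} (ha : IsSmoothSection a) (j : ℕ) (x : M) :
    symbol ha j x = coef j 0 (a x) := rfl

theorem ofSeries_apply (a : PowerSeries (SmoothFun m M)) (x : M) :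
    ofSeries a x = ofScalars fun j => (PowerSeries.coeff j a : SmoothFun m M) x := rfl

theorem loc_ofSeries (x : M) (a : PowerSeries (SmoothFun m M)) (p : 𝔼) :
    loc x (ofSeries a) p = ofScalars fun j =>
      (PowerSeries.coeff j a : SmoothFun m M) ((chartAt 𝔼 x).symm p) :=
  framePull_ofScalars _ _ _

theorem contDiffOn_smoothFun (f : SmoothFun m M) (x : M) :
    ContDiffOn ℝ ∞ (fun p => f ((chartAt 𝔼 x).symm p)) (chartAt 𝔼 x).target :=
  (contMDiffOn_iff_chart (n := ⊤)).1 fun y _ => f.contMDiff y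

theorem isSmoothSection_ofSeries (a : PowerSeries (SmoothFun m M)) :
    IsSmoothSection (ofSeries a) := by
  refine isSmoothSection_of_loc fun x => SmoothW.smoothWAt (U := (chartAt 𝔼 x).target)
    (chartAt 𝔼 x).open_target (fun j α => ?_) (mem_chart_target 𝔼 x)
  simp only [loc_ofSeries, coef_ofScalars]
  split_ifs
  · exact contDiffOn_smoothFun _ x
  · exact contDiffOn_const

theorem loc_add (x : M) (a b : M → Weyl m) (p : 𝔼) : loc x (a + b) p = loc x a p + loc x b p :=
  framePull_add _ _ _ _

theorem IsSmoothSection.add {a b : M → Weyl m} (ha : IsSmoothSection a) (hb : IsSmoothSection b) :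
    IsSmoothSection (a + b) :=
  isSmoothSection_of_loc fun x => (SmoothW.smoothWAt (chartAt 𝔼 x).open_target
    ((ha.loc x).add (hb.loc x)) (mem_chart_target 𝔼 x)).congr
      (Filter.Eventually.of_forall fun p => loc_add x a b p)

/-- A section is smooth if all its terms are terms of smooth sections. -/
theorem isSmoothSection_of_inFil {a : M → Weyl m} {s : ℕ → M → Weyl m}
    (hs : ∀ n, IsSmoothSection (s n)) (h : ∀ n x, InFil n (a x - s n x)) : IsSmoothSection a := by
  refine isSmoothSection_of_loc fun x j α => ?_
  refine (((hs (α.degree + 2 * j + 1)).loc x).smoothWAt (chartAt 𝔼 x).open_target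
    (mem_chart_target 𝔼 x) j α).congr_of_eventuallyEq (Filter.Eventually.of_forall fun p => ?_)
  have h1 := (h (α.degree + 2 * j + 1) ((chartAt 𝔼 x).symm p)).framePull x
    ((chartAt 𝔼 x).symm p) j α (Nat.lt_succ_self _)
  rw [framePull_sub, coef_sub] at h1
  exact sub_eq_zero.1 h1

/-- The operator `a ↦ δ⁻¹ (∇ a + r 1 a + r 2 a + …)`. -/
def fedosovStep (Ω : SymplecticForm m M) (conn : Connection m M) (ρ : ℕ → OneForm m M)
    (a : M → Weyl m) : M → Weyl m := deltaInv₁ (higherPart conn (fun k => adOp Ω (ρ k)) a)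

theorem higherPart_eq (Ω : SymplecticForm m M) (conn : Connection m M) {ρ : ℕ → OneForm m M}
    (h : IsGraded ρ) (a : M → Weyl m) (x : M) (v : 𝔼) :
    higherPart conn (fun k => adOp Ω (ρ k)) a x v =
      nabla conn a x v + bracket (Ω.poissonMatrix x) (totalForm ρ x v) (a x) :=
  congrArg (fun b : Weyl m => nabla conn a x v + b)
    (formalSum_bracket _ (fun k => h.homogeneous k x v) (a x))

theorem higherPart_eq_add (Ω : SymplecticForm m M) (conn : Connection m M) {ρ : ℕ → OneForm m M}
    (h : IsGraded ρ) (a : M → Weyl m) (x : M) (v : 𝔼) :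
    higherPart conn (fun k => adOp Ω (ρ k)) a x v =
      fedosovD conn (fun k => adOp Ω (ρ k)) a x v + dirE v (a x) := by
  rw [higherPart_eq Ω conn h, fedosovD_eq Ω conn h]
  abel

/-- The higher part is `D + δ`, and `δ⁻¹δ` removes only the part free of generators. This identity
links flatness with the fixed point equation in both directions. -/
theorem fedosovStep_eq (Ω : SymplecticForm m M) (conn : Connection m M) {ρ : ℕ → OneForm m M}
    (h : IsGraded ρ) (a : M → Weyl m) (x : M) :
    fedosovStep Ω conn ρ a x =
      divDegree 0 (contract fun v : 𝔼 => fedosovD conn (fun k => adOp Ω (ρ k)) a x v) +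
        (a x - ofScalars fun j => coef j 0 (a x)) := by
  have h1 : fedosovStep Ω conn ρ a x = divDegree 0 (contract fun v : 𝔼 =>
      higherPart conn (fun k => adOp Ω (ρ k)) a x v) := rfl
  have h2 : (contract fun v : 𝔼 => higherPart conn (fun k => adOp Ω (ρ k)) a x v) =
      contract (fun v : 𝔼 => fedosovD conn (fun k => adOp Ω (ρ k)) a x v) +
        contract fun v => dirE v (a x) := by
    rw [← contract_add]
    exact congrArg contract (funext fun v => higherPart_eq_add Ω conn h a x v)
  rw [h1, h2, ← divDegree_contract_dirE_eq, ← divDegreeL_apply, map_add, divDegreeL_apply,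
    divDegreeL_apply]

section

variable [T2Space M] {Ω : SymplecticForm m M} {conn : Connection m M}
  [conn.ContMDiffCovariantDerivative ∞] {ρ : ℕ → OneForm m M}

theorem isSmoothOneForm_adOp {σ : OneForm m M} (ht : conn.torsion = 0)
    (hs : IsSymplecticConnection Ω conn) (hσ : IsSmoothOneForm σ) {a : M → Weyl m}
    (ha : IsSmoothSection a) : IsSmoothOneForm (adOp Ω σ a) := by
  refine isSmoothOneForm_of_locOne (fun x => isLinearMap_bracket _ (hσ.1 x) _) fun x u => ?_
  have hG := localGeometry ht hs x
  refine ((SmoothW.bracket hG.isOpen hG.smoothP (hσ.locOne x u) (ha.loc x)).smoothWAt hG.isOpen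
    (mem_chart_target 𝔼 x)).congr ?_
  filter_upwards [(chartAt 𝔼 x).open_target.mem_nhds (mem_chart_target 𝔼 x)] with p hp
  revert p
  refine forall_target fun y hy => ?_
  rw [locOne_chartAt hy, locOne_chartAt hy, loc_chartAt hy, ← framePull_bracket Ω hy]
  rfl

theorem loc_fedosovStep (ht : conn.torsion = 0) (hs : IsSymplecticConnection Ω conn)
    (h : IsGraded ρ) {a : M → Weyl m} (ha : IsSmoothSection a) (x : M) :
    ∀ p ∈ (chartAt 𝔼 x).target, loc x (fedosovStep Ω conn ρ a) p =
      locStep (poissonMat Ω x) (christoffel conn x) (locOne x (totalForm ρ)) (loc x a) p := by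
  refine forall_target fun y hy => ?_
  have h1 : fedosovStep Ω conn ρ a y = divDegree 0 (contract fun v : 𝔼 =>
      nabla conn a y v + bracket (Ω.poissonMatrix y) (totalForm ρ y v) (a y)) :=
    congrArg (fun σ => divDegree 0 (contract σ)) (funext fun v => higherPart_eq Ω conn h a y v)
  rw [loc_chartAt hy, h1, framePull_divDegree, framePull_contract x y
    (isLinearMap_add (isLinearMap_nabla ht hs (ha y)) (isLinearMap_bracket _ (h.totalForm.1 y) _)),
    locStep]
  simp only [framePull_add, locOne_nabla conn hy (ha y), framePull_bracket Ω hy,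
    locOne_chartAt hy, loc_chartAt hy]

theorem isSmoothSection_fedosovStep (ht : conn.torsion = 0) (hs : IsSymplecticConnection Ω conn)
    (h : IsGraded ρ) {a : M → Weyl m} (ha : IsSmoothSection a) :
    IsSmoothSection (fedosovStep Ω conn ρ a) := by
  refine isSmoothSection_of_loc fun x => ?_
  have hG := localGeometry ht hs x
  exact (SmoothW.congr (SmoothW.locStep hG.isOpen hG.smoothP hG.smoothΓ (h.totalForm.locOne x)
    (ha.loc x)) (loc_fedosovStep ht hs h ha x)).smoothWAt hG.isOpen (mem_chart_target 𝔼 x)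

theorem inFil_fedosovStep_sub (ht : conn.torsion = 0) (hs : IsSymplecticConnection Ω conn)
    (h : IsGraded ρ) {a b : M → Weyl m} (ha : IsSmoothSection a)
    (hb : IsSmoothSection b) {n : ℕ} (hab : ∀ y, InFil n (a y - b y)) (y : M) :
    InFil (n + 1) (fedosovStep Ω conn ρ a y - fedosovStep Ω conn ρ b y) := by
  have hp := mem_chart_target 𝔼 y
  rw [← loc_center y (fedosovStep Ω conn ρ a), ← loc_center y (fedosovStep Ω conn ρ b),
    loc_fedosovStep ht hs h ha y _ hp, loc_fedosovStep ht hs h hb y _ hp]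
  refine InFil.locStep_sub _ _ (fun u => ?_) ((ha.loc y).diffW (chartAt 𝔼 y).open_target hp)
    ((hb.loc y).diffW (chartAt 𝔼 y).open_target hp) (Filter.Eventually.of_forall fun q => ?_)
  · rw [locOne_center]
    exact formalSum_inFil fun k => h.homogeneous k y u
  · rw [loc, loc, ← framePull_sub]
    exact (hab _).framePull _ _

/-- The solution of `A = a + δ⁻¹ (∇ A + r 1 A + r 2 A + …)` is unique. -/
theorem eq_of_fedosovStep (ht : conn.torsion = 0) (hs : IsSymplecticConnection Ω conn)
    (h : IsGraded ρ) {a b c : M → Weyl m} (ha : IsSmoothSection a) (hb : IsSmoothSection b)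
    (ha' : a = c + fedosovStep Ω conn ρ a) (hb' : b = c + fedosovStep Ω conn ρ b) : a = b := by
  have key : ∀ n y, InFil n (a y - b y) := fun n => by
    induction n with
    | zero => exact fun y => inFil_zero _
    | succ n ih =>
      intro y
      have h1 : a y - b y = fedosovStep Ω conn ρ a y - fedosovStep Ω conn ρ b y := by
        have h2 := congrFun ha' y
        have h3 := congrFun hb' y
        rw [Pi.add_apply] at h2 h3
        exact (congrArg₂ (fun a b : Weyl m => a - b) h2 h3).trans (add_sub_add_left_eq_sub _ _ _)
      rw [h1]
      exact inFil_fedosovStep_sub ht hs h ha hb ih y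
  exact funext fun y => sub_eq_zero.1 (eq_zero_of_inFil fun n => key n y)

theorem eq_ofSeries_add_fedosovStep (h : IsGraded ρ) {a : M → Weyl m} (ha : IsSmoothSection a)
    (hD : fedosovD conn (fun k => adOp Ω (ρ k)) a = 0) :
    a = ofSeries (PowerSeries.mk (symbol ha)) + fedosovStep Ω conn ρ a := by
  funext x
  have h1 : (fun v : 𝔼 => fedosovD conn (fun k => adOp Ω (ρ k)) a x v) = fun _ => 0 :=
    funext fun v => congrFun (congrFun hD x) v
  have h2 : contract (fun _ : 𝔼 => (0 : Weyl m)) = 0 :=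
    Finset.sum_eq_zero fun k _ => mul_zero _
  rw [Pi.add_apply, fedosovStep_eq Ω conn h, h1, h2, divDegree_zero, zero_add, ofSeries_apply]
  simp only [PowerSeries.coeff_mk, symbol_apply]
  rw [add_sub_cancel]

/-- A solution of `A = a + δ⁻¹ (∇ A + r 1 A + r 2 A + …)` is flat. -/
theorem fedosovD_eq_zero (ht : conn.torsion = 0) (hs : IsSymplecticConnection Ω conn)
    (h : IsGraded ρ) (hΩ : ∀ y u v, totalCurvature Ω conn ρ y u v = 0)
    {a : M → Weyl m} (ha : IsSmoothSection a)
    (h0 : ∀ x, divDegree 0 (contract fun v : 𝔼 =>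
      fedosovD conn (fun k => adOp Ω (ρ k)) a x v) = 0) :
    fedosovD conn (fun k => adOp Ω (ρ k)) a = 0 := by
  have hB := isSmoothOneForm_fedosovD ht hs h ha
  have key : ∀ n y (v : 𝔼), InFil n (fedosovD conn (fun k => adOp Ω (ρ k)) a y v) := fun n => by
    induction n with
    | zero => exact fun y v => inFil_zero _
    | succ n ih =>
      intro y v
      have hp := mem_chart_target 𝔼 y
      -- Let `B = DA`. By hypothesis `δ⁻¹B = 0`, so `B = δ⁻¹δB`; since the curvature vanishes, `DB =
      -- 0`, so `δB` may be replaced by `(D + δ)B`, and `B` is pushed up by one degree.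
      have h1 := homotopy_oneForm (hB.1 y) v
      have h2 : dirE v (divDegree 0 (contract (fedosovD conn (fun k => adOp Ω (ρ k)) a y))) = 0 :=
        (congrArg (dirE v) (h0 y)).trans (map_zero _)
      rw [h2, add_zero] at h1
      refine (congrArg (InFil (n + 1)) h1).mp ((InFil.contract fun u => ?_).divDegree 1)
      have h3 := (extend_fedosovD ht hs h hB y u v).symm.trans
        ((extend_fedosovD_fedosovD ht hs h ha y u v).trans
          ((congrArg (fun c => bracket (Ω.poissonMatrix y) c (a y)) (hΩ y u v)).trans
            (bracket_eq_zero_of_left _ (fun k => (partialD k).map_zero) _)))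
      have h4 : ∀ w w' : 𝔼, InFil n (locD (poissonMat Ω y) (christoffel conn y)
          (locOne y (totalForm ρ)) w (locOne y (fedosovD conn (fun k => adOp Ω (ρ k)) a) w')
            (chartAt 𝔼 y y) + dirE w (fedosovD conn (fun k => adOp Ω (ρ k)) a y w')) :=
        fun w w' => by
          have h5 : ∀ᶠ q in nhds (chartAt 𝔼 y y), InFil n
              (locOne y (fedosovD conn (fun k => adOp Ω (ρ k)) a) w' q) :=
            Filter.Eventually.of_forall fun q => (ih _ _).framePull _ _
          rw [locD, locE, locOne_center y (fedosovD conn (fun k => adOp Ω (ρ k)) a) w',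
            add_right_comm, sub_add_cancel]
          refine (InFil.locNabla h5 _ _).add (InFil.bracket (p := 2) (q := n) _ ?_
            (ih y w') (by omega))
          rw [locOne_center]
          exact formalSum_inFil fun k => h.homogeneous k y w
      have h6 := (h4 u v).sub (h4 v u)
      rw [add_sub_add_comm, h3, zero_add] at h6
      exact h6
  exact funext fun y => funext fun v => eq_zero_of_inFil fun n => key n y v

variable (Ω conn ρ) in
/-- The iterates of `A ↦ a + δ⁻¹ (∇ A + r 1 A + r 2 A + …)`. -/
def flatApprox (a : PowerSeries (SmoothFun m M)) : ℕ → M → Weyl m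
  | 0 => ofSeries a
  | n + 1 => ofSeries a + fedosovStep Ω conn ρ (flatApprox a n)

variable (Ω conn ρ) in
/-- The limit of the iterates of `A ↦ a + δ⁻¹ (∇ A + r 1 A + r 2 A + …)`. -/
def flatLift (a : PowerSeries (SmoothFun m M)) : M → Weyl m := fun x =>
  -- From the iterate with number `α.degree + 2 * j` on, this coefficient no longer changes.
  ofCoef fun j α => coef j α (flatApprox Ω conn ρ a (α.degree + 2 * j) x)

theorem isSmoothSection_flatApprox (ht : conn.torsion = 0) (hs : IsSymplecticConnection Ω conn)
    (h : IsGraded ρ) (a : PowerSeries (SmoothFun m M)) (n : ℕ) :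
    IsSmoothSection (flatApprox Ω conn ρ a n) := by
  induction n with
  | zero => exact isSmoothSection_ofSeries a
  | succ n ih => exact (isSmoothSection_ofSeries a).add (isSmoothSection_fedosovStep ht hs h ih)

theorem inFil_flatApprox_sub (ht : conn.torsion = 0) (hs : IsSymplecticConnection Ω conn)
    (h : IsGraded ρ) (a : PowerSeries (SmoothFun m M)) (n : ℕ) (x : M) :
    InFil (n + 1) (flatApprox Ω conn ρ a (n + 1) x - flatApprox Ω conn ρ a n x) := by
  induction n generalizing x with
  | zero =>
    have h1 : flatApprox Ω conn ρ a (0 + 1) x - flatApprox Ω conn ρ a 0 x =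
        fedosovStep Ω conn ρ (ofSeries a) x := add_sub_cancel_left _ _
    rw [h1]
    exact (InFil.contract fun u => inFil_zero _).divDegree 0
  | succ n ih =>
    have h1 : flatApprox Ω conn ρ a (n + 1 + 1) x - flatApprox Ω conn ρ a (n + 1) x =
        fedosovStep Ω conn ρ (flatApprox Ω conn ρ a (n + 1)) x -
          fedosovStep Ω conn ρ (flatApprox Ω conn ρ a n) x := add_sub_add_left_eq_sub _ _ _
    rw [h1]
    exact inFil_fedosovStep_sub ht hs h (isSmoothSection_flatApprox ht hs h a _)
      (isSmoothSection_flatApprox ht hs h a _) ih x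

theorem inFil_flatLift_sub (ht : conn.torsion = 0) (hs : IsSymplecticConnection Ω conn)
    (h : IsGraded ρ) (a : PowerSeries (SmoothFun m M)) (n : ℕ) (x : M) :
    InFil (n + 1) (flatLift Ω conn ρ a x - flatApprox Ω conn ρ a n x) := fun j α hα => by
  have key : ∀ i, α.degree + 2 * j ≤ i → coef j α (flatApprox Ω conn ρ a i x) =
      coef j α (flatApprox Ω conn ρ a (α.degree + 2 * j) x) := fun i hi => by
    induction i, hi using Nat.le_induction with
    | base => rfl
    | succ i hi ih =>
      have h1 := inFil_flatApprox_sub ht hs h a i x j α (by omega)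
      rw [coef_sub, sub_eq_zero] at h1
      rw [h1, ih]
  rw [coef_sub, flatLift, coef_ofCoef, key n (by omega), sub_self]

theorem isSmoothSection_flatLift (ht : conn.torsion = 0) (hs : IsSymplecticConnection Ω conn)
    (h : IsGraded ρ) (a : PowerSeries (SmoothFun m M)) :
    IsSmoothSection (flatLift Ω conn ρ a) :=
  isSmoothSection_of_inFil (isSmoothSection_flatApprox ht hs h a) fun n x =>
    (inFil_flatLift_sub ht hs h a n x).mono (by omega)

theorem flatLift_eq (ht : conn.torsion = 0) (hs : IsSymplecticConnection Ω conn)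
    (h : IsGraded ρ) (a : PowerSeries (SmoothFun m M)) :
    flatLift Ω conn ρ a = ofSeries a + fedosovStep Ω conn ρ (flatLift Ω conn ρ a) := by
  funext x
  refine sub_eq_zero.1 (eq_zero_of_inFil fun n => ?_)
  have h1 := inFil_flatLift_sub ht hs h a (n + 1) x
  have h2 := inFil_fedosovStep_sub ht hs h (isSmoothSection_flatLift ht hs h a)
    (isSmoothSection_flatApprox ht hs h a n) (inFil_flatLift_sub ht hs h a n) x
  have h3 : flatApprox Ω conn ρ a (n + 1) x =
    ofSeries a x + fedosovStep Ω conn ρ (flatApprox Ω conn ρ a n) x := rfl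
  have h4 := (h1.sub h2).mono (by omega : n ≤ n + 1 + 1)
  rw [h3] at h4
  rw [Pi.add_apply]
  refine (congrArg (InFil n) ?_).mp h4
  abel

theorem coef_zero_fedosovStep (a : M → Weyl m) (x : M) (j : ℕ) :
    coef j 0 (fedosovStep Ω conn ρ a x) = 0 := by
  have h1 : fedosovStep Ω conn ρ a x = divDegree 0 (contract fun v : 𝔼 =>
      higherPart conn (fun k => adOp Ω (ρ k)) a x v) := rfl
  rw [h1, coef_divDegree, contract, coef_sum,
    Finset.sum_eq_zero fun k _ => coef_zero_gen_mul j k _, zero_div]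

theorem coef_zero_flatLift (ht : conn.torsion = 0) (hs : IsSymplecticConnection Ω conn)
    (h : IsGraded ρ) (a : PowerSeries (SmoothFun m M)) (j : ℕ) (x : M) :
    coef j 0 (flatLift Ω conn ρ a x) = (PowerSeries.coeff j a : SmoothFun m M) x := by
  rw [flatLift_eq ht hs h, Pi.add_apply, coef_add, coef_zero_fedosovStep, add_zero, ofSeries_apply,
    coef_zero_ofScalars]

/-- Comparing the fixed point equation with `fedosovStep_eq` leaves `δ⁻¹DA = 0`, which is the
hypothesis of `fedosovD_eq_zero`. -/
theorem fedosovD_flatLift (ht : conn.torsion = 0) (hs : IsSymplecticConnection Ω conn)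
    (h : IsGraded ρ) (hΩ : ∀ y u v, totalCurvature Ω conn ρ y u v = 0)
    (a : PowerSeries (SmoothFun m M)) :
    fedosovD conn (fun k => adOp Ω (ρ k)) (flatLift Ω conn ρ a) = 0 := by
  refine fedosovD_eq_zero ht hs h hΩ (isSmoothSection_flatLift ht hs h a) fun x => ?_
  have h1 := congrFun (flatLift_eq ht hs h a) x
  rw [Pi.add_apply, fedosovStep_eq Ω conn h, ofSeries_apply] at h1
  simp only [coef_zero_flatLift ht hs h] at h1
  rw [add_left_comm, add_sub_cancel] at h1
  exact right_eq_add.1 h1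

/-- A flat section is determined by its terms free of the generators. -/
theorem flat_ext (ht : conn.torsion = 0) (hs : IsSymplecticConnection Ω conn) (h : IsGraded ρ)
    {a b : M → Weyl m} (ha : IsSmoothSection a) (hb : IsSmoothSection b)
    (hDa : fedosovD conn (fun k => adOp Ω (ρ k)) a = 0)
    (hDb : fedosovD conn (fun k => adOp Ω (ρ k)) b = 0)
    (hab : ∀ j x, coef j 0 (a x) = coef j 0 (b x)) : a = b := by
  have h1 : symbol ha = symbol hb := funext fun j => ContMDiffMap.ext fun x => hab j x
  refine eq_of_fedosovStep ht hs h ha hb (eq_ofSeries_add_fedosovStep h ha hDa) ?_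
  rw [h1]
  exact eq_ofSeries_add_fedosovStep h hb hDb

/-- The bijection between formal series of smooth functions and flat sections. -/
def flatEquiv (ht : conn.torsion = 0) (hs : IsSymplecticConnection Ω conn) (h : IsGraded ρ)
    (hΩ : ∀ y u v, totalCurvature Ω conn ρ y u v = 0) :
    PowerSeries (SmoothFun m M) ≃ FlatSection (fedosovD conn fun k => adOp Ω (ρ k)) where
  toFun a := ⟨flatLift Ω conn ρ a, isSmoothSection_flatLift ht hs h a,
    fedosovD_flatLift ht hs h hΩ a⟩
  invFun A := PowerSeries.mk (symbol A.2.1)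
  left_inv a := PowerSeries.ext fun j => ContMDiffMap.ext fun x => by
    rw [PowerSeries.coeff_mk]
    exact coef_zero_flatLift ht hs h a j x
  right_inv A := Subtype.ext <| flat_ext ht hs h (isSmoothSection_flatLift ht hs h _) A.2.1
    (fedosovD_flatLift ht hs h hΩ _) A.2.2 fun j x => by
      rw [coef_zero_flatLift ht hs h, PowerSeries.coeff_mk]
      rfl

end

end Fedosov

/-! ### Low order terms of the product, derivation property of `D`, and order of vanishing -/

namespace Fedosov

namespace Weyl

variable {m : ℕ}

local notation "𝔼" => EuclideanSpace ℝ (Fin m)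

theorem coef_zero_mul (a b : Weyl m) (j : ℕ) :
    coef j 0 (a * b) = ∑ s ∈ Finset.HasAntidiagonal.antidiagonal j,
      coef s.1 0 a * coef s.2 0 b := by
  rw [coef_mul]
  simp only [Finset.HasAntidiagonal.antidiagonal_zero, Finset.sum_singleton]

theorem coef_zero_zero_moyal (P : Matrix (Fin m) (Fin m) ℝ) (a b : Weyl m) :
    coef 0 0 (moyal P a b) = coef 0 0 a * coef 0 0 b := by
  have h : PowerSeries.coeff 0 (moyal P a b) = PowerSeries.coeff 0 a * PowerSeries.coeff 0 b := by
    rw [coeff_moyal, Finset.HasAntidiagonal.antidiagonal_zero, Finset.sum_singleton,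
      Finset.HasAntidiagonal.antidiagonal_zero, Finset.sum_singleton, moyalTerm, bidiff]
    simp
  rw [coef, h, coef, coef, MvPowerSeries.coeff_zero_eq_constantCoeff_apply, map_mul]
  rfl

theorem coeff_one_moyal (P : Matrix (Fin m) (Fin m) ℝ) (a b : Weyl m) :
    PowerSeries.coeff 1 (moyal P a b) = PowerSeries.coeff 0 a * PowerSeries.coeff 1 b +
      PowerSeries.coeff 1 a * PowerSeries.coeff 0 b +
        (-Complex.I / 2) • bidiff P 1 (PowerSeries.coeff 0 a) (PowerSeries.coeff 0 b) := by
  rw [coeff_moyal, Finset.Nat.sum_antidiagonal_succ, Finset.HasAntidiagonal.antidiagonal_zero,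
    Finset.sum_singleton, Finset.HasAntidiagonal.antidiagonal_zero, Finset.sum_singleton,
    Finset.Nat.sum_antidiagonal_succ, Finset.HasAntidiagonal.antidiagonal_zero,
    Finset.sum_singleton]
  simp only [moyalTerm, zero_add, pow_zero, pow_one, Nat.factorial_zero, Nat.factorial_one,
    Nat.cast_one, div_one, one_smul]
  rfl

/-- At order `t` the products of coefficients commute and cancel in the commutator, while the two
antisymmetric terms with factor `-i/2` add up to `-i`; multiplying by `i` gives the factor `1`. -/
theorem coeff_zero_bracket {P : Matrix (Fin m) (Fin m) ℝ} (hP : P.transpose = -P)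
    (a b : Weyl m) : PowerSeries.coeff 0 (bracket P a b) =
      bidiff P 1 (PowerSeries.coeff 0 a) (PowerSeries.coeff 0 b) := by
  rw [bracket, PowerSeries.coeff_mk, map_sub, coeff_one_moyal, coeff_one_moyal,
    bidiff_swap hP 1 (PowerSeries.coeff 0 a)]
  generalize bidiff P 1 (PowerSeries.coeff 0 a) (PowerSeries.coeff 0 b) = c
  have h1 : ∀ x y z w : MvPowerSeries (Fin m) ℂ, x * y + z * w + (-Complex.I / 2) • c -
      (w * z + y * x + (-Complex.I / 2) • ((-1) ^ 1 • c)) = (-Complex.I) • c := fun x y z w => by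
    rw [mul_comm w z, mul_comm y x, add_comm (z * w), add_sub_add_left_eq_sub, pow_one, neg_smul,
      one_smul, smul_neg, sub_neg_eq_add, ← add_smul]
    congr 1
    ring
  rw [h1, smul_smul]
  simp

theorem coef_zero_zero_bracket {P : Matrix (Fin m) (Fin m) ℝ} (hP : P.transpose = -P)
    (a b : Weyl m) : coef 0 0 (bracket P a b) = ∑ k, ∑ l, (P k l : ℂ) *
      coef 0 0 (partialE k a) * coef 0 0 (partialE l b) := by
  rw [coef, coeff_zero_bracket hP, bidiff]
  simp only [bidiff, map_sum]
  refine Finset.sum_congr rfl fun k _ => Finset.sum_congr rfl fun l _ => ?_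
  rw [MvPowerSeries.coeff_smul, MvPowerSeries.coeff_zero_eq_constantCoeff_apply, map_mul, coef,
    coef, partialE, partialE, PowerSeries.coeff_mk, PowerSeries.coeff_mk, mul_assoc]
  rfl

namespace LocalGeometry

variable {U : Set (EuclideanSpace ℝ (Fin m))}
  {P : EuclideanSpace ℝ (Fin m) → Matrix (Fin m) (Fin m) ℝ}
  {Γ : EuclideanSpace ℝ (Fin m) → EuclideanSpace ℝ (Fin m) → EuclideanSpace ℝ (Fin m) →
    EuclideanSpace ℝ (Fin m)}

/-- The three parts of `D` are derivations separately: `∇` because the bivector is parallel, `δ`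
because the bivector is constant along the fibre, and the bracket because it is an inner derivation
divided by `t`. -/
theorem locD_moyal (h : LocalGeometry U P Γ) (σ : 𝔼 → 𝔼 → Weyl m) {A B : 𝔼 → Weyl m}
    (hA : SmoothW U A) (hB : SmoothW U B) {p : 𝔼} (hp : p ∈ U) (u : 𝔼) :
    locD P Γ σ u (fun q => moyal (P q) (A q) (B q)) p =
      moyal (P p) (locD P Γ σ u A p) (B p) + moyal (P p) (A p) (locD P Γ σ u B p) := by
  simp only [locD, locE, locNabla_moyal (h.compatible p hp) u (hA.diffW h.isOpen hp)
    (hB.diffW h.isOpen hp), dirE_moyal, bracket_moyal_right, moyal_add_left, moyal_add_right,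
    moyal_sub_left, moyal_sub_right]
  abel

end LocalGeometry

theorem locD_add (P : 𝔼 → Matrix (Fin m) (Fin m) ℝ) (Γ : 𝔼 → 𝔼 → 𝔼 → 𝔼) (σ : 𝔼 → 𝔼 → Weyl m)
    {A B : 𝔼 → Weyl m} {p : 𝔼} (hA : DiffW A p) (hB : DiffW B p) (u : 𝔼) :
    locD P Γ σ u (fun q => A q + B q) p = locD P Γ σ u A p + locD P Γ σ u B p := by
  simp only [locD, locE_add Γ u hA hB, bracket_add_right]
  abel

theorem locD_congr (P : 𝔼 → Matrix (Fin m) (Fin m) ℝ) (Γ : 𝔼 → 𝔼 → 𝔼 → 𝔼) (σ : 𝔼 → 𝔼 → Weyl m)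
    {A B : 𝔼 → Weyl m} {p : 𝔼} (h : A =ᶠ[nhds p] B) (u : 𝔼) :
    locD P Γ σ u A p = locD P Γ σ u B p := by
  rw [locD, locD, locE_congr Γ u h, h.self_of_nhds]

theorem locD_ofScalars (P : 𝔼 → Matrix (Fin m) (Fin m) ℝ) (Γ : 𝔼 → 𝔼 → 𝔼 → 𝔼)
    (σ : 𝔼 → 𝔼 → Weyl m) (z : ℕ → ℂ) (u p : 𝔼) :
    locD P Γ σ u (fun _ => ofScalars z) p = 0 := by
  rw [locD, locE, locNabla_eq, dW_const, conW, dirE_ofScalars, bracket_swap,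
    bracket_eq_zero_of_left _ (partialE_ofScalars z)]
  simp only [dirE_ofScalars, mul_zero, Finset.sum_const_zero, sub_zero, neg_zero, add_zero]

/-- The function `f` is smooth on `U` and vanishes at `c` to order `n`. -/
def VanishTo (U : Set 𝔼) (c : 𝔼) : ℕ → (𝔼 → ℂ) → Prop
  | 0, f => ContDiffOn ℝ ∞ f U
  | n + 1, f => ContDiffOn ℝ ∞ f U ∧ f c = 0 ∧ ∀ u, VanishTo U c n fun p => fderiv ℝ f p u

theorem VanishTo.contDiffOn {U : Set 𝔼} {c : 𝔼} {n : ℕ} {f : 𝔼 → ℂ} (h : VanishTo U c n f) :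
    ContDiffOn ℝ ∞ f U := by
  cases n with
  | zero => exact h
  | succ n => exact h.1

theorem VanishTo.congr {U : Set 𝔼} (hU : IsOpen U) {c : 𝔼} (hc : c ∈ U) {n : ℕ} {f g : 𝔼 → ℂ}
    (h : VanishTo U c n f) (hfg : ∀ p ∈ U, g p = f p) : VanishTo U c n g := by
  induction n generalizing f g with
  | zero => exact ContDiffOn.congr h hfg
  | succ n ih =>
    refine ⟨h.1.congr hfg, (hfg c hc).trans h.2.1, fun u => ih (h.2.2 u) fun p hp => ?_⟩
    rw [Filter.EventuallyEq.fderiv_eq (Filter.eventually_of_mem (hU.mem_nhds hp) hfg)]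

theorem VanishTo.pred {U : Set 𝔼} {c : 𝔼} {n : ℕ} {f : 𝔼 → ℂ} (h : VanishTo U c (n + 1) f) :
    VanishTo U c n f := by
  induction n generalizing f with
  | zero => exact h.1
  | succ n ih => exact ⟨h.1, h.2.1, fun u => ih (h.2.2 u)⟩

theorem VanishTo.zero {U : Set 𝔼} {c : 𝔼} (n : ℕ) : VanishTo U c n fun _ => (0 : ℂ) := by
  induction n with
  | zero => exact contDiffOn_const
  | succ n ih =>
    refine ⟨contDiffOn_const, rfl, fun u => ?_⟩
    simpa only [fderiv_fun_const, Pi.zero_apply, ContinuousLinearMap.zero_apply] using ih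

theorem differentiableAt_of_contDiffOn {U : Set 𝔼} (hU : IsOpen U) {f : 𝔼 → ℂ}
    (hf : ContDiffOn ℝ ∞ f U) {p : 𝔼} (hp : p ∈ U) : DifferentiableAt ℝ f p :=
  (hf.contDiffAt (hU.mem_nhds hp)).differentiableAt (by simp)

theorem VanishTo.add {U : Set 𝔼} (hU : IsOpen U) {c : 𝔼} (hc : c ∈ U) {n : ℕ} {f g : 𝔼 → ℂ}
    (hf : VanishTo U c n f) (hg : VanishTo U c n g) : VanishTo U c n fun p => f p + g p := by
  induction n generalizing f g with
  | zero => exact ContDiffOn.add hf hg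
  | succ n ih =>
    refine ⟨hf.1.add hg.1, by simp only [hf.2.1, hg.2.1, add_zero], fun u =>
      (ih (hf.2.2 u) (hg.2.2 u)).congr hU hc fun p hp => ?_⟩
    rw [fderiv_fun_add (differentiableAt_of_contDiffOn hU hf.1 hp)
      (differentiableAt_of_contDiffOn hU hg.1 hp), ContinuousLinearMap.add_apply]

theorem VanishTo.mul {U : Set 𝔼} (hU : IsOpen U) {c : 𝔼} (hc : c ∈ U) {n : ℕ} {f g : 𝔼 → ℂ}
    (hg : ContDiffOn ℝ ∞ g U) (hf : VanishTo U c n f) : VanishTo U c n fun p => g p * f p := by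
  induction n generalizing f g with
  | zero => exact hg.mul hf
  | succ n ih =>
    refine ⟨hg.mul hf.1, by simp only [hf.2.1, mul_zero], fun u =>
      ((ih hg (hf.2.2 u)).add hU hc (ih (contDiffOn_fderiv_apply hU hg u) hf.pred)).congr hU hc
        fun p hp => ?_⟩
    rw [fderiv_fun_mul (differentiableAt_of_contDiffOn hU hg hp)
      (differentiableAt_of_contDiffOn hU hf.1 hp), ContinuousLinearMap.add_apply,
      ContinuousLinearMap.smul_apply, ContinuousLinearMap.smul_apply, smul_eq_mul, smul_eq_mul,
      mul_comm (f p)]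

/-- With this filtration the estimates `JetW`, which for the constant filtration express smoothness,
express that coefficients are local operators of bounded order. -/
theorem idealFil_vanishTo {U : Set 𝔼} (hU : IsOpen U) {c : 𝔼} (hc : c ∈ U) :
    IdealFil U (VanishTo U c) where
  isOpen := hU
  smooth h := h.contDiffOn
  zero := VanishTo.zero
  add hf hg := hf.add hU hc hg
  mul hg hf := hf.mul hU hc hg
  anti h hf := by
    induction h with
    | refl => exact hf
    | step _ ih => exact ih hf.pred
  deriv {n f} hf u := by
    cases n with
    | zero => exact contDiffOn_fderiv_apply hU hf u
    | succ n => exact hf.2.2 u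
  congr hf h := hf.congr hU hc h

theorem vanishTo_of_iteratedFDeriv {U : Set 𝔼} (hU : IsOpen U) {c : 𝔼} (hc : c ∈ U) {n : ℕ}
    {f : 𝔼 → ℂ} (hf : ContDiffOn ℝ ∞ f U) (h : ∀ i < n, iteratedFDeriv ℝ i f c = 0) :
    VanishTo U c n f := by
  induction n generalizing f with
  | zero => exact hf
  | succ n ih =>
    refine ⟨hf, ?_, fun u => ih (contDiffOn_fderiv_apply hU hf u) fun i hi => ?_⟩
    · have h1 := congrArg (fun T : ContinuousMultilinearMap ℝ (fun _ : Fin 0 => 𝔼) ℂ => T 0)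
        (h 0 (Nat.succ_pos n))
      exact (iteratedFDeriv_zero_apply _).symm.trans h1
    · have h1 : iteratedFDeriv ℝ i (fderiv ℝ f) c = 0 := by
        rw [← norm_eq_zero, norm_iteratedFDeriv_fderiv, h (i + 1) (by omega), norm_zero]
      have h2 : ContDiffAt ℝ i (fderiv ℝ f) c :=
        (hf.contDiffAt (hU.mem_nhds hc)).fderiv_right (by exact_mod_cast le_top)
      have h3 := ContinuousLinearMap.iteratedFDeriv_comp_left
        (ContinuousLinearMap.apply ℝ ℂ u) h2 le_rfl
      rw [h1] at h3
      refine h3.trans ?_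
      ext v
      simp

end Weyl

/-- One constant term is split off at a time; because `L` commutes with multiplication by the
parameter, the remainder enters with one coefficient less. -/
theorem coeff_eq_sum_of_map_X_mul {R : Type*} [CommRing R] (L : PowerSeries R →+ PowerSeries R)
    (hL : ∀ a, L (PowerSeries.X * a) = PowerSeries.X * L a) (n : ℕ) (a : PowerSeries R) :
    PowerSeries.coeff n (L a) = ∑ q ∈ Finset.HasAntidiagonal.antidiagonal n,
      PowerSeries.coeff q.1 (L (PowerSeries.C (PowerSeries.coeff q.2 a))) := by
  have h0 : ∀ a k, PowerSeries.coeff k (L a) = PowerSeries.coeff k (PowerSeries.X *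
      L (PowerSeries.mk fun p => PowerSeries.coeff (p + 1) a)) +
        PowerSeries.coeff k (L (PowerSeries.C (PowerSeries.coeff 0 a))) := fun a k => by
    conv_lhs => rw [PowerSeries.eq_X_mul_shift_add_const a, map_add, hL, map_add]
    rw [PowerSeries.coeff_zero_eq_constantCoeff_apply]
  induction n generalizing a with
  | zero =>
    rw [h0, PowerSeries.coeff_zero_X_mul, zero_add, Finset.HasAntidiagonal.antidiagonal_zero,
      Finset.sum_singleton]
  | succ n ih =>
    rw [h0, PowerSeries.coeff_succ_X_mul, ih, Finset.Nat.sum_antidiagonal_succ', add_comm]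
    simp only [PowerSeries.coeff_mk]

/-- A biadditive product which commutes with multiplication by the parameter is determined by the
products of constant series. -/
theorem coeff_eq_sum_of_X_mul {R : Type*} [CommRing R]
    (T : PowerSeries R →+ PowerSeries R →+ PowerSeries R)
    (hl : ∀ a b, T (PowerSeries.X * a) b = PowerSeries.X * T a b)
    (hr : ∀ a b, T a (PowerSeries.X * b) = PowerSeries.X * T a b) (n : ℕ)
    (a b : PowerSeries R) :
    PowerSeries.coeff n (T a b) = ∑ s ∈ Finset.HasAntidiagonal.antidiagonal n,
      ∑ q ∈ Finset.HasAntidiagonal.antidiagonal s.2, PowerSeries.coeff s.1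
        (T (PowerSeries.C (PowerSeries.coeff q.1 a)) (PowerSeries.C (PowerSeries.coeff q.2 b))) := by
  rw [coeff_eq_sum_of_map_X_mul (T a) (hr a)]
  have h1 : ∀ q : ℕ × ℕ, PowerSeries.coeff q.1 (T a (PowerSeries.C (PowerSeries.coeff q.2 b))) =
      ∑ r ∈ Finset.HasAntidiagonal.antidiagonal q.1, PowerSeries.coeff r.1
        (T (PowerSeries.C (PowerSeries.coeff r.2 a)) (PowerSeries.C (PowerSeries.coeff q.2 b))) :=
    fun q => coeff_eq_sum_of_map_X_mul (T.flip (PowerSeries.C (PowerSeries.coeff q.2 b)))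
      (fun a => hl a _) q.1 a
  simp only [h1]
  rw [Finset.sum_sigma', Finset.sum_sigma']
  refine Finset.sum_nbij' (fun x => ⟨(x.2.1, x.2.2 + x.1.2), (x.2.2, x.1.2)⟩)
    (fun x => ⟨(x.1.1 + x.2.1, x.2.2), (x.1.1, x.2.1)⟩) ?_ ?_ ?_ ?_ ?_
  · rintro ⟨⟨i, j⟩, ⟨k, l⟩⟩ h
    simp only [Finset.mem_sigma, Finset.HasAntidiagonal.mem_antidiagonal] at h
    refine Finset.mem_sigma.2 ⟨Finset.HasAntidiagonal.mem_antidiagonal.2 ?_,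
      Finset.HasAntidiagonal.mem_antidiagonal.2 rfl⟩
    change k + (l + j) = n
    omega
  · rintro ⟨⟨i, j⟩, ⟨k, l⟩⟩ h
    simp only [Finset.mem_sigma, Finset.HasAntidiagonal.mem_antidiagonal] at h
    refine Finset.mem_sigma.2 ⟨Finset.HasAntidiagonal.mem_antidiagonal.2 ?_,
      Finset.HasAntidiagonal.mem_antidiagonal.2 rfl⟩
    change i + k + l = n
    omega
  · rintro ⟨⟨i, j⟩, ⟨k, l⟩⟩ h
    simp only [Finset.mem_sigma, Finset.HasAntidiagonal.mem_antidiagonal] at h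
    obtain ⟨h1, rfl⟩ := h
    rfl
  · rintro ⟨⟨i, j⟩, ⟨k, l⟩⟩ h
    simp only [Finset.mem_sigma, Finset.HasAntidiagonal.mem_antidiagonal] at h
    obtain ⟨h1, rfl⟩ := h
    rfl
  · rintro ⟨⟨i, j⟩, ⟨k, l⟩⟩ h
    rfl

end Fedosov

/-! ### The star-product on formal series of smooth functions -/

namespace Fedosov

variable {m : ℕ} {M : Type*} [TopologicalSpace M] [ChartedSpace (EuclideanSpace ℝ (Fin m)) M]

local notation "𝔼" => EuclideanSpace ℝ (Fin m)

open Weyl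

variable [IsManifold (𝓡 m) ∞ M]

/-- Agreement of the derivatives of order at most `l`, with the value included, means that the
difference vanishes to order `l + 1`. -/
theorem vanishTo_of_sameJet {l : ℕ} {f f' : SmoothFun m M} {x : M} (h : SameJet l f f' x) :
    VanishTo (chartAt 𝔼 x).target (chartAt 𝔼 x x) (l + 1)
      fun p => (f - f') ((chartAt 𝔼 x).symm p) := by
  have hU := (chartAt 𝔼 x).open_target
  have hc := mem_chart_target 𝔼 x
  refine vanishTo_of_iteratedFDeriv hU hc (contDiffOn_smoothFun _ x) fun i hi => ?_
  have hs : ∀ g : SmoothFun m M, ContDiffAt ℝ i (fun p => g ((chartAt 𝔼 x).symm p))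
      (chartAt 𝔼 x x) := fun g =>
    ((contDiffOn_smoothFun g x).contDiffAt (hU.mem_nhds hc)).of_le (by exact_mod_cast le_top)
  exact (iteratedFDeriv_sub_apply (hs f) (hs f')).trans (sub_eq_zero.2 (h i (by omega)))

theorem coeff_mul_apply (a b : PowerSeries (SmoothFun m M)) (j : ℕ) (x : M) :
    (PowerSeries.coeff j (a * b) : SmoothFun m M) x =
      ∑ s ∈ Finset.HasAntidiagonal.antidiagonal j, (PowerSeries.coeff s.1 a : SmoothFun m M) x *
        (PowerSeries.coeff s.2 b : SmoothFun m M) x := by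
  rw [PowerSeries.coeff_mul]
  exact map_sum (ContMDiffMap.evalRingHom x) _ _

theorem isScalar_X : IsScalar (PowerSeries.X : PowerSeries (SmoothFun m M)) :=
  ⟨fun n => if n = 1 then 1 else 0, fun n x => by
    rw [PowerSeries.coeff_X]
    change _ = if n = 1 then (1 : ℂ) else 0
    split_ifs <;> rfl⟩

theorem isScalar_one : IsScalar (1 : PowerSeries (SmoothFun m M)) :=
  ⟨fun n => if n = 0 then 1 else 0, fun n x => by
    rw [PowerSeries.coeff_one]
    change _ = if n = 0 then (1 : ℂ) else 0
    split_ifs <;> rfl⟩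

/-- The fibrewise product of sections of the Weyl bundle. -/
def fiberMul (Ω : SymplecticForm m M) (a b : M → Weyl m) : M → Weyl m := fun x =>
  moyal (Ω.poissonMatrix x) (a x) (b x)

theorem loc_fiberMul (Ω : SymplecticForm m M) (a b : M → Weyl m) (x : M) :
    ∀ p ∈ (chartAt 𝔼 x).target, loc x (fiberMul Ω a b) p =
      moyal (poissonMat Ω x p) (loc x a p) (loc x b p) := by
  refine forall_target fun y hy => ?_
  rw [loc_chartAt hy, loc_chartAt hy, loc_chartAt hy, fiberMul, framePull_moyal Ω hy]

theorem fedosovD_center (Ω : SymplecticForm m M) (conn : Connection m M) {ρ : ℕ → OneForm m M}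
    (h : IsGraded ρ) {a : M → Weyl m} (ha : IsSmoothSection a) (y : M) (v : 𝔼) :
    fedosovD conn (fun k => adOp Ω (ρ k)) a y v =
      locD (poissonMat Ω y) (christoffel conn y) (locOne y (totalForm ρ)) v (loc y a)
        (chartAt 𝔼 y y) := by
  have h1 := framePull_fedosovD Ω conn h (mem_chart_source 𝔼 y) (ha y) v
  rwa [framePull_self, frame_self] at h1

theorem fedosovD_eq_zero_iff (Ω : SymplecticForm m M) (conn : Connection m M)
    {ρ : ℕ → OneForm m M} (h : IsGraded ρ) {a : M → Weyl m} (ha : IsSmoothSection a) :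
    fedosovD conn (fun k => adOp Ω (ρ k)) a = 0 ↔ ∀ y v, locD (poissonMat Ω y)
      (christoffel conn y) (locOne y (totalForm ρ)) v (loc y a) (chartAt 𝔼 y y) = 0 := by
  refine ⟨fun hD y v => ?_, fun hD => funext fun y => funext fun v => ?_⟩
  · rw [← fedosovD_center Ω conn h ha]
    exact congrFun (congrFun hD y) v
  · exact (fedosovD_center Ω conn h ha y v).trans (hD y v)

section

variable [T2Space M] {Ω : SymplecticForm m M} {conn : Connection m M}
  [conn.ContMDiffCovariantDerivative ∞] {ρ : ℕ → OneForm m M}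

theorem isSmoothSection_fiberMul (ht : conn.torsion = 0) (hs : IsSymplecticConnection Ω conn)
    {a b : M → Weyl m} (ha : IsSmoothSection a) (hb : IsSmoothSection b) :
    IsSmoothSection (fiberMul Ω a b) := by
  refine isSmoothSection_of_loc fun x => ?_
  have hG := localGeometry ht hs x
  exact (SmoothW.congr (SmoothW.moyal hG.isOpen hG.smoothP (ha.loc x) (hb.loc x))
    (loc_fiberMul Ω a b x)).smoothWAt hG.isOpen (mem_chart_target 𝔼 x)

/-- The product of two flat sections is flat. -/
theorem fedosovD_fiberMul (ht : conn.torsion = 0) (hs : IsSymplecticConnection Ω conn)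
    (h : IsGraded ρ) {a b : M → Weyl m} (ha : IsSmoothSection a) (hb : IsSmoothSection b)
    (hDa : fedosovD conn (fun k => adOp Ω (ρ k)) a = 0)
    (hDb : fedosovD conn (fun k => adOp Ω (ρ k)) b = 0) :
    fedosovD conn (fun k => adOp Ω (ρ k)) (fiberMul Ω a b) = 0 := by
  refine (fedosovD_eq_zero_iff Ω conn h (isSmoothSection_fiberMul ht hs ha hb)).2 fun y v => ?_
  have hp := mem_chart_target 𝔼 y
  rw [locD_congr _ _ _ (Filter.eventually_of_mem ((chartAt 𝔼 y).open_target.mem_nhds hp)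
      (loc_fiberMul Ω a b y)), (localGeometry ht hs y).locD_moyal _ (ha.loc y) (hb.loc y) hp,
    (fedosovD_eq_zero_iff Ω conn h ha).1 hDa, (fedosovD_eq_zero_iff Ω conn h hb).1 hDb,
    ← moyalL_apply, ← moyalL_apply, map_zero, map_zero, LinearMap.zero_apply, add_zero]

theorem fedosovD_add (h : IsGraded ρ) {a b : M → Weyl m} (ha : IsSmoothSection a)
    (hb : IsSmoothSection b) (hDa : fedosovD conn (fun k => adOp Ω (ρ k)) a = 0)
    (hDb : fedosovD conn (fun k => adOp Ω (ρ k)) b = 0) :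
    fedosovD conn (fun k => adOp Ω (ρ k)) (a + b) = 0 := by
  refine (fedosovD_eq_zero_iff Ω conn h (ha.add hb)).2 fun y v => ?_
  have hp := mem_chart_target 𝔼 y
  have hU := (chartAt 𝔼 y).open_target
  rw [locD_congr _ _ _ (Filter.Eventually.of_forall (loc_add y a b)),
    locD_add _ _ _ ((ha.loc y).diffW hU hp) ((hb.loc y).diffW hU hp),
    (fedosovD_eq_zero_iff Ω conn h ha).1 hDa, (fedosovD_eq_zero_iff Ω conn h hb).1 hDb, add_zero]

/-- Lifts are identified by exhibiting any smooth flat section with the right symbol; additivity and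
the lift of scalars are obtained in this way. -/
theorem flatLift_eq_of_flat (ht : conn.torsion = 0) (hs : IsSymplecticConnection Ω conn)
    (h : IsGraded ρ) (hΩ : ∀ y u v, totalCurvature Ω conn ρ y u v = 0)
    (a : PowerSeries (SmoothFun m M)) {A : M → Weyl m} (hA : IsSmoothSection A)
    (hD : fedosovD conn (fun k => adOp Ω (ρ k)) A = 0)
    (ha : ∀ j x, coef j 0 (A x) = (PowerSeries.coeff j a : SmoothFun m M) x) :
    flatLift Ω conn ρ a = A :=
  flat_ext ht hs h (isSmoothSection_flatLift ht hs h a) hA (fedosovD_flatLift ht hs h hΩ a) hD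
    fun j x => (coef_zero_flatLift ht hs h a j x).trans (ha j x).symm

theorem flatLift_add (ht : conn.torsion = 0) (hs : IsSymplecticConnection Ω conn)
    (h : IsGraded ρ) (hΩ : ∀ y u v, totalCurvature Ω conn ρ y u v = 0)
    (a b : PowerSeries (SmoothFun m M)) :
    flatLift Ω conn ρ (a + b) = flatLift Ω conn ρ a + flatLift Ω conn ρ b := by
  have ha := isSmoothSection_flatLift ht hs h a
  have hb := isSmoothSection_flatLift ht hs h b
  refine flatLift_eq_of_flat ht hs h hΩ _ (ha.add hb) (fedosovD_add h ha hb
    (fedosovD_flatLift ht hs h hΩ a) (fedosovD_flatLift ht hs h hΩ b)) fun j x => ?_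
  rw [Pi.add_apply, coef_add, coef_zero_flatLift ht hs h, coef_zero_flatLift ht hs h, map_add]
  rfl

/-- A series in `t` with constant coefficients has neither derivatives nor generators, so it is
annihilated by every part of `D` and is its own flat lift. -/
theorem flatLift_scalar (ht : conn.torsion = 0) (hs : IsSymplecticConnection Ω conn)
    (h : IsGraded ρ) (hΩ : ∀ y u v, totalCurvature Ω conn ρ y u v = 0)
    {c : PowerSeries (SmoothFun m M)} {z : ℕ → ℂ}
    (hc : ∀ n x, (PowerSeries.coeff n c : SmoothFun m M) x = z n) (x : M) :
    flatLift Ω conn ρ c x = ofScalars z := by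
  have h1 : ∀ x, ofSeries c x = ofScalars z := fun x => by
    rw [ofSeries_apply]
    exact congrArg ofScalars (funext fun n => hc n x)
  have hS := isSmoothSection_ofSeries c
  have hD : fedosovD conn (fun k => adOp Ω (ρ k)) (ofSeries c) = 0 := by
    refine (fedosovD_eq_zero_iff Ω conn h hS).2 fun y v => ?_
    have h2 : loc y (ofSeries c) = fun _ => ofScalars z := funext fun p => by
      rw [loc, h1, framePull_ofScalars]
    rw [h2, locD_ofScalars]
  rw [flatLift_eq_of_flat ht hs h hΩ c hS hD fun j x => by
    rw [ofSeries_apply, coef_zero_ofScalars], h1]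

/-- The star-product induced by the fibrewise product of flat sections. -/
def fedosovStar (ht : conn.torsion = 0) (hs : IsSymplecticConnection Ω conn) (h : IsGraded ρ)
    (hΩ : ∀ y u v, totalCurvature Ω conn ρ y u v = 0) (a b : PowerSeries (SmoothFun m M)) :
    PowerSeries (SmoothFun m M) :=
  (flatEquiv ht hs h hΩ).symm ⟨fiberMul Ω (flatLift Ω conn ρ a) (flatLift Ω conn ρ b),
    isSmoothSection_fiberMul ht hs (isSmoothSection_flatLift ht hs h a)
      (isSmoothSection_flatLift ht hs h b),
    fedosovD_fiberMul ht hs h (isSmoothSection_flatLift ht hs h a)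
      (isSmoothSection_flatLift ht hs h b) (fedosovD_flatLift ht hs h hΩ a)
      (fedosovD_flatLift ht hs h hΩ b)⟩

theorem flatLift_star (ht : conn.torsion = 0) (hs : IsSymplecticConnection Ω conn)
    (h : IsGraded ρ) (hΩ : ∀ y u v, totalCurvature Ω conn ρ y u v = 0)
    (a b : PowerSeries (SmoothFun m M)) (x : M) :
    flatLift Ω conn ρ (fedosovStar ht hs h hΩ a b) x =
      moyal (Ω.poissonMatrix x) (flatLift Ω conn ρ a x) (flatLift Ω conn ρ b x) :=
  congrFun (congrArg Subtype.val ((flatEquiv ht hs h hΩ).apply_symm_apply _)) x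

theorem coeff_star (ht : conn.torsion = 0) (hs : IsSymplecticConnection Ω conn)
    (h : IsGraded ρ) (hΩ : ∀ y u v, totalCurvature Ω conn ρ y u v = 0)
    (a b : PowerSeries (SmoothFun m M)) (j : ℕ) (x : M) :
    (PowerSeries.coeff j (fedosovStar ht hs h hΩ a b) : SmoothFun m M) x =
      coef j 0 (moyal (Ω.poissonMatrix x) (flatLift Ω conn ρ a x) (flatLift Ω conn ρ b x)) := by
  rw [← coef_zero_flatLift ht hs h, flatLift_star]

theorem fedosovStar_add_left (ht : conn.torsion = 0) (hs : IsSymplecticConnection Ω conn)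
    (h : IsGraded ρ) (hΩ : ∀ y u v, totalCurvature Ω conn ρ y u v = 0)
    (a b c : PowerSeries (SmoothFun m M)) : fedosovStar ht hs h hΩ (a + b) c =
      fedosovStar ht hs h hΩ a c + fedosovStar ht hs h hΩ b c :=
  PowerSeries.ext fun j => ContMDiffMap.ext fun x => by
    rw [map_add, coeff_star, flatLift_add ht hs h hΩ, Pi.add_apply, moyal_add_left, coef_add,
      ← coeff_star ht hs h hΩ, ← coeff_star ht hs h hΩ]
    rfl

theorem fedosovStar_add_right (ht : conn.torsion = 0) (hs : IsSymplecticConnection Ω conn)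
    (h : IsGraded ρ) (hΩ : ∀ y u v, totalCurvature Ω conn ρ y u v = 0)
    (a b c : PowerSeries (SmoothFun m M)) : fedosovStar ht hs h hΩ a (b + c) =
      fedosovStar ht hs h hΩ a b + fedosovStar ht hs h hΩ a c :=
  PowerSeries.ext fun j => ContMDiffMap.ext fun x => by
    rw [map_add, coeff_star, flatLift_add ht hs h hΩ, Pi.add_apply, moyal_add_right, coef_add,
      ← coeff_star ht hs h hΩ, ← coeff_star ht hs h hΩ]
    rfl

theorem fedosovStar_assoc (ht : conn.torsion = 0) (hs : IsSymplecticConnection Ω conn)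
    (h : IsGraded ρ) (hΩ : ∀ y u v, totalCurvature Ω conn ρ y u v = 0)
    (a b c : PowerSeries (SmoothFun m M)) :
    fedosovStar ht hs h hΩ (fedosovStar ht hs h hΩ a b) c =
      fedosovStar ht hs h hΩ a (fedosovStar ht hs h hΩ b c) :=
  PowerSeries.ext fun j => ContMDiffMap.ext fun x => by
    rw [coeff_star, coeff_star, flatLift_star, flatLift_star, moyal_assoc]

/-- The lift of a scalar is free of generators, so the Moyal product with it is the ordinary one.
Bilinearity over the scalars then follows from associativity, by writing `c * a` as a star-product.
-/
theorem scalar_fedosovStar (ht : conn.torsion = 0) (hs : IsSymplecticConnection Ω conn)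
    (h : IsGraded ρ) (hΩ : ∀ y u v, totalCurvature Ω conn ρ y u v = 0)
    {c : PowerSeries (SmoothFun m M)} (hc : IsScalar c) (a : PowerSeries (SmoothFun m M)) :
    fedosovStar ht hs h hΩ c a = c * a ∧ fedosovStar ht hs h hΩ a c = c * a := by
  obtain ⟨z, hz⟩ := hc
  have h1 : ∀ j x, coef j 0 (ofScalars z * flatLift Ω conn ρ a x) =
      (PowerSeries.coeff j (c * a) : SmoothFun m M) x := fun j x => by
    rw [coef_zero_mul, coeff_mul_apply]
    exact Finset.sum_congr rfl fun s _ => by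
      rw [coef_zero_ofScalars, coef_zero_flatLift ht hs h, hz]
  constructor <;> refine PowerSeries.ext fun j => ContMDiffMap.ext fun x => ?_
  · rw [coeff_star, flatLift_scalar ht hs h hΩ hz, moyal_eq_mul_of_left _ (partialE_ofScalars z),
      h1]
  · rw [coeff_star, flatLift_scalar ht hs h hΩ hz, moyal_eq_mul_of_right _ (partialE_ofScalars z),
      mul_comm, h1]

/-- In effect the coefficient of `t ^ j e ^ α` in the lift of `f` depends on `f` through derivatives
of order at most `j + α.degree`: this many steps of the filtration are lost, and the iteration loses
no more by `JetW.locStep`. -/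
theorem jetW_flatApprox (ht : conn.torsion = 0) (hs : IsSymplecticConnection Ω conn)
    (h : IsGraded ρ) {x : M} {I : ℕ → (𝔼 → ℂ) → Prop} (hI : IdealFil (chartAt 𝔼 x).target I)
    {n : ℕ} {f : SmoothFun m M} (hf : I n fun p => f ((chartAt 𝔼 x).symm p)) (k : ℕ) :
    JetW I n (loc x (flatApprox Ω conn ρ (PowerSeries.C f) k)) := by
  have h0 : JetW I n (loc x (ofSeries (PowerSeries.C f))) := fun j α => by
    by_cases hj : j = 0 ∧ α = 0
    · obtain ⟨rfl, rfl⟩ := hj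
      refine hI.congr (hI.anti (by omega) hf) fun p _ => ?_
      rw [loc_ofSeries, coef_zero_ofScalars, PowerSeries.coeff_zero_C]
    · refine hI.congr (hI.zero _) fun p _ => ?_
      rw [loc_ofSeries, coef_ofScalars]
      split_ifs with hα
      · rw [PowerSeries.coeff_ne_zero_C fun h => hj ⟨h, hα⟩]
        rfl
      · rfl
  induction k with
  | zero => exact h0
  | succ k ih =>
    have hG := localGeometry ht hs x
    refine JetW.congr hI (JetW.add hI h0 (JetW.locStep hI hG.smoothP hG.smoothΓ
      (h.totalForm.locOne x) ih)) fun p hp => ?_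
    rw [← loc_fedosovStep ht hs h (isSmoothSection_flatApprox ht hs h _ k) x p hp, ← loc_add]
    rfl

theorem jetW_flatLift (ht : conn.torsion = 0) (hs : IsSymplecticConnection Ω conn)
    (h : IsGraded ρ) {x : M} {I : ℕ → (𝔼 → ℂ) → Prop} (hI : IdealFil (chartAt 𝔼 x).target I)
    {n : ℕ} {f : SmoothFun m M} (hf : I n fun p => f ((chartAt 𝔼 x).symm p)) :
    JetW I n (loc x (flatLift Ω conn ρ (PowerSeries.C f))) := fun j α =>
  hI.congr (jetW_flatApprox ht hs h hI hf (α.degree + 2 * j) j α) fun p _ => by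
    have h1 := (inFil_flatLift_sub ht hs h (PowerSeries.C f) (α.degree + 2 * j)
      ((chartAt 𝔼 x).symm p)).framePull x ((chartAt 𝔼 x).symm p) j α (Nat.lt_succ_self _)
    rw [framePull_sub, coef_sub] at h1
    exact sub_eq_zero.1 h1

theorem coeff_star_eq_zero (ht : conn.torsion = 0) (hs : IsSymplecticConnection Ω conn)
    (h : IsGraded ρ) (hΩ : ∀ y u v, totalCurvature Ω conn ρ y u v = 0)
    {a b : PowerSeries (SmoothFun m M)} {l : ℕ} {x : M}
    (hJ : JetW (VanishTo (chartAt 𝔼 x).target (chartAt 𝔼 x x)) (l + 1) fun p =>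
      moyal (poissonMat Ω x p) (loc x (flatLift Ω conn ρ a) p) (loc x (flatLift Ω conn ρ b) p)) :
    (PowerSeries.coeff l (fedosovStar ht hs h hΩ a b) : SmoothFun m M) x = 0 := by
  have h1 := hJ l 0
  -- One step of vanishing is left after the loss of `l`, and this is just enough for the value at
  -- the center to be zero.
  have h2 : l + 1 - l - (0 : Fin m →₀ ℕ).degree = 0 + 1 := by simp
  rw [h2] at h1
  have h3 : coef l 0 (moyal (poissonMat Ω x (chartAt 𝔼 x x))
      (loc x (flatLift Ω conn ρ a) (chartAt 𝔼 x x))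
      (loc x (flatLift Ω conn ρ b) (chartAt 𝔼 x x))) = 0 := h1.2.1
  rw [poissonMat_center, loc_center, loc_center] at h3
  rw [coeff_star]
  exact h3

/-- Additivity in each argument reduces the claim to one factor, `f - f'` or `g - g'`, that vanishes
to order `l + 1`; the other factor only has to be smooth. -/
theorem fedosovStar_local (ht : conn.torsion = 0) (hs : IsSymplecticConnection Ω conn)
    (h : IsGraded ρ) (hΩ : ∀ y u v, totalCurvature Ω conn ρ y u v = 0) {l : ℕ}
    {f f' g g' : SmoothFun m M} {x : M} (hf : SameJet l f f' x) (hg : SameJet l g g' x) :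
    (PowerSeries.coeff l (fedosovStar ht hs h hΩ (PowerSeries.C f) (PowerSeries.C g)) :
      SmoothFun m M) x =
    (PowerSeries.coeff l (fedosovStar ht hs h hΩ (PowerSeries.C f') (PowerSeries.C g')) :
      SmoothFun m M) x := by
  have hI := idealFil_vanishTo (chartAt 𝔼 x).open_target (mem_chart_target 𝔼 x)
  have hG := localGeometry ht hs x
  have hS : ∀ a, SmoothW (chartAt 𝔼 x).target (loc x (flatLift Ω conn ρ a)) := fun a =>
    (isSmoothSection_flatLift ht hs h a).loc x
  have h1 := coeff_star_eq_zero ht hs h hΩ (JetW.moyal' hI hG.smoothP (hS (PowerSeries.C g))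
    (jetW_flatLift ht hs h hI (vanishTo_of_sameJet hf)))
  have h2 := coeff_star_eq_zero ht hs h hΩ (JetW.moyal hI hG.smoothP (hS (PowerSeries.C f'))
    (jetW_flatLift ht hs h hI (vanishTo_of_sameJet hg)))
  have h3 : fedosovStar ht hs h hΩ (PowerSeries.C f) (PowerSeries.C g) =
      fedosovStar ht hs h hΩ (PowerSeries.C (f - f')) (PowerSeries.C g) +
      (fedosovStar ht hs h hΩ (PowerSeries.C f') (PowerSeries.C (g - g')) +
        fedosovStar ht hs h hΩ (PowerSeries.C f') (PowerSeries.C g')) := by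
    rw [← fedosovStar_add_right, ← map_add, sub_add_cancel, ← fedosovStar_add_left, ← map_add,
      sub_add_cancel]
  rw [h3, map_add, map_add]
  change (PowerSeries.coeff l _ : SmoothFun m M) x + ((PowerSeries.coeff l _ : SmoothFun m M) x +
    (PowerSeries.coeff l _ : SmoothFun m M) x) = _
  rw [h1, h2, zero_add, zero_add]

/-- `B l` is the `l`-th coefficient of the product of two constant series. The product of general
series is recovered from these because it is linear over the parameter in both arguments. -/
theorem isLocal_fedosovStar (ht : conn.torsion = 0) (hs : IsSymplecticConnection Ω conn)
    (h : IsGraded ρ) (hΩ : ∀ y u v, totalCurvature Ω conn ρ y u v = 0) :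
    ∃ B : ℕ → (SmoothFun m M →+ SmoothFun m M →+ SmoothFun m M),
      (∀ k a b, PowerSeries.coeff k (fedosovStar ht hs h hΩ a b) =
        ∑ s ∈ Finset.HasAntidiagonal.antidiagonal k,
          ∑ q ∈ Finset.HasAntidiagonal.antidiagonal s.2,
            B s.1 (PowerSeries.coeff q.1 a) (PowerSeries.coeff q.2 b)) ∧
      ∀ l f f' g g' x, SameJet l f f' x → SameJet l g g' x → B l f g x = B l f' g' x := by
  let T : PowerSeries (SmoothFun m M) →+ PowerSeries (SmoothFun m M) →+
      PowerSeries (SmoothFun m M) := AddMonoidHom.mk'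
    (fun a => AddMonoidHom.mk' (fedosovStar ht hs h hΩ a) (fedosovStar_add_right ht hs h hΩ a))
    fun a b => AddMonoidHom.ext fun c => fedosovStar_add_left ht hs h hΩ a b c
  have hX := fun a => scalar_fedosovStar ht hs h hΩ isScalar_X a
  have hl : ∀ a b, T (PowerSeries.X * a) b = PowerSeries.X * T a b := fun a b => by
    change fedosovStar ht hs h hΩ _ _ = _ * fedosovStar ht hs h hΩ _ _
    rw [← (hX a).1, fedosovStar_assoc, (hX _).1]
  have hr : ∀ a b, T a (PowerSeries.X * b) = PowerSeries.X * T a b := fun a b => by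
    change fedosovStar ht hs h hΩ _ _ = _ * fedosovStar ht hs h hΩ _ _
    rw [← (hX b).2, ← fedosovStar_assoc, (hX _).2]
  refine ⟨fun l => AddMonoidHom.mk' (fun f => AddMonoidHom.mk'
    (fun g => PowerSeries.coeff l (T (PowerSeries.C f) (PowerSeries.C g)))
    fun g g' => by rw [map_add, map_add, map_add]) fun f f' => AddMonoidHom.ext fun g => ?_,
    fun k a b => coeff_eq_sum_of_X_mul T hl hr k a b,
    fun l f f' g g' x hf hg => fedosovStar_local ht hs h hΩ hf hg⟩
  change PowerSeries.coeff l (T (PowerSeries.C (f + f')) (PowerSeries.C g)) =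
    PowerSeries.coeff l (T (PowerSeries.C f) (PowerSeries.C g)) +
      PowerSeries.coeff l (T (PowerSeries.C f') (PowerSeries.C g))
  rw [map_add, map_add, AddMonoidHom.add_apply, map_add]

/-- The terms of degree one of a flat section are the derivatives of its symbol. -/
theorem partialE_flatLift (ht : conn.torsion = 0) (hs : IsSymplecticConnection Ω conn)
    (h : IsGraded ρ) (h0 : ρ 0 = 0) (hΩ : ∀ y u v, totalCurvature Ω conn ρ y u v = 0)
    (a : PowerSeries (SmoothFun m M)) (x : M) (k : Fin m) :
    coef 0 0 (partialE k (flatLift Ω conn ρ a x)) =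
      dirDeriv (⇑(PowerSeries.coeff 0 a : SmoothFun m M)) x (coordVec x k) := by
  have h1 : nabla conn (flatLift Ω conn ρ a) x (basisVec k) -
      dirE (basisVec k) (flatLift Ω conn ρ a x) + bracket (Ω.poissonMatrix x)
        (totalForm ρ x (basisVec k)) (flatLift Ω conn ρ a x) = 0 :=
    (fedosovD_eq Ω conn h _ x _).symm.trans
      (congrFun (congrFun (fedosovD_flatLift ht hs h hΩ a) x) (basisVec k))
  have h2 := congrArg (coef 0 0) h1
  -- The form starts in degree `3` and the bracket lowers the total degree by `2`, so this term
  -- starts in degree `1` and has no constant term.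
  have h3 : coef 0 0 (bracket (Ω.poissonMatrix x) (totalForm ρ x (basisVec k))
      (flatLift Ω conn ρ a x)) = 0 :=
    InFil.bracket (n := 1) _ (inFil_totalForm h h0 x _) (inFil_zero _) le_rfl 0 0 (by simp)
  -- The Christoffel part of `∇` carries a generator, and a change of frame leaves the terms free of
  -- generators alone; only the derivative of the symbol remains.
  have h4 : coef 0 0 (nabla conn (flatLift Ω conn ρ a) x (basisVec k)) =
      dirDeriv (⇑(PowerSeries.coeff 0 a : SmoothFun m M)) x (coordVec x k) := by
    have h5 : (fun y => coef 0 0 (inFrame x (flatLift Ω conn ρ a) y)) =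
        ⇑(PowerSeries.coeff 0 a : SmoothFun m M) := funext fun y =>
      (coef_zero_pull _ _ 0).trans (coef_zero_flatLift ht hs h a 0 y)
    have h6 : nabla conn (flatLift Ω conn ρ a) x (basisVec k) =
        ofCoef (fun j α => dirDeriv (fun y => coef j α (inFrame x (flatLift Ω conn ρ a) y)) x
          (coordVec x k)) -
        ∑ i, gen i * fiberDeriv (conn (extendVec (coordVec x i)) x (coordVec x k))
          (flatLift Ω conn ρ a x) := rfl
    rw [h6, coef_sub, coef_ofCoef, coef_sum, Finset.sum_eq_zero fun i _ =>
      coef_zero_gen_mul 0 i _, sub_zero, h5]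
  rw [coef_add, coef_sub, h3, h4, dirE_single, coef_zero, add_zero, sub_eq_zero] at h2
  exact h2.symm

theorem isStarProduct_fedosovStar (ht : conn.torsion = 0) (hs : IsSymplecticConnection Ω conn)
    (h : IsGraded ρ) (h0 : ρ 0 = 0) (hΩ : ∀ y u v, totalCurvature Ω conn ρ y u v = 0) :
    IsStarProduct Ω (fedosovStar ht hs h hΩ) where
  add_left := fedosovStar_add_left ht hs h hΩ
  add_right := fedosovStar_add_right ht hs h hΩ
  scalar_left c a b hc := by
    rw [← (scalar_fedosovStar ht hs h hΩ hc a).1, fedosovStar_assoc,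
      (scalar_fedosovStar ht hs h hΩ hc _).1]
  scalar_right c a b hc := by
    rw [← (scalar_fedosovStar ht hs h hΩ hc b).2, ← fedosovStar_assoc,
      (scalar_fedosovStar ht hs h hΩ hc _).2]
  assoc := fedosovStar_assoc ht hs h hΩ
  one_left a := by rw [(scalar_fedosovStar ht hs h hΩ isScalar_one a).1, one_mul]
  one_right a := by rw [(scalar_fedosovStar ht hs h hΩ isScalar_one a).2, one_mul]
  isLocal := isLocal_fedosovStar ht hs h hΩ
  coeff_zero a b := ContMDiffMap.ext fun x => by
    rw [coeff_star, coef_zero_zero_moyal, coef_zero_flatLift ht hs h, coef_zero_flatLift ht hs h]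
    rfl
  correspondence a b x := by
    have hP : (Ω.poissonMatrix x).transpose = -Ω.poissonMatrix x := by
      rw [← poissonMat_center, poissonMat_transpose]
    rw [map_sub]
    change Complex.I * ((PowerSeries.coeff 1 _ : SmoothFun m M) x -
      (PowerSeries.coeff 1 _ : SmoothFun m M) x) = _
    rw [coeff_star, coeff_star, ← coef_bracket, coef_zero_zero_bracket hP]
    simp only [partialE_flatLift ht hs h h0 hΩ]
    rfl

end

end Fedosov

end

theorem mainTheorem1 {m : ℕ} {M : Type*} [TopologicalSpace M] [T2Space M]
    [ChartedSpace (EuclideanSpace ℝ (Fin m)) M] [IsManifold (𝓡 m) ∞ M]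
    (Ω : SymplecticForm m M) (conn : Connection m M)
    [conn.ContMDiffCovariantDerivative ∞]
    (htorsion : conn.torsion = 0) (hsymplectic : IsSymplecticConnection Ω conn) :
    ∃ r : ℕ → (M → Weyl m) → OneForm m M,
      -- existence and uniqueness of the operators
      IsFedosovSequence Ω conn r ∧ (∀ r', IsFedosovSequence Ω conn r' → r' = r) ∧
      -- `r k` maps smooth sections of degree `i` to smooth `1`-forms of degree `i + k`
      (∀ k i a, IsSmoothSection a → (∀ x, Weyl.IsHomogeneous i (a x)) →
        IsSmoothOneForm (r k a) ∧ ∀ x v, Weyl.IsHomogeneous (i + k) (r k a x v)) ∧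
      -- `D` is a flat connection on the Weyl bundle
      (∀ a, IsSmoothSection a → IsSmoothOneForm (fedosovD conn r a)) ∧
      IsFlat (fedosovD conn r) ∧
      -- the graded equations and their recursive solution
      (∀ ρ, IsFedosovPotential Ω conn ρ → (∀ k, r k = adOp Ω (ρ k)) ∧
        ∀ k, delta₁ (ρ (k + 1)) = fedosovSource Ω conn ρ k ∧
          ρ (k + 1) = deltaInv₂ (fedosovSource Ω conn ρ k)) ∧
      -- the flat sections correspond to the formal series of smooth functions
      ∃ Q : PowerSeries (SmoothFun m M) ≃ FlatSection (fedosovD conn r),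
        (∀ a j x, Weyl.coef j 0 ((Q a).1 x) = PowerSeries.coeff j a x) ∧
        (∀ a, (Q a).1 = ofSeries a + deltaInv₁ (higherPart conn r (Q a).1)) ∧
        -- the induced product is a star-product
        ∃ star, IsStarProduct Ω star ∧
          ∀ a b x, (Q (star a b)).1 x =
            Weyl.moyal (Ω.poissonMatrix x) ((Q a).1 x) ((Q b).1 x) := by
  have h := isFedosovPotential_fedosovForm (Ω := Ω) htorsion hsymplectic
  obtain ⟨h0, hg, -, hΩ⟩ := (isFedosovPotential_iff htorsion hsymplectic).1 h
  -- The condition on `δ*` and the normalization determine the forms themselves, not only their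
  -- commutators; uniqueness of the operators is deduced from this.
  have hu : ∀ ρ, IsFedosovPotential Ω conn ρ → ρ = fedosovForm Ω conn := fun ρ hρ =>
    hρ.unique htorsion hsymplectic h
  refine ⟨fun k => adOp Ω (fedosovForm Ω conn k), ⟨_, h, fun k => rfl⟩, ?_, ?_,
    fun a ha => isSmoothOneForm_fedosovD htorsion hsymplectic hg ha, h.flat, ?_,
    flatEquiv htorsion hsymplectic hg hΩ, coef_zero_flatLift htorsion hsymplectic hg,
    flatLift_eq htorsion hsymplectic hg, fedosovStar htorsion hsymplectic hg hΩ,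
    isStarProduct_fedosovStar htorsion hsymplectic hg h0 hΩ,
    flatLift_star htorsion hsymplectic hg hΩ⟩
  · rintro r' ⟨ρ, hρ, hr⟩
    funext k
    rw [hr, hu ρ hρ]
  · exact fun k i a ha hi => ⟨isSmoothOneForm_adOp htorsion hsymplectic (hg.smooth k) ha,
      fun x v => Weyl.IsHomogeneous.bracket _ (hg.homogeneous k x v) (hi x) (by omega)⟩
  · exact fun ρ hρ => ⟨fun k => by rw [hu ρ hρ], hρ.graded htorsion hsymplectic⟩
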